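/- **Notation and standing setting.** Let $d\ge1$, $\mathfrak s\in[1,\infty)^d$, $\ell>0$, $|{\bf k}|_{\mathfrak s}=\sum_i\mathfrak s_ik_i$, $\|x\|_{\mathfrak s}=\sum_i|x_i|^{1/\mathfrak s_i}$, $\mathbb N[\mathfrak s]=\{|{\bf k}|_{\mathfrak s}:{\bf k}\in\mathbb N^d\}$, and let $G:\mathbb R^d\to[0,\infty)$ be measurable, $G_t(x)=t^{-|\mathfrak s|/\ell}G(t^{-\mathfrak s/\ell}x)$. A continuous $w:\mathbb R^d\to(0,1]$ is *$G$-controlled* with control function $w^*$ if $w^*:\mathbb R^d\to[1,\infty)$ is continuous, $w(x+y)\le w^*(x)w(y)$, and $\sup_{0<t\le T,\,x}\|x\|_{\mathfrak s}^n\,w^*(t^{\mathfrak s/\ell}x)G(x)<\infty$ for all $n\ge0$, $T>0$. Products of weights carry the product control functions, e.g. $(w^3v)^*=(w^*)^3v^*$. Put $\varphi(x)=|x_1|^{1/\mathfrak s_1}\wedge1$, $\varphi(x,y)=\varphi(x)\wedge\varphi(y)$, $H=(\mathbb R\setminus\{0\})\times\mathbb R^{d-1}$. A *$G$-type semigroup*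 is a family of continuous kernels $Q_t(x,y)$, $t>0$, with $\int Q_{t-r}(x,z)Q_r(z,y)\,dz=Q_t(x,y)$ for $0<r<t$, $\int Q_t(x,y)\,dy\to1$ as $t\downarrow0$, differentiable in $t$, with $|Q_t(x,y)|\lesssim G_t(x-y)$ and $|\partial_tQ_t(x,y)|\lesssim t^{-1}G_t(x-y)$. For $\alpha\le0$, $C^{\alpha,Q}(w)$ is the completion of the continuous functions $f$ with $\|fw\|_\infty<\infty$ under $\|f\|_{C^{\alpha,Q}(w)}=\sup_{0<t\le1}t^{-\alpha/\ell}\|w\,Q_tf\|_\infty$. A *$\bar\beta$-regularizing kernel* with constants $\delta,C_K>0$ is a family of continuous kernels $K_t(x,y)$ with $\int K_{t-r}(x,z)Q_r(z,y)\,dz=K_t(x,y)$ whose derivatives $\partial_x^{\bf k}K_t$, $|{\bf k}|_{\mathfrak s}<\delta$, exist and satisfy $|\partial^{\bf k}_xK_t(x,y)|\le C_Kt^{(\bar\beta-|{\bf k}|_{\mathfrak s})/\ell-1}G_t(x-y)$ and, for $\|h\|_{\mathfrak s}\le t^{1/\ell}$, $$\Big|\partial_x^{\bf k}K_t(x+h,y)-\sum_{|{\bf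 l}|_{\mathfrak s}<\delta-|{\bf k}|_{\mathfrak s}}\tfrac{h^{\bf l}}{{\bf l}!}\partial_x^{{\bf k}+{\bf l}}K_t(x,y)\Big|\le C_K\|h\|_{\mathfrak s}^{\delta-|{\bf k}|_{\mathfrak s}}t^{(\bar\beta-\delta)/\ell-1}G_t(x-y).$$ Put $\partial^{\bf k}K(x,\Lambda)=\int_0^1\partial^{\bf k}K_t(x,\Lambda)\,dt$, where $\partial^{\bf k}K_t(x,f)=\int\partial^{\bf k}_xK_t(x,y)f(y)\,dy$ is extended continuously to distributions. A *regularity structure* $\mathscr T=(\mathbf A,\mathbf T,\mathbf G)$ consists of a locally finite index set $\mathbf A\subset\mathbb R$ bounded below, with smallest element $\alpha_0$, an algebraic direct sum $\mathbf T=\bigoplus_{\alpha\in\mathbf A}\mathbf T_\alpha$ of Banach spaces, and a group $\mathbf G$ of continuous linear operators on $\mathbf T$ with $(g-\mathrm{id})\mathbf T_\alpha\subset\mathbf T_{<\alpha}$ for $g\in\mathbf G$. A *smooth model* is a pair of continuous linear $\Pi_x:\mathbf T\to C(\mathbb R^d)\cap L^\infty(w)$ and $\Gamma_{xy}\in\mathbf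 G$ with $\Pi_x\Gamma_{xy}=\Pi_y$, $\Gamma_{xx}=\mathrm{id}$, $\Gamma_{xy}\Gamma_{yz}=\Gamma_{xz}$ and, for every $\gamma$, $$\|\Pi\|_{\gamma,w}=\sup_{\alpha<\gamma,\,0<t\le1,\,x,\,\tau\in\mathbf T_\alpha\setminus\{0\}}t^{-\alpha/\ell}w(x)\frac{|Q_t(x,\Pi_x\tau)|}{\|\tau\|_\alpha}<\infty,\qquad\|\Gamma\|_{\gamma,w}=\sup_{\beta'<\alpha<\gamma,\,x\ne y,\,\tau\in\mathbf T_\alpha\setminus\{0\}}\frac{w(x)\|\Gamma_{yx}\tau\|_{\beta'}}{w^*(y-x)\|y-x\|_{\mathfrak s}^{\alpha-\beta'}\|\tau\|_\alpha}<\infty .$$ $\mathscr M_w(\mathscr T)$, the set of *models*, is the completion of the smooth models under the pseudo-metrics $|||M^{(1)};M^{(2)}|||_{\gamma,w}=\|\Pi^{(1)}-\Pi^{(2)}\|_{\gamma,w}+\|\Gamma^{(1)}-\Gamma^{(2)}\|_{\gamma,w}$, $\gamma\in\mathbb R$; $|||M|||_{\gamma,w}=\|\Pi\|_{\gamma,w}+\|\Gamma\|_{\gamma,w}$.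 For $\eta\le\gamma$, $\mathcal D^{\gamma,\eta}_v(\Gamma)$ is the set of $f:H\to\mathbf T_{<\gamma}$ for which both $$(\!|f|\!)_{\gamma,\eta,v}=\sup_{\alpha<\gamma,\,x\in H}\frac{v(x)\|f(x)\|_\alpha}{\varphi(x)^{(\eta-\alpha)\wedge0}},\qquad\|f\|_{\gamma,\eta,v}=\sup_{\alpha<\gamma}\ \sup_{\substack{x\ne y\in H\\ \|y-x\|_{\mathfrak s}\le\varphi(x,y)}}\frac{v(x)\|f(y)-\Gamma_{yx}f(x)\|_\alpha}{\varphi(x,y)^{\eta-\gamma}v^*(x-y)\|y-x\|_{\mathfrak s}^{\gamma-\alpha}}$$ are finite; $|||f|||_{\gamma,\eta,v}$ is their sum, and $|||f^{(1)};f^{(2)}|||_{\gamma,\eta,v}$ is obtained by replacing $f$ by $f^{(1)}-f^{(2)}$ and $f(y)-\Gamma_{yx}f(x)$ by the difference of these increments. $\Lambda\in C^{\zeta,Q}(wv)$ ($\zeta\le0$) is a *reconstruction* of $f$ if, with $\Lambda_x=\Lambda-\Pi_xf(x)$, $$[\![\Lambda]\!]_{\gamma,\eta,wv}=\sup_{0<t\le1,\,x\in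 H}t^{-\gamma/\ell}\varphi(x)^{\gamma-\eta}(wv)(x)|Q_t(x,\Lambda_x)|<\infty;$$ $[\![\Lambda^{(1)};\Lambda^{(2)}]\!]_{\gamma,\eta,wv}$ is defined with $\Lambda^{(1)}_x-\Lambda^{(2)}_x$ in place of $\Lambda_x$. Let $\bar{\mathscr T}$ be a regularity structure, with index set $\bar{\mathbf A}\supset\mathbb N[\mathfrak s]$, containing linearly independent monomials $X^{\bf k}\in\bar{\mathbf T}_{|{\bf k}|_{\mathfrak s}}$, ${\bf k}\in\mathbb N^d$, whose span is stable under $\bar{\mathbf G}$; let $\mathcal I:\mathbf T\to\bar{\mathbf T}$ be continuous linear with $\mathcal I\mathbf T_\alpha\subset\bar{\mathbf T}_{\alpha+\beta}$, and let $\|\mathcal I\|$ be its operator norm from $\mathbf T_{<\gamma}$ to $\bar{\mathbf T}_{<\gamma+\beta}$. Set $$\mathcal J(x)\tau=\sum_{|{\bf k}|_{\mathfrak s}<\alpha+\beta}\frac{X^{\bf k}}{{\bf k}!}\partial^{\bf k}K(x,\Pi_x\tau)\quad(\tau\in\mathbf T_\alpha,\ \alpha+\beta<\delta).$$ Models $M=(\Pi,\Gamma)\in\mathscr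 M_w(\mathscr T)$, $\bar M=(\bar\Pi,\bar\Gamma)\in\mathscr M_w(\bar{\mathscr T})$ are *compatible* if $\bar\Pi_xX^{\bf k}=(\cdot-x)^{\bf k}$, $\bar\Gamma_{yx}X^{\bf k}=\sum_{{\bf l}\le{\bf k}}\binom{\bf k}{\bf l}(y-x)^{\bf l}X^{{\bf k}-{\bf l}}$ and $\bar\Gamma_{yx}(\mathcal I+\mathcal J(x))\tau=(\mathcal I+\mathcal J(y))\Gamma_{yx}\tau$ for all $\tau\in\mathbf T_{<\delta-\beta}$. **Theorem.** Let $w,v$ be $G$-controlled weights with $w^*$ symmetric ($w^*(-x)=w^*(x)$) and $w^3v$ $G$-controlled. Let $0<\beta\le\bar\beta$, $\gamma+\bar\beta<\delta$, $\eta\in(\gamma-\mathfrak s_1,\gamma]$, $\alpha_0>\gamma-\mathfrak s_1$, $\zeta\le\eta\wedge\alpha_0\wedge0$, and assume either $\beta<\bar\beta$, or $\beta=\bar\beta$ and $\{\alpha+\bar\beta:\alpha\in\mathbf A\cup\{\gamma,\zeta\}\}\cap\mathbb N[\mathfrak s]=\emptyset$. Then for every compatible pair $(M,\bar M)$, every $f\in\mathcal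 D^{\gamma,\eta}_v(\Gamma)$ and every reconstruction $\Lambda\in C^{\zeta,Q}(wv)$ of $f$, the integrals below and those in $\mathcal J$ converge absolutely, and the function $$\mathcal Kf(x)=\mathcal If(x)+\mathcal J(x)f(x)+\sum_{|{\bf k}|_{\mathfrak s}<\gamma+\beta}\frac{X^{\bf k}}{{\bf k}!}\partial^{\bf k}K(x,\Lambda_x)\qquad(x\in H)$$ belongs to $\mathcal D^{\gamma+\beta,\zeta+\beta}_{w^3v}(\bar\Gamma)$, with $$(\!|\mathcal Kf|\!)_{\gamma+\beta,\zeta+\beta,w^3v}\le C\Big(\|\mathcal I\|(\!|f|\!)_{\gamma,\eta,v}+C_K\big\{\|\Pi\|_{\gamma,w}(1+\|\Gamma\|_{\gamma,w})^2|||f|||_{\gamma,\eta,v}+\|\Lambda\|_{C^{\zeta,Q}(wv)}+[\![\Lambda]\!]_{\gamma,\eta,wv}\big\}\Big),$$ $$\|\mathcal Kf\|_{\gamma+\beta,\zeta+\beta,w^3v}\le C\Big(\|\mathcal I\|\big\{\|\Gamma\|_{\gamma,w}(\!|f|\!)_{\gamma,\eta,v}+\|f\|_{\gamma,\eta,v}\big\}+C_K\big\{\|\Pi\|_{\gamma,w}(1+\|\Gamma\|_{\gamma,w})^2|||f|||_{\gamma,\eta,v}+[\![\Lambda]\!]_{\gamma,\eta,wv}\big\}\Big).$$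 Here $C$ depends only on $d,\mathfrak s,\ell,G$, on $w,v$ and their control functions, on $\gamma,\eta,\zeta,\beta,\bar\beta,\delta$, on $\mathbf A$, and on an upper bound for the norms $\|X^{\bf k}\|$, $|{\bf k}|_{\mathfrak s}<\gamma+\beta$. Moreover (for fixed $Q$, $K$, $\mathscr T$, $\bar{\mathscr T}$, $\mathcal I$) there is a quadratic function $C_R>0$ of $R>0$ such that, for all compatible pairs $(M^{(i)},\bar M^{(i)})$, all $f^{(i)}\in\mathcal D^{\gamma,\eta}_v(\Gamma^{(i)})$ and all reconstructions $\Lambda^{(i)}\in C^{\zeta,Q}(wv)$ of $f^{(i)}$, $i=1,2$, with $|||M^{(i)}|||_{\gamma,w}\le R$ and $|||f^{(i)}|||_{\gamma,\eta,v}\le R$, $$|||\mathcal Kf^{(1)};\mathcal Kf^{(2)}|||_{\gamma+\beta,\zeta+\beta,w^3v}\le C_R\Big(|||M^{(1)};M^{(2)}|||_{\gamma,w}+|||f^{(1)};f^{(2)}|||_{\gamma,\eta,v}+\|\Lambda^{(1)}-\Lambda^{(2)}\|_{C^{\zeta,Q}(wv)}+[\![\Lambda^{(1)};\Lambda^{(2)}]\!]_{\gamma,\eta,wv}\Big),$$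 and if $\gamma>0$ the last two terms on the right-hand side may be omitted. -/

import Mathlib

open MeasureTheory Filter Topology Set
open scoped ENNReal

universe u u₁ u₂

noncomputable section

/-! ### Scalings, multi-indices, temporal weight -/

/-- Points of `ℝ^d`; the temporal variable is the coordinate `x 0`. -/
abbrev Pt (d : ℕ) := Fin d → ℝ

/-- Scaled degree `|k|_s = ∑ s_i k_i`. -/
def mdeg {d : ℕ} (s : Fin d → ℝ) (k : Fin d → ℕ) : ℝ := ∑ i, s i * (k i : ℝ)

/-- `k! = ∏ k_i!`. -/
def mfact {d : ℕ} (k : Fin d → ℕ) : ℕ := ∏ i, (k i).factorial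

/-- `binom(k, l) = ∏ binom(k_i, l_i)`. -/
def mchoose {d : ℕ} (k l : Fin d → ℕ) : ℕ := ∏ i, (k i).choose (l i)

/-- `x^k = ∏ x_i^{k_i}`. -/
def mpow {d : ℕ} (x : Pt d) (k : Fin d → ℕ) : ℝ := ∏ i, x i ^ k i

/-- `‖x‖_s = ∑ |x_i|^{1/s_i}`. -/
def sNorm {d : ℕ} (s : Fin d → ℝ) (x : Pt d) : ℝ := ∑ i, |x i| ^ (1 / s i)

/-- The finite set of multi-indices `k` with `|k|_s < c` (see `mem_mbelow`). -/
def mbelow {d : ℕ} (s : Fin d → ℝ) (c : ℝ) : Finset (Fin d → ℕ) :=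
  (Fintype.piFinset fun _ : Fin d => Finset.range ⌈c⌉₊).filter fun k => mdeg s k < c

theorem mem_mbelow {d : ℕ} {s : Fin d → ℝ} (hs : ∀ i, 1 ≤ s i) {c : ℝ} {k : Fin d → ℕ} :
    k ∈ mbelow s c ↔ mdeg s k < c := by
  unfold mbelow
  rw [Finset.mem_filter, Fintype.mem_piFinset]
  refine ⟨fun h => h.2, fun h => ⟨fun i => ?_, h⟩⟩
  rw [Finset.mem_range]
  have h1 : s i * (k i : ℝ) ≤ mdeg s k :=
    Finset.single_le_sum (f := fun j => s j * (k j : ℝ))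
      (fun j _ => mul_nonneg (zero_le_one.trans (hs j)) (Nat.cast_nonneg _)) (Finset.mem_univ i)
  have h2 : (k i : ℝ) ≤ s i * (k i : ℝ) :=
    le_mul_of_one_le_left (Nat.cast_nonneg _) (hs i)
  exact Nat.lt_ceil.2 (lt_of_le_of_lt (h2.trans h1) h)

/-- `t^{s/ℓ} x`. -/
def sScale {d : ℕ} (s : Fin d → ℝ) (ℓ t : ℝ) (x : Pt d) : Pt d := fun i => t ^ (s i / ℓ) * x i

/-- `G_t(x) = t^{-|s|/ℓ} G(t^{-s/ℓ} x)`. -/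
def Gt {d : ℕ} (s : Fin d → ℝ) (ℓ : ℝ) (G : Pt d → ℝ) (t : ℝ) (x : Pt d) : ℝ :=
  t ^ (-(∑ i, s i) / ℓ) * G (fun i => t ^ (-s i / ℓ) * x i)

/-- `φ(x) = |x_1|^{1/s_1} ∧ 1`. -/
def tw {d : ℕ} [NeZero d] (s : Fin d → ℝ) (x : Pt d) : ℝ := min (|x 0| ^ (1 / s 0)) 1

/-- `φ(x, y) = φ(x) ∧ φ(y)`. -/
def tw₂ {d : ℕ} [NeZero d] (s : Fin d → ℝ) (x y : Pt d) : ℝ := min (tw s x) (tw s y)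

/-! ### Weights, semigroups, Besov spaces -/

/-- `w` is a `G`-controlled weight, with the control function `w^*` equal to `wst`. -/
structure IsControlled {d : ℕ} (s : Fin d → ℝ) (ℓ : ℝ) (G : Pt d → ℝ) (w wst : Pt d → ℝ) :
    Prop where
  continuous : Continuous w
  pos : ∀ x, 0 < w x
  le_one : ∀ x, w x ≤ 1
  continuous_st : Continuous wst
  one_le_st : ∀ x, 1 ≤ wst x
  moderate : ∀ x y, w (x + y) ≤ wst x * w y
  integrable : ∀ (n : ℕ) (T : ℝ), 0 < T → ∃ B : ℝ, ∀ t ∈ Ioc 0 T, ∀ x,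
    sNorm s x ^ n * wst (sScale s ℓ t x) * G x ≤ B

/-- `G`-type semigroups; only the values at `t > 0` matter. -/
structure IsGSemigroup {d : ℕ} (s : Fin d → ℝ) (ℓ : ℝ) (G : Pt d → ℝ)
    (Q : ℝ → Pt d → Pt d → ℝ) : Prop where
  continuous : ∀ t, 0 < t → Continuous (Function.uncurry (Q t))
  semigroup : ∀ r t, 0 < r → r < t → ∀ x y, ∫ z, Q (t - r) x z * Q r z y = Q t x y
  conservative : ∀ x, Tendsto (fun t => ∫ y, Q t x y) (𝓝[>] 0) (𝓝 1)
  upper : ∃ C₁ : ℝ, 0 < C₁ ∧ ∀ t, 0 < t → ∀ x y, |Q t x y| ≤ C₁ * Gt s ℓ G t (x - y)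
  time_deriv : ∃ C₂ : ℝ, 0 < C₂ ∧ ∀ t, 0 < t → ∀ x y,
    DifferentiableAt ℝ (fun r => Q r x y) t ∧
    |deriv (fun r => Q r x y) t| ≤ C₂ * t⁻¹ * Gt s ℓ G t (x - y)

/-- A distribution `Λ` is represented by its regularizations: `Λ t x` stands for `(Q_t Λ)(x)`,
`0 < t ≤ 1`. -/
abbrev Distr (d : ℕ) := ℝ → Pt d → ℝ

/-- The distribution given by a function `f`: `(Q_t f)(x) = ∫ Q_t(x, y) f(y) dy`. -/
def ofFun {d : ℕ} (Q : ℝ → Pt d → Pt d → ℝ) (f : Pt d → ℝ) : Distr d :=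
  fun t x => ∫ y, Q t x y * f y

/-- `‖Λ‖_{C^{α,Q}(w)} = sup_{0<t≤1} t^{-α/ℓ} ‖Q_t Λ‖_{L^∞(w)}` (the functions `Q_t Λ` are
continuous and `w` is continuous and positive, so that the essential supremum is a supremum). -/
def besovNorm {d : ℕ} (ℓ α : ℝ) (w : Pt d → ℝ) (Λ : Distr d) : ℝ≥0∞ :=
  ⨆ t : ℝ, ⨆ _ : t ∈ Ioc (0 : ℝ) 1, ⨆ x : Pt d, ENNReal.ofReal (t ^ (-α / ℓ) * (|Λ t x| * w x))

/-- `f ∈ C(w)`. -/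
def MemC {d : ℕ} (w f : Pt d → ℝ) : Prop :=
  Continuous f ∧ ∃ c : ℝ, ∀ x, |f x| * w x ≤ c

/-- `Λ ∈ C^{α,Q}(w)`. The completion of `C(w)` under `‖·‖_{C^{α,Q}(w)}` is realized as the closure
of `{(Q_t f)_{0<t≤1} ; f ∈ C(w)}` in the (complete) space of families of continuous functions
with the norm `besovNorm`. -/
def MemBesov {d : ℕ} (ℓ : ℝ) (Q : ℝ → Pt d → Pt d → ℝ) (α : ℝ) (w : Pt d → ℝ) (Λ : Distr d) :
    Prop :=
  ∀ ε : ℝ, 0 < ε → ∃ f, MemC w f ∧ besovNorm ℓ α w (Λ - ofFun Q f) ≤ ENNReal.ofReal ε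

/-! ### Regularity structures and models -/

/-- A regularity structure with index set `A`. The family `V` is indexed by all reals, with
`V α = 0` for `α ∉ A`; the model space is the algebraic direct sum of the `V α`. An operator on it
is continuous if and only if all its components `V α → V β` are (`A` being locally finite and the
operators lower triangular). -/
structure RegStruct (A : Set ℝ) where
  bddBelow : BddBelow A
  locFinite : ∀ a b : ℝ, (A ∩ Icc a b).Finite
  V : ℝ → Type u
  [normed : ∀ α, NormedAddCommGroup (V α)]
  [space : ∀ α, NormedSpace ℝ (V α)]
  [complete : ∀ α, CompleteSpace (V α)]
  trivial_off : ∀ α, α ∉ A → Subsingleton (V α)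
  grp : Subgroup ((Π₀ α, V α) ≃ₗ[ℝ] (Π₀ α, V α))
  grp_continuous : ∀ g ∈ grp, ∀ α β, Continuous fun τ : V α => (g (DFinsupp.single α τ)) β
  grp_lower : ∀ g ∈ grp, ∀ α (τ : V α) β, ¬ β < α →
    (g (DFinsupp.single α τ) - DFinsupp.single α τ) β = 0

attribute [instance] RegStruct.normed RegStruct.space RegStruct.complete

/-- The model space `⨁ V α`. -/
abbrev RegStruct.Tot {A : Set ℝ} (T : RegStruct.{u} A) := Π₀ α, T.V α

/-- `τ ∈ T_{<γ}`. -/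
def RegStruct.Below {A : Set ℝ} (T : RegStruct.{u} A) (γ : ℝ) (τ : T.Tot) : Prop :=
  ∀ α, γ ≤ α → τ α = 0

/-- `‖Π‖_{γ,w}`; the argument `P x τ t y` stands for `Q_t(y, Π_x τ)`. -/
def piNorm {d : ℕ} {A : Set ℝ} {T : RegStruct.{u} A} (ℓ : ℝ) (w : Pt d → ℝ) (γ : ℝ)
    (P : Pt d → T.Tot → Distr d) : ℝ≥0∞ :=
  ⨆ α : ℝ, ⨆ _ : α < γ, ⨆ t : ℝ, ⨆ _ : t ∈ Ioc (0 : ℝ) 1, ⨆ x : Pt d, ⨆ τ : T.V α,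
    ENNReal.ofReal (t ^ (-α / ℓ) * w x * |P x (DFinsupp.single α τ) t x| / ‖τ‖)

/-- `‖Γ‖_{γ,w}`. -/
def gamNorm {d : ℕ} {A : Set ℝ} {T : RegStruct.{u} A} (s : Fin d → ℝ) (w wst : Pt d → ℝ) (γ : ℝ)
    (Γ : Pt d → Pt d → T.Tot → T.Tot) : ℝ≥0∞ :=
  ⨆ α : ℝ, ⨆ β : ℝ, ⨆ _ : β < α ∧ α < γ, ⨆ x : Pt d, ⨆ y : Pt d, ⨆ _ : x ≠ y, ⨆ τ : T.V α,
    ENNReal.ofReal (w x * ‖(Γ y x (DFinsupp.single α τ)) β‖ /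
      (wst (y - x) * sNorm s (y - x) ^ (α - β) * ‖τ‖))

/-- Smooth models: `Π_x : T → C(w)` continuous linear, `Γ_{xy}` in the structure group. -/
structure IsSmoothModel {d : ℕ} {A : Set ℝ} {T : RegStruct.{u} A} (s : Fin d → ℝ) (ℓ : ℝ)
    (Q : ℝ → Pt d → Pt d → ℝ) (w wst : Pt d → ℝ)
    (P : Pt d → T.Tot →ₗ[ℝ] (Pt d → ℝ)) (Γ : Pt d → Pt d → (T.Tot ≃ₗ[ℝ] T.Tot)) : Prop where
  continuous : ∀ x τ, Continuous (P x τ)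
  bounded : ∀ x α, ∃ c : ℝ, ∀ (τ : T.V α) y, |P x (DFinsupp.single α τ) y| * w y ≤ c * ‖τ‖
  mem_grp : ∀ x y, Γ x y ∈ T.grp
  pi_gam : ∀ x y τ, P x (Γ x y τ) = P y τ
  gam_self : ∀ x τ, Γ x x τ = τ
  gam_comp : ∀ x y z τ, Γ x y (Γ y z τ) = Γ x z τ
  pi_finite : ∀ γ, piNorm ℓ w γ (fun x (τ : T.Tot) => ofFun Q (P x τ)) < ∞
  gam_finite : ∀ γ, gamNorm s w wst γ (fun x y (τ : T.Tot) => Γ x y τ) < ∞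

/-- The data `(Π, Γ)` of a model; `Pi x τ t y` stands for `Q_t(y, Π_x τ)`. -/
structure ModelData (d : ℕ) {A : Set ℝ} (T : RegStruct.{u} A) where
  Pi : Pt d → T.Tot →ₗ[ℝ] Distr d
  Gam : Pt d → Pt d → T.Tot →ₗ[ℝ] T.Tot

/-- `M ∈ 𝓜_w(T)`, the completion of the set of smooth models under the pseudo-metrics
`|||·;·|||_{γ,w}`: by continuity a limit of smooth models keeps the algebraic relations (and is
determined by `Γ` and by the values `Q_t(x, Π_x τ)`, since `Π_x = Π_y Γ_{yx}`). -/
structure IsModel {d : ℕ} {A : Set ℝ} {T : RegStruct.{u} A} (s : Fin d → ℝ) (ℓ : ℝ)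
    (Q : ℝ → Pt d → Pt d → ℝ) (w wst : Pt d → ℝ) (M : ModelData d T) : Prop where
  lower : ∀ x y α (τ : T.V α) β, ¬ β < α →
    (M.Gam x y (DFinsupp.single α τ) - DFinsupp.single α τ) β = 0
  pi_gam : ∀ x y τ, ∀ t ∈ Ioc (0 : ℝ) 1, ∀ z, M.Pi x (M.Gam x y τ) t z = M.Pi y τ t z
  gam_self : ∀ x τ, M.Gam x x τ = τ
  gam_comp : ∀ x y z τ, M.Gam x y (M.Gam y z τ) = M.Gam x z τ
  pi_finite : ∀ γ, piNorm ℓ w γ (fun x (τ : T.Tot) => M.Pi x τ) < ∞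
  gam_finite : ∀ γ, gamNorm s w wst γ (fun x y (τ : T.Tot) => M.Gam x y τ) < ∞
  approx : ∀ γ ε : ℝ, 0 < ε → ∃ P Γ, IsSmoothModel s ℓ Q w wst P Γ ∧
    piNorm ℓ w γ (fun x (τ : T.Tot) => M.Pi x τ - ofFun Q (P x τ)) ≤ ENNReal.ofReal ε ∧
    gamNorm s w wst γ (fun x y (τ : T.Tot) => M.Gam x y τ - Γ x y τ) ≤ ENNReal.ofReal ε

/-- `‖Π‖_{γ,w}` of a model. -/
def ModelData.piN {d : ℕ} {A : Set ℝ} {T : RegStruct.{u} A} (M : ModelData d T) (ℓ : ℝ)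
    (w : Pt d → ℝ) (γ : ℝ) : ℝ≥0∞ :=
  piNorm ℓ w γ (fun x (τ : T.Tot) => M.Pi x τ)

/-- `‖Γ‖_{γ,w}` of a model. -/
def ModelData.gamN {d : ℕ} {A : Set ℝ} {T : RegStruct.{u} A} (M : ModelData d T)
    (s : Fin d → ℝ) (w wst : Pt d → ℝ) (γ : ℝ) : ℝ≥0∞ :=
  gamNorm s w wst γ (fun x y (τ : T.Tot) => M.Gam x y τ)

/-- `|||M₁; M₂|||_{γ,w}`. -/
def modelDist {d : ℕ} {A : Set ℝ} {T : RegStruct.{u} A} (s : Fin d → ℝ) (ℓ : ℝ)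
    (w wst : Pt d → ℝ) (γ : ℝ) (M₁ M₂ : ModelData d T) : ℝ≥0∞ :=
  piNorm ℓ w γ (fun x (τ : T.Tot) => M₁.Pi x τ - M₂.Pi x τ) +
    gamNorm s w wst γ (fun x y (τ : T.Tot) => M₁.Gam x y τ - M₂.Gam x y τ)

/-! ### Singular modelled distributions and reconstructions -/

/-- `⦅f⦆_{γ,η,v}`; only the values of `f` off the hyperplane `x 0 = 0` matter. -/
def sizeNorm {d : ℕ} [NeZero d] {A : Set ℝ} {T : RegStruct.{u} A} (s : Fin d → ℝ) (γ η : ℝ)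
    (v : Pt d → ℝ) (f : Pt d → T.Tot) : ℝ≥0∞ :=
  ⨆ α : ℝ, ⨆ _ : α < γ, ⨆ x : Pt d, ⨆ _ : x 0 ≠ 0,
    ENNReal.ofReal (v x * ‖f x α‖ / tw s x ^ min (η - α) 0)

/-- The local Hölder-type seminorm of increments `Δ y x`. -/
def incrNorm {d : ℕ} [NeZero d] {A : Set ℝ} {T : RegStruct.{u} A} (s : Fin d → ℝ) (γ η : ℝ)
    (v vst : Pt d → ℝ) (Δ : Pt d → Pt d → T.Tot) : ℝ≥0∞ :=
  ⨆ α : ℝ, ⨆ _ : α < γ, ⨆ x : Pt d, ⨆ y : Pt d,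
    ⨆ _ : x 0 ≠ 0 ∧ y 0 ≠ 0 ∧ x ≠ y ∧ sNorm s (y - x) ≤ tw₂ s x y,
    ENNReal.ofReal (v x * ‖Δ y x α‖ /
      (tw₂ s x y ^ (η - γ) * vst (x - y) * sNorm s (y - x) ^ (γ - α)))

/-- `Δ^Γ_{yx} f = f(y) - Γ_{yx} f(x)`. -/
def incr {d : ℕ} {A : Set ℝ} {T : RegStruct.{u} A} (M : ModelData d T) (f : Pt d → T.Tot)
    (y x : Pt d) : T.Tot :=
  f y - M.Gam y x (f x)

/-- `‖f‖_{γ,η,v}`. -/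
def holNorm {d : ℕ} [NeZero d] {A : Set ℝ} {T : RegStruct.{u} A} (s : Fin d → ℝ) (γ η : ℝ)
    (v vst : Pt d → ℝ) (M : ModelData d T) (f : Pt d → T.Tot) : ℝ≥0∞ :=
  incrNorm s γ η v vst (incr M f)

/-- `|||f|||_{γ,η,v} = ⦅f⦆_{γ,η,v} + ‖f‖_{γ,η,v}`. -/
def mdNorm {d : ℕ} [NeZero d] {A : Set ℝ} {T : RegStruct.{u} A} (s : Fin d → ℝ) (γ η : ℝ)
    (v vst : Pt d → ℝ) (M : ModelData d T) (f : Pt d → T.Tot) : ℝ≥0∞ :=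
  sizeNorm s γ η v f + holNorm s γ η v vst M f

/-- `f ∈ 𝓓_v^{γ,η}(Γ)`. -/
structure IsMD {d : ℕ} [NeZero d] {A : Set ℝ} {T : RegStruct.{u} A} (s : Fin d → ℝ) (γ η : ℝ)
    (v vst : Pt d → ℝ) (M : ModelData d T) (f : Pt d → T.Tot) : Prop where
  below : ∀ x : Pt d, x 0 ≠ 0 → T.Below γ (f x)
  size_finite : sizeNorm s γ η v f < ∞
  hol_finite : holNorm s γ η v vst M f < ∞

/-- `|||f₁; f₂|||_{γ,η,v}`. -/
def mdDist {d : ℕ} [NeZero d] {A : Set ℝ} {T : RegStruct.{u} A} (s : Fin d → ℝ) (γ η : ℝ)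
    (v vst : Pt d → ℝ) (M₁ M₂ : ModelData d T) (f₁ f₂ : Pt d → T.Tot) : ℝ≥0∞ :=
  sizeNorm s γ η v (fun x => f₁ x - f₂ x) +
    incrNorm s γ η v vst (fun y x => incr M₁ f₁ y x - incr M₂ f₂ y x)

/-- `Λ_x = Λ - Π_x f(x)`. -/
def recenter {d : ℕ} {A : Set ℝ} {T : RegStruct.{u} A} (M : ModelData d T) (f : Pt d → T.Tot)
    (Λ : Distr d) (x : Pt d) : Distr d :=
  Λ - M.Pi x (f x)

/-- `sup_{t,x} t^{-γ/ℓ} φ(x)^{γ-η} u(x) |Q_t(x, L_x)|` for a family `L_x` of distributions. -/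
def recNorm {d : ℕ} [NeZero d] (s : Fin d → ℝ) (ℓ γ η : ℝ) (u : Pt d → ℝ)
    (L : Pt d → Distr d) : ℝ≥0∞ :=
  ⨆ t : ℝ, ⨆ _ : t ∈ Ioc (0 : ℝ) 1, ⨆ x : Pt d, ⨆ _ : x 0 ≠ 0,
    ENNReal.ofReal (t ^ (-γ / ℓ) * tw s x ^ (γ - η) * u x * |L x t x|)

/-- `Λ ∈ C^{ζ,Q}(u)` is a reconstruction of `f ∈ 𝓓_v^{γ,η}(Γ)` for `M`, where `u = wv`. -/
structure IsReconstruction {d : ℕ} [NeZero d] {A : Set ℝ} {T : RegStruct.{u} A} (s : Fin d → ℝ)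
    (ℓ : ℝ) (Q : ℝ → Pt d → Pt d → ℝ) (γ η ζ : ℝ) (u : Pt d → ℝ) (M : ModelData d T)
    (f : Pt d → T.Tot) (Λ : Distr d) : Prop where
  mem : MemBesov ℓ Q ζ u Λ
  finite : recNorm s ℓ γ η u (recenter M f Λ) < ∞

/-! ### Regularizing kernels -/

/-- `K = D 0` is a `βbar`-regularizing kernel admissible for `Q`, with constants `δ` and `CK`, and
`D k t x y = ∂_x^k K_t(x, y)` for `|k|_s < δ`; only `t > 0` matters. -/
structure IsRegKernel {d : ℕ} (s : Fin d → ℝ) (ℓ : ℝ) (G : Pt d → ℝ)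
    (Q : ℝ → Pt d → Pt d → ℝ) (βbar δ CK : ℝ)
    (D : (Fin d → ℕ) → ℝ → Pt d → Pt d → ℝ) : Prop where
  delta_pos : 0 < δ
  const_pos : 0 < CK
  continuous : ∀ t, 0 < t → Continuous (Function.uncurry (D 0 t))
  partials : ∀ k i, mdeg s (k + Pi.single i 1) < δ → ∀ t, 0 < t → ∀ x y,
    HasDerivAt (fun r => D k t (Function.update x i r) y) (D (k + Pi.single i 1) t x y) (x i)
  conv : ∀ r t, 0 < r → r < t → ∀ x y, ∫ z, D 0 (t - r) x z * Q r z y = D 0 t x y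
  upper : ∀ k, mdeg s k < δ → ∀ t, 0 < t → ∀ x y,
    |D k t x y| ≤ CK * t ^ ((βbar - mdeg s k) / ℓ - 1) * Gt s ℓ G t (x - y)
  holder : ∀ k, mdeg s k < δ → ∀ t, 0 < t → ∀ x y h, sNorm s h ≤ t ^ (1 / ℓ) →
    |D k t (x + h) y - ∑ l ∈ mbelow s (δ - mdeg s k), mpow h l / (mfact l : ℝ) * D (k + l) t x y| ≤
      CK * sNorm s h ^ (δ - mdeg s k) * t ^ ((βbar - δ) / ℓ - 1) * Gt s ℓ G t (x - y)

/-- `∂^k K_t(x, Λ)`. For a function `f` this is `∫ ∂_x^k K_t(x, y) f(y) dy`, which by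
`K_t = K_{t/2} Q_{t/2}` equals `∫ ∂_x^k K_{t/2}(x, y) (Q_{t/2} f)(y) dy`; the latter expression is
its continuous extension to distributions. -/
def kerT {d : ℕ} (D : (Fin d → ℕ) → ℝ → Pt d → Pt d → ℝ) (k : Fin d → ℕ) (t : ℝ) (x : Pt d)
    (Λ : Distr d) : ℝ :=
  ∫ y, D k (t / 2) x y * Λ (t / 2) y

/-- `∂^k K(x, Λ) = ∫_0^1 ∂^k K_t(x, Λ) dt`. -/
def kerI {d : ℕ} (D : (Fin d → ℕ) → ℝ → Pt d → Pt d → ℝ) (k : Fin d → ℕ) (x : Pt d)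
    (Λ : Distr d) : ℝ :=
  ∫ t in (0 : ℝ)..1, kerT D k t x Λ

/-- The integrals defining `∂^k K(x, Λ)` converge absolutely. -/
def KerConv {d : ℕ} (D : (Fin d → ℕ) → ℝ → Pt d → Pt d → ℝ) (k : Fin d → ℕ) (x : Pt d)
    (Λ : Distr d) : Prop :=
  (∀ t ∈ Ioc (0 : ℝ) 1, Integrable fun y => D k (t / 2) x y * Λ (t / 2) y) ∧
    IntervalIntegrable (fun t => kerT D k t x Λ) volume 0 1

/-! ### Abstract integration, compatible models, the operator `𝓚` -/

/-- `X k` (for `k ∈ ℕ^d`) are the monomials of the polynomial structure inside `T`. -/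
structure IsPolySector {d : ℕ} {A : Set ℝ} (T : RegStruct.{u} A) (s : Fin d → ℝ)
    (X : ∀ k : Fin d → ℕ, T.V (mdeg s k)) : Prop where
  index : ∀ k : Fin d → ℕ, mdeg s k ∈ A
  indep : LinearIndependent ℝ fun k : Fin d → ℕ => (DFinsupp.single (mdeg s k) (X k) : T.Tot)
  closed : ∀ g ∈ T.grp, ∀ k : Fin d → ℕ, g (DFinsupp.single (mdeg s k) (X k)) ∈
    Submodule.span ℝ
      (Set.range fun k : Fin d → ℕ => (DFinsupp.single (mdeg s k) (X k) : T.Tot))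

/-- An abstract integration of order `β`, given by its restrictions `I : V α → V̄ (α + β)`. -/
abbrev AbsInt {A Abar : Set ℝ} (T : RegStruct.{u₁} A) (Tbar : RegStruct.{u₂} Abar) (β : ℝ) :=
  ∀ α, T.V α →L[ℝ] Tbar.V (α + β)

open Classical in
/-- The operator `I : T → T̄`. -/
def AbsInt.app {A Abar : Set ℝ} {T : RegStruct.{u₁} A} {Tbar : RegStruct.{u₂} Abar} {β : ℝ}
    (I : AbsInt T Tbar β) (τ : T.Tot) : Tbar.Tot :=
  τ.sum fun α σ => DFinsupp.single (α + β) (I α σ)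

/-- The operator norm of `I : T_{<γ} → T̄_{<γ+β}`. -/
def AbsInt.opN {A Abar : Set ℝ} {T : RegStruct.{u₁} A} {Tbar : RegStruct.{u₂} Abar} {β : ℝ}
    (I : AbsInt T Tbar β) (γ : ℝ) : ℝ≥0∞ :=
  ⨆ α : ℝ, ⨆ _ : α < γ, ENNReal.ofReal ‖I α‖

/-- `∑_{|k|_s < r} c_k X^k / k!`. -/
def polySum {d : ℕ} {A : Set ℝ} {T : RegStruct.{u} A} (s : Fin d → ℝ)
    (X : ∀ k : Fin d → ℕ, T.V (mdeg s k)) (r : ℝ) (c : (Fin d → ℕ) → ℝ) : T.Tot :=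
  ∑ k ∈ mbelow s r, (c k / (mfact k : ℝ)) • (DFinsupp.single (mdeg s k) (X k) : T.Tot)

open Classical in
/-- `𝓙(x) τ`, for `τ = ∑_α τ_α`: the sum over `α` of
`∑_{|k|_s < α + β} (X^k / k!) ∂^k K(x, Π_x τ_α)`. -/
def opJ {d : ℕ} {A Abar : Set ℝ} {T : RegStruct.{u₁} A} {Tbar : RegStruct.{u₂} Abar}
    (s : Fin d → ℝ) (X : ∀ k : Fin d → ℕ, Tbar.V (mdeg s k)) (β : ℝ)
    (D : (Fin d → ℕ) → ℝ → Pt d → Pt d → ℝ) (M : ModelData d T) (x : Pt d) (τ : T.Tot) :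
    Tbar.Tot :=
  τ.sum fun α σ =>
    polySum s X (α + β) fun k => kerI D k x (M.Pi x (DFinsupp.single α σ))

/-- `𝓝(x; f, Λ)`. -/
def opN {d : ℕ} {A Abar : Set ℝ} {T : RegStruct.{u₁} A} {Tbar : RegStruct.{u₂} Abar}
    (s : Fin d → ℝ) (X : ∀ k : Fin d → ℕ, Tbar.V (mdeg s k)) (γ β : ℝ)
    (D : (Fin d → ℕ) → ℝ → Pt d → Pt d → ℝ) (M : ModelData d T) (f : Pt d → T.Tot)
    (Λ : Distr d) (x : Pt d) : Tbar.Tot :=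
  polySum s X (γ + β) fun k => kerI D k x (recenter M f Λ x)

/-- `𝓚f(x) = I f(x) + 𝓙(x) f(x) + 𝓝(x; f, Λ)`. -/
def opK {d : ℕ} {A Abar : Set ℝ} {T : RegStruct.{u₁} A} {Tbar : RegStruct.{u₂} Abar}
    (s : Fin d → ℝ) (X : ∀ k : Fin d → ℕ, Tbar.V (mdeg s k)) (γ β : ℝ)
    (D : (Fin d → ℕ) → ℝ → Pt d → Pt d → ℝ) (I : AbsInt T Tbar β) (M : ModelData d T)
    (f : Pt d → T.Tot) (Λ : Distr d) (x : Pt d) : Tbar.Tot :=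
  I.app (f x) + opJ s X β D M x (f x) + opN s X γ β D M f Λ x

/-- The pair `(M, Mbar)` is compatible for `I`. -/
structure IsCompatible {d : ℕ} {A Abar : Set ℝ} {T : RegStruct.{u₁} A}
    {Tbar : RegStruct.{u₂} Abar} (s : Fin d → ℝ) (Q : ℝ → Pt d → Pt d → ℝ)
    (X : ∀ k : Fin d → ℕ, Tbar.V (mdeg s k)) (δ β : ℝ)
    (D : (Fin d → ℕ) → ℝ → Pt d → Pt d → ℝ) (I : AbsInt T Tbar β)
    (M : ModelData d T) (Mbar : ModelData d Tbar) : Prop where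
  pi_poly : ∀ x k, ∀ t ∈ Ioc (0 : ℝ) 1, ∀ y,
    Mbar.Pi x (DFinsupp.single (mdeg s k) (X k)) t y = ofFun Q (fun z => mpow (z - x) k) t y
  gam_poly : ∀ x y k, Mbar.Gam y x (DFinsupp.single (mdeg s k) (X k)) =
    ∑ l ∈ Finset.Iic k, ((mchoose k l : ℝ) * mpow (y - x) l) •
      (DFinsupp.single (mdeg s (k - l)) (X (k - l)) : Tbar.Tot)
  comm : ∀ x y (τ : T.Tot), T.Below (δ - β) τ →
    Mbar.Gam y x (I.app τ + opJ s X β D M x τ) =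
      I.app (M.Gam y x τ) + opJ s X β D M y (M.Gam y x τ)

end

/-! ### Scaled degrees, the anisotropic norm and the distance to the hyperplane. -/

section Scaling

variable {d : ℕ} {s : Fin d → ℝ}

/-! The estimate is linear in a small family of distributions: the recentred reconstruction L_x = Λ
− Π_x f(x), the pieces T^α_x = Π_x f(x)_α, and the pieces S^α_{yx} = Π_y (f(y) − Γ_{yx} f(x))_α.
They satisfy Λ = L_x + ∑_α T^α_x and L_x = L_y + ∑_α S^α_{yx}. `Sys` keeps these two relations and
the pointwise bounds and forgets the model. Differences of two sets of data satisfy the same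
relations, with constants given by the product rule (`ModelPair.sys`), so only differences are
estimated; the bounds for a single f are the comparison with zero data over the same model.

Algebra: compatibility makes the increment of 𝓚f equal to the image under I of the increment of f,
plus a polynomial. Its k-th coefficient, up to k!, is ∂^k K(y, L_y) + ∑ ∂^k K(y, S^α_{yx}) − ∑_l
(y−x)^l/l! ∂^{k+l} K(x, L_x), the middle sum being over |k| < α + β (`incr_opK`). The size of 𝓚f
involves ∂^k K(x, L_x) + ∑ ∂^k K(x, T^α_x) instead (`opK_eq`).

Space: the hypotheses bound Q_r L_x only at x itself. At another point z, L_x is replaced by L_z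
plus the terms S^α_{zx} when x and z are close compared with their distance to the hyperplane;
otherwise the terms T^α at both points are used, and ‖x−z‖ then dominates φ(x) (`Sys.abs_L_le`).
Integration against G_r meets the singularity φ(z)^{η−γ}, which is integrable because γ − η < s_1;
with η replaced by min(η, α_0) this remains true since α_0 > γ − s_1. The outcome is the size
r^{γ/ℓ} φ(x)^{η−γ} (`Sys.gInt_L`).

Time: the integral in r is split at r = ρ^ℓ, with ρ = φ(x) for the size and ρ = ‖y−x‖ for the
increments (`split_bound`). For small r every term of the coefficient is integrable at 0 separately.
For large r the relations regroup the coefficient: L_x + ∑ T^α_x becomes Λ minus the components with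
|k| ≥ α + β (`size_coef_bound`), while the increment coefficient becomes a Taylor remainder of the
kernel acting on L_x, plus terms with nonpositive target exponents (`hol_coef_bound`). A logarithm
could appear only when an exponent vanishes; this is excluded by β < β̄ or by the non-integrality
condition.

If γ > 0, the reconstruction bound is itself controlled by the modelled distribution: writing Q_t =
Q_{t−εt} Q_{εt} with ε small, the unknown constant reproduces itself with a factor 1/2 and is
absorbed (`Sys.bound_L_of_semigroup`).

Models and distributions are elements of completions. Joint measurability and the semigroup identity
are proved for continuous functions and pass to limits, the approximation errors being controlled
off the diagonal. -/

theorem mdeg_nonneg (hs : ∀ i, 1 ≤ s i) (k : Fin d → ℕ) : 0 ≤ mdeg s k :=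
  Finset.sum_nonneg fun i _ => mul_nonneg (zero_le_one.trans (hs i)) (Nat.cast_nonneg _)

theorem mdeg_add (k l : Fin d → ℕ) : mdeg s (k + l) = mdeg s k + mdeg s l := by
  simp [mdeg, mul_add, Finset.sum_add_distrib]

theorem mdeg_zero : mdeg s (0 : Fin d → ℕ) = 0 := by simp [mdeg]

theorem sNorm_nonneg (x : Pt d) : 0 ≤ sNorm s x :=
  Finset.sum_nonneg fun _ _ => Real.rpow_nonneg (abs_nonneg _) _

theorem sNorm_neg (x : Pt d) : sNorm s (-x) = sNorm s x := by simp [sNorm]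

theorem sNorm_sub_comm (x y : Pt d) : sNorm s (x - y) = sNorm s (y - x) := by
  rw [← sNorm_neg, neg_sub]

theorem sNorm_zero (hs : ∀ i, 1 ≤ s i) : sNorm s (0 : Pt d) = 0 := by
  refine Finset.sum_eq_zero fun i _ => ?_
  have : (1 / s i) ≠ 0 := one_div_ne_zero (by linarith [hs i])
  rw [Pi.zero_apply, abs_zero, Real.zero_rpow this]

theorem abs_rpow_le_sNorm (x : Pt d) (i : Fin d) : |x i| ^ (1 / s i) ≤ sNorm s x :=
  Finset.single_le_sum (f := fun j => |x j| ^ (1 / s j))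
    (fun _ _ => Real.rpow_nonneg (abs_nonneg _) _) (Finset.mem_univ i)

theorem abs_le_sNorm_rpow (hs : ∀ i, 1 ≤ s i) (x : Pt d) (i : Fin d) :
    |x i| ≤ sNorm s x ^ s i := by
  have h0 : 0 < s i := by linarith [hs i]
  calc |x i| = (|x i| ^ (1 / s i)) ^ s i := by
        rw [← Real.rpow_mul (abs_nonneg _), one_div_mul_cancel h0.ne', Real.rpow_one]
    _ ≤ _ := Real.rpow_le_rpow (Real.rpow_nonneg (abs_nonneg _) _) (abs_rpow_le_sNorm x i) h0.le

theorem sNorm_pos {x : Pt d} (hx : x ≠ 0) : 0 < sNorm s x := by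
  obtain ⟨i, hi⟩ := Function.ne_iff.1 hx
  exact (Real.rpow_pos_of_pos (abs_pos.2 hi) _).trans_le (abs_rpow_le_sNorm x i)

/-- The exponent 1/s_i is at most 1, so the power is subadditive. The triangle inequality behind
`tw_le_add` is this bound in the temporal coordinate. -/
theorem abs_add_rpow_le (hs : ∀ i, 1 ≤ s i) (i : Fin d) (a b : ℝ) :
    |a + b| ^ (1 / s i) ≤ |a| ^ (1 / s i) + |b| ^ (1 / s i) := by
  have h0 : 0 < s i := by linarith [hs i]
  refine (Real.rpow_le_rpow (abs_nonneg _) (abs_add_le a b) (by positivity)).trans ?_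
  exact Real.rpow_add_le_add_rpow (abs_nonneg _) (abs_nonneg _) (by positivity)
    ((div_le_one h0).2 (hs i))

theorem sNorm_scale {ℓ t : ℝ} (hs : ∀ i, 1 ≤ s i) (ht : 0 < t) (x : Pt d) :
    sNorm s (fun i => t ^ (-s i / ℓ) * x i) = t ^ (-1 / ℓ) * sNorm s x := by
  unfold sNorm
  rw [Finset.mul_sum]
  refine Finset.sum_congr rfl fun i _ => ?_
  have h0 : s i ≠ 0 := by linarith [hs i]
  rw [abs_mul, Real.mul_rpow (abs_nonneg _) (abs_nonneg _),
    abs_of_nonneg (Real.rpow_nonneg ht.le _), ← Real.rpow_mul ht.le]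
  congr 2
  field_simp

theorem continuous_sNorm (hs : ∀ i, 1 ≤ s i) : Continuous (sNorm s : Pt d → ℝ) := by
  unfold sNorm
  refine continuous_finsetSum _ fun i _ => ?_
  have : 0 ≤ 1 / s i := by have := hs i; positivity
  exact (continuous_abs.comp (continuous_apply i)).rpow_const fun _ => Or.inr this

theorem abs_mpow_le (hs : ∀ i, 1 ≤ s i) (h : Pt d) (l : Fin d → ℕ) :
    |mpow h l| ≤ sNorm s h ^ mdeg s l := by
  have h0 := sNorm_nonneg (s := s) h
  unfold mpow mdeg
  rw [Finset.abs_prod, Real.rpow_sum_of_nonneg h0]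
  · refine Finset.prod_le_prod (fun _ _ => abs_nonneg _) fun i _ => ?_
    rw [abs_pow, Real.rpow_mul h0, Real.rpow_natCast]
    exact pow_le_pow_left₀ (abs_nonneg _) (abs_le_sNorm_rpow hs h i) _
  · exact fun i _ => mul_nonneg (zero_le_one.trans (hs i)) (Nat.cast_nonneg _)

theorem mfact_pos (k : Fin d → ℕ) : 0 < mfact k := Finset.prod_pos fun _ _ => Nat.factorial_pos _

theorem one_le_mfact (k : Fin d → ℕ) : (1 : ℝ) ≤ mfact k := by
  exact_mod_cast mfact_pos k

theorem abs_div_mfact_le (a : ℝ) (k : Fin d → ℕ) : |a / (mfact k : ℝ)| ≤ |a| := by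
  rw [abs_div, abs_of_pos (zero_lt_one.trans_le (one_le_mfact k))]
  exact div_le_self (abs_nonneg _) (one_le_mfact k)

variable [NeZero d]

theorem tw_nonneg (x : Pt d) : 0 ≤ tw s x :=
  le_min (Real.rpow_nonneg (abs_nonneg _) _) zero_le_one

theorem tw_pos {x : Pt d} (hx : x 0 ≠ 0) : 0 < tw s x :=
  lt_min (Real.rpow_pos_of_pos (abs_pos.2 hx) _) one_pos

theorem tw_le_one (x : Pt d) : tw s x ≤ 1 := min_le_right _ _

theorem tw₂_pos {x y : Pt d} (hx : x 0 ≠ 0) (hy : y 0 ≠ 0) : 0 < tw₂ s x y :=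
  lt_min (tw_pos hx) (tw_pos hy)

theorem tw₂_le_one (x y : Pt d) : tw₂ s x y ≤ 1 := (min_le_left _ _).trans (tw_le_one x)

theorem tw_le_add (hs : ∀ i, 1 ≤ s i) (x z : Pt d) : tw s x ≤ tw s z + sNorm s (z - x) := by
  have h1 : |x 0| ^ (1 / s 0) ≤ |z 0| ^ (1 / s 0) + sNorm s (z - x) := by
    have h := abs_add_rpow_le hs 0 (z 0) ((x - z) 0)
    have e : z 0 + (x - z) 0 = x 0 := by simp
    rw [e] at h
    refine h.trans (add_le_add_right ?_ _)
    rw [sNorm_sub_comm]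
    exact abs_rpow_le_sNorm _ _
  have h2 := sNorm_nonneg (s := s) (z - x)
  unfold tw
  rcases min_cases (|z 0| ^ (1 / s 0)) 1 with h | h <;> rw [h.1]
  · exact (min_le_left _ _).trans h1
  · exact (min_le_right _ _).trans (by linarith)

/-- Points violating the locality constraint are far apart. -/
theorem tw_le_two_mul (hs : ∀ i, 1 ≤ s i) {x z : Pt d} (h : ¬ sNorm s (z - x) ≤ tw₂ s x z) :
    tw s x ≤ 2 * sNorm s (z - x) := by
  have h1 := tw_le_add hs x z
  have h2 := sNorm_nonneg (s := s) (z - x)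
  have h3 : tw₂ s x z < sNorm s (z - x) := not_le.1 h
  unfold tw₂ at h3
  rcases min_cases (tw s x) (tw s z) with h | h <;> rw [h.1] at h3 <;> linarith

theorem continuous_tw (hs : ∀ i, 1 ≤ s i) : Continuous (tw s : Pt d → ℝ) := by
  have : 0 ≤ 1 / s 0 := by have := hs 0; positivity
  exact ((continuous_abs.comp (continuous_apply 0)).rpow_const fun _ => Or.inr this).min
    continuous_const

theorem ae_apply_zero_ne : ∀ᵐ z : Pt d, z 0 ≠ 0 := by
  exact compl_mem_ae_iff.2 (Measure.pi_hyperplane (fun _ : Fin d => (volume : Measure ℝ)) 0 0)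

/-- Replacing the minimum by a sum makes the singular factor a function of one coordinate, so that
the integrals over space factorize. -/
theorem tw_rpow_neg_le (a : ℝ) (x : Pt d) :
    tw s x ^ (-a) ≤ 1 + |x 0| ^ (-(a / s 0)) := by
  have h0 : 0 ≤ |x 0| ^ (-(a / s 0)) := Real.rpow_nonneg (abs_nonneg _) _
  unfold tw
  rcases min_cases (|x 0| ^ (1 / s 0)) 1 with h | h <;> rw [h.1]
  · rw [← Real.rpow_mul (abs_nonneg _)]
    have : 1 / s 0 * -a = -(a / s 0) := by ring
    rw [this]; linarith
  · simp [h0]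

end Scaling

/-! ### One-dimensional integrals with a power singularity. -/

section OneDim

/-- The integrable singularity `|z|^{-b}` on the unit interval. -/
theorem integrable_indicator_abs_rpow {b : ℝ} (hb : b < 1) :
    Integrable (fun z : ℝ => (Ioc (-1 : ℝ) 1).indicator (fun z => |z| ^ (-b)) z) := by
  rw [integrable_indicator_iff measurableSet_Ioc, ← Ioc_union_Ioc_eq_Ioc (b := 0) (by norm_num)
    (by norm_num)]
  have h1 : IntegrableOn (fun z : ℝ => |z| ^ (-b)) (Ioc 0 1) := by
    have := (intervalIntegral.intervalIntegrable_rpow' (a := 0) (b := 1) (r := -b) (by linarith)).1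
    refine this.congr_fun (fun z hz => ?_) measurableSet_Ioc
    simp only [abs_of_pos hz.1]
  refine IntegrableOn.union ?_ h1
  have h2 : IntervalIntegrable (fun z : ℝ => |z| ^ (-b)) volume 0 1 :=
    (intervalIntegrable_iff_integrableOn_Ioc_of_le zero_le_one).2 h1
  -- The negative half is the reflection of the positive one.
  have h3 := (IntervalIntegrable.comp_mul_left (c := -1) h2 (by finiteness) (by finiteness)).symm
  simp only [neg_mul, one_mul, abs_neg, div_neg, div_one, neg_zero] at h3
  exact (intervalIntegrable_iff_integrableOn_Ioc_of_le (by norm_num)).1 h3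

/-- Write |z|^{-b} = λ^b |λz|^{-b}. Where |λz| ≥ 1 this is at most λ^b, and the Cauchy profile has
mass π; where |λz| ≤ 1 the profile is at most λ, and rescaling leaves a fixed convergent integral.
An explicit majorant g is produced, and not only a bound on the integral, because in dimension d the
integrand is dominated by a product of such majorants. -/
theorem singular_cauchy_bound {b : ℝ} (hb0 : 0 ≤ b) (hb : b < 1) :
    ∃ C : ℝ, 0 ≤ C ∧ ∀ lam : ℝ, 1 ≤ lam → ∀ x : ℝ, ∃ g : ℝ → ℝ, Integrable g ∧
      (∀ z, lam * (1 + (lam * (x - z)) ^ 2)⁻¹ * (1 + |z| ^ (-b)) ≤ g z) ∧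
      ∫ z, g z ≤ C * lam ^ b := by
  set k : ℝ → ℝ := fun z : ℝ => (Ioc (-1 : ℝ) 1).indicator (fun z => |z| ^ (-b)) z with hk
  have hki := integrable_indicator_abs_rpow hb
  have hk0 : ∀ z, 0 ≤ k z := fun z => indicator_nonneg (fun _ _ => Real.rpow_nonneg (abs_nonneg _) _) z
  refine ⟨2 * Real.pi + ∫ z, k z, add_nonneg (by positivity) (integral_nonneg hk0), ?_⟩
  intro lam hl x
  have l0 : 0 < lam := by linarith
  have lb : 1 ≤ lam ^ b := Real.one_le_rpow hl hb0
  have i1 : Integrable fun z : ℝ => lam * (1 + (lam * (x - z)) ^ 2)⁻¹ :=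
    ((integrable_inv_one_add_sq.comp_mul_left' l0.ne').comp_sub_left x).const_mul lam
  have i2 : Integrable fun z : ℝ => k (lam * z) := hki.comp_mul_left' l0.ne'
  have e1 : ∫ z : ℝ, lam * (1 + (lam * (x - z)) ^ 2)⁻¹ = Real.pi := by
    rw [integral_const_mul, integral_sub_left_eq_self (fun z : ℝ => (1 + (lam * z) ^ 2)⁻¹),
      Measure.integral_comp_mul_left (fun z : ℝ => (1 + z ^ 2)⁻¹), integral_univ_inv_one_add_sq,
      abs_of_pos (inv_pos.2 l0), smul_eq_mul, mul_inv_cancel_left₀ l0.ne']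
  have e2 : lam * ∫ z : ℝ, k (lam * z) = ∫ z, k z := by
    rw [Measure.integral_comp_mul_left k, abs_of_pos (inv_pos.2 l0), smul_eq_mul,
      mul_inv_cancel_left₀ l0.ne']
  refine ⟨fun z => lam * (1 + (lam * (x - z)) ^ 2)⁻¹ * (1 + lam ^ b) + lam ^ b * lam * k (lam * z),
    (i1.mul_const _).add (i2.const_mul _), fun z => ?_, ?_⟩
  · have hq1 : lam * (1 + (lam * (x - z)) ^ 2)⁻¹ ≤ lam := mul_le_of_le_one_right l0.le
      (inv_le_one_of_one_le₀ (by nlinarith [sq_nonneg (lam * (x - z))]))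
    have hq0 : 0 ≤ lam * (1 + (lam * (x - z)) ^ 2)⁻¹ := by positivity
    have key : |z| ^ (-b) = lam ^ b * |lam * z| ^ (-b) := by
      rw [abs_mul, Real.mul_rpow (abs_nonneg _) (abs_nonneg _), abs_of_pos l0, ← mul_assoc,
        ← Real.rpow_add l0, add_neg_cancel, Real.rpow_zero, one_mul]
    dsimp only
    generalize lam * (1 + (lam * (x - z)) ^ 2)⁻¹ = q at hq1 hq0 ⊢
    rw [mul_add, mul_add, mul_one, add_assoc]
    refine add_le_add_right ?_ _
    have hp0 : (0 : ℝ) ≤ |lam * z| ^ (-b) := Real.rpow_nonneg (abs_nonneg _) _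
    by_cases hz : lam * z ∈ Ioc (-1 : ℝ) 1
    · have : k (lam * z) = |lam * z| ^ (-b) := indicator_of_mem hz _
      rw [this, key]
      have h2 : 0 ≤ lam ^ b * |lam * z| ^ (-b) := mul_nonneg (zero_le_one.trans lb) hp0
      have h3 := mul_le_mul_of_nonneg_right hq1 h2
      have h4 : 0 ≤ q * lam ^ b := mul_nonneg hq0 (zero_le_one.trans lb)
      calc _ ≤ _ := h3
        _ = lam ^ b * lam * |lam * z| ^ (-b) := by ring
        _ ≤ _ := le_add_of_nonneg_left h4
    · have h1 : 1 ≤ |lam * z| := by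
        by_contra hcon
        rw [not_le, abs_lt] at hcon
        exact hz ⟨hcon.1, hcon.2.le⟩
      have h2 : |lam * z| ^ (-b) ≤ 1 := Real.rpow_le_one_of_one_le_of_nonpos h1 (by linarith)
      have h3 : |z| ^ (-b) ≤ lam ^ b := by
        rw [key]; exact mul_le_of_le_one_right (zero_le_one.trans lb) h2
      have h4 := mul_le_mul_of_nonneg_left h3 hq0
      have h5 : 0 ≤ lam ^ b * lam * k (lam * z) :=
        mul_nonneg (mul_nonneg (zero_le_one.trans lb) l0.le) (hk0 _)
      linarith
  · rw [integral_add (i1.mul_const _) (i2.const_mul _), integral_mul_const, e1, integral_const_mul,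
      mul_assoc, e2]
    have hJ : 0 ≤ ∫ z, k z := integral_nonneg hk0
    nlinarith [Real.pi_pos]

end OneDim

/-! ### Decay of the kernel profile and integrals singular at the hyperplane. -/

section Decay

variable {d : ℕ} {s : Fin d → ℝ} {ℓ : ℝ} {G W U : Pt d → ℝ}

/-- Each coordinate grows at most polynomially in the scaled norm, so decay faster than all powers
of the norm dominates a product of Cauchy profiles. -/
theorem prod_one_add_sq_le (hs : ∀ i, 1 ≤ s i) :
    ∃ m : ℕ, ∀ x : Pt d, ∏ i, (1 + x i ^ 2) ≤ (2 * (1 + sNorm s x) ^ m) ^ d := by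
  obtain ⟨m, hm⟩ := exists_nat_ge (∑ i, s i)
  refine ⟨2 * m, fun x => ?_⟩
  have hN := sNorm_nonneg (s := s) x
  have : ∀ i ∈ Finset.univ, 1 + x i ^ 2 ≤ 2 * (1 + sNorm s x) ^ (2 * m) := by
    intro i _
    have h1 : s i ≤ m := (Finset.single_le_sum (f := s) (fun j _ => zero_le_one.trans (hs j))
      (Finset.mem_univ i)).trans hm
    have h2 : |x i| ≤ (1 + sNorm s x) ^ m := by
      refine (abs_le_sNorm_rpow hs x i).trans ?_
      refine (Real.rpow_le_rpow hN (by linarith : sNorm s x ≤ 1 + sNorm s x)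
        (by linarith [hs i])).trans ?_
      rw [← Real.rpow_natCast]
      exact Real.rpow_le_rpow_of_exponent_le (by linarith) h1
    have h3 : x i ^ 2 ≤ (1 + sNorm s x) ^ (2 * m) := by
      rw [← sq_abs, mul_comm 2 m, pow_mul]
      exact pow_le_pow_left₀ (abs_nonneg _) h2 2
    have h4 : 1 ≤ (1 + sNorm s x) ^ (2 * m) := one_le_pow₀ (by linarith)
    linarith
  refine (Finset.prod_le_prod (fun i _ => by positivity) this).trans_eq ?_
  simp

/-- The moments of order 0 and n = md + q together control (1 + ‖x‖)^n: md powers pay for the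
product ∏(1 + x_i²), and q ≥ p powers for ‖x‖^p. The product form of the bound is what allows
integration one coordinate at a time. -/
theorem IsControlled.decay (hU : IsControlled s ℓ G W U) (hs : ∀ i, 1 ≤ s i) (hG0 : ∀ x, 0 ≤ G x)
    {p : ℝ} (hp : 0 ≤ p) :
    ∃ B : ℝ, 0 ≤ B ∧ ∀ r ∈ Ioc (0 : ℝ) 1, ∀ x,
      sNorm s x ^ p * U (sScale s ℓ r x) * G x ≤ B * ∏ i, (1 + x i ^ 2)⁻¹ := by
  obtain ⟨m, hm⟩ := prod_one_add_sq_le hs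
  obtain ⟨q, hq⟩ := exists_nat_ge p
  set n := m * d + q with hn
  obtain ⟨B₀, hB₀⟩ := hU.integrable 0 1 one_pos
  obtain ⟨B₁, hB₁⟩ := hU.integrable n 1 one_pos
  refine ⟨2 ^ d * 2 ^ n * (max B₀ 0 + max B₁ 0), by positivity, fun r hr x => ?_⟩
  have hN := sNorm_nonneg (s := s) x
  have hP : 0 < ∏ i, (1 + x i ^ 2) := Finset.prod_pos fun i _ => by positivity
  rw [Finset.prod_inv_distrib, ← div_eq_mul_inv, le_div_iff₀ hP]
  have hu : 0 ≤ U (sScale s ℓ r x) * G x :=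
    mul_nonneg (zero_le_one.trans (hU.one_le_st _)) (hG0 x)
  have h1 : sNorm s x ^ p ≤ (1 + sNorm s x) ^ q := by
    refine (Real.rpow_le_rpow hN (by linarith : sNorm s x ≤ 1 + sNorm s x) hp).trans ?_
    rw [← Real.rpow_natCast]
    exact Real.rpow_le_rpow_of_exponent_le (by linarith) hq
  have h2 : sNorm s x ^ p * ∏ i, (1 + x i ^ 2) ≤ 2 ^ d * 2 ^ n * (1 + sNorm s x ^ n) := by
    calc _ ≤ (1 + sNorm s x) ^ q * (2 * (1 + sNorm s x) ^ m) ^ d :=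
          mul_le_mul h1 (hm x) hP.le (by positivity)
      _ = 2 ^ d * (1 + sNorm s x) ^ n := by rw [hn, mul_pow, pow_add, pow_mul]; ring
      _ ≤ _ := by
        rw [mul_assoc]
        refine mul_le_mul_of_nonneg_left ?_ (by positivity)
        rcases le_total (sNorm s x) 1 with h | h
        · calc (1 + sNorm s x) ^ n ≤ 2 ^ n := pow_le_pow_left₀ (by linarith) (by linarith) _
            _ ≤ _ := le_mul_of_one_le_right (by positivity) (by linarith [pow_nonneg hN n])
        · calc (1 + sNorm s x) ^ n ≤ (2 * sNorm s x) ^ n :=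
                pow_le_pow_left₀ (by linarith) (by linarith) _
            _ = 2 ^ n * sNorm s x ^ n := mul_pow _ _ _
            _ ≤ _ := by gcongr; linarith
  have h3 := hB₀ r hr x
  have h4 := hB₁ r hr x
  rw [pow_zero, one_mul] at h3
  calc sNorm s x ^ p * U (sScale s ℓ r x) * G x * ∏ i, (1 + x i ^ 2)
      = (sNorm s x ^ p * ∏ i, (1 + x i ^ 2)) * (U (sScale s ℓ r x) * G x) := by ring
    _ ≤ (2 ^ d * 2 ^ n * (1 + sNorm s x ^ n)) * (U (sScale s ℓ r x) * G x) :=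
        mul_le_mul_of_nonneg_right h2 hu
    _ = 2 ^ d * 2 ^ n * (U (sScale s ℓ r x) * G x
          + sNorm s x ^ n * U (sScale s ℓ r x) * G x) := by ring
    _ ≤ _ := by
        refine mul_le_mul_of_nonneg_left ?_ (by positivity)
        exact add_le_add (h3.trans (le_max_left _ _)) (h4.trans (le_max_left _ _))

theorem Gt_nonneg (hG0 : ∀ x, 0 ≤ G x) {r : ℝ} (hr : 0 < r) (x : Pt d) : 0 ≤ Gt s ℓ G r x :=
  mul_nonneg (Real.rpow_nonneg hr.le _) (hG0 _)

theorem measurable_Gt (hGm : Measurable G) (r : ℝ) : Measurable (Gt s ℓ G r) := by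
  unfold Gt
  exact (hGm.comp (measurable_pi_lambda _ fun i => (measurable_pi_apply i).const_mul _)).const_mul _

/-- Under x = r^{s/ℓ} ξ the prefactor of G_r splits into the normalizations of Cauchy profiles of
width r^{s_i/ℓ}, and ‖x‖^p yields the gain r^{p/ℓ}. -/
theorem IsControlled.decay_Gt (hU : IsControlled s ℓ G W U) (hs : ∀ i, 1 ≤ s i)
    (hG0 : ∀ x, 0 ≤ G x) {p : ℝ} (hp : 0 ≤ p) :
    ∃ B : ℝ, 0 ≤ B ∧ ∀ r ∈ Ioc (0 : ℝ) 1, ∀ x,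
      Gt s ℓ G r x * (U x * sNorm s x ^ p) ≤
        B * r ^ (p / ℓ) * ∏ i, (r ^ (-s i / ℓ) * (1 + (r ^ (-s i / ℓ) * x i) ^ 2)⁻¹) := by
  obtain ⟨B, hB0, hB⟩ := hU.decay hs hG0 hp
  refine ⟨B, hB0, fun r hr x => ?_⟩
  have hr0 := hr.1
  set ξ : Pt d := fun i => r ^ (-s i / ℓ) * x i with hξ
  have e1 : sScale s ℓ r ξ = x := by
    funext i
    simp only [sScale, hξ]
    rw [← mul_assoc, ← Real.rpow_add hr0, neg_div, add_neg_cancel, Real.rpow_zero, one_mul]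
  have e2 : sNorm s x ^ p = r ^ (p / ℓ) * sNorm s ξ ^ p := by
    rw [hξ, sNorm_scale hs hr0, Real.mul_rpow (Real.rpow_nonneg hr0.le _) (sNorm_nonneg _),
      ← Real.rpow_mul hr0.le, ← mul_assoc, ← Real.rpow_add hr0]
    have : p / ℓ + -1 / ℓ * p = 0 := by ring
    rw [this, Real.rpow_zero, one_mul]
  have e3 : r ^ (-(∑ i, s i) / ℓ) = ∏ i, r ^ (-s i / ℓ) := by
    rw [← Real.rpow_sum_of_pos hr0, ← Finset.sum_neg_distrib, Finset.sum_div]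
  have h := hB r hr ξ
  rw [e1] at h
  rw [Finset.prod_mul_distrib, ← e3, e2]
  have hc : 0 ≤ r ^ (-(∑ i, s i) / ℓ) * r ^ (p / ℓ) := by positivity
  calc Gt s ℓ G r x * (U x * (r ^ (p / ℓ) * sNorm s ξ ^ p))
      = r ^ (-(∑ i, s i) / ℓ) * r ^ (p / ℓ) * (sNorm s ξ ^ p * U x * G ξ) := by
        unfold Gt; ring
    _ ≤ _ := mul_le_mul_of_nonneg_left h hc
    _ = _ := by ring

variable [NeZero d]

/-- The basic integral estimate with a singularity on the hyperplane `x 0 = 0`. -/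
theorem IsControlled.integral_tw (hU : IsControlled s ℓ G W U) (hs : ∀ i, 1 ≤ s i) (hℓ : 0 < ℓ)
    (hGm : Measurable G) (hG0 : ∀ x, 0 ≤ G x) {p a : ℝ} (hp : 0 ≤ p) (ha0 : 0 ≤ a)
    (ha : a < s 0) :
    ∃ C : ℝ, 0 ≤ C ∧ ∀ r ∈ Ioc (0 : ℝ) 1, ∀ x : Pt d,
      Integrable (fun z => Gt s ℓ G r (x - z) * (U (x - z) * sNorm s (x - z) ^ p * tw s z ^ (-a))) ∧
      ∫ z, Gt s ℓ G r (x - z) * (U (x - z) * sNorm s (x - z) ^ p * tw s z ^ (-a)) ≤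
        C * r ^ ((p - a) / ℓ) := by
  obtain ⟨B, hB0, hB⟩ := hU.decay_Gt hs hG0 hp
  have hs0 : 0 < s 0 := by linarith [hs 0]
  obtain ⟨C, hC0, hC⟩ := singular_cauchy_bound (b := a / s 0) (by positivity)
    ((div_lt_one hs0).2 ha)
  obtain ⟨C', hC'0, hC'⟩ := singular_cauchy_bound (b := 0) le_rfl one_pos
  -- The temporal coordinate contributes C (r^{-s_0/ℓ})^{a/s_0} = C r^{-a/ℓ}, convergent because a <
  -- s_0; each of the d − 1 others contributes C'.
  refine ⟨B * (C * C' ^ (d - 1)), by positivity, fun r hr x => ?_⟩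
  have hr0 := hr.1
  have hlam : ∀ i, 1 ≤ r ^ (-s i / ℓ) := fun i =>
    Real.one_le_rpow_of_pos_of_le_one_of_nonpos hr0 hr.2
      (div_nonpos_of_nonpos_of_nonneg (by linarith [hs i]) hℓ.le)
  choose g hgi hg hgC using fun i => hC' _ (hlam i) (x i)
  obtain ⟨g₀, hg₀i, hg₀, hg₀C⟩ := hC _ (hlam 0) (x 0)
  set h : Fin d → ℝ → ℝ := fun i => if i = 0 then g₀ else g i with hh
  have hhi : ∀ i, Integrable (h i) := by
    intro i; by_cases hi : i = 0 <;> simp only [hh, hi, if_true, if_false] <;> first | exact hg₀i | exact hgi i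
  have hq0 : ∀ i (z : ℝ), 0 ≤ r ^ (-s i / ℓ) * (1 + (r ^ (-s i / ℓ) * (x i - z)) ^ 2)⁻¹ :=
    fun i z => by positivity
  have hdom : Integrable (fun z : Pt d => B * r ^ (p / ℓ) * ∏ i, h i (z i)) :=
    (Integrable.fintype_prod hhi).const_mul _
  have hle : ∀ z, Gt s ℓ G r (x - z) * (U (x - z) * sNorm s (x - z) ^ p * tw s z ^ (-a)) ≤
      B * r ^ (p / ℓ) * ∏ i, h i (z i) := by
    intro z
    have h1 := hB r hr (x - z)
    have h2 := tw_rpow_neg_le (s := s) a z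
    have h0 : 0 ≤ tw s z ^ (-a) := Real.rpow_nonneg (tw_nonneg _) _
    have hpr : 0 ≤ ∏ i, (r ^ (-s i / ℓ) * (1 + (r ^ (-s i / ℓ) * (x - z) i) ^ 2)⁻¹) :=
      Finset.prod_nonneg fun i _ => hq0 i (z i)
    calc _ = Gt s ℓ G r (x - z) * (U (x - z) * sNorm s (x - z) ^ p) * tw s z ^ (-a) := by ring
      _ ≤ (B * r ^ (p / ℓ) * ∏ i, (r ^ (-s i / ℓ) * (1 + (r ^ (-s i / ℓ) * (x - z) i) ^ 2)⁻¹)) *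
          (1 + |z 0| ^ (-(a / s 0))) :=
        mul_le_mul h1 h2 h0 (mul_nonneg (mul_nonneg hB0 (Real.rpow_nonneg hr0.le _)) hpr)
      _ = B * r ^ (p / ℓ) * ∏ i, (r ^ (-s i / ℓ) * (1 + (r ^ (-s i / ℓ) * (x i - z i)) ^ 2)⁻¹ *
          if i = 0 then 1 + |z 0| ^ (-(a / s 0)) else 1) := by
        conv_rhs => rw [Finset.prod_mul_distrib, Finset.prod_ite_eq' Finset.univ (0 : Fin d),
          if_pos (Finset.mem_univ _)]
        simp only [Pi.sub_apply]
        ring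
      _ ≤ _ := by
        refine mul_le_mul_of_nonneg_left ?_ (mul_nonneg hB0 (Real.rpow_nonneg hr0.le _))
        refine Finset.prod_le_prod (fun i _ => mul_nonneg (hq0 i _) ?_) fun i _ => ?_
        · split_ifs
          · exact add_nonneg zero_le_one (Real.rpow_nonneg (abs_nonneg _) _)
          · exact zero_le_one
        · by_cases hi : i = 0
          · subst hi
            simpa only [hh, if_true] using hg₀ (z 0)
          · simp only [hh, hi, if_false]
            refine le_trans ?_ (hg i (z i))
            rw [neg_zero, Real.rpow_zero]
            exact mul_le_mul_of_nonneg_left (by norm_num) (hq0 i _)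
  have hnn : ∀ z, 0 ≤ Gt s ℓ G r (x - z) * (U (x - z) * sNorm s (x - z) ^ p * tw s z ^ (-a)) :=
    fun z => mul_nonneg (Gt_nonneg hG0 hr0 _) (mul_nonneg (mul_nonneg
      (zero_le_one.trans (hU.one_le_st _)) (Real.rpow_nonneg (sNorm_nonneg _) _))
      (Real.rpow_nonneg (tw_nonneg _) _))
  have hmeas : Measurable
      (fun z => Gt s ℓ G r (x - z) * (U (x - z) * sNorm s (x - z) ^ p * tw s z ^ (-a))) := by
    have hsub : Measurable fun z : Pt d => x - z := measurable_const.sub measurable_id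
    exact ((measurable_Gt hGm r).comp hsub).mul ((((hU.continuous_st.measurable.comp hsub)).mul
      (((continuous_sNorm hs).measurable.comp hsub).pow_const p)).mul
      ((continuous_tw hs).measurable.pow_const _))
  refine ⟨hdom.mono' hmeas.aestronglyMeasurable (Eventually.of_forall fun z => ?_), ?_⟩
  · rw [Real.norm_of_nonneg (hnn z)]; exact hle z
  · refine (integral_mono_of_nonneg (Eventually.of_forall hnn) hdom
      (Eventually.of_forall hle)).trans ?_
    rw [integral_const_mul, integral_fintype_prod_volume_eq_prod]
    have hprod : ∏ i, ∫ z, h i z ≤ ∏ i : Fin d, if i = 0 then C * (r ^ (-s 0 / ℓ)) ^ (a / s 0) else C' := by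
      refine Finset.prod_le_prod (fun i _ => ?_) fun i _ => ?_
      · refine integral_nonneg fun z => ?_
        by_cases hi : i = 0
        · subst hi
          simp only [hh, if_true]
          exact (mul_nonneg (hq0 0 z) (add_nonneg zero_le_one
            (Real.rpow_nonneg (abs_nonneg _) _))).trans (hg₀ z)
        · simp only [hh, hi, if_false]
          exact (mul_nonneg (hq0 i z) (add_nonneg zero_le_one
            (Real.rpow_nonneg (abs_nonneg _) _))).trans (hg i z)
      · by_cases hi : i = 0
        · subst hi
          simpa only [hh, if_true] using hg₀C
        · simpa only [hh, hi, if_false, Real.rpow_zero, mul_one] using hgC i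
    have hpe : (∏ i : Fin d, if i = 0 then C * (r ^ (-s 0 / ℓ)) ^ (a / s 0) else C') =
        C * (r ^ (-s 0 / ℓ)) ^ (a / s 0) * C' ^ (d - 1) := by
      rw [← Finset.mul_prod_erase Finset.univ _ (Finset.mem_univ (0 : Fin d)), if_pos rfl]
      congr 1
      rw [Finset.prod_congr rfl (g := fun _ => C') fun i hi => if_neg (Finset.ne_of_mem_erase hi)]
      simp
    have hre : (r ^ (-s 0 / ℓ)) ^ (a / s 0) = r ^ (-a / ℓ) := by
      rw [← Real.rpow_mul hr0.le]; congr 1; field_simp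
    rw [hpe, hre] at hprod
    refine (mul_le_mul_of_nonneg_left hprod (mul_nonneg hB0 (Real.rpow_nonneg hr0.le _))).trans_eq ?_
    have : (p - a) / ℓ = p / ℓ + -a / ℓ := by ring
    rw [this, Real.rpow_add hr0]
    ring

/-- When x ≤ 2n, the factor n^a x^{-a} can be inserted at the cost of 2^a. This is how a large
separation of two points makes up for closeness to the hyperplane. -/
theorem rpow_neg_le_of_le_two_mul {a x n : ℝ} (ha : 0 ≤ a) (hx : 0 < x) (h : x ≤ 2 * n) :
    1 ≤ 2 ^ a * n ^ a * x ^ (-a) := by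
  have hn : 0 ≤ n := by linarith
  rw [← Real.mul_rpow (by norm_num) hn, Real.rpow_neg hx.le, ← div_eq_mul_inv,
    one_le_div (Real.rpow_pos_of_pos hx _)]
  exact Real.rpow_le_rpow hx.le h ha

/-- If φ(x) ≤ 2φ(z), the singular factor is at most 2^a φ(x)^{-a}. Otherwise φ(x) ≤ 2‖x − z‖, and
φ(z)^{-a} may be multiplied by 2^a ‖x − z‖^a φ(x)^{-a}; the additional moment of order a exactly
offsets the loss r^{-a/ℓ} in `IsControlled.integral_tw`. The singularity thus moves from the
integration variable to x without any loss in r. -/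
theorem IsControlled.integral_tw₂ (hU : IsControlled s ℓ G W U) (hs : ∀ i, 1 ≤ s i) (hℓ : 0 < ℓ)
    (hGm : Measurable G) (hG0 : ∀ x, 0 ≤ G x) {p a : ℝ} (hp : 0 ≤ p) (ha0 : 0 ≤ a)
    (ha : a < s 0) :
    ∃ C : ℝ, 0 ≤ C ∧ ∀ r ∈ Ioc (0 : ℝ) 1, ∀ x : Pt d, x 0 ≠ 0 →
      Integrable (fun z => Gt s ℓ G r (x - z) *
        (U (x - z) * sNorm s (x - z) ^ p * tw₂ s x z ^ (-a))) ∧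
      ∫ z, Gt s ℓ G r (x - z) * (U (x - z) * sNorm s (x - z) ^ p * tw₂ s x z ^ (-a)) ≤
        C * (r ^ (p / ℓ) * tw s x ^ (-a)) := by
  obtain ⟨C₁, hC₁0, hC₁⟩ := hU.integral_tw hs hℓ hGm hG0 hp le_rfl (lt_of_le_of_lt ha0 ha)
  obtain ⟨C₂, hC₂0, hC₂⟩ := hU.integral_tw hs hℓ hGm hG0 (add_nonneg hp ha0) ha0 ha
  refine ⟨2 ^ a * C₁ + 2 ^ a * C₂, by positivity, fun r hr x hx => ?_⟩
  have hr0 := hr.1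
  obtain ⟨i1, b1⟩ := hC₁ r hr x
  obtain ⟨i2, b2⟩ := hC₂ r hr x
  have hφ := tw_pos (s := s) hx
  have h2a : (1 : ℝ) ≤ 2 ^ a := Real.one_le_rpow (by norm_num) ha0
  have hdom := (i1.const_mul (2 ^ a * tw s x ^ (-a))).add (i2.const_mul (2 ^ a * tw s x ^ (-a)))
  have hnn : ∀ z, 0 ≤ Gt s ℓ G r (x - z) * (U (x - z) * sNorm s (x - z) ^ p * tw₂ s x z ^ (-a)) :=
    fun z => mul_nonneg (Gt_nonneg hG0 hr0 _) (mul_nonneg (mul_nonneg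
      (zero_le_one.trans (hU.one_le_st _)) (Real.rpow_nonneg (sNorm_nonneg _) _))
      (Real.rpow_nonneg (le_min (tw_nonneg _) (tw_nonneg _)) _))
  have hle : ∀ᵐ z, Gt s ℓ G r (x - z) * (U (x - z) * sNorm s (x - z) ^ p * tw₂ s x z ^ (-a)) ≤
      (2 ^ a * tw s x ^ (-a)) *
        (Gt s ℓ G r (x - z) * (U (x - z) * sNorm s (x - z) ^ p * tw s z ^ (-0 : ℝ))) +
      (2 ^ a * tw s x ^ (-a)) *
        (Gt s ℓ G r (x - z) * (U (x - z) * sNorm s (x - z) ^ (p + a) * tw s z ^ (-a))) := by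
    filter_upwards [ae_apply_zero_ne] with z hz
    have hg : 0 ≤ Gt s ℓ G r (x - z) * (U (x - z) * sNorm s (x - z) ^ p) :=
      mul_nonneg (Gt_nonneg hG0 hr0 _) (mul_nonneg (zero_le_one.trans (hU.one_le_st _))
        (Real.rpow_nonneg (sNorm_nonneg _) _))
    have hz0 := tw_pos (s := s) hz
    rw [neg_zero, Real.rpow_zero, Real.rpow_add_of_nonneg (sNorm_nonneg _) hp ha0]
    have key : tw₂ s x z ^ (-a) ≤ 2 ^ a * tw s x ^ (-a) +
        2 ^ a * tw s x ^ (-a) * (sNorm s (x - z) ^ a * tw s z ^ (-a)) := by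
      have e0 : 0 ≤ sNorm s (x - z) ^ a * tw s z ^ (-a) :=
        mul_nonneg (Real.rpow_nonneg (sNorm_nonneg _) _) (Real.rpow_nonneg hz0.le _)
      have e1 : 0 ≤ tw s x ^ (-a) := Real.rpow_nonneg hφ.le _
      have e2 : 0 ≤ tw s z ^ (-a) := Real.rpow_nonneg hz0.le _
      rcases le_total (tw s x) (tw s z) with h | h
      · rw [tw₂, min_eq_left h]
        have := mul_le_mul_of_nonneg_right h2a e1
        have := mul_nonneg (mul_nonneg (zero_le_one.trans h2a) e1) e0
        linarith
      · rw [tw₂, min_eq_right h]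
        have t1 := tw_le_add hs x z
        rw [sNorm_sub_comm] at t1
        rcases le_total (sNorm s (x - z)) (tw s z) with h' | h'
        · have : tw s z ^ (-a) ≤ 2 ^ a * tw s x ^ (-a) := by
            rw [Real.rpow_neg hz0.le, Real.rpow_neg hφ.le, ← div_eq_mul_inv,
              inv_le_comm₀ (Real.rpow_pos_of_pos hz0 _) (by positivity), inv_div,
              div_le_iff₀ (by positivity), mul_comm, ← Real.mul_rpow (by norm_num) hz0.le]
            exact Real.rpow_le_rpow hφ.le (by linarith) ha0
          have := mul_nonneg (mul_nonneg (zero_le_one.trans h2a) e1) e0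
          linarith
        · have h3 := rpow_neg_le_of_le_two_mul ha0 hφ (by linarith : tw s x ≤ 2 * sNorm s (x - z))
          have h4 := mul_le_mul_of_nonneg_right h3 e2
          have := mul_nonneg (zero_le_one.trans h2a) e1
          linarith
    calc _ = Gt s ℓ G r (x - z) * (U (x - z) * sNorm s (x - z) ^ p) * tw₂ s x z ^ (-a) := by ring
      _ ≤ _ := mul_le_mul_of_nonneg_left key hg
      _ = _ := by ring
  have hmeas : Measurable
      (fun z => Gt s ℓ G r (x - z) * (U (x - z) * sNorm s (x - z) ^ p * tw₂ s x z ^ (-a))) := by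
    have hsub : Measurable fun z : Pt d => x - z := measurable_const.sub measurable_id
    exact ((measurable_Gt hGm r).comp hsub).mul ((((hU.continuous_st.measurable.comp hsub)).mul
      (((continuous_sNorm hs).measurable.comp hsub).pow_const p)).mul
      (((measurable_const.min (continuous_tw hs).measurable)).pow_const _))
  refine ⟨hdom.mono' hmeas.aestronglyMeasurable (hle.mono fun z h => ?_), ?_⟩
  · rw [Real.norm_of_nonneg (hnn z)]; exact h
  · refine (integral_mono_of_nonneg (Eventually.of_forall hnn) hdom hle).trans ?_
    simp only [Pi.add_apply]
    rw [integral_add (i1.const_mul _) (i2.const_mul _), integral_const_mul, integral_const_mul]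
    have hc : 0 ≤ 2 ^ a * tw s x ^ (-a) := by positivity
    have := mul_le_mul_of_nonneg_left b1 hc
    have := mul_le_mul_of_nonneg_left b2 hc
    rw [sub_zero] at *
    rw [add_sub_cancel_right] at *
    calc _ ≤ _ := add_le_add ‹_› ‹_›
      _ = _ := by ring

end Decay

/-! ### Power integrals in time. -/

section TimeIntegrals

theorem intervalIntegrable_rpow_sub_one {e T S : ℝ} (hT : 0 < T) (hS : T ≤ S) :
    IntervalIntegrable (fun t : ℝ => t ^ (e - 1)) volume T S :=
  intervalIntegral.intervalIntegrable_rpow (Or.inr fun h => by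
    rw [uIcc_of_le hS] at h; linarith [h.1])

theorem integral_rpow_head {e : ℝ} (he : 0 < e) (T : ℝ) :
    ∫ t in (0 : ℝ)..T, t ^ (e - 1) = T ^ e / e := by
  rw [integral_rpow (Or.inl (by linarith)), sub_add_cancel, Real.zero_rpow he.ne', sub_zero]

/-- For c' < 0 the integrand is at most t^{c'-1} on (0, 1]; for c' = 0 necessarily c > 0 and the
integral stays bounded. The only case excluded among c' ≤ min(c, 0) is c = c' = 0, where a logarithm
would appear. -/
theorem integral_rpow_tail {c c' : ℝ} (h1 : c' ≤ c) (h2 : c' ≤ 0) (h3 : c = 0 → c' < 0) :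
    ∃ C : ℝ, 0 ≤ C ∧ ∀ T : ℝ, 0 < T → ∀ S : ℝ, T ≤ S → S ≤ 1 →
      ∫ t in T..S, t ^ (c - 1) ≤ C * T ^ c' := by
  rcases h2.lt_or_eq with h | h
  · refine ⟨1 / (-c'), by have : 0 < -c' := by linarith
                          positivity, fun T hT S hTS hS => ?_⟩
    have hmono : ∫ t in T..S, t ^ (c - 1) ≤ ∫ t in T..S, t ^ (c' - 1) := by
      refine intervalIntegral.integral_mono_on hTS (intervalIntegrable_rpow_sub_one hT hTS)
        (intervalIntegrable_rpow_sub_one hT hTS) fun t ht => ?_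
      exact Real.rpow_le_rpow_of_exponent_ge (hT.trans_le ht.1) (ht.2.trans hS) (by linarith)
    refine hmono.trans ?_
    rw [integral_rpow (Or.inr ⟨by linarith, fun h => by
      rw [uIcc_of_le hTS] at h; linarith [h.1]⟩), sub_add_cancel]
    have h4 : 0 ≤ S ^ c' := Real.rpow_nonneg (by linarith) _
    rw [one_div, inv_mul_eq_div, ← neg_div_neg_eq]
    exact div_le_div_of_nonneg_right (by linarith) (by linarith)
  · subst h
    have hc : 0 < c := lt_of_le_of_ne h1 fun h => (h3 h.symm).false
    refine ⟨1 / c, by positivity, fun T hT S hTS hS => ?_⟩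
    rw [integral_rpow (Or.inl (by linarith)), sub_add_cancel, Real.rpow_zero, mul_one]
    have h4 : 0 ≤ T ^ c := Real.rpow_nonneg hT.le _
    have h5 : S ^ c ≤ 1 := Real.rpow_le_one (by linarith) hS hc.le
    exact div_le_div_of_nonneg_right (by linarith) hc.le

theorem abs_integral_le_of_split {ι κ : Type*} (J : Finset ι) (I : Finset κ) {a e : ι → ℝ}
    {b g : κ → ℝ} {F : ℝ → ℝ} {T S : ℝ} (hT : 0 < T) (hS : T ≤ S)
    (hF : IntervalIntegrable F volume 0 S) (he : ∀ j ∈ J, 0 < e j)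
    (h1 : ∀ t ∈ Ioc 0 T, |F t| ≤ ∑ j ∈ J, a j * t ^ (e j - 1))
    (h2 : ∀ t ∈ Ioc T S, |F t| ≤ ∑ i ∈ I, b i * t ^ (g i - 1)) :
    |∫ t in (0 : ℝ)..S, F t| ≤
      ∑ j ∈ J, a j * (T ^ e j / e j) + ∑ i ∈ I, b i * ∫ t in T..S, t ^ (g i - 1) := by
  have hF1 : IntervalIntegrable F volume 0 T := hF.mono_set (by
    rw [uIcc_of_le hT.le, uIcc_of_le (hT.le.trans hS)]; exact Icc_subset_Icc le_rfl hS)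
  have hF2 : IntervalIntegrable F volume T S := hF.mono_set (by
    rw [uIcc_of_le hS, uIcc_of_le (hT.le.trans hS)]; exact Icc_subset_Icc hT.le le_rfl)
  rw [← intervalIntegral.integral_add_adjacent_intervals hF1 hF2]
  refine (abs_add_le _ _).trans (add_le_add ?_ ?_)
  · have hi : ∀ j ∈ J, IntervalIntegrable (fun t : ℝ => a j * t ^ (e j - 1)) volume 0 T :=
      fun j hj => (intervalIntegral.intervalIntegrable_rpow' (by linarith [he j hj])).const_mul _
    have hsum := IntervalIntegrable.sum J hi
    rw [Finset.sum_fn] at hsum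
    refine (intervalIntegral.norm_integral_le_of_norm_le (f := F) hT.le
      (Eventually.of_forall fun t ht => h1 t ht) hsum).trans_eq ?_
    rw [intervalIntegral.integral_finsetSum hi]
    refine Finset.sum_congr rfl fun j hj => ?_
    rw [intervalIntegral.integral_const_mul, integral_rpow_head (he j hj)]
  · have hi : ∀ j ∈ I, IntervalIntegrable (fun t : ℝ => b j * t ^ (g j - 1)) volume T S :=
      fun j _ => (intervalIntegrable_rpow_sub_one hT hS).const_mul _
    have hsum := IntervalIntegrable.sum I hi
    rw [Finset.sum_fn] at hsum
    refine (intervalIntegral.norm_integral_le_of_norm_le (f := F) hS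
      (Eventually.of_forall fun t ht => h2 t ht) hsum).trans_eq ?_
    rw [intervalIntegral.integral_finsetSum hi]
    exact Finset.sum_congr rfl fun j _ => intervalIntegral.integral_const_mul _ _

end TimeIntegrals

/-! ### The kernel acting on distributions. -/

section KernelIntegrals

variable {d : ℕ} {s : Fin d → ℝ} {ℓ : ℝ} {G : Pt d → ℝ}

/-- `F` is measurable and `∫ G_r(x - z) |F(z)| dz ≤ B`. -/
def GInt (s : Fin d → ℝ) (ℓ : ℝ) (G : Pt d → ℝ) (r : ℝ) (x : Pt d) (F : Pt d → ℝ) (B : ℝ) : Prop :=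
  AEStronglyMeasurable F volume ∧ Integrable (fun z => Gt s ℓ G r (x - z) * |F z|) ∧
    ∫ z, Gt s ℓ G r (x - z) * |F z| ≤ B

theorem GInt.mono {r : ℝ} {x : Pt d} {F : Pt d → ℝ} {B B' : ℝ} (h : GInt s ℓ G r x F B)
    (hB : B ≤ B') : GInt s ℓ G r x F B' := ⟨h.1, h.2.1, h.2.2.trans hB⟩

theorem GInt.of_le {r : ℝ} {x : Pt d} {F g : Pt d → ℝ} {B : ℝ} (hGm : Measurable G)
    (hG0 : ∀ x, 0 ≤ G x) (hr : 0 < r) (hF : AEStronglyMeasurable F volume)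
    (hle : ∀ᵐ z, |F z| ≤ g z) (hg : Integrable fun z => Gt s ℓ G r (x - z) * g z)
    (hB : ∫ z, Gt s ℓ G r (x - z) * g z ≤ B) : GInt s ℓ G r x F B := by
  have hle' : ∀ᵐ z, Gt s ℓ G r (x - z) * |F z| ≤ Gt s ℓ G r (x - z) * g z :=
    hle.mono fun z h => mul_le_mul_of_nonneg_left h (Gt_nonneg hG0 hr _)
  have hnn : ∀ z, 0 ≤ Gt s ℓ G r (x - z) * |F z| :=
    fun z => mul_nonneg (Gt_nonneg hG0 hr _) (abs_nonneg _)
  refine ⟨hF, hg.mono' ?_ (hle'.mono fun z h => ?_), ?_⟩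
  · exact ((measurable_Gt hGm r).comp
      (measurable_const.sub measurable_id)).aestronglyMeasurable.mul hF.norm
  · rw [Real.norm_of_nonneg (hnn z)]; exact h
  · exact (integral_mono_of_nonneg (Eventually.of_forall hnn) hg hle').trans hB

theorem GInt.kernel {r : ℝ} {x : Pt d} {F κ : Pt d → ℝ} {B c : ℝ} (h : GInt s ℓ G r x F B)
    (hc : 0 ≤ c) (hκ : AEStronglyMeasurable κ volume)
    (hκle : ∀ z, |κ z| ≤ c * Gt s ℓ G r (x - z)) :
    Integrable (fun z => κ z * F z) ∧ |∫ z, κ z * F z| ≤ c * B := by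
  have hle : ∀ z, ‖κ z * F z‖ ≤ c * (Gt s ℓ G r (x - z) * |F z|) := fun z => by
    rw [Real.norm_eq_abs, abs_mul, ← mul_assoc]
    exact mul_le_mul_of_nonneg_right (hκle z) (abs_nonneg _)
  refine ⟨(h.2.1.const_mul c).mono' (hκ.mul h.1) (Eventually.of_forall hle), ?_⟩
  refine (norm_integral_le_of_norm_le (h.2.1.const_mul c) (Eventually.of_forall hle)).trans ?_
  rw [integral_const_mul]
  exact mul_le_mul_of_nonneg_left h.2.2 hc

/-- Joint measurability of a distribution in the variables `t ∈ (0, 1]` and `x`. -/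
def DMeas (Λ : Distr d) : Prop :=
  Measurable fun p : ℝ × Pt d => (Ioc (0 : ℝ) 1).indicator (fun t => Λ t p.2) p.1

theorem DMeas.measurable {Λ : Distr d} (h : DMeas Λ) {t : ℝ} (ht : t ∈ Ioc (0 : ℝ) 1) :
    Measurable (Λ t) := by
  have := h.comp (measurable_const.prodMk measurable_id : Measurable fun x : Pt d => (t, x))
  convert this using 1
  funext y
  exact (indicator_of_mem ht (fun t => Λ t y)).symm

theorem DMeas.sub {Λ Λ' : Distr d} (h : DMeas Λ) (h' : DMeas Λ') : DMeas (Λ - Λ') := by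
  have := Measurable.sub h h'
  unfold DMeas
  convert this using 2 with p
  by_cases hp : p.1 ∈ Ioc (0 : ℝ) 1
  · simp only [indicator_of_mem hp, Pi.sub_apply]
  · simp only [indicator_of_notMem hp, sub_zero, Pi.sub_apply]

theorem DMeas.add {Λ Λ' : Distr d} (h : DMeas Λ) (h' : DMeas Λ') : DMeas (Λ + Λ') := by
  have := Measurable.add h h'
  unfold DMeas
  convert this using 2 with p
  by_cases hp : p.1 ∈ Ioc (0 : ℝ) 1
  · simp only [indicator_of_mem hp, Pi.add_apply]
  · simp only [indicator_of_notMem hp, add_zero, Pi.add_apply]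

theorem DMeas.zero : DMeas (0 : Distr d) := by
  unfold DMeas
  convert (measurable_const : Measurable fun _ : ℝ × Pt d => (0 : ℝ)) using 2 with p
  simp

/-- Joint measurability in `t > 0` and `y` of the derivatives of the kernel. -/
def KMeas (s : Fin d → ℝ) (δ : ℝ) (D : (Fin d → ℕ) → ℝ → Pt d → Pt d → ℝ) : Prop :=
  ∀ k, mdeg s k < δ → ∀ x,
    Measurable fun p : ℝ × Pt d => (Ioi (0 : ℝ)).indicator (fun t => D k t x p.2) p.1

variable {D : (Fin d → ℕ) → ℝ → Pt d → Pt d → ℝ} {δ βbar CK : ℝ} {Q : ℝ → Pt d → Pt d → ℝ}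

theorem KMeas.measurable (h : KMeas s δ D) {k : Fin d → ℕ} (hk : mdeg s k < δ) {t : ℝ}
    (ht : 0 < t) (x : Pt d) : Measurable (D k t x) := by
  have := (h k hk x).comp
    (measurable_const.prodMk measurable_id : Measurable fun x : Pt d => (t, x))
  convert this using 1
  funext y
  exact (indicator_of_mem (mem_Ioi.2 ht) (fun t => D k t x y)).symm

/-- `∫ D_k,r(x, y) Λ(r, y) dy`. -/
noncomputable def kerR (D : (Fin d → ℕ) → ℝ → Pt d → Pt d → ℝ) (k : Fin d → ℕ) (x : Pt d)
    (Λ : Distr d) (r : ℝ) : ℝ :=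
  ∫ y, D k r x y * Λ r y

/-- The factorization K_t = K_{t/2} Q_{t/2} puts kernel and distribution at the same time r = t/2.
The range (0, 1/2] and the factor 2 in the later estimates come from this substitution. -/
theorem kerI_eq (k : Fin d → ℕ) (x : Pt d) (Λ : Distr d) :
    kerI D k x Λ = 2 * ∫ r in (0 : ℝ)..(1 / 2), kerR D k x Λ r := by
  unfold kerI
  have := intervalIntegral.integral_comp_div (a := 0) (b := 1) (kerR D k x Λ) (two_ne_zero' ℝ)
  rw [zero_div, smul_eq_mul] at this
  exact this

theorem aestronglyMeasurable_kerR (hD : KMeas s δ D) {k : Fin d → ℕ} (hk : mdeg s k < δ)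
    (x : Pt d) {Λ : Distr d} (hΛ : DMeas Λ) :
    AEStronglyMeasurable (kerR D k x Λ) (volume.restrict (Ioc 0 1)) := by
  have h1 := ((hD k hk x).mul hΛ).stronglyMeasurable
  have h2 := (h1.integral_prod_right' (ν := (volume : Measure (Pt d)))).aestronglyMeasurable
    (μ := volume.restrict (Ioc (0 : ℝ) 1))
  refine h2.congr ((ae_restrict_iff' measurableSet_Ioc).2 (Eventually.of_forall fun r hr => ?_))
  unfold kerR
  refine integral_congr_ae (Eventually.of_forall fun y => ?_)
  simp only [Pi.mul_apply, indicator_of_mem hr, indicator_of_mem (mem_Ioi.2 hr.1)]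

theorem GInt.kerR (hK : IsRegKernel s ℓ G Q βbar δ CK D) (hD : KMeas s δ D) {k : Fin d → ℕ}
    (hk : mdeg s k < δ) {x : Pt d} {Λ : Distr d} {r c e : ℝ} (hr : 0 < r)
    (h : GInt s ℓ G r x (Λ r) (c * r ^ (e / ℓ))) :
    Integrable (fun y => D k r x y * Λ r y) ∧
      |kerR D k x Λ r| ≤ CK * c * r ^ ((e + βbar - mdeg s k) / ℓ - 1) := by
  have hc : 0 ≤ CK * r ^ ((βbar - mdeg s k) / ℓ - 1) :=
    mul_nonneg hK.const_pos.le (Real.rpow_nonneg hr.le _)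
  have := h.kernel hc (hD.measurable hk hr x).aestronglyMeasurable
    fun z => hK.upper k hk r hr x z
  refine ⟨this.1, this.2.trans_eq ?_⟩
  have e1 : (e + βbar - mdeg s k) / ℓ - 1 = ((βbar - mdeg s k) / ℓ - 1) + e / ℓ := by ring
  rw [e1, Real.rpow_add hr]
  ring

/-- The time integrand is of order r^{(e + β̄ − |k|)/ℓ − 1}, so |k| < e + β̄ is what makes it
integrable at 0. -/
theorem kerConv_of_GInt (hK : IsRegKernel s ℓ G Q βbar δ CK D) (hD : KMeas s δ D) (hℓ : 0 < ℓ)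
    {k : Fin d → ℕ} (hk : mdeg s k < δ) {x : Pt d} {Λ : Distr d} (hΛ : DMeas Λ) {c e : ℝ}
    (he : mdeg s k < e + βbar)
    (h : ∀ r ∈ Ioc (0 : ℝ) 1, GInt s ℓ G r x (Λ r) (c * r ^ (e / ℓ))) :
    KerConv D k x Λ := by
  have hhalf : ∀ t ∈ Ioc (0 : ℝ) 1, t / 2 ∈ Ioc (0 : ℝ) 1 := fun t ht =>
    ⟨by linarith [ht.1], by linarith [ht.1, ht.2]⟩
  refine ⟨fun t ht => ((h _ (hhalf t ht)).kerR hK hD hk (hhalf t ht).1).1, ?_⟩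
  have hpos : 0 < (e + βbar - mdeg s k) / ℓ := div_pos (by linarith) hℓ
  have h1 : IntervalIntegrable (kerR D k x Λ) volume 0 1 := by
    rw [intervalIntegrable_iff_integrableOn_Ioc_of_le zero_le_one]
    have h2 : IntervalIntegrable
        (fun r : ℝ => CK * c * r ^ ((e + βbar - mdeg s k) / ℓ - 1)) volume 0 1 :=
      (intervalIntegral.intervalIntegrable_rpow' (by linarith)).const_mul _
    rw [intervalIntegrable_iff_integrableOn_Ioc_of_le zero_le_one] at h2
    refine Integrable.mono' h2 (aestronglyMeasurable_kerR hD hk x hΛ) ?_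
    exact (ae_restrict_iff' measurableSet_Ioc).2
      (Eventually.of_forall fun r hr => ((h r hr).kerR hK hD hk hr.1).2)
  have h3 : IntervalIntegrable (kerR D k x Λ) volume 0 (1 / 2) := h1.mono_set (by
    rw [uIcc_of_le zero_le_one, uIcc_of_le (by norm_num)]
    exact Icc_subset_Icc le_rfl (by norm_num))
  have h4 := h3.comp_mul_left (c := 1 / 2) (by finiteness) (by finiteness)
  norm_num at h4
  refine h4.congr ?_
  intro t _
  unfold kerR kerT
  simp only [div_eq_inv_mul, mul_one]

theorem KerConv.intervalIntegrable {k : Fin d → ℕ} {x : Pt d} {Λ : Distr d}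
    (h : KerConv D k x Λ) : IntervalIntegrable (kerR D k x Λ) volume 0 (1 / 2) := by
  have h4 := h.2.comp_mul_left (c := 2) (by finiteness) (by finiteness)
  norm_num at h4
  refine h4.congr ?_
  intro t _
  unfold kerR kerT
  simp only [mul_div_cancel_left₀ t (two_ne_zero' ℝ)]

theorem kerI_sub {k : Fin d → ℕ} {x : Pt d} {Λ Λ' : Distr d} (h : KerConv D k x Λ)
    (h' : KerConv D k x Λ') : kerI D k x (Λ - Λ') = kerI D k x Λ - kerI D k x Λ' := by
  unfold kerI
  rw [← intervalIntegral.integral_sub h.2 h'.2]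
  refine intervalIntegral.integral_congr_uIoo fun t ht => ?_
  rw [uIoo_of_le zero_le_one] at ht
  have ht' : t ∈ Ioc (0 : ℝ) 1 := ⟨ht.1, ht.2.le⟩
  unfold kerT
  rw [← integral_sub (h.1 t ht') (h'.1 t ht')]
  simp only [Pi.sub_apply, mul_sub]

end KernelIntegrals

/-! ### Schauder estimates for the polynomial coefficients. -/

section Schauder

/-- A length ρ corresponds to the time ρ^ℓ. Below it the terms c ρ^p r^{e/ℓ−1} integrate to c
ρ^{p+e}; above it the terms c ρ^q r^{g/ℓ−1} integrate to c ρ^{q+g'}, where g is the exponent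
supplied by β̄ and g' the one required with β. As ρ ≤ 1, it is enough that all final exponents are
at least N. -/
theorem split_bound {ι κ : Type*} (J : Finset ι) (I : Finset κ) (p e : ι → ℝ) (q g g' : κ → ℝ)
    (N : ℝ) {ℓ : ℝ} (hℓ : 0 < ℓ) (he : ∀ j ∈ J, 0 < e j) (hp : ∀ j ∈ J, N ≤ p j + e j)
    (hg : ∀ i ∈ I, g' i ≤ g i ∧ g' i ≤ 0 ∧ (g i = 0 → g' i < 0))
    (hq : ∀ i ∈ I, N ≤ q i + g' i) :
    ∃ C : ℝ, 0 ≤ C ∧ ∀ ρ : ℝ, 0 < ρ → ρ ≤ 1 → ∀ c : ℝ, 0 ≤ c → ∀ F : ℝ → ℝ,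
      IntervalIntegrable F volume 0 (1 / 2) →
      (∀ r ∈ Ioc (0 : ℝ) (1 / 2), r ≤ ρ ^ ℓ → |F r| ≤ ∑ j ∈ J, c * ρ ^ p j * r ^ (e j / ℓ - 1)) →
      (∀ r ∈ Ioc (0 : ℝ) (1 / 2), ρ ^ ℓ < r → |F r| ≤ ∑ i ∈ I, c * ρ ^ q i * r ^ (g i / ℓ - 1)) →
      |∫ r in (0 : ℝ)..(1 / 2), F r| ≤ C * c * ρ ^ N := by
  classical
  have htail : ∀ i, ∃ C : ℝ, 0 ≤ C ∧ (i ∈ I → ∀ T : ℝ, 0 < T → ∀ S : ℝ, T ≤ S → S ≤ 1 →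
      ∫ t in T..S, t ^ (g i / ℓ - 1) ≤ C * T ^ (g' i / ℓ)) := by
    intro i
    by_cases hi : i ∈ I
    · obtain ⟨h1, h2, h3⟩ := hg i hi
      obtain ⟨C, hC, h⟩ := integral_rpow_tail (c := g i / ℓ) (c' := g' i / ℓ)
        (div_le_div_of_nonneg_right h1 hℓ.le) (div_nonpos_of_nonpos_of_nonneg h2 hℓ.le)
        (fun h => div_neg_of_neg_of_pos (h3 ((div_eq_zero_iff.1 h).resolve_right hℓ.ne')) hℓ)
      exact ⟨C, hC, fun _ => h⟩
    · exact ⟨0, le_rfl, fun h => absurd h hi⟩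
  choose Ct hCt0 hCt using htail
  refine ⟨∑ j ∈ J, ℓ / e j + ∑ i ∈ I, Ct i * 2 ^ (-(g' i / ℓ)), add_nonneg
    (Finset.sum_nonneg fun j hj => div_nonneg hℓ.le (he j hj).le)
    (Finset.sum_nonneg fun i _ => mul_nonneg (hCt0 i) (by positivity)), ?_⟩
  intro ρ hρ0 hρ1 c hc F hF h1 h2
  -- The cap 1/2 is the end of the time interval. It costs only the factor 2^{-g'/ℓ}, because T ≥
  -- ρ^ℓ/2.
  set T := min (ρ ^ ℓ) (1 / 2) with hT
  have hρℓ : 0 < ρ ^ ℓ := Real.rpow_pos_of_pos hρ0 _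
  have hT0 : 0 < T := lt_min hρℓ (by norm_num)
  have hTS : T ≤ 1 / 2 := min_le_right _ _
  have hmain := abs_integral_le_of_split J I (a := fun j => c * ρ ^ p j) (e := fun j => e j / ℓ)
    (b := fun i => c * ρ ^ q i) (g := fun i => g i / ℓ) hT0 hTS hF
    (fun j hj => div_pos (he j hj) hℓ)
    (fun r hr => h1 r ⟨hr.1, hr.2.trans hTS⟩ (hr.2.trans (min_le_left _ _)))
    (fun r hr => h2 r ⟨hT0.trans hr.1, hr.2⟩ (by
      rcases min_lt_iff.1 hr.1 with h | h
      · exact h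
      · exact absurd hr.2 (not_le.2 h)))
  refine hmain.trans ?_
  rw [add_mul, add_mul, Finset.sum_mul, Finset.sum_mul, Finset.sum_mul, Finset.sum_mul]
  have hpow : ∀ a b : ℝ, N ≤ a + b → ρ ^ a * ρ ^ b ≤ ρ ^ N := fun a b hab => by
    rw [← Real.rpow_add hρ0]
    exact Real.rpow_le_rpow_of_exponent_ge hρ0 hρ1 hab
  refine add_le_add (Finset.sum_le_sum fun j hj => ?_) (Finset.sum_le_sum fun i hi => ?_)
  · have hTe : T ^ (e j / ℓ) ≤ ρ ^ e j := by
      calc T ^ (e j / ℓ) ≤ (ρ ^ ℓ) ^ (e j / ℓ) :=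
            Real.rpow_le_rpow hT0.le (min_le_left _ _) (div_nonneg (he j hj).le hℓ.le)
        _ = ρ ^ e j := by rw [← Real.rpow_mul hρ0.le, mul_div_cancel₀ _ hℓ.ne']
    have hle : 0 ≤ ℓ / e j := div_nonneg hℓ.le (he j hj).le
    calc c * ρ ^ p j * (T ^ (e j / ℓ) / (e j / ℓ))
        = ℓ / e j * c * (ρ ^ p j * T ^ (e j / ℓ)) := by
          have := (he j hj).ne'
          field_simp
      _ ≤ ℓ / e j * c * ρ ^ N := by
          refine mul_le_mul_of_nonneg_left ?_ (mul_nonneg hle hc)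
          exact (mul_le_mul_of_nonneg_left hTe (Real.rpow_nonneg hρ0.le _)).trans
            (hpow _ _ (hp j hj))
  · obtain ⟨-, hg2, -⟩ := hg i hi
    have hTe : T ^ (g' i / ℓ) ≤ 2 ^ (-(g' i / ℓ)) * ρ ^ g' i := by
      have hTlow : ρ ^ ℓ / 2 ≤ T := le_min (by linarith)
        (by have := Real.rpow_le_one hρ0.le hρ1 hℓ.le; linarith)
      calc T ^ (g' i / ℓ) ≤ (ρ ^ ℓ / 2) ^ (g' i / ℓ) :=
            Real.rpow_le_rpow_of_nonpos (by positivity) hTlow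
              (div_nonpos_of_nonpos_of_nonneg hg2 hℓ.le)
        _ = _ := by
          rw [Real.div_rpow hρℓ.le (by norm_num), ← Real.rpow_mul hρ0.le,
            mul_div_cancel₀ _ hℓ.ne', Real.rpow_neg (by norm_num), div_eq_inv_mul]
    have := hCt i hi T hT0 (1 / 2) hTS (by norm_num)
    calc c * ρ ^ q i * ∫ t in T..1 / 2, t ^ (g i / ℓ - 1)
        ≤ c * ρ ^ q i * (Ct i * (2 ^ (-(g' i / ℓ)) * ρ ^ g' i)) :=
          mul_le_mul_of_nonneg_left (this.trans (mul_le_mul_of_nonneg_left hTe (hCt0 i)))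
            (mul_nonneg hc (Real.rpow_nonneg hρ0.le _))
      _ = Ct i * 2 ^ (-(g' i / ℓ)) * c * (ρ ^ q i * ρ ^ g' i) := by ring
      _ ≤ _ := mul_le_mul_of_nonneg_left (hpow _ _ (hq i hi))
          (mul_nonneg (mul_nonneg (hCt0 i) (by positivity)) hc)

variable {d : ℕ} {s : Fin d → ℝ} {ℓ : ℝ} {G : Pt d → ℝ}

theorem kerR_sum_add {D : (Fin d → ℕ) → ℝ → Pt d → Pt d → ℝ} {k : Fin d → ℕ} {x : Pt d} {r : ℝ}
    {𝔸 : Finset ℝ} {L Λ : Distr d} {T : ℝ → Distr d}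
    (hL : Integrable fun y => D k r x y * L r y)
    (hT : ∀ α ∈ 𝔸, Integrable fun y => D k r x y * T α r y)
    (rel : ∀ z, Λ r z = L r z + ∑ α ∈ 𝔸, T α r z) :
    kerR D k x Λ r = kerR D k x L r + ∑ α ∈ 𝔸, kerR D k x (T α) r := by
  unfold kerR
  rw [← integral_finsetSum _ hT, ← integral_add hL (integrable_finsetSum _ hT)]
  refine integral_congr_ae (Eventually.of_forall fun z => ?_)
  simp only [rel, mul_add, Finset.mul_sum]

variable {γ η ζ β βbar δ : ℝ}

/-- Here ρ = φ. For r ≤ φ^ℓ, L and the components with |k| < α + β all have positive time exponents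
and are integrated one by one. For r > φ^ℓ their sum equals Λ minus the components with |k| ≥ α + β;
there the bound on Λ no longer sees the hyperplane, and the exponents α + β − |k| are nonpositive,
as needed at large times. -/
theorem size_coef_bound (hℓ : 0 < ℓ) (hββ : β ≤ βbar) (hγδ : γ + βbar < δ)
    (hηγ : η ≤ γ) (hζη : ζ ≤ η) (𝔸 : Finset ℝ) (h𝔸 : ∀ α ∈ 𝔸, η ≤ α ∧ α < γ) (k : Fin d → ℕ)
    (hcase : β < βbar ∨ ∀ a ∈ (𝔸 : Set ℝ) ∪ {γ, ζ}, a + βbar ≠ mdeg s k)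
    (hk : mdeg s k < γ + β) :
    ∃ C : ℝ, 0 ≤ C ∧ ∀ (Q : ℝ → Pt d → Pt d → ℝ) (CK : ℝ)
      (D : (Fin d → ℕ) → ℝ → Pt d → Pt d → ℝ), IsRegKernel s ℓ G Q βbar δ CK D → KMeas s δ D →
      ∀ (x : Pt d) (φ c : ℝ), 0 < φ → φ ≤ 1 → 0 ≤ c → ∀ (L Λ : Distr d) (T : ℝ → Distr d),
      DMeas L → (∀ α ∈ 𝔸, DMeas (T α)) →
      (∀ r ∈ Ioc (0 : ℝ) 1, GInt s ℓ G r x (L r) (c * φ ^ (η - γ) * r ^ (γ / ℓ))) →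
      (∀ α ∈ 𝔸, ∀ r ∈ Ioc (0 : ℝ) 1, GInt s ℓ G r x (T α r) (c * φ ^ (η - α) * r ^ (α / ℓ))) →
      (∀ r ∈ Ioc (0 : ℝ) 1, GInt s ℓ G r x (Λ r) (c * r ^ (ζ / ℓ))) →
      (∀ r ∈ Ioc (0 : ℝ) 1, ∀ z, Λ r z = L r z + ∑ α ∈ 𝔸, T α r z) →
      |kerI D k x L + ∑ α ∈ 𝔸 with mdeg s k < α + β, kerI D k x (T α)| ≤
        C * (CK * c) * φ ^ min (ζ + β - mdeg s k) 0 := by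
  classical
  set m := mdeg s k with hm
  set 𝔽 := 𝔸.filter fun α => m < α + β with h𝔽
  set 𝔽' := 𝔸.filter fun α => ¬ m < α + β with h𝔽'
  -- No logarithm: when the exponent with β̄ vanishes, the one with β is strictly negative.
  have hcase' : ∀ a, a ∈ (𝔸 : Set ℝ) ∪ {γ, ζ} → a + βbar - m = 0 → a + β - m < 0 := by
    intro a ha h
    rcases hcase with h' | h'
    · linarith
    · exact absurd (by linarith) (h' a ha)
  have hγ𝔽 : γ ∉ 𝔽 := fun h => (h𝔸 γ (Finset.mem_filter.1 h).1).2.false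
  -- The index γ stands for L, and `none` for Λ.
  obtain ⟨C, hC0, hC⟩ := split_bound (insert γ 𝔽) (Finset.insertNone 𝔽') (fun α => η - α)
    (fun α => α + βbar - m) (fun o => o.elim 0 fun α => η - α)
    (fun o => o.elim (ζ + βbar - m) fun α => α + βbar - m)
    (fun o => o.elim (min (ζ + β - m) 0) fun α => α + β - m) (min (ζ + β - m) 0) hℓ
    (by
      intro α hα
      rcases Finset.mem_insert.1 hα with rfl | h
      · linarith
      · linarith [(Finset.mem_filter.1 h).2])
    (by
      intro α _
      exact (min_le_left _ _).trans (by linarith))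
    (by
      intro o ho
      cases o with
      | none =>
        refine ⟨(min_le_left _ _).trans (by simp only [Option.elim]; linarith), min_le_right _ _, fun h => ?_⟩
        exact (min_le_left _ _).trans_lt (hcase' ζ (by simp) h)
      | some α =>
        have hα := Finset.mem_filter.1 (Finset.some_mem_insertNone.1 ho)
        simp only [Option.elim]
        refine ⟨by linarith, by linarith [hα.2], fun h => ?_⟩
        exact hcase' α (Or.inl hα.1) h)
    (by
      intro o ho
      cases o with
      | none => simp
      | some α => exact (min_le_left _ _).trans (by simp only [Option.elim]; linarith))
  refine ⟨2 * C, by positivity, ?_⟩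
  intro Q CK D hK hD x φ c hφ0 hφ1 hc L Λ T hLm hTm hL hT hΛ rel
  have hmδ : m < δ := by linarith
  have hLc : KerConv D k x L := kerConv_of_GInt hK hD hℓ hmδ hLm (by linarith) hL
  have hTc : ∀ α ∈ 𝔽, KerConv D k x (T α) := fun α hα =>
    kerConv_of_GInt hK hD hℓ hmδ (hTm α (Finset.mem_filter.1 hα).1)
      (by linarith [(Finset.mem_filter.1 hα).2]) (hT α (Finset.mem_filter.1 hα).1)
  have hi : ∀ α ∈ 𝔽, IntervalIntegrable (kerR D k x (T α)) volume 0 (1 / 2) :=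
    fun α hα => (hTc α hα).intervalIntegrable
  have hsum : IntervalIntegrable (fun r => ∑ α ∈ 𝔽, kerR D k x (T α) r) volume 0 (1 / 2) := by
    have := IntervalIntegrable.sum 𝔽 hi
    rwa [Finset.sum_fn] at this
  have heq : kerI D k x L + ∑ α ∈ 𝔽, kerI D k x (T α) =
      2 * ∫ r in (0 : ℝ)..(1 / 2), (kerR D k x L r + ∑ α ∈ 𝔽, kerR D k x (T α) r) := by
    rw [intervalIntegral.integral_add hLc.intervalIntegrable hsum,
      intervalIntegral.integral_finsetSum hi, mul_add, Finset.mul_sum, kerI_eq]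
    simp only [kerI_eq]
  rw [heq, abs_mul, abs_two]
  have hmem : ∀ r ∈ Ioc (0 : ℝ) (1 / 2), r ∈ Ioc (0 : ℝ) 1 := fun r hr =>
    ⟨hr.1, hr.2.trans (by norm_num)⟩
  have hCK := hK.const_pos.le
  have := hC φ hφ0 hφ1 (CK * c) (mul_nonneg hCK hc)
    (fun r => kerR D k x L r + ∑ α ∈ 𝔽, kerR D k x (T α) r) (hLc.intervalIntegrable.add hsum)
    (fun r hr _ => by
      rw [Finset.sum_insert hγ𝔽]
      refine (abs_add_le _ _).trans (add_le_add ?_ ?_)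
      · refine ((hL r (hmem r hr)).kerR hK hD hmδ hr.1).2.trans_eq ?_
        ring
      · refine (Finset.abs_sum_le_sum_abs _ _).trans (Finset.sum_le_sum fun α hα => ?_)
        refine ((hT α (Finset.mem_filter.1 hα).1 r (hmem r hr)).kerR hK hD hmδ hr.1).2.trans_eq ?_
        ring)
    (fun r hr _ => by
      have e1 := kerR_sum_add (((hL r (hmem r hr)).kerR hK hD hmδ hr.1).1)
        (fun α hα => ((hT α hα r (hmem r hr)).kerR hK hD hmδ hr.1).1) (rel r (hmem r hr))
      rw [← Finset.sum_filter_add_sum_filter_not 𝔸 fun α => m < α + β] at e1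
      have e2 : kerR D k x L r + ∑ α ∈ 𝔽, kerR D k x (T α) r =
          kerR D k x Λ r - ∑ α ∈ 𝔽', kerR D k x (T α) r := by
        rw [e1]; ring
      rw [e2, Finset.sum_insertNone]
      refine (abs_sub _ _).trans (add_le_add ?_ ?_)
      · refine ((hΛ r (hmem r hr)).kerR hK hD hmδ hr.1).2.trans_eq ?_
        simp [hm]
      · refine (Finset.abs_sum_le_sum_abs _ _).trans (Finset.sum_le_sum fun α hα => ?_)
        refine ((hT α (Finset.mem_filter.1 hα).1 r (hmem r hr)).kerR hK hD hmδ hr.1).2.trans_eq ?_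
        simp only [Option.elim]
        ring)
  linarith

/-- Here ρ = ‖y − x‖. At small times all terms are integrable separately. At large times L_y plus
the retained S^α equals L_x minus the discarded ones, so the coefficient becomes the kernel at y
minus its Taylor polynomial at x, both acting on L_x. Completing this polynomial up to order δ − |k|
leaves the Hölder remainder of the kernel, of order ρ^{δ−|k|}; the added terms have time exponents
that are nonpositive once β̄ is replaced by β, so they are needed, and controlled, at large times
only. -/
theorem hol_coef_bound (hs : ∀ i, 1 ≤ s i) (hℓ : 0 < ℓ) (hββ : β ≤ βbar)
    (hγδ : γ + βbar < δ) (𝔸 : Finset ℝ) (h𝔸 : ∀ α ∈ 𝔸, α < γ) (k : Fin d → ℕ)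
    (hcase : β < βbar ∨ ∀ a ∈ (𝔸 : Set ℝ) ∪ {γ, ζ}, ∀ k : Fin d → ℕ, a + βbar ≠ mdeg s k)
    (hk : mdeg s k < γ + β) :
    ∃ C : ℝ, 0 ≤ C ∧ ∀ (Q : ℝ → Pt d → Pt d → ℝ) (CK : ℝ)
      (D : (Fin d → ℕ) → ℝ → Pt d → Pt d → ℝ), IsRegKernel s ℓ G Q βbar δ CK D → KMeas s δ D →
      ∀ (x y : Pt d) (c : ℝ), 0 < sNorm s (y - x) → sNorm s (y - x) ≤ 1 → 0 ≤ c →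
      ∀ (Lx Ly : Distr d) (S : ℝ → Distr d),
      DMeas Lx → DMeas Ly → (∀ α ∈ 𝔸, DMeas (S α)) →
      (∀ r ∈ Ioc (0 : ℝ) 1, GInt s ℓ G r x (Lx r) (c * r ^ (γ / ℓ))) →
      (∀ r ∈ Ioc (0 : ℝ) 1, GInt s ℓ G r y (Ly r) (c * r ^ (γ / ℓ))) →
      (∀ α ∈ 𝔸, ∀ r ∈ Ioc (0 : ℝ) 1,
        GInt s ℓ G r y (S α r) (c * sNorm s (y - x) ^ (γ - α) * r ^ (α / ℓ))) →
      (∀ r ∈ Ioc (0 : ℝ) 1, ∀ z, Lx r z = Ly r z + ∑ α ∈ 𝔸, S α r z) →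
      |kerI D k y Ly + ∑ α ∈ 𝔸 with mdeg s k < α + β, kerI D k y (S α) -
          ∑ l ∈ mbelow s (γ + β - mdeg s k),
            mpow (y - x) l / (mfact l : ℝ) * kerI D (k + l) x Lx| ≤
        C * (CK * c) * sNorm s (y - x) ^ (γ + β - mdeg s k) := by
  classical
  set m := mdeg s k with hm
  set 𝔽 := 𝔸.filter fun α => m < α + β with h𝔽
  set 𝔽' := 𝔸.filter fun α => ¬ m < α + β with h𝔽'
  set B := mbelow s (γ + β - m) with hB
  -- The Taylor terms that the regularity of the kernel provides but 𝓚 does not contain.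
  set B' := mbelow s (δ - m) \ B with hB'
  have hcase' : ∀ a, a ∈ (𝔸 : Set ℝ) ∪ {γ, ζ} → ∀ l : Fin d → ℕ, a + βbar - m - mdeg s l = 0 →
      a + β - m - mdeg s l < 0 := by
    intro a ha l h
    rcases hcase with h' | h'
    · linarith
    · refine absurd ?_ (h' a ha (k + l))
      rw [mdeg_add]; linarith
  have hγ𝔽 : γ ∉ 𝔽 := fun h => (h𝔸 γ (Finset.mem_filter.1 h).1).false
  have hBmem : ∀ l ∈ B, mdeg s l < γ + β - m := fun l hl => (mem_mbelow hs).1 hl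
  have hB'mem : ∀ l ∈ B', mdeg s l < δ - m ∧ γ + β - m ≤ mdeg s l := fun l hl => by
    have := Finset.mem_sdiff.1 hl
    exact ⟨(mem_mbelow hs).1 this.1, not_lt.1 fun h => this.2 ((mem_mbelow hs).2 h)⟩
  have hBsub : B ⊆ mbelow s (δ - m) := fun l hl =>
    (mem_mbelow hs).2 ((hBmem l hl).trans (by linarith))
  -- Small times: γ stands for L_y, 𝔽 for the retained S^α, B for the Taylor terms. Large times: 𝔽'
  -- for the discarded S^α, `none` for the Taylor remainder, B' for the added terms.
  obtain ⟨C, hC0, hC⟩ := split_bound ((insert γ 𝔽).disjSum B) (𝔽'.disjSum (Finset.insertNone B'))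
    (Sum.elim (fun α => γ - α) fun l => mdeg s l)
    (Sum.elim (fun α => α + βbar - m) fun l => γ + βbar - m - mdeg s l)
    (Sum.elim (fun α => γ - α) fun o => o.elim (δ - m) fun l => mdeg s l)
    (Sum.elim (fun α => α + βbar - m) fun o => o.elim (γ + βbar - δ)
      fun l => γ + βbar - m - mdeg s l)
    (Sum.elim (fun α => α + β - m) fun o => o.elim (γ + βbar - δ)
      fun l => γ + β - m - mdeg s l) (γ + β - m) hℓ
    (by
      intro j hj
      rcases Finset.mem_disjSum.1 hj with ⟨α, hα, rfl⟩ | ⟨l, hl, rfl⟩ <;>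
        simp only [Sum.elim_inl, Sum.elim_inr]
      · rcases Finset.mem_insert.1 hα with rfl | h
        · linarith
        · linarith [(Finset.mem_filter.1 h).2]
      · linarith [hBmem l hl])
    (by
      intro j hj
      rcases Finset.mem_disjSum.1 hj with ⟨α, hα, rfl⟩ | ⟨l, hl, rfl⟩ <;>
        simp only [Sum.elim_inl, Sum.elim_inr] <;> linarith)
    (by
      intro j hj
      rcases Finset.mem_disjSum.1 hj with ⟨α, hα, rfl⟩ | ⟨o, ho, rfl⟩ <;>
        simp only [Sum.elim_inl, Sum.elim_inr]
      · have hα' := Finset.mem_filter.1 hα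
        refine ⟨by linarith, by linarith [hα'.2], fun h => ?_⟩
        have := hcase' α (Or.inl hα'.1) 0 (by rw [mdeg_zero]; linarith)
        rw [mdeg_zero] at this; linarith
      · cases o with
        | none => exact ⟨le_rfl, by simp only [Option.elim]; linarith, fun _ => by simp only [Option.elim]; linarith⟩
        | some l =>
          have hl := hB'mem l (Finset.some_mem_insertNone.1 ho)
          simp only [Option.elim]
          exact ⟨by linarith, by linarith [hl.2], hcase' γ (by simp) l⟩)
    (by
      intro j hj
      rcases Finset.mem_disjSum.1 hj with ⟨α, hα, rfl⟩ | ⟨o, ho, rfl⟩ <;>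
        simp only [Sum.elim_inl, Sum.elim_inr]
      · linarith
      · cases o <;> simp only [Option.elim] <;> linarith)
  refine ⟨2 * C, by positivity, ?_⟩
  intro Q CK D hK hD x y c hh0 hh1 hc Lx Ly S hLxm hLym hSm hLx hLy hS rel
  set h := sNorm s (y - x) with hh
  have hmδ : m < δ := by linarith
  have hkl : ∀ l ∈ mbelow s (δ - m), mdeg s (k + l) < δ := fun l hl => by
    rw [mdeg_add]; linarith [(mem_mbelow hs).1 hl]
  have hLyc : KerConv D k y Ly := kerConv_of_GInt hK hD hℓ hmδ hLym (by linarith) hLy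
  have hLxc : ∀ l ∈ B, KerConv D (k + l) x Lx := fun l hl =>
    kerConv_of_GInt hK hD hℓ (hkl l (hBsub hl)) hLxm (by rw [mdeg_add]; linarith [hBmem l hl]) hLx
  have hSc : ∀ α ∈ 𝔽, KerConv D k y (S α) := fun α hα =>
    kerConv_of_GInt hK hD hℓ hmδ (hSm α (Finset.mem_filter.1 hα).1)
      (by linarith [(Finset.mem_filter.1 hα).2]) (hS α (Finset.mem_filter.1 hα).1)
  have hi : ∀ α ∈ 𝔽, IntervalIntegrable (kerR D k y (S α)) volume 0 (1 / 2) :=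
    fun α hα => (hSc α hα).intervalIntegrable
  have hsum : IntervalIntegrable (fun r => ∑ α ∈ 𝔽, kerR D k y (S α) r) volume 0 (1 / 2) := by
    have := IntervalIntegrable.sum 𝔽 hi
    rwa [Finset.sum_fn] at this
  set p : (Fin d → ℕ) → ℝ := fun l => mpow (y - x) l / (mfact l : ℝ) with hp
  have hpl : ∀ l, |p l| ≤ h ^ mdeg s l := fun l => (abs_div_mfact_le _ _).trans (abs_mpow_le hs _ _)
  have hi' : ∀ l ∈ B, IntervalIntegrable (fun r => p l * kerR D (k + l) x Lx r) volume 0 (1 / 2) :=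
    fun l hl => (hLxc l hl).intervalIntegrable.const_mul _
  have hsum' : IntervalIntegrable (fun r => ∑ l ∈ B, p l * kerR D (k + l) x Lx r)
      volume 0 (1 / 2) := by
    have := IntervalIntegrable.sum B hi'
    rwa [Finset.sum_fn] at this
  have heq : kerI D k y Ly + ∑ α ∈ 𝔽, kerI D k y (S α) - ∑ l ∈ B, p l * kerI D (k + l) x Lx =
      2 * ∫ r in (0 : ℝ)..(1 / 2), (kerR D k y Ly r + ∑ α ∈ 𝔽, kerR D k y (S α) r -
        ∑ l ∈ B, p l * kerR D (k + l) x Lx r) := by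
    rw [intervalIntegral.integral_sub (hLyc.intervalIntegrable.add hsum) hsum',
      intervalIntegral.integral_add hLyc.intervalIntegrable hsum,
      intervalIntegral.integral_finsetSum hi, intervalIntegral.integral_finsetSum hi',
      mul_sub, mul_add, Finset.mul_sum, Finset.mul_sum, kerI_eq]
    simp only [kerI_eq, intervalIntegral.integral_const_mul]
    congr 1
    exact Finset.sum_congr rfl fun l _ => by ring
  rw [heq, abs_mul, abs_two]
  have hmem : ∀ r ∈ Ioc (0 : ℝ) (1 / 2), r ∈ Ioc (0 : ℝ) 1 := fun r hr =>
    ⟨hr.1, hr.2.trans (by norm_num)⟩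
  have hCK := hK.const_pos.le
  have hterm : ∀ r ∈ Ioc (0 : ℝ) 1, ∀ l ∈ mbelow s (δ - m), |p l * kerR D (k + l) x Lx r| ≤
      CK * c * h ^ mdeg s l * r ^ ((γ + βbar - m - mdeg s l) / ℓ - 1) := fun r hr l hl => by
    have h1 := ((hLx r hr).kerR hK hD (hkl l hl) hr.1).2
    rw [abs_mul]
    refine (mul_le_mul (hpl l) h1 (abs_nonneg _) (Real.rpow_nonneg hh0.le _)).trans_eq ?_
    rw [mdeg_add, ← sub_sub]
    ring
  have := hC h hh0 hh1 (CK * c) (mul_nonneg hCK hc)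
    (fun r => kerR D k y Ly r + ∑ α ∈ 𝔽, kerR D k y (S α) r -
        ∑ l ∈ B, p l * kerR D (k + l) x Lx r) ((hLyc.intervalIntegrable.add hsum).sub hsum')
    (fun r hr _ => by
      rw [Finset.sum_disjSum, Finset.sum_insert hγ𝔽]
      refine (abs_sub _ _).trans (add_le_add ((abs_add_le _ _).trans (add_le_add ?_ ?_)) ?_)
      · refine ((hLy r (hmem r hr)).kerR hK hD hmδ hr.1).2.trans_eq ?_
        simp [hm]
      · refine (Finset.abs_sum_le_sum_abs _ _).trans (Finset.sum_le_sum fun α hα => ?_)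
        refine ((hS α (Finset.mem_filter.1 hα).1 r (hmem r hr)).kerR hK hD hmδ hr.1).2.trans_eq ?_
        simp only [Sum.elim_inl]
        ring
      · refine (Finset.abs_sum_le_sum_abs _ _).trans (Finset.sum_le_sum fun l hl => ?_)
        exact hterm r (hmem r hr) l (hBsub hl))
    (fun r hr hrh => by
      have hr1 := hmem r hr
      have hLyi := ((hLy r hr1).kerR hK hD hmδ hr.1).1
      have hSi := fun α hα => ((hS α hα r hr1).kerR hK hD hmδ hr.1).1
      have e1 := kerR_sum_add hLyi hSi (rel r hr1)
      rw [← Finset.sum_filter_add_sum_filter_not 𝔸 fun α => m < α + β] at e1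
      set Rem := kerR D k y Lx r - ∑ l ∈ mbelow s (δ - m), p l * kerR D (k + l) x Lx r with hRem
      have e2 : kerR D k y Ly r + ∑ α ∈ 𝔽, kerR D k y (S α) r -
          ∑ l ∈ B, p l * kerR D (k + l) x Lx r =
          -(∑ α ∈ 𝔽', kerR D k y (S α) r) +
            (Rem + ∑ l ∈ B', p l * kerR D (k + l) x Lx r) := by
        rw [hRem, e1, ← Finset.sum_sdiff hBsub]; ring
      rw [e2, Finset.sum_disjSum, Finset.sum_insertNone]
      refine (abs_add_le _ _).trans (add_le_add ?_ ((abs_add_le _ _).trans (add_le_add ?_ ?_)))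
      · rw [abs_neg]
        refine (Finset.abs_sum_le_sum_abs _ _).trans (Finset.sum_le_sum fun α hα => ?_)
        refine ((hS α (Finset.mem_filter.1 hα).1 r hr1).kerR hK hD hmδ hr.1).2.trans_eq ?_
        simp only [Sum.elim_inl]
        ring
      · have hyLx : Integrable fun z => D k r y z * Lx r z := by
          refine (hLyi.add (integrable_finsetSum _ hSi)).congr (Eventually.of_forall fun z => ?_)
          simp only [Pi.add_apply, rel r hr1, mul_add, Finset.mul_sum]
        have hxLx : ∀ l ∈ mbelow s (δ - m),
            Integrable fun z => p l * (D (k + l) r x z * Lx r z) :=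
          fun l hl => (((hLx r hr1).kerR hK hD (hkl l hl) hr.1).1).const_mul _
        have e3 : Rem = ∫ z, (D k r y z - ∑ l ∈ mbelow s (δ - m), p l * D (k + l) r x z) *
            Lx r z := by
          rw [hRem]
          unfold kerR
          simp only [← integral_const_mul]
          rw [← integral_finsetSum _ hxLx, ← integral_sub hyLx (integrable_finsetSum _ hxLx)]
          refine integral_congr_ae (Eventually.of_forall fun z => ?_)
          simp only [sub_mul, Finset.sum_mul, mul_assoc]
        rw [e3]
        -- Times above h^ℓ are those at which the Hölder bound of the kernel applies to the
        -- displacement h.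
        have hrh' : h ≤ r ^ (1 / ℓ) := by
          calc h = (h ^ ℓ) ^ (1 / ℓ) := by
                rw [← Real.rpow_mul hh0.le, mul_one_div_cancel hℓ.ne', Real.rpow_one]
            _ ≤ _ := Real.rpow_le_rpow (Real.rpow_nonneg hh0.le _) hrh.le (by positivity)
        have hκ : ∀ z, |D k r y z - ∑ l ∈ mbelow s (δ - m), p l * D (k + l) r x z| ≤
            CK * h ^ (δ - m) * r ^ ((βbar - δ) / ℓ - 1) * Gt s ℓ G r (x - z) := fun z => by
          have := hK.holder k hmδ r hr.1 x z (y - x) hrh'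
          rwa [add_sub_cancel] at this
        have hκm : AEStronglyMeasurable
            (fun z => D k r y z - ∑ l ∈ mbelow s (δ - m), p l * D (k + l) r x z) volume := by
          refine Measurable.aestronglyMeasurable ((hD.measurable hmδ hr.1 y).sub ?_)
          exact Finset.measurable_sum _ fun l hl =>
            (hD.measurable (hkl l hl) hr.1 x).const_mul _
        refine ((hLx r hr1).kernel (mul_nonneg (mul_nonneg hCK (Real.rpow_nonneg hh0.le _))
          (Real.rpow_nonneg hr.1.le _)) hκm hκ).2.trans_eq ?_
        simp only [Sum.elim_inr, Option.elim]
        have e4 : (γ + βbar - δ) / ℓ - 1 = ((βbar - δ) / ℓ - 1) + γ / ℓ := by ring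
        rw [e4, Real.rpow_add hr.1]
        ring
      · refine (Finset.abs_sum_le_sum_abs _ _).trans (Finset.sum_le_sum fun l hl => ?_)
        exact hterm r hr1 l (Finset.mem_sdiff.1 hl).1)
  linarith

end Schauder

/-! ### The abstract system of distributions and its spatial estimates. -/

section System

variable {d : ℕ} {s : Fin d → ℝ} {ℓ : ℝ} {G W U : Pt d → ℝ}

theorem GInt.of_sum {ι : Type*} (I : Finset ι) {r : ℝ} {x : Pt d} {F : Pt d → ℝ}
    {g : ι → Pt d → ℝ} {a b : ι → ℝ} (hGm : Measurable G) (hG0 : ∀ x, 0 ≤ G x) (hr : 0 < r)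
    (hF : AEStronglyMeasurable F volume) (ha : ∀ i ∈ I, 0 ≤ a i)
    (hle : ∀ᵐ z, |F z| ≤ ∑ i ∈ I, a i * g i z)
    (hg : ∀ i ∈ I, Integrable (fun z => Gt s ℓ G r (x - z) * g i z) ∧
      ∫ z, Gt s ℓ G r (x - z) * g i z ≤ b i) :
    GInt s ℓ G r x F (∑ i ∈ I, a i * b i) := by
  have e : (fun z => Gt s ℓ G r (x - z) * ∑ i ∈ I, a i * g i z) =
      fun z => ∑ i ∈ I, a i * (Gt s ℓ G r (x - z) * g i z) := by
    funext z
    rw [Finset.mul_sum]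
    exact Finset.sum_congr rfl fun i _ => by ring
  have hi : ∀ i ∈ I, Integrable fun z => a i * (Gt s ℓ G r (x - z) * g i z) :=
    fun i hi => (hg i hi).1.const_mul _
  refine GInt.of_le hGm hG0 hr hF hle (by rw [e]; exact integrable_finsetSum _ hi) ?_
  rw [e, integral_finsetSum _ hi]
  refine Finset.sum_le_sum fun i hi => ?_
  rw [integral_const_mul]
  exact mul_le_mul_of_nonneg_left (hg i hi).2 (ha i hi)

theorem IsControlled.inv_le (hU : IsControlled s ℓ G W U) (x z : Pt d) :
    (W z)⁻¹ ≤ U (x - z) * (W x)⁻¹ := by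
  have h := hU.moderate (x - z) z
  rw [sub_add_cancel] at h
  rw [← div_eq_mul_inv, le_div_iff₀ (hU.pos x), inv_mul_le_iff₀ (hU.pos z), mul_comm]
  exact h

/-- `∑_{α' ≤ α} r^{α'/ℓ} n^{α - α'}`. -/
noncomputable def hSum (𝔸 : Finset ℝ) (ℓ α r n : ℝ) : ℝ :=
  ∑ α' ∈ 𝔸 with α' ≤ α, r ^ (α' / ℓ) * n ^ (α - α')

theorem hSum_zero {𝔸 : Finset ℝ} {α : ℝ} (hα : α ∈ 𝔸) (r : ℝ) :
    hSum 𝔸 ℓ α r 0 = r ^ (α / ℓ) := by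
  unfold hSum
  have hα' : α ∈ 𝔸.filter (fun α' => α' ≤ α) := Finset.mem_filter.2 ⟨hα, le_refl α⟩
  rw [Finset.sum_eq_single_of_mem α hα' fun α' _ hne => by
    rw [Real.zero_rpow (sub_ne_zero.2 hne.symm), mul_zero]]
  simp

theorem hSum_nonneg (𝔸 : Finset ℝ) (α : ℝ) {r n : ℝ} (hr : 0 ≤ r) (hn : 0 ≤ n) :
    0 ≤ hSum 𝔸 ℓ α r n :=
  Finset.sum_nonneg fun _ _ => mul_nonneg (Real.rpow_nonneg hr _) (Real.rpow_nonneg hn _)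

/-- The distributions attached to a singular modelled distribution and its reconstruction: `L x` is
the recentered reconstruction, `T α x` and `S α y x` are the realizations of the components of `f x`
and of the increments; with pointwise bounds. -/
structure Sys [NeZero d] (s : Fin d → ℝ) (ℓ : ℝ) (W U : Pt d → ℝ) (𝔸 : Finset ℝ) (γ η : ℝ)
    (L : Pt d → Distr d) (S : ℝ → Pt d → Pt d → Distr d) (T : ℝ → Pt d → Distr d) (Λ : Distr d)
    (A Rc : ℝ) : Prop where
  measL : ∀ x, DMeas (L x)
  measS : ∀ α y x, DMeas (S α y x)
  measT : ∀ α x, DMeas (T α x)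
  measΛ : DMeas Λ
  rel_T : ∀ x : Pt d, x 0 ≠ 0 → ∀ r ∈ Ioc (0 : ℝ) 1, ∀ z, Λ r z = L x r z + ∑ α ∈ 𝔸, T α x r z
  rel_S : ∀ x y : Pt d, x 0 ≠ 0 → y 0 ≠ 0 → ∀ r ∈ Ioc (0 : ℝ) 1, ∀ z,
    L x r z = L y r z + ∑ α ∈ 𝔸, S α y x r z
  bound_L : ∀ r ∈ Ioc (0 : ℝ) 1, ∀ x : Pt d, x 0 ≠ 0 →
    |L x r x| ≤ Rc * r ^ (γ / ℓ) * tw s x ^ (η - γ) * (W x)⁻¹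
  bound_T : ∀ α ∈ 𝔸, ∀ r ∈ Ioc (0 : ℝ) 1, ∀ x : Pt d, x 0 ≠ 0 → ∀ z,
    |T α x r z| ≤ A * (tw s x ^ (η - α) * (W x)⁻¹) * (U (x - z) * hSum 𝔸 ℓ α r (sNorm s (x - z)))
  bound_S : ∀ α ∈ 𝔸, ∀ r ∈ Ioc (0 : ℝ) 1, ∀ x y : Pt d, x 0 ≠ 0 → y 0 ≠ 0 → x ≠ y →
    sNorm s (y - x) ≤ tw₂ s x y → ∀ z,
    |S α y x r z| ≤ A * (sNorm s (y - x) ^ (γ - α) * tw₂ s x y ^ (η - γ) * U (x - y) * (W x)⁻¹) *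
      (U (y - z) * hSum 𝔸 ℓ α r (sNorm s (y - z)))

variable [NeZero d] {𝔸 : Finset ℝ} {γ η ζ β βbar δ : ℝ}

/-- Integrated against G_r, a factor ‖x − z‖^{α−α'} is worth r^{(α−α')/ℓ}; every summand of `hSum`
therefore contributes the same power r^{α/ℓ}. -/
theorem IsControlled.gInt_hSum (hU : IsControlled s ℓ G W U) (hs : ∀ i, 1 ≤ s i) (hℓ : 0 < ℓ)
    (hGm : Measurable G) (hG0 : ∀ x, 0 ≤ G x) (𝔸 : Finset ℝ) :
    ∃ C : ℝ, 0 ≤ C ∧ ∀ α ∈ 𝔸, ∀ r ∈ Ioc (0 : ℝ) 1, ∀ (x : Pt d) (F : Pt d → ℝ) (c : ℝ), 0 ≤ c →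
      AEStronglyMeasurable F volume →
      (∀ z, |F z| ≤ c * (U (x - z) * hSum 𝔸 ℓ α r (sNorm s (x - z)))) →
      GInt s ℓ G r x F (C * c * r ^ (α / ℓ)) := by
  have hs0 : 0 < s 0 := by linarith [hs 0]
  have h : ∀ α α' : ℝ, ∃ C : ℝ, 0 ≤ C ∧ (α' ≤ α → ∀ r ∈ Ioc (0 : ℝ) 1, ∀ x : Pt d,
      Integrable (fun z => Gt s ℓ G r (x - z) *
        (U (x - z) * sNorm s (x - z) ^ (α - α') * tw s z ^ (-0 : ℝ))) ∧
      ∫ z, Gt s ℓ G r (x - z) * (U (x - z) * sNorm s (x - z) ^ (α - α') * tw s z ^ (-0 : ℝ)) ≤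
        C * r ^ ((α - α' - 0) / ℓ)) := fun α α' => by
    by_cases hle : α' ≤ α
    · obtain ⟨C, hC, h⟩ := hU.integral_tw hs hℓ hGm hG0 (sub_nonneg.2 hle) le_rfl hs0
      exact ⟨C, hC, fun _ => h⟩
    · exact ⟨0, le_rfl, fun h => absurd h hle⟩
  choose C hC0 hC using h
  refine ⟨∑ α ∈ 𝔸, ∑ α' ∈ 𝔸, C α α', Finset.sum_nonneg fun α _ => Finset.sum_nonneg fun α' _ =>
    hC0 α α', fun α hα r hr x F c hc hF hle => ?_⟩
  have hr0 := hr.1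
  have hG := GInt.of_sum (s := s) (ℓ := ℓ) (x := x) (𝔸.filter fun α' => α' ≤ α)
    (a := fun α' => c * r ^ (α' / ℓ))
    (b := fun α' => C α α' * r ^ ((α - α' - 0) / ℓ))
    (g := fun α' z => U (x - z) * sNorm s (x - z) ^ (α - α') * tw s z ^ (-0 : ℝ))
    hGm hG0 hr.1 hF (fun α' _ => mul_nonneg hc (Real.rpow_nonneg hr0.le _))
    (Eventually.of_forall fun z => (hle z).trans_eq (by
      unfold hSum
      rw [Finset.mul_sum, Finset.mul_sum]
      refine Finset.sum_congr rfl fun α' _ => ?_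
      rw [neg_zero, Real.rpow_zero]
      ring))
    (fun α' hα' => hC α α' (Finset.mem_filter.1 hα').2 r hr x)
  refine hG.mono ?_
  have : ∀ α' ∈ 𝔸.filter (fun α' => α' ≤ α),
      c * r ^ (α' / ℓ) * (C α α' * r ^ ((α - α' - 0) / ℓ)) = C α α' * (c * r ^ (α / ℓ)) := by
    intro α' _
    have e : α / ℓ = α' / ℓ + (α - α' - 0) / ℓ := by ring
    rw [e, Real.rpow_add hr0]
    ring
  rw [Finset.sum_congr rfl this, ← Finset.sum_mul, mul_assoc]
  refine mul_le_mul_of_nonneg_right ?_ (mul_nonneg hc (Real.rpow_nonneg hr0.le _))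
  refine (Finset.sum_le_sum_of_subset_of_nonneg (Finset.filter_subset _ _)
    fun α' _ _ => hC0 α α').trans ?_
  exact Finset.single_le_sum (f := fun α => ∑ α' ∈ 𝔸, C α α')
    (fun α _ => Finset.sum_nonneg fun α' _ => hC0 α α') hα

variable {L : Pt d → Distr d} {S : ℝ → Pt d → Pt d → Distr d} {T : ℝ → Pt d → Distr d}
  {Λ : Distr d} {A Rc : ℝ}

theorem Sys.abs_T_diag (h : Sys s ℓ W U 𝔸 γ η L S T Λ A Rc) (hs : ∀ i, 1 ≤ s i) {α : ℝ}
    (hα : α ∈ 𝔸) {r : ℝ} (hr : r ∈ Ioc (0 : ℝ) 1) {z : Pt d} (hz : z 0 ≠ 0) :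
    |T α z r z| ≤ A * U 0 * r ^ (α / ℓ) * tw s z ^ (η - α) * (W z)⁻¹ := by
  refine (h.bound_T α hα r hr z hz z).trans_eq ?_
  rw [sub_self, sNorm_zero hs, hSum_zero hα]
  ring

/-- The distribution is recentred at z, where the reconstruction bound applies directly. For x and z
close, L_x − L_z is a sum of increments S^α. For x and z far apart no increment bound is available,
but the difference equals ∑ T^α_z − ∑ T^α_x, and the missing powers of φ(x) are supplied by ‖x − z‖.
-/
theorem Sys.abs_L_le (h : Sys s ℓ W U 𝔸 γ η L S T Λ A Rc) (hU : IsControlled s ℓ G W U)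
    (hs : ∀ i, 1 ≤ s i) (h𝔸 : ∀ α ∈ 𝔸, η ≤ α ∧ α < γ) (hηγ : η ≤ γ) (hA : 0 ≤ A) (hR : 0 ≤ Rc)
    {r : ℝ} (hr : r ∈ Ioc (0 : ℝ) 1) {x z : Pt d} (hx : x 0 ≠ 0) (hz : z 0 ≠ 0) :
    |L x r z| ≤ (U (x - z) * (W x)⁻¹ * tw₂ s x z ^ (η - γ)) * (Rc * r ^ (γ / ℓ) +
      2 ^ (γ - η) * (U 0 + 𝔸.card) * A * ∑ α ∈ 𝔸, r ^ (α / ℓ) * sNorm s (x - z) ^ (γ - α)) := by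
  have hr0 := hr.1
  have hU1 : 1 ≤ U (x - z) := hU.one_le_st _
  have hU0 : 1 ≤ U 0 := hU.one_le_st _
  have hWx := inv_pos.2 (hU.pos x)
  set n := sNorm s (x - z) with hn
  have hn0 : 0 ≤ n := sNorm_nonneg _
  have ht := tw₂_pos (s := s) hx hz
  set t := tw₂ s x z with htdef
  have h2 : (1 : ℝ) ≤ 2 ^ (γ - η) := Real.one_le_rpow (by norm_num) (by linarith)
  have hsum0 : 0 ≤ ∑ α ∈ 𝔸, r ^ (α / ℓ) * n ^ (γ - α) := Finset.sum_nonneg fun α _ =>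
    mul_nonneg (Real.rpow_nonneg hr0.le _) (Real.rpow_nonneg hn0 _)
  have htp : 0 ≤ t ^ (η - γ) := Real.rpow_nonneg ht.le _
  have hpre : 0 ≤ U (x - z) * (W x)⁻¹ * t ^ (η - γ) :=
    mul_nonneg (mul_nonneg (zero_le_one.trans hU1) hWx.le) htp
  have hanti : ∀ {a b e : ℝ}, 0 < a → a ≤ b → e ≤ 0 → b ^ e ≤ a ^ e := fun ha hab he =>
    Real.rpow_le_rpow_of_nonpos ha hab he
  have hLz : |L z r z| ≤ (U (x - z) * (W x)⁻¹ * t ^ (η - γ)) * (Rc * r ^ (γ / ℓ)) := by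
    calc |L z r z| ≤ Rc * r ^ (γ / ℓ) * tw s z ^ (η - γ) * (W z)⁻¹ := h.bound_L r hr z hz
      _ ≤ Rc * r ^ (γ / ℓ) * t ^ (η - γ) * (U (x - z) * (W x)⁻¹) := by
        refine mul_le_mul (mul_le_mul_of_nonneg_left (hanti ht (min_le_right _ _) (by linarith))
          (by positivity)) (hU.inv_le x z) (inv_pos.2 (hU.pos z)).le (by positivity)
      _ = _ := by ring
  have hrest : |L x r z - L z r z| ≤ (U (x - z) * (W x)⁻¹ * t ^ (η - γ)) *
      (2 ^ (γ - η) * (U 0 + 𝔸.card) * A * ∑ α ∈ 𝔸, r ^ (α / ℓ) * n ^ (γ - α)) := by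
    have hU0A : 0 ≤ U 0 * A := by positivity
    rcases eq_or_ne x z with rfl | hxz
    · rw [sub_self, abs_zero]
      exact mul_nonneg hpre (mul_nonneg (by positivity) hsum0)
    by_cases hloc : sNorm s (z - x) ≤ t
    -- The increments are based at z and evaluated at z, so only the leading term of `hSum`
    -- survives.
    · have e : L x r z - L z r z = ∑ α ∈ 𝔸, S α z x r z := by
        rw [h.rel_S x z hx hz r hr z]; ring
      rw [e]
      refine (Finset.abs_sum_le_sum_abs _ _).trans ?_
      calc ∑ α ∈ 𝔸, |S α z x r z|
          ≤ ∑ α ∈ 𝔸, (U (x - z) * (W x)⁻¹ * t ^ (η - γ)) * (U 0 * A) *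
              (r ^ (α / ℓ) * n ^ (γ - α)) := by
            refine Finset.sum_le_sum fun α hα => ?_
            refine (h.bound_S α hα r hr x z hx hz hxz hloc z).trans_eq ?_
            rw [sub_self, sNorm_zero hs, hSum_zero hα, sNorm_sub_comm z x]
            ring
        _ = (U (x - z) * (W x)⁻¹ * t ^ (η - γ)) *
              (U 0 * A * ∑ α ∈ 𝔸, r ^ (α / ℓ) * n ^ (γ - α)) := by
            rw [← Finset.mul_sum, mul_assoc]
        _ ≤ _ := by
            refine mul_le_mul_of_nonneg_left (mul_le_mul_of_nonneg_right ?_ hsum0) hpre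
            refine mul_le_mul_of_nonneg_right ?_ hA
            calc U 0 ≤ U 0 + 𝔸.card := le_add_of_nonneg_right (Nat.cast_nonneg _)
              _ ≤ _ := le_mul_of_one_le_left (by positivity) h2
    · have hfar : tw s x ≤ 2 * n := by
        have := tw_le_two_mul hs hloc
        rwa [sNorm_sub_comm] at this
      have hφ := tw_pos (s := s) hx
      -- Since φ(x) ≤ 2‖x − z‖, this factor can be inserted for free; it turns φ^{η−α} into φ^{η−γ}
      -- and creates the power ‖x − z‖^{γ−α}.
      have hfac : ∀ α ∈ 𝔸, 1 ≤ 2 ^ (γ - η) * n ^ (γ - α) * tw s x ^ (α - γ) := fun α hα => by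
        have h1 := rpow_neg_le_of_le_two_mul (sub_nonneg.2 (h𝔸 α hα).2.le) hφ hfar
        rw [neg_sub] at h1
        refine h1.trans (mul_le_mul_of_nonneg_right (mul_le_mul_of_nonneg_right ?_
          (Real.rpow_nonneg hn0 _)) (Real.rpow_nonneg hφ.le _))
        exact Real.rpow_le_rpow_of_exponent_le (by norm_num) (by linarith [(h𝔸 α hα).1])
      have e : L x r z - L z r z = ∑ α ∈ 𝔸, T α z r z - ∑ α ∈ 𝔸, T α x r z := by
        have h1 := h.rel_T x hx r hr z
        have h2 := h.rel_T z hz r hr z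
        linarith
      rw [e]
      have htφ : ∀ α ∈ 𝔸, ∀ a, t ≤ a → a ^ (η - α) * tw s x ^ (α - γ) ≤ t ^ (η - γ) :=
        fun α hα a ha => by
          have e1 : η - γ = (η - α) + (α - γ) := by ring
          rw [e1, Real.rpow_add ht]
          exact mul_le_mul (hanti ht ha (by linarith [(h𝔸 α hα).1]))
            (hanti ht (min_le_left _ _) (by linarith [(h𝔸 α hα).2]))
            (Real.rpow_nonneg hφ.le _) (Real.rpow_nonneg ht.le _)
      have hTz : ∀ α ∈ 𝔸, |T α z r z| ≤ (U (x - z) * (W x)⁻¹ * t ^ (η - γ)) *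
          (2 ^ (γ - η) * U 0 * A) * (r ^ (α / ℓ) * n ^ (γ - α)) := fun α hα => by
        have hz0 := tw_pos (s := s) hz
        have hWz := (inv_pos.2 (hU.pos z)).le
        calc |T α z r z| ≤ A * U 0 * r ^ (α / ℓ) * tw s z ^ (η - α) * (W z)⁻¹ :=
              h.abs_T_diag hs hα hr hz
          _ ≤ A * U 0 * r ^ (α / ℓ) * tw s z ^ (η - α) * (W z)⁻¹ *
              (2 ^ (γ - η) * n ^ (γ - α) * tw s x ^ (α - γ)) :=
            le_mul_of_one_le_right (by positivity) (hfac α hα)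
          _ = A * U 0 * r ^ (α / ℓ) * (2 ^ (γ - η) * n ^ (γ - α)) *
              ((W z)⁻¹ * (tw s z ^ (η - α) * tw s x ^ (α - γ))) := by ring
          _ ≤ A * U 0 * r ^ (α / ℓ) * (2 ^ (γ - η) * n ^ (γ - α)) *
              ((U (x - z) * (W x)⁻¹) * t ^ (η - γ)) := by
            refine mul_le_mul_of_nonneg_left (mul_le_mul (hU.inv_le x z)
              (htφ α hα _ (min_le_right _ _)) (by positivity) (by positivity)) (by positivity)
          _ = _ := by ring
      have hTx : ∀ α ∈ 𝔸, |T α x r z| ≤ (U (x - z) * (W x)⁻¹ * t ^ (η - γ)) *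
          (2 ^ (γ - η) * A) * ∑ α' ∈ 𝔸, r ^ (α' / ℓ) * n ^ (γ - α') := fun α hα => by
        have hs0 := hSum_nonneg (ℓ := ℓ) 𝔸 α hr0.le hn0
        have hsum : n ^ (γ - α) * hSum 𝔸 ℓ α r n ≤ ∑ α' ∈ 𝔸, r ^ (α' / ℓ) * n ^ (γ - α') := by
          unfold hSum
          rw [Finset.mul_sum]
          refine le_trans (Finset.sum_le_sum fun α' hα' => ?_)
            (Finset.sum_le_sum_of_subset_of_nonneg (Finset.filter_subset (fun α' => α' ≤ α) 𝔸)
            fun α' _ _ => mul_nonneg (Real.rpow_nonneg hr0.le _) (Real.rpow_nonneg hn0 _))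
          have hle := (Finset.mem_filter.1 hα').2
          have e1 : γ - α' = (γ - α) + (α - α') := by ring
          rw [e1, Real.rpow_add_of_nonneg hn0 (by linarith [(h𝔸 α hα).2]) (by linarith)]
          exact (by ring : n ^ (γ - α) * (r ^ (α' / ℓ) * n ^ (α - α')) =
            r ^ (α' / ℓ) * (n ^ (γ - α) * n ^ (α - α'))).le
        calc |T α x r z| ≤ A * (tw s x ^ (η - α) * (W x)⁻¹) * (U (x - z) * hSum 𝔸 ℓ α r n) :=
              h.bound_T α hα r hr x hx z
          _ ≤ A * (tw s x ^ (η - α) * (W x)⁻¹) * (U (x - z) * hSum 𝔸 ℓ α r n) *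
              (2 ^ (γ - η) * n ^ (γ - α) * tw s x ^ (α - γ)) :=
            le_mul_of_one_le_right (by positivity) (hfac α hα)
          _ = A * (W x)⁻¹ * U (x - z) * 2 ^ (γ - η) *
              ((tw s x ^ (η - α) * tw s x ^ (α - γ)) * (n ^ (γ - α) * hSum 𝔸 ℓ α r n)) := by ring
          _ ≤ A * (W x)⁻¹ * U (x - z) * 2 ^ (γ - η) *
              (t ^ (η - γ) * ∑ α' ∈ 𝔸, r ^ (α' / ℓ) * n ^ (γ - α')) := by
            refine mul_le_mul_of_nonneg_left (mul_le_mul (htφ α hα _ (min_le_left _ _)) hsum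
              (by positivity) htp) (by positivity)
          _ = _ := by ring
      refine (abs_sub _ _).trans ?_
      calc |∑ α ∈ 𝔸, T α z r z| + |∑ α ∈ 𝔸, T α x r z|
          ≤ ∑ α ∈ 𝔸, (U (x - z) * (W x)⁻¹ * t ^ (η - γ)) *
            (2 ^ (γ - η) * U 0 * A) * (r ^ (α / ℓ) * n ^ (γ - α)) +
            ∑ α ∈ 𝔸, (U (x - z) * (W x)⁻¹ * t ^ (η - γ)) *
          (2 ^ (γ - η) * A) * ∑ α' ∈ 𝔸, r ^ (α' / ℓ) * n ^ (γ - α') :=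
            add_le_add ((Finset.abs_sum_le_sum_abs _ _).trans (Finset.sum_le_sum hTz))
              ((Finset.abs_sum_le_sum_abs _ _).trans (Finset.sum_le_sum hTx))
        _ = _ := by
          rw [← Finset.mul_sum, Finset.sum_const, nsmul_eq_mul]
          ring
  calc |L x r z| = |L z r z + (L x r z - L z r z)| := by rw [add_sub_cancel]
    _ ≤ |L z r z| + |L x r z - L z r z| := abs_add_le _ _
    _ ≤ _ := add_le_add hLz hrest
    _ = _ := by ring

/-- The time r of the distribution and the time r' of the integrating kernel are kept apart because
the absorption argument for γ > 0 needs r much smaller than r'. Elsewhere r = r', and all the powers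
combine to r^{γ/ℓ}. -/
theorem Sys.gInt_L (hU : IsControlled s ℓ G W U) (hs : ∀ i, 1 ≤ s i) (hℓ : 0 < ℓ)
    (hGm : Measurable G) (hG0 : ∀ x, 0 ≤ G x) (h𝔸 : ∀ α ∈ 𝔸, η ≤ α ∧ α < γ) (hηγ : η ≤ γ)
    (hη : γ - s 0 < η) :
    ∃ C : ℝ, 0 ≤ C ∧ ∀ L S T Λ A Rc, Sys s ℓ W U 𝔸 γ η L S T Λ A Rc → 0 ≤ A → 0 ≤ Rc →
      ∀ r ∈ Ioc (0 : ℝ) 1, ∀ r' ∈ Ioc (0 : ℝ) 1, ∀ x : Pt d, x 0 ≠ 0 →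
      GInt s ℓ G r' x (L x r) (C * (Rc * r ^ (γ / ℓ) + A * ∑ α ∈ 𝔸,
        r ^ (α / ℓ) * r' ^ ((γ - α) / ℓ)) * (tw s x ^ (η - γ) * (W x)⁻¹)) := by
  have h : ∀ α : ℝ, ∃ C : ℝ, 0 ≤ C ∧ (α ≤ γ → ∀ r ∈ Ioc (0 : ℝ) 1, ∀ x : Pt d, x 0 ≠ 0 →
      Integrable (fun z => Gt s ℓ G r (x - z) *
        (U (x - z) * sNorm s (x - z) ^ (γ - α) * tw₂ s x z ^ (-(γ - η)))) ∧
      ∫ z, Gt s ℓ G r (x - z) *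
        (U (x - z) * sNorm s (x - z) ^ (γ - α) * tw₂ s x z ^ (-(γ - η))) ≤
        C * (r ^ ((γ - α) / ℓ) * tw s x ^ (-(γ - η)))) := fun α => by
    by_cases hle : α ≤ γ
    · obtain ⟨C, hC, h⟩ := hU.integral_tw₂ hs hℓ hGm hG0 (p := γ - α) (a := γ - η)
        (sub_nonneg.2 hle) (by linarith) (by linarith)
      exact ⟨C, hC, fun _ => h⟩
    · exact ⟨0, le_rfl, fun h => absurd h hle⟩
  choose C hC0 hC using h
  have hγ𝔸 : γ ∉ 𝔸 := fun h => (h𝔸 γ h).2.false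
  set c₀ := 2 ^ (γ - η) * (U 0 + 𝔸.card) with hc₀
  have hc₀0 : 0 ≤ c₀ := mul_nonneg (by positivity)
    (add_nonneg (zero_le_one.trans (hU.one_le_st _)) (Nat.cast_nonneg _))
  have hCs : 0 ≤ ∑ α ∈ 𝔸, C α := Finset.sum_nonneg fun α _ => hC0 α
  refine ⟨C γ + c₀ * ∑ α ∈ 𝔸, C α, add_nonneg (hC0 _) (mul_nonneg hc₀0 hCs), ?_⟩
  intro L S T Λ A Rc hsys hA hR r hr r' hr' x hx
  have hr0 := hr.1
  have hr'0 := hr'.1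
  have hW := (inv_pos.2 (hU.pos x)).le
  -- As γ ∉ 𝔸, this index is free to carry the reconstruction term with constant Rc.
  have hG := GInt.of_sum (s := s) (ℓ := ℓ) (x := x) (insert γ 𝔸)
    (a := fun α => (if α = γ then Rc else c₀ * A) * (W x)⁻¹ * r ^ (α / ℓ))
    (b := fun α => C α * (r' ^ ((γ - α) / ℓ) * tw s x ^ (-(γ - η))))
    (g := fun α z => U (x - z) * sNorm s (x - z) ^ (γ - α) * tw₂ s x z ^ (-(γ - η)))
    hGm hG0 hr'.1 (((hsys.measL x).measurable hr).aestronglyMeasurable)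
    (fun α _ => mul_nonneg (mul_nonneg (by split_ifs <;> positivity) hW)
      (Real.rpow_nonneg hr0.le _))
    (by
      filter_upwards [ae_apply_zero_ne] with z hz
      refine (hsys.abs_L_le hU hs h𝔸 hηγ hA hR hr hx hz).trans_eq ?_
      rw [Finset.sum_insert hγ𝔸, if_pos rfl, sub_self, Real.rpow_zero, neg_sub, mul_add,
        Finset.mul_sum, Finset.mul_sum]
      refine congrArg₂ _ (by ring) (Finset.sum_congr rfl fun α hα => ?_)
      rw [if_neg (h𝔸 α hα).2.ne]
      ring)
    (fun α hα => hC α (by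
      rcases Finset.mem_insert.1 hα with rfl | h
      · exact le_rfl
      · exact (h𝔸 α h).2.le) r' hr' x hx)
  refine hG.mono ?_
  rw [Finset.sum_insert hγ𝔸, if_pos rfl, sub_self, zero_div, Real.rpow_zero, neg_sub]
  set ψ := tw s x ^ (η - γ) * (W x)⁻¹ with hψ
  have hψ0 : 0 ≤ ψ := mul_nonneg (Real.rpow_nonneg (tw_nonneg _) _) hW
  have hsum : ∑ α ∈ 𝔸, (if α = γ then Rc else c₀ * A) * (W x)⁻¹ * r ^ (α / ℓ) *
      (C α * (r' ^ ((γ - α) / ℓ) * tw s x ^ (η - γ))) ≤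
      c₀ * A * ψ * ((∑ α ∈ 𝔸, C α) * ∑ α ∈ 𝔸, r ^ (α / ℓ) * r' ^ ((γ - α) / ℓ)) := by
    have : ∑ α ∈ 𝔸, C α * (r ^ (α / ℓ) * r' ^ ((γ - α) / ℓ)) ≤
        (∑ α ∈ 𝔸, C α) * ∑ α ∈ 𝔸, r ^ (α / ℓ) * r' ^ ((γ - α) / ℓ) := by
      rw [Finset.sum_mul]
      refine Finset.sum_le_sum fun α hα => mul_le_mul_of_nonneg_left ?_ (hC0 α)
      exact Finset.single_le_sum (f := fun α => r ^ (α / ℓ) * r' ^ ((γ - α) / ℓ))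
        (fun α _ => by positivity) hα
    refine le_trans (le_of_eq ?_) (mul_le_mul_of_nonneg_left this (by positivity))
    rw [Finset.mul_sum]
    refine Finset.sum_congr rfl fun α hα => ?_
    rw [if_neg (h𝔸 α hα).2.ne]
    ring
  have hX : 0 ≤ ∑ α ∈ 𝔸, r ^ (α / ℓ) * r' ^ ((γ - α) / ℓ) :=
    Finset.sum_nonneg fun α _ => by positivity
  have t1 : 0 ≤ C γ * (A * (∑ α ∈ 𝔸, r ^ (α / ℓ) * r' ^ ((γ - α) / ℓ)) * ψ) :=
    mul_nonneg (hC0 γ) (by positivity)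
  have t2 : 0 ≤ c₀ * (∑ α ∈ 𝔸, C α) * (Rc * r ^ (γ / ℓ) * ψ) := by positivity
  calc _ ≤ Rc * (W x)⁻¹ * r ^ (γ / ℓ) * (C γ * (1 * tw s x ^ (η - γ))) +
        c₀ * A * ψ * ((∑ α ∈ 𝔸, C α) * ∑ α ∈ 𝔸, r ^ (α / ℓ) * r' ^ ((γ - α) / ℓ)) :=
        add_le_add_right hsum _
    _ = C γ * (Rc * r ^ (γ / ℓ) * ψ) +
        c₀ * (∑ α ∈ 𝔸, C α) * (A * (∑ α ∈ 𝔸, r ^ (α / ℓ) * r' ^ ((γ - α) / ℓ)) * ψ) := by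
      rw [hψ]; ring
    _ ≤ _ := by
      refine (le_add_of_nonneg_right (add_nonneg t1 t2)).trans_eq ?_
      ring

end System

/-! ### Integral and coefficient bounds for a system; absorption for positive γ. -/

section SystemBounds

variable {d : ℕ} {s : Fin d → ℝ} {ℓ : ℝ} {G W U : Pt d → ℝ} [NeZero d] {𝔸 : Finset ℝ}
  {γ η ζ β βbar δ : ℝ}

theorem Sys.gInt_L_diag (hU : IsControlled s ℓ G W U) (hs : ∀ i, 1 ≤ s i) (hℓ : 0 < ℓ)
    (hGm : Measurable G) (hG0 : ∀ x, 0 ≤ G x) (h𝔸 : ∀ α ∈ 𝔸, η ≤ α ∧ α < γ) (hηγ : η ≤ γ)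
    (hη : γ - s 0 < η) :
    ∃ C : ℝ, 0 ≤ C ∧ ∀ L S T Λ A Rc, Sys s ℓ W U 𝔸 γ η L S T Λ A Rc → 0 ≤ A → 0 ≤ Rc →
      ∀ x : Pt d, x 0 ≠ 0 → ∀ r ∈ Ioc (0 : ℝ) 1,
      GInt s ℓ G r x (L x r) (C * (A + Rc) * (W x)⁻¹ * tw s x ^ (η - γ) * r ^ (γ / ℓ)) := by
  obtain ⟨C, hC0, hC⟩ := Sys.gInt_L hU hs hℓ hGm hG0 h𝔸 hηγ hη
  refine ⟨C * (1 + 𝔸.card), by positivity, fun L S T Λ A Rc h hA hR x hx r hr => ?_⟩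
  refine (hC L S T Λ A Rc h hA hR r hr r hr x hx).mono ?_
  have hr0 := hr.1
  have e : ∑ α ∈ 𝔸, r ^ (α / ℓ) * r ^ ((γ - α) / ℓ) = 𝔸.card * r ^ (γ / ℓ) := by
    rw [← nsmul_eq_mul, ← Finset.sum_const]
    refine Finset.sum_congr rfl fun α _ => ?_
    rw [← Real.rpow_add hr0]
    congr 1
    ring
  rw [e]
  have hW := (inv_pos.2 (hU.pos x)).le
  have h1 : 0 ≤ tw s x ^ (η - γ) := Real.rpow_nonneg (tw_nonneg _) _
  have h2 : 0 ≤ (A + 𝔸.card * Rc) * r ^ (γ / ℓ) := by positivity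
  have h3 : 0 ≤ C * (tw s x ^ (η - γ) * (W x)⁻¹) := by positivity
  have := mul_nonneg h3 h2
  linarith [this]

/-- For almost every z, the value of Λ at z is expanded with z itself as base point. A factor
φ(z)^{η−α} integrates to r^{(η−α)/ℓ}, so each term r^{α/ℓ} φ(z)^{η−α} ends as r^{η/ℓ} ≤ r^{ζ/ℓ}. The
regularity of Λ at order ζ is thus recovered from the bounds on L and T. -/
theorem Sys.gInt_Λ (hU : IsControlled s ℓ G W U) (hs : ∀ i, 1 ≤ s i) (hℓ : 0 < ℓ)
    (hGm : Measurable G) (hG0 : ∀ x, 0 ≤ G x) (h𝔸 : ∀ α ∈ 𝔸, η ≤ α ∧ α < γ) (hηγ : η ≤ γ)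
    (hη : γ - s 0 < η) (hζ : ζ ≤ η) :
    ∃ C : ℝ, 0 ≤ C ∧ ∀ L S T Λ A Rc, Sys s ℓ W U 𝔸 γ η L S T Λ A Rc → 0 ≤ A → 0 ≤ Rc →
      ∀ x : Pt d, ∀ r ∈ Ioc (0 : ℝ) 1,
      GInt s ℓ G r x (Λ r) (C * (A + Rc) * (W x)⁻¹ * r ^ (ζ / ℓ)) := by
  have h : ∀ α : ℝ, ∃ C : ℝ, 0 ≤ C ∧ (η ≤ α ∧ α ≤ γ → ∀ r ∈ Ioc (0 : ℝ) 1, ∀ x : Pt d,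
      Integrable (fun z => Gt s ℓ G r (x - z) *
        (U (x - z) * sNorm s (x - z) ^ (0 : ℝ) * tw s z ^ (-(α - η)))) ∧
      ∫ z, Gt s ℓ G r (x - z) * (U (x - z) * sNorm s (x - z) ^ (0 : ℝ) * tw s z ^ (-(α - η))) ≤
        C * r ^ ((0 - (α - η)) / ℓ)) := fun α => by
    by_cases hle : η ≤ α ∧ α ≤ γ
    · obtain ⟨C, hC, h⟩ := hU.integral_tw hs hℓ hGm hG0 (p := 0) (a := α - η) le_rfl
        (by linarith) (by linarith)
      exact ⟨C, hC, fun _ => h⟩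
    · exact ⟨0, le_rfl, fun h => absurd h hle⟩
  choose C hC0 hC using h
  have hγ𝔸 : γ ∉ 𝔸 := fun h => (h𝔸 γ h).2.false
  have hU0 : 1 ≤ U 0 := hU.one_le_st _
  have hCs : 0 ≤ ∑ α ∈ insert γ 𝔸, C α := Finset.sum_nonneg fun α _ => hC0 α
  refine ⟨U 0 * ∑ α ∈ insert γ 𝔸, C α, by positivity, ?_⟩
  intro L S T Λ A Rc hsys hA hR x r hr
  have hr0 := hr.1
  have hW := (inv_pos.2 (hU.pos x)).le
  have hG := GInt.of_sum (s := s) (ℓ := ℓ) (x := x) (insert γ 𝔸)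
    (a := fun α => U 0 * (A + Rc) * (W x)⁻¹ * r ^ (α / ℓ))
    (b := fun α => C α * r ^ ((0 - (α - η)) / ℓ))
    (g := fun α z => U (x - z) * sNorm s (x - z) ^ (0 : ℝ) * tw s z ^ (-(α - η)))
    hGm hG0 hr.1 ((hsys.measΛ.measurable hr).aestronglyMeasurable)
    (fun α _ => by positivity)
    (by
      filter_upwards [ae_apply_zero_ne] with z hz
      have hz0 := tw_pos (s := s) hz
      have hWz := (inv_pos.2 (hU.pos z)).le
      have hUxz : 0 ≤ U (x - z) := zero_le_one.trans (hU.one_le_st _)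
      have hinv := hU.inv_le x z
      rw [hsys.rel_T z hz r hr z, Finset.sum_insert hγ𝔸]
      refine (abs_add_le _ _).trans (add_le_add ?_
        ((Finset.abs_sum_le_sum_abs _ _).trans (Finset.sum_le_sum fun α hα => ?_)))
      · rw [Real.rpow_zero, mul_one, neg_sub]
        calc |L z r z| ≤ Rc * r ^ (γ / ℓ) * tw s z ^ (η - γ) * (W z)⁻¹ := hsys.bound_L r hr z hz
          _ ≤ (U 0 * (A + Rc)) * r ^ (γ / ℓ) * tw s z ^ (η - γ) * (U (x - z) * (W x)⁻¹) := by
            have : Rc ≤ U 0 * (A + Rc) := by nlinarith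
            gcongr
          _ = _ := by ring
      · rw [Real.rpow_zero, mul_one, neg_sub]
        calc |T α z r z| ≤ A * U 0 * r ^ (α / ℓ) * tw s z ^ (η - α) * (W z)⁻¹ :=
              hsys.abs_T_diag hs hα hr hz
          _ ≤ (U 0 * (A + Rc)) * r ^ (α / ℓ) * tw s z ^ (η - α) * (U (x - z) * (W x)⁻¹) := by
            have : A * U 0 ≤ U 0 * (A + Rc) := by nlinarith
            gcongr
          _ = _ := by ring)
    (fun α hα => hC α (by
      rcases Finset.mem_insert.1 hα with rfl | h
      · exact ⟨hηγ, le_rfl⟩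
      · exact ⟨(h𝔸 α h).1, (h𝔸 α h).2.le⟩) r hr x)
  refine hG.mono ?_
  have e : ∀ α ∈ insert γ 𝔸, U 0 * (A + Rc) * (W x)⁻¹ * r ^ (α / ℓ) *
      (C α * r ^ ((0 - (α - η)) / ℓ)) = C α * (U 0 * (A + Rc) * (W x)⁻¹ * r ^ (η / ℓ)) := by
    intro α _
    have : η / ℓ = α / ℓ + (0 - (α - η)) / ℓ := by ring
    rw [this, Real.rpow_add hr0]
    ring
  rw [Finset.sum_congr rfl e, ← Finset.sum_mul]
  have hpow : r ^ (η / ℓ) ≤ r ^ (ζ / ℓ) :=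
    Real.rpow_le_rpow_of_exponent_ge hr0 hr.2 (div_le_div_of_nonneg_right hζ hℓ.le)
  calc _ = U 0 * (∑ α ∈ insert γ 𝔸, C α) * (A + Rc) * (W x)⁻¹ * r ^ (η / ℓ) := by ring
    _ ≤ _ := mul_le_mul_of_nonneg_left hpow (by positivity)

theorem Sys.gInt_T (hU : IsControlled s ℓ G W U) (hs : ∀ i, 1 ≤ s i) (hℓ : 0 < ℓ)
    (hGm : Measurable G) (hG0 : ∀ x, 0 ≤ G x) :
    ∃ C : ℝ, 0 ≤ C ∧ ∀ L S T Λ A Rc, Sys s ℓ W U 𝔸 γ η L S T Λ A Rc → 0 ≤ A →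
      ∀ x : Pt d, x 0 ≠ 0 → ∀ α ∈ 𝔸, ∀ r ∈ Ioc (0 : ℝ) 1,
      GInt s ℓ G r x (T α x r) (C * A * (W x)⁻¹ * tw s x ^ (η - α) * r ^ (α / ℓ)) := by
  obtain ⟨C, hC0, hC⟩ := hU.gInt_hSum hs hℓ hGm hG0 𝔸
  refine ⟨C, hC0, fun L S T Λ A Rc h hA x hx α hα r hr => ?_⟩
  have hW := (inv_pos.2 (hU.pos x)).le
  have hφ := tw_pos (s := s) hx
  refine (hC α hα r hr x (T α x r) _ (by positivity)
    ((h.measT α x).measurable hr).aestronglyMeasurable (h.bound_T α hα r hr x hx)).mono ?_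
  exact le_of_eq (by ring)

theorem Sys.gInt_S (hU : IsControlled s ℓ G W U) (hs : ∀ i, 1 ≤ s i) (hℓ : 0 < ℓ)
    (hGm : Measurable G) (hG0 : ∀ x, 0 ≤ G x) :
    ∃ C : ℝ, 0 ≤ C ∧ ∀ L S T Λ A Rc, Sys s ℓ W U 𝔸 γ η L S T Λ A Rc → 0 ≤ A →
      ∀ x y : Pt d, x 0 ≠ 0 → y 0 ≠ 0 → x ≠ y → sNorm s (y - x) ≤ tw₂ s x y →
      ∀ α ∈ 𝔸, ∀ r ∈ Ioc (0 : ℝ) 1,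
      GInt s ℓ G r y (S α y x r) (C * A * (tw₂ s x y ^ (η - γ) * U (x - y) * (W x)⁻¹) *
        sNorm s (y - x) ^ (γ - α) * r ^ (α / ℓ)) := by
  obtain ⟨C, hC0, hC⟩ := hU.gInt_hSum hs hℓ hGm hG0 𝔸
  refine ⟨C, hC0, fun L S T Λ A Rc h hA x y hx hy hxy hloc α hα r hr => ?_⟩
  have hW := (inv_pos.2 (hU.pos x)).le
  have hφ := tw₂_pos (s := s) hx hy
  have hUxy : 0 ≤ U (x - y) := zero_le_one.trans (hU.one_le_st _)
  have hn := sNorm_nonneg (s := s) (y - x)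
  refine (hC α hα r hr y (S α y x r) _ (by positivity)
    ((h.measS α y x).measurable hr).aestronglyMeasurable
    (h.bound_S α hα r hr x y hx hy hxy hloc)).mono ?_
  exact le_of_eq (by ring)

theorem Sys.kerConv_L (hU : IsControlled s ℓ G W U) (hs : ∀ i, 1 ≤ s i) (hℓ : 0 < ℓ)
    (hGm : Measurable G) (hG0 : ∀ x, 0 ≤ G x) (h𝔸 : ∀ α ∈ 𝔸, η ≤ α ∧ α < γ) (hηγ : η ≤ γ)
    (hη : γ - s 0 < η) {L S T Λ A Rc} (h : Sys s ℓ W U 𝔸 γ η L S T Λ A Rc) (hA : 0 ≤ A)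
    (hR : 0 ≤ Rc) {Q : ℝ → Pt d → Pt d → ℝ} {CK : ℝ} {D : (Fin d → ℕ) → ℝ → Pt d → Pt d → ℝ}
    (hK : IsRegKernel s ℓ G Q βbar δ CK D) (hD : KMeas s δ D) {x : Pt d} (hx : x 0 ≠ 0)
    {k : Fin d → ℕ} (hk : mdeg s k < δ) (hkγ : mdeg s k < γ + βbar) : KerConv D k x (L x) := by
  obtain ⟨C, hC0, hC⟩ := Sys.gInt_L_diag hU hs hℓ hGm hG0 h𝔸 hηγ hη
  exact kerConv_of_GInt hK hD hℓ hk (h.measL x) hkγ (hC L S T Λ A Rc h hA hR x hx)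

theorem Sys.size_coef (hU : IsControlled s ℓ G W U) (hs : ∀ i, 1 ≤ s i) (hℓ : 0 < ℓ)
    (hGm : Measurable G) (hG0 : ∀ x, 0 ≤ G x) (h𝔸 : ∀ α ∈ 𝔸, η ≤ α ∧ α < γ) (hηγ : η ≤ γ)
    (hη : γ - s 0 < η) (hζ : ζ ≤ η) (hββ : β ≤ βbar) (hγδ : γ + βbar < δ)
    (hcase : β < βbar ∨ ∀ a ∈ (𝔸 : Set ℝ) ∪ {γ, ζ}, ∀ k : Fin d → ℕ, a + βbar ≠ mdeg s k) :
    ∃ C : ℝ, 0 ≤ C ∧ ∀ (Q : ℝ → Pt d → Pt d → ℝ) (CK : ℝ)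
      (D : (Fin d → ℕ) → ℝ → Pt d → Pt d → ℝ), IsRegKernel s ℓ G Q βbar δ CK D → KMeas s δ D →
      ∀ L S T Λ A Rc, Sys s ℓ W U 𝔸 γ η L S T Λ A Rc → 0 ≤ A → 0 ≤ Rc →
      ∀ k, mdeg s k < γ + β → ∀ x : Pt d, x 0 ≠ 0 →
      |kerI D k x (L x) + ∑ α ∈ 𝔸 with mdeg s k < α + β, kerI D k x (T α x)| ≤
        C * (CK * (A + Rc)) * (tw s x ^ min (ζ + β - mdeg s k) 0 * (W x)⁻¹) := by
  obtain ⟨C₁, hC₁0, hC₁⟩ := Sys.gInt_L_diag hU hs hℓ hGm hG0 h𝔸 hηγ hη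
  obtain ⟨C₂, hC₂0, hC₂⟩ := Sys.gInt_Λ hU hs hℓ hGm hG0 h𝔸 hηγ hη hζ
  obtain ⟨C₃, hC₃0, hC₃⟩ := Sys.gInt_T (𝔸 := 𝔸) (γ := γ) (η := η) hU hs hℓ hGm hG0
  -- The constant is set to 0 for degrees out of range, so that constants can be chosen for all k
  -- and summed over the finitely many relevant ones.
  have hk : ∀ k : Fin d → ℕ, ∃ C : ℝ, 0 ≤ C ∧ (mdeg s k < γ + β → _) := fun k => by
    by_cases hk : mdeg s k < γ + β
    · obtain ⟨C, hC, h⟩ := size_coef_bound (G := G) hℓ hββ hγδ hηγ hζ 𝔸 h𝔸 k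
        (hcase.imp_right fun h a ha => h a ha k) hk
      exact ⟨C, hC, fun _ => h⟩
    · exact ⟨0, le_rfl, fun h => absurd h hk⟩
  choose C hC0 hC using hk
  refine ⟨(∑ k ∈ mbelow s (γ + β), C k) * (C₁ + C₂ + C₃),
    mul_nonneg (Finset.sum_nonneg fun k _ => hC0 k) (by positivity), ?_⟩
  intro Q CK D hK hD L S T Λ A Rc h hA hR k hk x hx
  have hW := (inv_pos.2 (hU.pos x)).le
  have hφ := tw_pos (s := s) hx
  have := hC k hk Q CK D hK hD x (tw s x) ((C₁ + C₂ + C₃) * (A + Rc) * (W x)⁻¹) hφ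
    (tw_le_one x) (by positivity) (L x) Λ (fun α => T α x) (h.measL x) (fun α _ => h.measT α x)
    (fun r hr => (hC₁ L S T Λ A Rc h hA hR x hx r hr).mono (by
      have := hr.1
      gcongr; linarith))
    (fun α hα r hr => (hC₃ L S T Λ A Rc h hA x hx α hα r hr).mono (by
      have := hr.1
      gcongr <;> linarith))
    (fun r hr => (hC₂ L S T Λ A Rc h hA hR x r hr).mono (by
      have := hr.1
      gcongr; linarith))
    (h.rel_T x hx)
  refine this.trans ?_
  have hle : C k ≤ ∑ k ∈ mbelow s (γ + β), C k :=
    Finset.single_le_sum (fun k _ => hC0 k) ((mem_mbelow hs).2 hk)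
  have hCK := hK.const_pos.le
  calc _ = C k * ((C₁ + C₂ + C₃) * (CK * (A + Rc)) *
        (tw s x ^ min (ζ + β - mdeg s k) 0 * (W x)⁻¹)) := by ring
    _ ≤ (∑ k ∈ mbelow s (γ + β), C k) * ((C₁ + C₂ + C₃) * (CK * (A + Rc)) *
        (tw s x ^ min (ζ + β - mdeg s k) 0 * (W x)⁻¹)) :=
      mul_le_mul_of_nonneg_right hle (by positivity)
    _ = _ := by ring

theorem Sys.hol_coef (hU : IsControlled s ℓ G W U) (hs : ∀ i, 1 ≤ s i) (hℓ : 0 < ℓ)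
    (hGm : Measurable G) (hG0 : ∀ x, 0 ≤ G x) (h𝔸 : ∀ α ∈ 𝔸, η ≤ α ∧ α < γ) (hηγ : η ≤ γ)
    (hη : γ - s 0 < η) (hζ : ζ ≤ η) (hββ : β ≤ βbar) (hγδ : γ + βbar < δ)
    (hcase : β < βbar ∨ ∀ a ∈ (𝔸 : Set ℝ) ∪ {γ, ζ}, ∀ k : Fin d → ℕ, a + βbar ≠ mdeg s k) :
    ∃ C : ℝ, 0 ≤ C ∧ ∀ (Q : ℝ → Pt d → Pt d → ℝ) (CK : ℝ)
      (D : (Fin d → ℕ) → ℝ → Pt d → Pt d → ℝ), IsRegKernel s ℓ G Q βbar δ CK D → KMeas s δ D →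
      ∀ L S T Λ A Rc, Sys s ℓ W U 𝔸 γ η L S T Λ A Rc → 0 ≤ A → 0 ≤ Rc →
      ∀ k, mdeg s k < γ + β → ∀ x y : Pt d, x 0 ≠ 0 → y 0 ≠ 0 → x ≠ y →
      sNorm s (y - x) ≤ tw₂ s x y →
      |kerI D k y (L y) + ∑ α ∈ 𝔸 with mdeg s k < α + β, kerI D k y (S α y x) -
          ∑ l ∈ mbelow s (γ + β - mdeg s k),
            mpow (y - x) l / (mfact l : ℝ) * kerI D (k + l) x (L x)| ≤
        C * (CK * (A + Rc)) * (tw₂ s x y ^ (ζ - γ) * U (x - y) *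
          sNorm s (y - x) ^ (γ + β - mdeg s k) * (W x)⁻¹) := by
  obtain ⟨C₁, hC₁0, hC₁⟩ := Sys.gInt_L_diag hU hs hℓ hGm hG0 h𝔸 hηγ hη
  obtain ⟨C₃, hC₃0, hC₃⟩ := Sys.gInt_S (𝔸 := 𝔸) (γ := γ) (η := η) hU hs hℓ hGm hG0
  have hk : ∀ k : Fin d → ℕ, ∃ C : ℝ, 0 ≤ C ∧ (mdeg s k < γ + β → _) := fun k => by
    by_cases hk : mdeg s k < γ + β
    · obtain ⟨C, hC, h⟩ := hol_coef_bound (G := G) hs hℓ hββ hγδ 𝔸 (fun α hα => (h𝔸 α hα).2) k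
        hcase hk
      exact ⟨C, hC, fun _ => h⟩
    · exact ⟨0, le_rfl, fun h => absurd h hk⟩
  choose C hC0 hC using hk
  refine ⟨(∑ k ∈ mbelow s (γ + β), C k) * (C₁ + C₃),
    mul_nonneg (Finset.sum_nonneg fun k _ => hC0 k) (by positivity), ?_⟩
  intro Q CK D hK hD L S T Λ A Rc h hA hR k hk x y hx hy hxy hloc
  have hW := (inv_pos.2 (hU.pos x)).le
  have hWy := (inv_pos.2 (hU.pos y)).le
  have hφ := tw₂_pos (s := s) hx hy
  have hφx := tw_pos (s := s) hx
  have hφy := tw_pos (s := s) hy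
  have hU1 : 1 ≤ U (x - y) := hU.one_le_st _
  have hh0 : 0 < sNorm s (y - x) := sNorm_pos (sub_ne_zero.2 hxy.symm)
  have hx' : tw s x ^ (η - γ) ≤ tw₂ s x y ^ (η - γ) :=
    Real.rpow_le_rpow_of_nonpos hφ (min_le_left _ _) (by linarith)
  have hy' : tw s y ^ (η - γ) ≤ tw₂ s x y ^ (η - γ) :=
    Real.rpow_le_rpow_of_nonpos hφ (min_le_right _ _) (by linarith)
  -- E dominates φ^{η−γ}/W at x and at y, so one constant serves both base points.
  set E := tw₂ s x y ^ (η - γ) * U (x - y) * (W x)⁻¹ with hE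
  have hE0 : 0 ≤ E := by positivity
  have hEx : (W x)⁻¹ * tw s x ^ (η - γ) ≤ E := by
    rw [hE, mul_comm]
    refine mul_le_mul_of_nonneg_right (hx'.trans ?_) hW
    exact le_mul_of_one_le_right (by positivity) hU1
  have hEy : (W y)⁻¹ * tw s y ^ (η - γ) ≤ E := by
    calc _ ≤ (U (x - y) * (W x)⁻¹) * tw₂ s x y ^ (η - γ) :=
          mul_le_mul (hU.inv_le x y) hy' (by positivity) (by positivity)
      _ = E := by rw [hE]; ring
  have hAR : 0 ≤ A + Rc := by positivity
  have := hC k hk Q CK D hK hD x y ((C₁ + C₃) * (A + Rc) * E) hh0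
    (hloc.trans (tw₂_le_one x y)) (by positivity) (L x) (L y) (fun α => S α y x) (h.measL x)
    (h.measL y) (fun α _ => h.measS α y x)
    (fun r hr => (hC₁ L S T Λ A Rc h hA hR x hx r hr).mono (by
      have := hr.1
      refine mul_le_mul_of_nonneg_right ?_ (by positivity)
      rw [mul_assoc]
      refine mul_le_mul (mul_le_mul_of_nonneg_right (by linarith) hAR) hEx (by positivity)
        (by positivity)))
    (fun r hr => (hC₁ L S T Λ A Rc h hA hR y hy r hr).mono (by
      have := hr.1
      refine mul_le_mul_of_nonneg_right ?_ (by positivity)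
      rw [mul_assoc]
      refine mul_le_mul (mul_le_mul_of_nonneg_right (by linarith) hAR) hEy (by positivity)
        (by positivity)))
    (fun α hα r hr => (hC₃ L S T Λ A Rc h hA x y hx hy hxy hloc α hα r hr).mono (by
      have := hr.1
      refine mul_le_mul_of_nonneg_right (mul_le_mul_of_nonneg_right
        (mul_le_mul_of_nonneg_right ?_ hE0) (by positivity)) (by positivity)
      exact mul_le_mul (by linarith) (by linarith) hA (by positivity)))
    (h.rel_S x y hx hy)
  refine this.trans ?_
  have hle : C k ≤ ∑ k ∈ mbelow s (γ + β), C k :=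
    Finset.single_le_sum (fun k _ => hC0 k) ((mem_mbelow hs).2 hk)
  have hCK := hK.const_pos.le
  -- The target space has exponent ζ ≤ η, and φ ≤ 1.
  have hζ' : tw₂ s x y ^ (η - γ) ≤ tw₂ s x y ^ (ζ - γ) :=
    Real.rpow_le_rpow_of_exponent_ge hφ (tw₂_le_one x y) (by linarith)
  calc _ = C k * (tw₂ s x y ^ (η - γ) * ((C₁ + C₃) * (CK * (A + Rc)) *
        (U (x - y) * sNorm s (y - x) ^ (γ + β - mdeg s k) * (W x)⁻¹))) := by rw [hE]; ring
    _ ≤ (∑ k ∈ mbelow s (γ + β), C k) * (tw₂ s x y ^ (ζ - γ) * ((C₁ + C₃) * (CK * (A + Rc)) *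
        (U (x - y) * sNorm s (y - x) ^ (γ + β - mdeg s k) * (W x)⁻¹))) :=
      mul_le_mul hle (mul_le_mul_of_nonneg_right hζ' (by positivity)) (by positivity)
        (Finset.sum_nonneg fun k _ => hC0 k)
    _ = _ := by ring

/-- For `γ > 0` the reconstruction bound follows from the bounds on the modelled distribution. -/
theorem Sys.bound_L_of_semigroup (hU : IsControlled s ℓ G W U) (hs : ∀ i, 1 ≤ s i) (hℓ : 0 < ℓ)
    (hGm : Measurable G) (hG0 : ∀ x, 0 ≤ G x) (h𝔸 : ∀ α ∈ 𝔸, η ≤ α ∧ α < γ) (hηγ : η ≤ γ)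
    (hη : γ - s 0 < η) (hγ : 0 < γ) {Q : ℝ → Pt d → Pt d → ℝ} (hQ : IsGSemigroup s ℓ G Q) :
    ∃ C : ℝ, 0 ≤ C ∧ ∀ L S T Λ A Rc, Sys s ℓ W U 𝔸 γ η L S T Λ A Rc → 0 ≤ A → 0 ≤ Rc →
      (∀ x : Pt d, x 0 ≠ 0 → ∀ r t, 0 < r → r < t → t ≤ 1 →
        L x t x = ∫ z, Q (t - r) x z * L x r z) →
      Sys s ℓ W U 𝔸 γ η L S T Λ A (C * A) := by
  obtain ⟨C₁, hC₁0, hC₁⟩ := hQ.upper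
  obtain ⟨C₂, hC₂0, hC₂⟩ := Sys.gInt_L hU hs hℓ hGm hG0 h𝔸 hηγ hη
  set M := 2 * (C₁ * C₂) + 2 with hM
  have hM1 : 1 < M := by have := mul_nonneg hC₁0.le hC₂0; linarith
  have hM0 : 0 < M := by linarith
  set ε : ℝ := M ^ (-(ℓ / γ)) with hε
  have hε0 : 0 < ε := Real.rpow_pos_of_pos hM0 _
  have hε1 : ε < 1 := Real.rpow_lt_one_of_one_lt_of_neg hM1 (by
    have : 0 < ℓ / γ := by positivity
    linarith)
  have hεp : ε ^ (γ / ℓ) = M⁻¹ := by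
    rw [hε, ← Real.rpow_mul hM0.le, ← Real.rpow_neg_one]
    congr 1
    field_simp
  have hhalf : C₁ * C₂ * ε ^ (γ / ℓ) ≤ 1 / 2 := by
    rw [hεp, ← div_eq_mul_inv, div_le_div_iff₀ hM0 two_pos]
    linarith
  set C := C₁ * C₂ * ∑ α ∈ 𝔸, ε ^ (α / ℓ) with hCdef
  have hC0 : 0 ≤ C := mul_nonneg (mul_nonneg hC₁0.le hC₂0)
    (Finset.sum_nonneg fun α _ => Real.rpow_nonneg hε0.le _)
  refine ⟨2 * C, by positivity, fun L S T Λ A Rc h hA hR hsg => ?_⟩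
  -- Writing Q_t = Q_{t−εt} Q_{εt} and integrating the off-diagonal bound at time εt, the constant R
  -- returns multiplied by C₁C₂ε^{γ/ℓ} ≤ 1/2.
  have hstep : ∀ R, 0 ≤ R → Sys s ℓ W U 𝔸 γ η L S T Λ A R →
      Sys s ℓ W U 𝔸 γ η L S T Λ A (R / 2 + C * A) := by
    intro R hR h
    refine { h with bound_L := fun t ht x hx => ?_ }
    have ht0 := ht.1
    have hr0 : 0 < ε * t := mul_pos hε0 ht0
    have hrt : ε * t < t := mul_lt_of_lt_one_left ht0 hε1
    have hr : ε * t ∈ Ioc (0 : ℝ) 1 := ⟨hr0, hrt.le.trans ht.2⟩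
    have hr' : t - ε * t ∈ Ioc (0 : ℝ) 1 := ⟨by linarith, by linarith [ht.2]⟩
    rw [hsg x hx (ε * t) t hr0 hrt ht.2]
    have hφ := tw_pos (s := s) hx
    have hW := (inv_pos.2 (hU.pos x)).le
    have hQm : AEStronglyMeasurable (Q (t - ε * t) x) volume :=
      ((hQ.continuous _ hr'.1).comp (continuous_const.prodMk continuous_id)).aestronglyMeasurable
    have hk := ((hC₂ L S T Λ A R h hA hR _ hr _ hr' x hx).kernel hC₁0.le hQm
      (fun z => hC₁ _ hr'.1 x z)).2
    refine hk.trans ?_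
    have e1 : (ε * t) ^ (γ / ℓ) = ε ^ (γ / ℓ) * t ^ (γ / ℓ) := Real.mul_rpow hε0.le ht0.le
    have e2 : ∑ α ∈ 𝔸, (ε * t) ^ (α / ℓ) * (t - ε * t) ^ ((γ - α) / ℓ) ≤
        (∑ α ∈ 𝔸, ε ^ (α / ℓ)) * t ^ (γ / ℓ) := by
      rw [Finset.sum_mul]
      refine Finset.sum_le_sum fun α hα => ?_
      have e3 : γ / ℓ = α / ℓ + (γ - α) / ℓ := by ring
      rw [Real.mul_rpow hε0.le ht0.le, e3, Real.rpow_add ht0, mul_assoc]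
      refine mul_le_mul_of_nonneg_left (mul_le_mul_of_nonneg_left ?_ (by positivity))
        (by positivity)
      exact Real.rpow_le_rpow hr'.1.le (by linarith)
        (div_nonneg (by linarith [(h𝔸 α hα).2]) hℓ.le)
    have hψ : 0 ≤ tw s x ^ (η - γ) * (W x)⁻¹ := by positivity
    calc C₁ * (C₂ * (R * (ε * t) ^ (γ / ℓ) + A * ∑ α ∈ 𝔸,
          (ε * t) ^ (α / ℓ) * (t - ε * t) ^ ((γ - α) / ℓ)) * (tw s x ^ (η - γ) * (W x)⁻¹))
        ≤ C₁ * (C₂ * (R * (ε ^ (γ / ℓ) * t ^ (γ / ℓ)) + A * ((∑ α ∈ 𝔸, ε ^ (α / ℓ)) *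
          t ^ (γ / ℓ))) * (tw s x ^ (η - γ) * (W x)⁻¹)) := by
          rw [e1]; gcongr
      _ = ((C₁ * C₂ * ε ^ (γ / ℓ)) * R + C * A) *
          (t ^ (γ / ℓ) * (tw s x ^ (η - γ) * (W x)⁻¹)) := by rw [hCdef]; ring
      _ ≤ (1 / 2 * R + C * A) * (t ^ (γ / ℓ) * (tw s x ^ (η - γ) * (W x)⁻¹)) := by
          gcongr
      _ = _ := by ring
  -- The map R ↦ R/2 + CA has the fixed point 2CA. Starting from the finite constant Rc, the excess
  -- over it is at most Rc/2^n after n steps.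
  have hiter : ∀ n : ℕ, Sys s ℓ W U 𝔸 γ η L S T Λ A (Rc / 2 ^ n + 2 * C * A) := by
    intro n
    induction n with
    | zero =>
      refine { h with bound_L := fun t ht x hx => (h.bound_L t ht x hx).trans ?_ }
      have hφ := tw_pos (s := s) hx
      have hW := (inv_pos.2 (hU.pos x)).le
      have := ht.1
      have : 0 ≤ 2 * C * A := by positivity
      gcongr
      simpa using this
    | succ n ih =>
      have := hstep _ (by positivity) ih
      have e : (Rc / 2 ^ n + 2 * C * A) / 2 + C * A = Rc / 2 ^ (n + 1) + 2 * C * A := by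
        rw [pow_succ]; field_simp; ring
      rwa [e] at this
  refine { h with bound_L := fun t ht x hx => ?_ }
  have hlim : Tendsto (fun n : ℕ => (Rc / 2 ^ n + 2 * C * A) * t ^ (γ / ℓ) * tw s x ^ (η - γ) *
      (W x)⁻¹) atTop (𝓝 ((0 + 2 * C * A) * t ^ (γ / ℓ) * tw s x ^ (η - γ) * (W x)⁻¹)) := by
    refine (((Tendsto.add_const _ ?_).mul_const _).mul_const _).mul_const _
    have := (tendsto_pow_atTop_nhds_zero_of_lt_one (r := (1 / 2 : ℝ)) (by norm_num)
      (by norm_num)).const_mul Rc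
    simpa [div_eq_mul_inv] using this
  rw [zero_add] at hlim
  exact ge_of_tendsto' hlim fun n => (hiter n).bound_L t ht x hx

end SystemBounds

/-! ### Joint measurability in time and space. -/

section Measurability

variable {d : ℕ} {s : Fin d → ℝ} {ℓ : ℝ} {G W U : Pt d → ℝ} {Q : ℝ → Pt d → Pt d → ℝ}
  {βbar δ CK : ℝ} {D : (Fin d → ℕ) → ℝ → Pt d → Pt d → ℝ}

/-- A function continuous in time for fixed space points and measurable in space for fixed time is
jointly measurable. Parametrizing time by the exponential gives continuity on the whole real line.
-/
theorem IsGSemigroup.measurable (hQ : IsGSemigroup s ℓ G Q) :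
    Measurable fun p : ℝ × Pt d × Pt d =>
      (Ioi (0 : ℝ)).indicator (fun t => Q t p.2.1 p.2.2) p.1 := by
  have hu : Measurable (Function.uncurry fun (τ : ℝ) (p : Pt d × Pt d) =>
      Q (Real.exp τ) p.1 p.2) := by
    refine measurable_uncurry_of_continuous_of_measurable (fun p => ?_) fun τ => ?_
    · obtain ⟨C, -, hC⟩ := hQ.time_deriv
      refine continuous_iff_continuousAt.2 fun τ => ?_
      exact ContinuousAt.comp (f := Real.exp) (g := fun r => Q r p.1 p.2)
        (hC _ (Real.exp_pos τ) p.1 p.2).1.continuousAt Real.continuous_exp.continuousAt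
    · exact (hQ.continuous _ (Real.exp_pos τ)).measurable
  have h2 : Measurable fun p : ℝ × Pt d × Pt d => Q (Real.exp (Real.log p.1)) p.2.1 p.2.2 :=
    hu.comp ((Real.measurable_log.comp measurable_fst).prodMk measurable_snd)
  have h3 : Measurable (({p : ℝ × Pt d × Pt d | 0 < p.1}).indicator
      fun p => Q (Real.exp (Real.log p.1)) p.2.1 p.2.2) :=
    h2.indicator (measurableSet_lt measurable_const measurable_fst)
  convert h3 using 1
  funext p
  by_cases hp : 0 < p.1
  · rw [indicator_of_mem (mem_Ioi.2 hp), indicator_of_mem (by exact hp), Real.exp_log hp]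
  · rw [indicator_of_notMem (by simpa using hp), indicator_of_notMem (by exact hp)]

/-- No regularity of K_t in t is assumed. For t > t₀ it is inherited from the semigroup through K_t
= K_{t₀} Q_{t−t₀}, and t₀ tends to 0. Spatial derivatives follow by induction on the order, as
limits of difference quotients. -/
theorem IsRegKernel.kMeas (hK : IsRegKernel s ℓ G Q βbar δ CK D) (hQ : IsGSemigroup s ℓ G Q)
    (hs : ∀ i, 1 ≤ s i) : KMeas s δ D := by
  have hzero : ∀ x, Measurable fun p : ℝ × Pt d =>
      (Ioi (0 : ℝ)).indicator (fun t => D 0 t x p.2) p.1 := by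
    intro x
    set t₀ : ℕ → ℝ := fun n => 1 / ((n : ℝ) + 1) with ht₀
    have ht₀0 : ∀ n, 0 < t₀ n := fun n => by positivity
    have hF : ∀ n, Measurable fun p : ℝ × Pt d => ∫ z, D 0 (t₀ n) x z *
        (Ioi (0 : ℝ)).indicator (fun t => Q t z p.2) (p.1 - t₀ n) := by
      intro n
      have h1 : Measurable fun q : (ℝ × Pt d) × Pt d =>
          (Ioi (0 : ℝ)).indicator (fun t => Q t q.2 q.1.2) (q.1.1 - t₀ n) :=
        hQ.measurable.comp (((measurable_fst.comp measurable_fst).sub measurable_const).prodMk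
          (measurable_snd.prodMk (measurable_snd.comp measurable_fst)))
      have h2 : Measurable fun q : (ℝ × Pt d) × Pt d => D 0 (t₀ n) x q.2 :=
        ((hK.continuous _ (ht₀0 n)).comp (continuous_const.prodMk continuous_snd)).measurable
      exact ((h2.mul h1).stronglyMeasurable.integral_prod_right' (ν := volume)).measurable
    refine measurable_of_tendsto_metrizable
      (f := fun (n : ℕ) (p : ℝ × Pt d) => ∫ z, D 0 (t₀ n) x z *
        (Ioi (0 : ℝ)).indicator (fun t => Q t z p.2) (p.1 - t₀ n)) hF ?_
    rw [tendsto_pi_nhds]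
    intro p
    by_cases hp : 0 < p.1
    · rw [indicator_of_mem (mem_Ioi.2 hp)]
      -- At each point the sequence is constant once t₀ n is below the given time.
      have hev : ∀ᶠ n in atTop, t₀ n < p.1 :=
        (tendsto_one_div_add_atTop_nhds_zero_nat (𝕜 := ℝ)).eventually_lt_const hp
      refine tendsto_const_nhds.congr' (hev.mono fun n hn => ?_)
      have := hK.conv (p.1 - t₀ n) p.1 (by linarith) (by linarith [ht₀0 n]) x p.2
      rw [sub_sub_cancel] at this
      rw [← this]
      simp only [indicator_of_mem (mem_Ioi.2 (sub_pos.2 hn))]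
    · rw [indicator_of_notMem (by simpa using hp)]
      refine tendsto_const_nhds.congr fun n => ?_
      have : p.1 - t₀ n ∉ Ioi (0 : ℝ) := by
        have := ht₀0 n
        simp only [mem_Ioi, not_lt]; linarith
      simp only [indicator_of_notMem this, mul_zero, integral_zero]
  have hmain : ∀ n : ℕ, ∀ k : Fin d → ℕ, ∑ i, k i = n → mdeg s k < δ → ∀ x,
      Measurable fun p : ℝ × Pt d => (Ioi (0 : ℝ)).indicator (fun t => D k t x p.2) p.1 := by
    intro n
    induction n with
    | zero =>
      intro k hk _ x
      have : k = 0 := by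
        funext i
        exact Finset.sum_eq_zero_iff.1 hk i (Finset.mem_univ i)
      rw [this]
      exact hzero x
    | succ n ih =>
      intro k hk hkδ x
      obtain ⟨i, hi⟩ : ∃ i, k i ≠ 0 := by
        by_contra hcon
        push Not at hcon
        simp [hcon] at hk
      set k' : Fin d → ℕ := k - Pi.single i 1 with hk'
      have hkk' : k = k' + Pi.single i 1 := by
        funext j
        by_cases hj : j = i
        · subst hj; simp [hk']; omega
        · simp [hk', hj]
      have hsum : ∑ j, k' j = n := by
        rw [hkk'] at hk
        simp only [Pi.add_apply, Finset.sum_add_distrib, Finset.sum_pi_single', Finset.mem_univ,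
          if_true] at hk
        omega
      have hdeg : mdeg s k = mdeg s k' + s i := by
        rw [hkk', mdeg_add]
        congr 1
        unfold mdeg
        rw [Finset.sum_eq_single i] <;> simp +contextual
      have hk'δ : mdeg s k' < δ := by linarith [hs i]
      set t₀ : ℕ → ℝ := fun n => 1 / ((n : ℝ) + 1) with ht₀
      have ht₀lim : Tendsto t₀ atTop (𝓝[≠] 0) :=
        tendsto_nhdsWithin_iff.2 ⟨tendsto_one_div_add_atTop_nhds_zero_nat,
          Eventually.of_forall fun n => by
            have : 0 < t₀ n := by positivity
            exact this.ne'⟩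
      refine measurable_of_tendsto_metrizable (f := fun (n : ℕ) (p : ℝ × Pt d) => (t₀ n)⁻¹ *
        ((Ioi (0 : ℝ)).indicator (fun t => D k' t (Function.update x i (x i + t₀ n)) p.2) p.1 -
          (Ioi (0 : ℝ)).indicator (fun t => D k' t x p.2) p.1))
        (fun n => ((ih k' hsum hk'δ _).sub (ih k' hsum hk'δ x)).const_mul _) ?_
      rw [tendsto_pi_nhds]
      intro p
      by_cases hp : 0 < p.1
      · simp only [indicator_of_mem (mem_Ioi.2 hp)]
        have hd := hK.partials k' i (by rwa [← hkk']) p.1 hp x p.2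
        rw [hasDerivAt_iff_tendsto_slope_zero] at hd
        have := hd.comp ht₀lim
        simp only [Function.update_eq_self, ← hkk', smul_eq_mul] at this
        exact this
      · have hp' : p.1 ∉ Ioi (0 : ℝ) := by simpa using hp
        simp only [indicator_of_notMem hp', sub_zero, mul_zero]
        exact tendsto_const_nhds
  exact fun k hk x => hmain _ k rfl hk x

theorem measurable_ofFun (hQ : IsGSemigroup s ℓ G Q) {f : Pt d → ℝ} (hf : Measurable f) :
    DMeas (ofFun Q f) := by
  have h1 : Measurable fun q : (ℝ × Pt d) × Pt d =>
      (Ioi (0 : ℝ)).indicator (fun t => Q t q.1.2 q.2) q.1.1 :=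
    hQ.measurable.comp ((measurable_fst.comp measurable_fst).prodMk
      ((measurable_snd.comp measurable_fst).prodMk measurable_snd))
  have h2 : Measurable fun q : (ℝ × Pt d) × Pt d => f q.2 := hf.comp measurable_snd
  have h3 := ((h1.mul h2).stronglyMeasurable.integral_prod_right' (ν := volume)).measurable
  have h4 := h3.indicator (s := {p : ℝ × Pt d | p.1 ∈ Ioc (0 : ℝ) 1})
    (measurable_fst measurableSet_Ioc)
  unfold DMeas
  convert h4 using 1
  funext p
  by_cases hp : p.1 ∈ Ioc (0 : ℝ) 1
  · rw [indicator_of_mem hp, indicator_of_mem (by exact hp)]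
    simp only [Pi.mul_apply, indicator_of_mem (mem_Ioi.2 hp.1)]
    rfl
  · rw [indicator_of_notMem hp, indicator_of_notMem (by exact hp)]

theorem DMeas.of_tendsto {Λn : ℕ → Distr d} {Λ : Distr d} (h : ∀ n, DMeas (Λn n))
    (hlim : ∀ t ∈ Ioc (0 : ℝ) 1, ∀ x, Tendsto (fun n => Λn n t x) atTop (𝓝 (Λ t x))) :
    DMeas Λ := by
  refine measurable_of_tendsto_metrizable h (tendsto_pi_nhds.2 fun p => ?_)
  by_cases hp : p.1 ∈ Ioc (0 : ℝ) 1
  · simpa only [indicator_of_mem hp] using hlim p.1 hp p.2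
  · simp only [indicator_of_notMem hp]
    exact tendsto_const_nhds

theorem MemBesov.approx {α : ℝ} {u : Pt d → ℝ} (hu : ∀ x, 0 < u x) {Λ : Distr d}
    (h : MemBesov ℓ Q α u Λ) (n : ℕ) : ∃ f, MemC u f ∧ ∀ t ∈ Ioc (0 : ℝ) 1, ∀ x,
      |Λ t x - ofFun Q f t x| ≤ (1 / ((n : ℝ) + 1)) * (t ^ (α / ℓ) * (u x)⁻¹) := by
  obtain ⟨f, hf, hle⟩ := h (1 / ((n : ℝ) + 1)) (by positivity)
  refine ⟨f, hf, fun t ht x => ?_⟩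
  have h1 : ENNReal.ofReal (t ^ (-α / ℓ) * (|(Λ - ofFun Q f) t x| * u x)) ≤
      ENNReal.ofReal (1 / ((n : ℝ) + 1)) := by
    refine le_trans ?_ hle
    exact le_iSup_of_le t (le_iSup_of_le ht (le_iSup_of_le x le_rfl))
  rw [ENNReal.ofReal_le_ofReal_iff (by positivity)] at h1
  have ht0 := ht.1
  have e : t ^ (-α / ℓ) = (t ^ (α / ℓ))⁻¹ := by rw [neg_div, Real.rpow_neg ht0.le]
  rw [e, inv_mul_le_iff₀ (by positivity), ← le_div_iff₀ (hu x)] at h1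
  refine h1.trans_eq ?_
  rw [div_eq_mul_inv]
  ring

theorem MemBesov.dMeas (hQ : IsGSemigroup s ℓ G Q) {α : ℝ} {u : Pt d → ℝ} (hu : ∀ x, 0 < u x)
    {Λ : Distr d} (h : MemBesov ℓ Q α u Λ) : DMeas Λ := by
  choose f hf hle using h.approx hu
  refine DMeas.of_tendsto (fun n => measurable_ofFun hQ (hf n).1.measurable) fun t ht x => ?_
  rw [tendsto_iff_dist_tendsto_zero]
  have hlim : Tendsto (fun n : ℕ => (1 / ((n : ℝ) + 1)) * (t ^ (α / ℓ) * (u x)⁻¹)) atTop (𝓝 0) := by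
    simpa using (tendsto_one_div_add_atTop_nhds_zero_nat (𝕜 := ℝ)).mul_const (t ^ (α / ℓ) * (u x)⁻¹)
  refine squeeze_zero (fun _ => dist_nonneg) (fun n => ?_) hlim
  rw [dist_comm, Real.dist_eq]
  exact hle n t ht x

end Measurability

/-! ### The semigroup identity for distributions. -/

section Semigroup

variable {d : ℕ} {s : Fin d → ℝ} {ℓ : ℝ} {G w wst u ust : Pt d → ℝ}
  {Q : ℝ → Pt d → Pt d → ℝ}

/-- The semigroup property of a distribution, evaluated at the point `x`. -/
def SGAt (Q : ℝ → Pt d → Pt d → ℝ) (x : Pt d) (Λ : Distr d) : Prop :=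
  ∀ r t, 0 < r → r < t → t ≤ 1 →
    (Integrable fun z => Q (t - r) x z * Λ r z) ∧ Λ t x = ∫ z, Q (t - r) x z * Λ r z

theorem SGAt.add {x : Pt d} {Λ Λ' : Distr d} (h : SGAt Q x Λ) (h' : SGAt Q x Λ') :
    SGAt Q x (Λ + Λ') := fun r t hr hrt ht => by
  have h1 := h r t hr hrt ht
  have h2 := h' r t hr hrt ht
  have e : (fun z => Q (t - r) x z * (Λ + Λ') r z) =
      fun z => Q (t - r) x z * Λ r z + Q (t - r) x z * Λ' r z := by
    funext z; simp only [Pi.add_apply, mul_add]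
  rw [e]
  refine ⟨h1.1.add h2.1, ?_⟩
  rw [integral_add h1.1 h2.1, ← h1.2, ← h2.2]
  rfl

theorem SGAt.sub {x : Pt d} {Λ Λ' : Distr d} (h : SGAt Q x Λ) (h' : SGAt Q x Λ') :
    SGAt Q x (Λ - Λ') := fun r t hr hrt ht => by
  have h1 := h r t hr hrt ht
  have h2 := h' r t hr hrt ht
  have e : (fun z => Q (t - r) x z * (Λ - Λ') r z) =
      fun z => Q (t - r) x z * Λ r z - Q (t - r) x z * Λ' r z := by
    funext z; simp only [Pi.sub_apply, mul_sub]
  rw [e]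
  refine ⟨h1.1.sub h2.1, ?_⟩
  rw [integral_sub h1.1 h2.1, ← h1.2, ← h2.2]
  rfl

theorem SGAt.zero (x : Pt d) : SGAt Q x (0 : Distr d) := fun r t _ _ _ => by simp

/-- Both sides of the identity pass to the limit: the left one pointwise, the right one because the
error is at most ε_n times a function integrable against the kernel. -/
theorem SGAt.of_approx (hQ : IsGSemigroup s ℓ G Q) {x : Pt d} {Λ : Distr d} {Λn : ℕ → Distr d}
    {ε : ℕ → ℝ} (hε : Tendsto ε atTop (𝓝 0)) {g : ℝ → Pt d → ℝ} (hn : ∀ n, SGAt Q x (Λn n))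
    (hΛ : DMeas Λ) (hΛn : ∀ n, DMeas (Λn n))
    (hle : ∀ r ∈ Ioc (0 : ℝ) 1, ∀ n z, |Λ r z - Λn n r z| ≤ ε n * g r z)
    (hg : ∀ r ∈ Ioc (0 : ℝ) 1, ∀ r' ∈ Ioc (0 : ℝ) 1,
      Integrable fun z => Gt s ℓ G r' (x - z) * g r z) : SGAt Q x Λ := by
  obtain ⟨C₁, hC₁0, hC₁⟩ := hQ.upper
  intro r t hr hrt ht
  have hr1 : r ∈ Ioc (0 : ℝ) 1 := ⟨hr, by linarith⟩
  have hr2 : t - r ∈ Ioc (0 : ℝ) 1 := ⟨by linarith, by linarith⟩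
  have hQm : Measurable (Q (t - r) x) :=
    ((hQ.continuous _ hr2.1).comp (continuous_const.prodMk continuous_id)).measurable
  have hdle : ∀ n z, ‖Q (t - r) x z * (Λ r z - Λn n r z)‖ ≤
      (C₁ * ε n) * (Gt s ℓ G (t - r) (x - z) * g r z) := fun n z => by
    rw [Real.norm_eq_abs, abs_mul]
    refine (mul_le_mul (hC₁ _ hr2.1 x z) (hle r hr1 n z) (abs_nonneg _)
      ((abs_nonneg _).trans (hC₁ _ hr2.1 x z))).trans_eq ?_
    ring
  have hd : ∀ n, Integrable fun z => Q (t - r) x z * (Λ r z - Λn n r z) := fun n =>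
    ((hg r hr1 _ hr2).const_mul (C₁ * ε n)).mono'
      (hQm.mul ((hΛ.measurable hr1).sub ((hΛn n).measurable hr1))).aestronglyMeasurable
      (Eventually.of_forall (hdle n))
  have hi : Integrable fun z => Q (t - r) x z * Λ r z := by
    refine ((hd 0).add (hn 0 r t hr hrt ht).1).congr (Eventually.of_forall fun z => ?_)
    simp only [Pi.add_apply]; ring
  refine ⟨hi, ?_⟩
  have l1 : Tendsto (fun n => Λn n t x) atTop (𝓝 (Λ t x)) := by
    rw [tendsto_iff_dist_tendsto_zero]
    have hlim : Tendsto (fun n => ε n * g t x) atTop (𝓝 0) := by simpa using hε.mul_const (g t x)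
    refine squeeze_zero (fun _ => dist_nonneg) (fun n => ?_) hlim
    rw [dist_comm, Real.dist_eq]
    exact hle t ⟨by linarith, ht⟩ n x
  have l2 : Tendsto (fun n => Λn n t x) atTop (𝓝 (∫ z, Q (t - r) x z * Λ r z)) := by
    rw [tendsto_iff_dist_tendsto_zero]
    have hlim : Tendsto (fun n => (C₁ * ε n) * ∫ z, Gt s ℓ G (t - r) (x - z) * g r z) atTop
        (𝓝 0) := by
      simpa using (hε.const_mul C₁).mul_const (∫ z, Gt s ℓ G (t - r) (x - z) * g r z)
    refine squeeze_zero (fun _ => dist_nonneg) (fun n => ?_) hlim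
    rw [dist_comm, Real.dist_eq, (hn n r t hr hrt ht).2, ← integral_sub hi (hn n r t hr hrt ht).1]
    simp only [← mul_sub]
    refine (norm_integral_le_of_norm_le ((hg r hr1 _ hr2).const_mul _)
      (Eventually.of_forall (hdle n))).trans_eq ?_
    rw [integral_const_mul]
  exact tendsto_nhds_unique l1 l2

variable [NeZero d]

theorem IsControlled.integrable_Gt (hw : IsControlled s ℓ G w wst) (hs : ∀ i, 1 ≤ s i)
    (hℓ : 0 < ℓ) (hGm : Measurable G) (hG0 : ∀ x, 0 ≤ G x) {r : ℝ} (hr : r ∈ Ioc (0 : ℝ) 1)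
    (x : Pt d) : Integrable fun z => Gt s ℓ G r (x - z) * wst (x - z) := by
  obtain ⟨C, -, hC⟩ := hw.integral_tw hs hℓ hGm hG0 le_rfl le_rfl
    (zero_lt_one.trans_le (hs 0))
  simpa using (hC r hr x).1

theorem integrable_mul_of_memC (hw : IsControlled s ℓ G w wst) (hs : ∀ i, 1 ≤ s i)
    (hℓ : 0 < ℓ) (hGm : Measurable G) (hG0 : ∀ x, 0 ≤ G x) (hQ : IsGSemigroup s ℓ G Q)
    {f : Pt d → ℝ} (hf : Continuous f) {c : ℝ} (hc : ∀ x, |f x| * w x ≤ c) {r : ℝ}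
    (hr : r ∈ Ioc (0 : ℝ) 1) (x : Pt d) : Integrable fun y => Q r x y * f y := by
  obtain ⟨C₁, hC₁0, hC₁⟩ := hQ.upper
  have hc0 : 0 ≤ c := (mul_nonneg (abs_nonneg _) (hw.pos x).le).trans (hc x)
  refine ((hw.integrable_Gt hs hℓ hGm hG0 hr x).const_mul (C₁ * c * (w x)⁻¹)).mono'
    (((hQ.continuous r hr.1).comp (continuous_const.prodMk continuous_id)).mul
      hf).aestronglyMeasurable (Eventually.of_forall fun y => ?_)
  have h1 : |f y| ≤ c * (wst (x - y) * (w x)⁻¹) := by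
    have := hc y
    rw [← le_div_iff₀ (hw.pos y), div_eq_mul_inv] at this
    exact this.trans (mul_le_mul_of_nonneg_left (hw.inv_le x y) hc0)
  rw [Real.norm_eq_abs, abs_mul]
  refine (mul_le_mul (hC₁ r hr.1 x y) h1 (abs_nonneg _)
    (mul_nonneg hC₁0.le (Gt_nonneg hG0 hr.1 _))).trans_eq ?_
  ring

/-- This is Fubini's theorem. Applying moderateness twice bounds f(y) by w*(z−y) w*(x−z)/w(x), so
that the double integrand is dominated by the integrand of a convolution of two integrable
functions. -/
theorem ofFun_semigroup (hw : IsControlled s ℓ G w wst) (hs : ∀ i, 1 ≤ s i)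
    (hℓ : 0 < ℓ) (hGm : Measurable G) (hG0 : ∀ x, 0 ≤ G x) (hQ : IsGSemigroup s ℓ G Q)
    {f : Pt d → ℝ} (hf : Continuous f) {c : ℝ} (hc : ∀ x, |f x| * w x ≤ c) {r t : ℝ}
    (hr : 0 < r) (hrt : r < t) (ht : t ≤ 1) (x : Pt d) :
    ofFun Q f t x = ∫ z, Q (t - r) x z * ofFun Q f r z := by
  obtain ⟨C₁, hC₁0, hC₁⟩ := hQ.upper
  have hr1 : r ∈ Ioc (0 : ℝ) 1 := ⟨hr, by linarith⟩
  have hr2 : t - r ∈ Ioc (0 : ℝ) 1 := ⟨by linarith, by linarith⟩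
  have hc0 : 0 ≤ c := (mul_nonneg (abs_nonneg _) (hw.pos x).le).trans (hc x)
  have i1 := hw.integrable_Gt hs hℓ hGm hG0 hr2 x
  have i2 : Integrable fun v => Gt s ℓ G r (-v) * wst (-v) := by
    simpa using hw.integrable_Gt hs hℓ hGm hG0 hr1 0
  -- The convolution evaluates its second factor at y − z, which is why that factor was reflected.
  have i3 := (i1.convolution_integrand (ContinuousLinearMap.mul ℝ ℝ) i2).swap
  have i4 : Integrable (fun p : Pt d × Pt d => Q (t - r) x p.1 * (Q r p.1 p.2 * f p.2))
      (volume.prod volume) := by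
    refine (i3.const_mul (C₁ * (C₁ * (c * (w x)⁻¹)))).mono' ?_ (Eventually.of_forall fun p => ?_)
    · exact ((((hQ.continuous _ hr2.1).comp (continuous_const.prodMk continuous_fst))).mul
        ((hQ.continuous r hr).mul (hf.comp continuous_snd))).aestronglyMeasurable
    · have hG1 := Gt_nonneg (s := s) (ℓ := ℓ) hG0 hr2.1 (x - p.1)
      have hG2 := Gt_nonneg (s := s) (ℓ := ℓ) hG0 hr (p.1 - p.2)
      have hw1 : 0 ≤ wst (p.1 - p.2) := zero_le_one.trans (hw.one_le_st _)
      have h1 : |f p.2| ≤ c * (wst (p.1 - p.2) * (wst (x - p.1) * (w x)⁻¹)) := by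
        have := hc p.2
        rw [← le_div_iff₀ (hw.pos p.2), div_eq_mul_inv] at this
        refine this.trans (mul_le_mul_of_nonneg_left ((hw.inv_le p.1 p.2).trans ?_) hc0)
        exact mul_le_mul_of_nonneg_left (hw.inv_le x p.1) hw1
      rw [Real.norm_eq_abs, abs_mul, abs_mul]
      refine (mul_le_mul (hC₁ _ hr2.1 x p.1) (mul_le_mul (hC₁ r hr p.1 p.2) h1 (abs_nonneg _)
        (mul_nonneg hC₁0.le hG2)) (by positivity) (mul_nonneg hC₁0.le hG1)).trans_eq ?_
      simp only [Function.comp_apply, Prod.fst_swap, Prod.snd_swap, ContinuousLinearMap.mul_apply',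
        neg_sub]
      ring
  unfold ofFun
  calc ∫ y, Q t x y * f y = ∫ y, ∫ z, Q (t - r) x z * (Q r z y * f y) := by
        refine integral_congr_ae (Eventually.of_forall fun y => ?_)
        simp only [← hQ.semigroup r t hr hrt x y, ← mul_assoc, integral_mul_const]
    _ = ∫ z, ∫ y, Q (t - r) x z * (Q r z y * f y) := (integral_integral_swap i4).symm
    _ = _ := by simp only [integral_const_mul]

theorem SGAt.ofFun (hw : IsControlled s ℓ G w wst) (hs : ∀ i, 1 ≤ s i)
    (hℓ : 0 < ℓ) (hGm : Measurable G) (hG0 : ∀ x, 0 ≤ G x) (hQ : IsGSemigroup s ℓ G Q)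
    {f : Pt d → ℝ} (hf : Continuous f) {c : ℝ} (hc : ∀ x, |f x| * w x ≤ c) (x : Pt d) :
    SGAt Q x (ofFun Q f) := fun r t hr hrt ht => by
  refine ⟨?_, ofFun_semigroup hw hs hℓ hGm hG0 hQ hf hc hr hrt ht x⟩
  obtain ⟨C₁, hC₁0, hC₁⟩ := hQ.upper
  have hr1 : r ∈ Ioc (0 : ℝ) 1 := ⟨hr, by linarith⟩
  have hr2 : t - r ∈ Ioc (0 : ℝ) 1 := ⟨by linarith, by linarith⟩
  have hc0 : 0 ≤ c := (mul_nonneg (abs_nonneg _) (hw.pos x).le).trans (hc x)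
  set J := ∫ v, Gt s ℓ G r (0 - v) * wst (0 - v) with hJ
  -- By translation invariance the weighted mass J of G_r is the same at every z, so Q_r f grows no
  -- faster than the weight.
  have hbd : ∀ z, |_root_.ofFun Q f r z| ≤ C₁ * c * J * (wst (x - z) * (w x)⁻¹) := fun z => by
    have i2 := hw.integrable_Gt hs hℓ hGm hG0 hr1 z
    have hJz : ∫ y, Gt s ℓ G r (z - y) * wst (z - y) = J := by
      rw [hJ, integral_sub_left_eq_self (fun v => Gt s ℓ G r v * wst v),
        integral_sub_left_eq_self (fun v => Gt s ℓ G r v * wst v)]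
    have hJ0 : 0 ≤ J := integral_nonneg fun v =>
      mul_nonneg (Gt_nonneg hG0 hr _) (zero_le_one.trans (hw.one_le_st _))
    have h1 : |_root_.ofFun Q f r z| ≤ ∫ y, (C₁ * c * (w z)⁻¹) *
        (Gt s ℓ G r (z - y) * wst (z - y)) := by
      refine norm_integral_le_of_norm_le (f := fun y => Q r z y * f y) (i2.const_mul _)
        (Eventually.of_forall fun y => ?_)
      have h1 : |f y| ≤ c * (wst (z - y) * (w z)⁻¹) := by
        have := hc y
        rw [← le_div_iff₀ (hw.pos y), div_eq_mul_inv] at this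
        exact this.trans (mul_le_mul_of_nonneg_left (hw.inv_le z y) hc0)
      rw [Real.norm_eq_abs, abs_mul]
      refine (mul_le_mul (hC₁ r hr z y) h1 (abs_nonneg _)
        (mul_nonneg hC₁0.le (Gt_nonneg hG0 hr _))).trans_eq ?_
      ring
    rw [integral_const_mul, hJz] at h1
    calc _ ≤ C₁ * c * J * (w z)⁻¹ := h1.trans_eq (by ring)
      _ ≤ _ := mul_le_mul_of_nonneg_left (hw.inv_le x z) (by positivity)
  have i1 := hw.integrable_Gt hs hℓ hGm hG0 hr2 x
  refine (i1.const_mul (C₁ * (C₁ * c * J * (w x)⁻¹))).mono' ?_ (Eventually.of_forall fun z => ?_)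
  · exact (((hQ.continuous _ hr2.1).comp (continuous_const.prodMk continuous_id)).measurable.mul
      ((measurable_ofFun hQ hf.measurable).measurable hr1)).aestronglyMeasurable
  · rw [Real.norm_eq_abs, abs_mul]
    refine (mul_le_mul (hC₁ _ hr2.1 x z) (hbd z) (abs_nonneg _)
      (mul_nonneg hC₁0.le (Gt_nonneg hG0 hr2.1 _))).trans_eq ?_
    ring

theorem MemBesov.sgAt (hu : IsControlled s ℓ G u ust) (hs : ∀ i, 1 ≤ s i)
    (hℓ : 0 < ℓ) (hGm : Measurable G) (hG0 : ∀ x, 0 ≤ G x) (hQ : IsGSemigroup s ℓ G Q)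
    {α : ℝ} {Λ : Distr d} (h : MemBesov ℓ Q α u Λ) (x : Pt d) : SGAt Q x Λ := by
  choose f hf hle using h.approx hu.pos
  refine SGAt.of_approx hQ (tendsto_one_div_add_atTop_nhds_zero_nat (𝕜 := ℝ))
    (g := fun r z => r ^ (α / ℓ) * (u x)⁻¹ * ust (x - z))
    (fun n => (hf n).2.elim fun c hc => SGAt.ofFun hu hs hℓ hGm hG0 hQ (hf n).1 hc x)
    (h.dMeas hQ hu.pos) (fun n => measurable_ofFun hQ (hf n).1.measurable)
    (fun r hr n z => (hle n r hr z).trans ?_) fun r hr r' hr' => ?_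
  · have := hr.1
    refine mul_le_mul_of_nonneg_left ?_ (by positivity)
    refine (mul_le_mul_of_nonneg_left (hu.inv_le x z) (by positivity)).trans_eq ?_
    ring
  · refine ((hu.integrable_Gt hs hℓ hGm hG0 hr' x).const_mul (r ^ (α / ℓ) * (u x)⁻¹)).congr
      (Eventually.of_forall fun z => ?_)
    simp only
    ring

end Semigroup

/-! ### Off-diagonal bounds and smooth approximation of models. -/

section Models

variable {d : ℕ} {A : Set ℝ} {T : RegStruct.{u} A} {s : Fin d → ℝ} {ℓ : ℝ}
  {G w wst v vst : Pt d → ℝ} {Q : ℝ → Pt d → Pt d → ℝ}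

theorem RegStruct.eq_zero_of_notMem {α : ℝ} (h : α ∉ A) (τ : T.V α) : τ = 0 :=
  @Subsingleton.elim _ (T.trivial_off α h) τ 0

theorem RegStruct.eq_sum_single (τ : T.Tot) {F : Finset ℝ} (h : ∀ α, α ∉ F → τ α = 0) :
    τ = ∑ α ∈ F, DFinsupp.single α (τ α) := by
  classical
  refine DFinsupp.ext fun β => ?_
  rw [DFinsupp.finsetSum_apply]
  by_cases hβ : β ∈ F
  · rw [Finset.sum_eq_single_of_mem β hβ fun α _ hne => DFinsupp.single_eq_of_ne (by tauto),
      DFinsupp.single_eq_same]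
  · rw [h β hβ]
    refine (Finset.sum_eq_zero fun α hα => DFinsupp.single_eq_of_ne ?_).symm
    rintro rfl
    exact hβ hα

theorem RegStruct.exists_finset (T : RegStruct.{u} A) (γ : ℝ) :
    ∃ 𝔸 : Finset ℝ, ∀ α, α ∈ 𝔸 ↔ α ∈ A ∧ α < γ := by
  obtain ⟨a, ha⟩ := T.bddBelow
  have hf : (A ∩ Iio γ).Finite := (T.locFinite a γ).subset fun α hα =>
    ⟨hα.1, ha hα.1, (le_of_lt hα.2)⟩
  exact ⟨hf.toFinset, fun α => by simp⟩

/-- The algebraic relations between `Π` and `Γ` used in pointwise estimates. -/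
structure ModelLike (M : ModelData d T) : Prop where
  lower : ∀ x y α (τ : T.V α) β, ¬ β < α →
    (M.Gam x y (DFinsupp.single α τ) - DFinsupp.single α τ) β = 0
  pi_gam : ∀ x y τ, ∀ t ∈ Ioc (0 : ℝ) 1, ∀ z, M.Pi x (M.Gam x y τ) t z = M.Pi y τ t z

theorem IsModel.modelLike {M : ModelData d T} (h : IsModel s ℓ Q w wst M) : ModelLike M :=
  ⟨h.lower, h.pi_gam⟩

/-- Real bounds for two models and their difference. -/
structure ModelPair (s : Fin d → ℝ) (ℓ : ℝ) (w wst : Pt d → ℝ) (γ : ℝ) (M₁ M₂ : ModelData d T)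
    (P₂ dP G₁ G₂ dG : ℝ) : Prop where
  pi₂ : ∀ α < γ, ∀ r ∈ Ioc (0 : ℝ) 1, ∀ x (τ : T.V α),
    |M₂.Pi x (DFinsupp.single α τ) r x| ≤ P₂ * (r ^ (α / ℓ) * ‖τ‖ * (w x)⁻¹)
  dpi : ∀ α < γ, ∀ r ∈ Ioc (0 : ℝ) 1, ∀ x (τ : T.V α),
    |M₁.Pi x (DFinsupp.single α τ) r x - M₂.Pi x (DFinsupp.single α τ) r x| ≤
      dP * (r ^ (α / ℓ) * ‖τ‖ * (w x)⁻¹)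
  gam₁ : ∀ α < γ, ∀ β < α, ∀ x y, x ≠ y → ∀ τ : T.V α,
    ‖(M₁.Gam y x (DFinsupp.single α τ)) β‖ ≤
      G₁ * (wst (y - x) * sNorm s (y - x) ^ (α - β) * ‖τ‖ * (w x)⁻¹)
  gam₂ : ∀ α < γ, ∀ β < α, ∀ x y, x ≠ y → ∀ τ : T.V α,
    ‖(M₂.Gam y x (DFinsupp.single α τ)) β‖ ≤
      G₂ * (wst (y - x) * sNorm s (y - x) ^ (α - β) * ‖τ‖ * (w x)⁻¹)
  dgam : ∀ α < γ, ∀ β < α, ∀ x y, x ≠ y → ∀ τ : T.V α,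
    ‖(M₁.Gam y x (DFinsupp.single α τ) - M₂.Gam y x (DFinsupp.single α τ)) β‖ ≤
      dG * (wst (y - x) * sNorm s (y - x) ^ (α - β) * ‖τ‖ * (w x)⁻¹)

theorem ModelLike.gam_same {M : ModelData d T} (h : ModelLike M) (x y : Pt d) {α : ℝ}
    (τ : T.V α) : (M.Gam x y (DFinsupp.single α τ)) α = τ := by
  have := h.lower x y α τ α (lt_irrefl _)
  rw [DFinsupp.sub_apply, DFinsupp.single_eq_same, sub_eq_zero] at this
  exact this

theorem ModelLike.gam_above {M : ModelData d T} (h : ModelLike M) (x y : Pt d) {α β : ℝ}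
    (τ : T.V α) (hβ : α < β) : (M.Gam x y (DFinsupp.single α τ)) β = 0 := by
  have := h.lower x y α τ β (not_lt.2 hβ.le)
  rw [DFinsupp.sub_apply, DFinsupp.single_eq_of_ne hβ.ne', sub_zero] at this
  exact this

/-- The model norms control Π_z only when tested at z. Recentring Π_x τ at the evaluation point
through Γ_{zx} reduces every off-diagonal bound to that case, with finitely many lower
homogeneities. -/
theorem ModelLike.pi_expand {M : ModelData d T} (h : ModelLike M) {𝔸 : Finset ℝ} {γ : ℝ}
    (h𝔸 : ∀ α, α ∈ 𝔸 ↔ α ∈ A ∧ α < γ) {α : ℝ} (hα : α < γ) (τ : T.V α) (x z : Pt d) {r : ℝ}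
    (hr : r ∈ Ioc (0 : ℝ) 1) (y : Pt d) :
    M.Pi x (DFinsupp.single α τ) r y = ∑ α' ∈ 𝔸 with α' ≤ α,
      M.Pi z (DFinsupp.single α' ((M.Gam z x (DFinsupp.single α τ)) α')) r y := by
  rw [← h.pi_gam z x _ r hr y]
  conv_lhs => rw [RegStruct.eq_sum_single (F := 𝔸.filter fun α' => α' ≤ α)
    (M.Gam z x (DFinsupp.single α τ)) (fun α' hα' => by
      by_cases h1 : α' ∈ A
      · refine h.gam_above z x τ ?_
        by_contra hle
        exact hα' (Finset.mem_filter.2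
          ⟨(h𝔸 α').2 ⟨h1, (not_lt.1 hle).trans_lt hα⟩, not_lt.1 hle⟩)
      · exact RegStruct.eq_zero_of_notMem h1 _), map_sum]
  rw [Finset.sum_apply, Finset.sum_apply]

/-- Off-diagonal bound for the difference of two models. -/
theorem ModelPair.pi_sub_le {γ : ℝ} {M₁ M₂ : ModelData d T} {P₂ dP G₁ G₂ dG : ℝ}
    (h : ModelPair s ℓ w wst γ M₁ M₂ P₂ dP G₁ G₂ dG) (h₁ : ModelLike M₁) (h₂ : ModelLike M₂)
    (hs : ∀ i, 1 ≤ s i) (hw : IsControlled s ℓ G w wst) (hsym : ∀ x, wst (-x) = wst x)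
    (hP : 0 ≤ P₂) (hdP : 0 ≤ dP) (hG₁ : 0 ≤ G₁) (hG₂ : 0 ≤ G₂) (hdG : 0 ≤ dG)
    {𝔸 : Finset ℝ} (h𝔸 : ∀ α, α ∈ 𝔸 ↔ α ∈ A ∧ α < γ) {α : ℝ} (hα : α ∈ 𝔸) (τ₁ τ₂ : T.V α)
    (x : Pt d) {r : ℝ} (hr : r ∈ Ioc (0 : ℝ) 1) (z : Pt d) :
    |M₁.Pi x (DFinsupp.single α τ₁) r z - M₂.Pi x (DFinsupp.single α τ₂) r z| ≤
      (dP * (1 + G₁) * ‖τ₁‖ + P₂ * dG * ‖τ₁‖ + P₂ * (1 + G₂) * ‖τ₁ - τ₂‖) *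
        (wst (x - z) ^ 2 * (w x)⁻¹ ^ 2) * hSum 𝔸 ℓ α r (sNorm s (x - z)) := by
  have hαγ := ((h𝔸 α).1 hα).2
  have hr0 := hr.1
  -- The diagonal difference splits into a change of model at fixed σ₁ and a change of argument for
  -- the second model.
  have hsub : ∀ {α' : ℝ} (_ : α' < γ) (z : Pt d) (σ₁ σ₂ : T.V α'),
      |M₁.Pi z (DFinsupp.single α' σ₁) r z - M₂.Pi z (DFinsupp.single α' σ₂) r z| ≤
        (dP * ‖σ₁‖ + P₂ * ‖σ₁ - σ₂‖) * (r ^ (α' / ℓ) * (w z)⁻¹) := by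
    intro α' hα' z σ₁ σ₂
    have e : M₁.Pi z (DFinsupp.single α' σ₁) r z - M₂.Pi z (DFinsupp.single α' σ₂) r z =
        (M₁.Pi z (DFinsupp.single α' σ₁) r z - M₂.Pi z (DFinsupp.single α' σ₁) r z) +
          M₂.Pi z (DFinsupp.single α' (σ₁ - σ₂)) r z := by
      rw [DFinsupp.single_sub, map_sub]
      simp only [Pi.sub_apply]
      ring
    rw [e]
    refine (abs_add_le _ _).trans ((add_le_add (h.dpi α' hα' r hr z σ₁)
      (h.pi₂ α' hα' r hr z (σ₁ - σ₂))).trans_eq ?_)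
    ring
  set K := dP * (1 + G₁) * ‖τ₁‖ + P₂ * dG * ‖τ₁‖ + P₂ * (1 + G₂) * ‖τ₁ - τ₂‖ with hK
  have hwx := inv_pos.2 (hw.pos x)
  have hw1 : 1 ≤ (w x)⁻¹ := (one_le_inv₀ (hw.pos x)).2 (hw.le_one x)
  have hu : 1 ≤ wst (x - z) := hw.one_le_st _
  have hwz : (w z)⁻¹ ≤ wst (x - z) * (w x)⁻¹ := hw.inv_le x z
  have hn0 : 0 ≤ sNorm s (x - z) := sNorm_nonneg _
  have hK0 : 0 ≤ K := by positivity
  have hbase : dP * ‖τ₁‖ + P₂ * ‖τ₁ - τ₂‖ ≤ K := by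
    have t1 : 0 ≤ dP * G₁ * ‖τ₁‖ := by positivity
    have t2 : 0 ≤ P₂ * dG * ‖τ₁‖ := by positivity
    have t3 : 0 ≤ P₂ * G₂ * ‖τ₁ - τ₂‖ := by positivity
    rw [hK]; linarith
  rcases eq_or_ne x z with rfl | hxz
  · rw [sub_self, sNorm_zero hs, hSum_zero hα]
    have hu0 : 1 ≤ wst 0 := hw.one_le_st _
    refine (hsub hαγ x τ₁ τ₂).trans ?_
    calc _ ≤ K * (r ^ (α / ℓ) * (w x)⁻¹) := by gcongr
      _ = K * (1 * (w x)⁻¹) * r ^ (α / ℓ) := by ring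
      _ ≤ _ := by
        gcongr
        · exact one_le_pow₀ hu0
        · exact le_self_pow₀ hw1 two_ne_zero
  rw [h₁.pi_expand h𝔸 hαγ τ₁ x z hr z, h₂.pi_expand h𝔸 hαγ τ₂ x z hr z, ← Finset.sum_sub_distrib]
  unfold hSum
  rw [Finset.mul_sum]
  refine (Finset.abs_sum_le_sum_abs _ _).trans (Finset.sum_le_sum fun α' hα' => ?_)
  obtain ⟨hα'1, hα'2⟩ := Finset.mem_filter.1 hα'
  refine (hsub ((h𝔸 α').1 hα'1).2 z _ _).trans ?_
  set n := sNorm s (x - z) with hn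
  have hfin : (dP * ‖(M₁.Gam z x (DFinsupp.single α τ₁)) α'‖ +
      P₂ * ‖(M₁.Gam z x (DFinsupp.single α τ₁)) α' - (M₂.Gam z x (DFinsupp.single α τ₂)) α'‖) ≤
      K * (wst (x - z) * (w x)⁻¹ * n ^ (α - α')) := by
    rcases hα'2.lt_or_eq with hlt | rfl
    -- Symmetry of w* reconciles the argument in the norm of Γ with the one in the moderateness
    -- bound. The transport by Γ costs one factor w*/w(x) and the diagonal bound at z another, which
    -- gives the squares in the conclusion.
    · have e1 : wst (z - x) = wst (x - z) := by rw [← hsym, neg_sub]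
      have b1 := h.gam₁ α hαγ α' hlt x z hxz τ₁
      have b2 : ‖(M₁.Gam z x (DFinsupp.single α τ₁)) α' -
          (M₂.Gam z x (DFinsupp.single α τ₂)) α'‖ ≤
          (dG * ‖τ₁‖ + G₂ * ‖τ₁ - τ₂‖) * (wst (x - z) * (w x)⁻¹ * n ^ (α - α')) := by
        have c1 := h.dgam α hαγ α' hlt x z hxz τ₁
        have c2 := h.gam₂ α hαγ α' hlt x z hxz (τ₁ - τ₂)
        have e : (M₁.Gam z x (DFinsupp.single α τ₁)) α' -
            (M₂.Gam z x (DFinsupp.single α τ₂)) α' =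
            (M₁.Gam z x (DFinsupp.single α τ₁) - M₂.Gam z x (DFinsupp.single α τ₁)) α' +
            (M₂.Gam z x (DFinsupp.single α (τ₁ - τ₂))) α' := by
          rw [DFinsupp.single_sub, map_sub, DFinsupp.sub_apply, DFinsupp.sub_apply]
          abel
        rw [e]
        refine (norm_add_le _ _).trans ((add_le_add c1 c2).trans_eq ?_)
        rw [e1, sNorm_sub_comm z x]
        ring
      rw [e1, sNorm_sub_comm z x] at b1
      have hE : 0 ≤ wst (x - z) * (w x)⁻¹ * n ^ (α - α') := by positivity
      calc _ ≤ dP * (G₁ * (wst (x - z) * n ^ (α - α') * ‖τ₁‖ * (w x)⁻¹)) +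
            P₂ * ((dG * ‖τ₁‖ + G₂ * ‖τ₁ - τ₂‖) * (wst (x - z) * (w x)⁻¹ * n ^ (α - α'))) := by
            gcongr
        _ = (dP * G₁ * ‖τ₁‖ + P₂ * dG * ‖τ₁‖ + P₂ * G₂ * ‖τ₁ - τ₂‖) *
            (wst (x - z) * (w x)⁻¹ * n ^ (α - α')) := by ring
        _ ≤ _ := by
            refine mul_le_mul_of_nonneg_right ?_ hE
            have t1 : 0 ≤ dP * ‖τ₁‖ := by positivity
            have t2 : 0 ≤ P₂ * ‖τ₁ - τ₂‖ := by positivity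
            rw [hK]; linarith
    · rw [h₁.gam_same, h₂.gam_same, sub_self, Real.rpow_zero, mul_one]
      refine hbase.trans (le_mul_of_one_le_right hK0 ?_)
      exact one_le_mul_of_one_le_of_one_le hu hw1
  calc _ ≤ (K * (wst (x - z) * (w x)⁻¹ * n ^ (α - α'))) *
        (r ^ (α' / ℓ) * (wst (x - z) * (w x)⁻¹)) := by
        refine mul_le_mul hfin (mul_le_mul_of_nonneg_left hwz (by positivity)) ?_ (by positivity)
        exact mul_nonneg (by positivity) (inv_pos.2 (hw.pos z)).le
    _ = _ := by ring

theorem piNorm_le {γ : ℝ} {P : Pt d → T.Tot → Distr d} {N : ℝ} (hw : ∀ x, 0 < w x) (hN : 0 ≤ N)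
    (h0 : ∀ x, P x 0 = 0) (h : piNorm ℓ w γ P ≤ ENNReal.ofReal N) {α : ℝ} (hα : α < γ) {r : ℝ}
    (hr : r ∈ Ioc (0 : ℝ) 1) (x : Pt d) (τ : T.V α) :
    |P x (DFinsupp.single α τ) r x| ≤ N * (r ^ (α / ℓ) * ‖τ‖ * (w x)⁻¹) := by
  -- For τ = 0 the quotient in the supremum is a division by zero and carries no information.
  rcases eq_or_ne τ 0 with rfl | hτ
  · simp [h0]
  have h1 : ENNReal.ofReal (r ^ (-α / ℓ) * w x * |P x (DFinsupp.single α τ) r x| / ‖τ‖) ≤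
      ENNReal.ofReal N := by
    refine le_trans ?_ h
    exact le_iSup_of_le α (le_iSup_of_le hα (le_iSup_of_le r (le_iSup_of_le hr
      (le_iSup_of_le x (le_iSup_of_le τ le_rfl)))))
  rw [ENNReal.ofReal_le_ofReal_iff hN] at h1
  have hτ' : 0 < ‖τ‖ := norm_pos_iff.2 hτ
  have hr0 := hr.1
  have e : r ^ (-α / ℓ) = (r ^ (α / ℓ))⁻¹ := by rw [neg_div, Real.rpow_neg hr0.le]
  have hrp : 0 < r ^ (α / ℓ) := Real.rpow_pos_of_pos hr0 _
  rw [e, div_le_iff₀ hτ', mul_assoc, inv_mul_le_iff₀ hrp, mul_comm (w x), ← le_div_iff₀ (hw x)]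
    at h1
  refine h1.trans_eq ?_
  rw [div_eq_mul_inv]
  ring

theorem gamNorm_le {γ : ℝ} {Γ : Pt d → Pt d → T.Tot → T.Tot} {N : ℝ}
    (hw : IsControlled s ℓ G w wst) (hN : 0 ≤ N) (h0 : ∀ x y, Γ x y 0 = 0)
    (h : gamNorm s w wst γ Γ ≤ ENNReal.ofReal N) {α β : ℝ} (hα : α < γ) (hβ : β < α)
    {x y : Pt d} (hxy : x ≠ y) (τ : T.V α) :
    ‖(Γ y x (DFinsupp.single α τ)) β‖ ≤
      N * (wst (y - x) * sNorm s (y - x) ^ (α - β) * ‖τ‖ * (w x)⁻¹) := by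
  rcases eq_or_ne τ 0 with rfl | hτ
  · simp [h0]
  have h1 : ENNReal.ofReal (w x * ‖(Γ y x (DFinsupp.single α τ)) β‖ /
      (wst (y - x) * sNorm s (y - x) ^ (α - β) * ‖τ‖)) ≤ ENNReal.ofReal N := by
    refine le_trans ?_ h
    exact le_iSup_of_le α (le_iSup_of_le β (le_iSup_of_le ⟨hβ, hα⟩ (le_iSup_of_le x
      (le_iSup_of_le y (le_iSup_of_le hxy (le_iSup_of_le τ le_rfl))))))
  rw [ENNReal.ofReal_le_ofReal_iff hN] at h1
  have hτ' : 0 < ‖τ‖ := norm_pos_iff.2 hτ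
  have hu : 0 < wst (y - x) := zero_lt_one.trans_le (hw.one_le_st _)
  have hn : 0 < sNorm s (y - x) := sNorm_pos (sub_ne_zero.2 hxy.symm)
  rw [div_le_iff₀ (by positivity), mul_comm (w x), ← le_div_iff₀ (hw.pos x)] at h1
  refine h1.trans_eq ?_
  rw [div_eq_mul_inv]
  ring

theorem ModelPair.of_norms {γ : ℝ} {M₁ M₂ : ModelData d T} {P₂ dP G₁ G₂ dG : ℝ}
    (hw : IsControlled s ℓ G w wst)
    (hP : 0 ≤ P₂) (hdP : 0 ≤ dP) (hG₁ : 0 ≤ G₁) (hG₂ : 0 ≤ G₂) (hdG : 0 ≤ dG)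
    (h1 : M₂.piN ℓ w γ ≤ ENNReal.ofReal P₂)
    (h2 : piNorm ℓ w γ (fun x (τ : T.Tot) => M₁.Pi x τ - M₂.Pi x τ) ≤ ENNReal.ofReal dP)
    (h3 : M₁.gamN s w wst γ ≤ ENNReal.ofReal G₁) (h4 : M₂.gamN s w wst γ ≤ ENNReal.ofReal G₂)
    (h5 : gamNorm s w wst γ (fun x y (τ : T.Tot) => M₁.Gam x y τ - M₂.Gam x y τ) ≤
      ENNReal.ofReal dG) : ModelPair s ℓ w wst γ M₁ M₂ P₂ dP G₁ G₂ dG where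
  pi₂ α hα r hr x τ := piNorm_le hw.pos hP (fun x => map_zero _) h1 hα hr x τ
  dpi α hα r hr x τ := piNorm_le hw.pos hdP (fun x => by simp) h2 hα hr x τ
  gam₁ α hα β hβ x y hxy τ := gamNorm_le hw hG₁ (fun x y => map_zero _) h3 hα hβ hxy τ
  gam₂ α hα β hβ x y hxy τ := gamNorm_le hw hG₂ (fun x y => map_zero _) h4 hα hβ hxy τ
  dgam α hα β hβ x y hxy τ := gamNorm_le hw hdG (fun x y => by simp) h5 hα hβ hxy τ

theorem ModelPair.self {γ : ℝ} {M : ModelData d T} {P G' : ℝ} (hw : IsControlled s ℓ G w wst)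
    (hP : 0 ≤ P) (hG' : 0 ≤ G') (h1 : M.piN ℓ w γ ≤ ENNReal.ofReal P)
    (h3 : M.gamN s w wst γ ≤ ENNReal.ofReal G') : ModelPair s ℓ w wst γ M M P 0 G' G' 0 where
  pi₂ α hα r hr x τ := piNorm_le hw.pos hP (fun x => map_zero _) h1 hα hr x τ
  dpi α hα r hr x τ := by simp
  gam₁ α hα β hβ x y hxy τ := gamNorm_le hw hG' (fun x y => map_zero _) h3 hα hβ hxy τ
  gam₂ α hα β hβ x y hxy τ := gamNorm_le hw hG' (fun x y => map_zero _) h3 hα hβ hxy τ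
  dgam α hα β hβ x y hxy τ := by simp

theorem IsSmoothModel.exists_bound {P : Pt d → T.Tot →ₗ[ℝ] (Pt d → ℝ)}
    {Γ : Pt d → Pt d → (T.Tot ≃ₗ[ℝ] T.Tot)} (h : IsSmoothModel s ℓ Q w wst P Γ)
    (hw : ∀ x, 0 < w x) (x : Pt d) (τ : T.Tot) : ∃ c : ℝ, ∀ y, |P x τ y| * w y ≤ c := by
  induction τ using DFinsupp.induction with
  | h0 => exact ⟨0, fun y => by simp⟩
  | ha α b f _ _ ih =>
    obtain ⟨c, hc⟩ := ih
    obtain ⟨c', hc'⟩ := h.bounded x α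
    refine ⟨c' * ‖b‖ + c, fun y => ?_⟩
    rw [map_add, Pi.add_apply]
    calc _ ≤ (|P x (DFinsupp.single α b) y| + |P x f y|) * w y :=
          mul_le_mul_of_nonneg_right (abs_add_le _ _) (hw y).le
      _ ≤ _ := by rw [add_mul]; exact add_le_add (hc' b y) (hc y)

/-- The data of a smooth model, with `Π_x τ` seen as a distribution. -/
noncomputable def smoothData (Q : ℝ → Pt d → Pt d → ℝ) (P : Pt d → T.Tot →ₗ[ℝ] (Pt d → ℝ))
    (Γ : Pt d → Pt d → (T.Tot ≃ₗ[ℝ] T.Tot))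
    (hint : ∀ x τ, ∀ t ∈ Ioc (0 : ℝ) 1, ∀ y, Integrable fun z => Q t y z * P x τ z) :
    ModelData d T where
  Pi x :=
    -- Additivity in τ uses integrability, which is available only for 0 < t ≤ 1; the value 0
    -- elsewhere keeps the map linear at all times.
    { toFun := fun τ t y => (Ioc (0 : ℝ) 1).indicator (fun t => ofFun Q (P x τ) t y) t
      map_add' := fun τ σ => by
        funext t y
        by_cases ht : t ∈ Ioc (0 : ℝ) 1
        · simp only [Pi.add_apply, indicator_of_mem ht, ofFun, map_add, mul_add]
          exact integral_add (hint x τ t ht y) (hint x σ t ht y)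
        · simp only [Pi.add_apply, indicator_of_notMem ht, add_zero]
      map_smul' := fun c τ => by
        funext t y
        by_cases ht : t ∈ Ioc (0 : ℝ) 1
        · simp only [Pi.smul_apply, indicator_of_mem ht, ofFun, map_smul, smul_eq_mul,
            RingHom.id_apply, ← integral_const_mul]
          exact integral_congr_ae (Eventually.of_forall fun z => by ring)
        · simp only [Pi.smul_apply, indicator_of_notMem ht, smul_zero] }
  Gam x y := (Γ x y).toLinearMap

variable [NeZero d]

/-- Approximants at distance at most 1 inherit the bounds of M increased by 1. Uniformity in ε is
what lets `ModelPair.pi_sub_le` turn convergence on the diagonal into convergence off it. -/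
theorem IsModel.exists_approx {M : ModelData d T} (hM : IsModel s ℓ Q w wst M)
    (hs : ∀ i, 1 ≤ s i) (hℓ : 0 < ℓ) (hGm : Measurable G) (hG0 : ∀ x, 0 ≤ G x)
    (hQ : IsGSemigroup s ℓ G Q) (hw : IsControlled s ℓ G w wst) (γ : ℝ) :
    ∃ P G' : ℝ, 0 ≤ P ∧ 0 ≤ G' ∧ ∀ ε : ℝ, 0 < ε → ε ≤ 1 → ∃ M' : ModelData d T, ModelLike M' ∧
      ModelPair s ℓ w wst γ M M' (P + 1) ε G' (G' + 1) ε ∧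
      ∀ x τ, ∃ f : Pt d → ℝ, Continuous f ∧ (∃ c : ℝ, ∀ y, |f y| * w y ≤ c) ∧
        ∀ t ∈ Ioc (0 : ℝ) 1, ∀ y, M'.Pi x τ t y = ofFun Q f t y := by
  refine ⟨(M.piN ℓ w γ).toReal, (M.gamN s w wst γ).toReal, ENNReal.toReal_nonneg,
    ENNReal.toReal_nonneg, fun ε hε hε1 => ?_⟩
  have hP0 : 0 ≤ (M.piN ℓ w γ).toReal := ENNReal.toReal_nonneg
  have hG0' : 0 ≤ (M.gamN s w wst γ).toReal := ENNReal.toReal_nonneg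
  obtain ⟨P, Γ, hsm, hpi, hgam⟩ := hM.approx γ ε hε
  have hint : ∀ x τ, ∀ t ∈ Ioc (0 : ℝ) 1, ∀ y, Integrable fun z => Q t y z * P x τ z :=
    fun x τ t ht y => by
      obtain ⟨c, hc⟩ := hsm.exists_bound hw.pos x τ
      exact integrable_mul_of_memC hw hs hℓ hGm hG0 hQ (hsm.continuous x τ) hc ht y
  have hPi : ∀ x τ, ∀ t ∈ Ioc (0 : ℝ) 1, ∀ y,
      (smoothData Q P Γ hint).Pi x τ t y = ofFun Q (P x τ) t y := fun x τ t ht y =>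
    indicator_of_mem ht (fun t => ofFun Q (P x τ) t y)
  have hd : ∀ α < γ, ∀ r ∈ Ioc (0 : ℝ) 1, ∀ x (τ : T.V α),
      |M.Pi x (DFinsupp.single α τ) r x - (smoothData Q P Γ hint).Pi x (DFinsupp.single α τ) r x| ≤
      ε * (r ^ (α / ℓ) * ‖τ‖ * (w x)⁻¹) := fun α hα r hr x τ => by
    rw [hPi x _ r hr x]
    refine piNorm_le (P := fun x (τ : T.Tot) => M.Pi x τ - ofFun Q (P x τ)) hw.pos hε.le
      (fun x => ?_) hpi hα hr x τ
    funext t y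
    simp [ofFun]
  have hdg : ∀ α < γ, ∀ β < α, ∀ x y, x ≠ y → ∀ τ : T.V α,
      ‖(M.Gam y x (DFinsupp.single α τ) -
        (smoothData Q P Γ hint).Gam y x (DFinsupp.single α τ)) β‖ ≤
      ε * (wst (y - x) * sNorm s (y - x) ^ (α - β) * ‖τ‖ * (w x)⁻¹) :=
    fun α hα β hβ x y hxy τ =>
      gamNorm_le (Γ := fun x y (τ : T.Tot) => M.Gam x y τ - Γ x y τ) hw hε.le
        (fun x y => by simp) hgam hα hβ hxy τ
  have hwi : ∀ x, 0 ≤ (w x)⁻¹ := fun x => (inv_pos.2 (hw.pos x)).le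
  refine ⟨smoothData Q P Γ hint, ⟨fun x y α τ β hβ =>
      T.grp_lower _ (hsm.mem_grp x y) α τ β hβ, fun x y τ t ht z => ?_⟩,
    ⟨fun α hα r hr x τ => ?_, hd, fun α hα β hβ x y hxy τ => ?_, fun α hα β hβ x y hxy τ => ?_,
      hdg⟩, fun x τ => ⟨P x τ, hsm.continuous x τ, hsm.exists_bound hw.pos x τ, hPi x τ⟩⟩
  · rw [hPi x _ t ht z, hPi y _ t ht z]
    have : P x ((smoothData Q P Γ hint).Gam x y τ) = P y τ := hsm.pi_gam x y τ
    rw [this]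
  · have h1 := piNorm_le (P := fun x (τ : T.Tot) => M.Pi x τ) hw.pos hP0 (fun x => map_zero _)
      (ENNReal.ofReal_toReal (hM.pi_finite γ).ne).ge hα hr x τ
    have h2 := hd α hα r hr x τ
    have h3 := abs_sub_abs_le_abs_sub ((smoothData Q P Γ hint).Pi x (DFinsupp.single α τ) r x)
      (M.Pi x (DFinsupp.single α τ) r x)
    rw [abs_sub_comm] at h3
    have hr0 := hr.1
    have hwx := hwi x
    have h4 : 0 ≤ r ^ (α / ℓ) * ‖τ‖ * (w x)⁻¹ := by positivity
    have h5 := mul_le_mul_of_nonneg_right hε1 h4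
    change |M.Pi x (DFinsupp.single α τ) r x| ≤ _ at h1
    rw [add_mul]
    linarith
  · exact gamNorm_le (Γ := fun x y (τ : T.Tot) => M.Gam x y τ) hw hG0' (fun x y => map_zero _)
      (ENNReal.ofReal_toReal (hM.gam_finite γ).ne).ge hα hβ hxy τ
  · have h1 := gamNorm_le (Γ := fun x y (τ : T.Tot) => M.Gam x y τ) hw hG0' (fun x y => map_zero _)
      (ENNReal.ofReal_toReal (hM.gam_finite γ).ne).ge hα hβ hxy τ
    have h2 := hdg α hα β hβ x y hxy τ
    rw [DFinsupp.sub_apply] at h2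
    have h3 := norm_sub_norm_le ((smoothData Q P Γ hint).Gam y x (DFinsupp.single α τ) β)
      (M.Gam y x (DFinsupp.single α τ) β)
    rw [norm_sub_rev] at h3
    have hwx := hwi x
    have hu : 0 ≤ wst (y - x) := zero_le_one.trans (hw.one_le_st _)
    have hn := sNorm_nonneg (s := s) (y - x)
    have h4 : 0 ≤ wst (y - x) * sNorm s (y - x) ^ (α - β) * ‖τ‖ * (w x)⁻¹ := by positivity
    have h5 := mul_le_mul_of_nonneg_right hε1 h4
    change ‖(M.Gam y x (DFinsupp.single α τ)) β‖ ≤ _ at h1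
    rw [add_mul]
    linarith

end Models

/-! ### Measurability, semigroup identity and kernel convergence for models. -/

section ModelRegularity

variable {d : ℕ} {A : Set ℝ} {T : RegStruct.{u} A} {s : Fin d → ℝ} {ℓ : ℝ}
  {G w wst W U : Pt d → ℝ} {Q : ℝ → Pt d → Pt d → ℝ}

theorem kerConv_zero (D : (Fin d → ℕ) → ℝ → Pt d → Pt d → ℝ) (k : Fin d → ℕ) (x : Pt d) :
    KerConv D k x 0 := by
  have e : (fun t => kerT D k t x 0) = 0 := by
    funext t
    simp [kerT]
  refine ⟨fun t _ => by simp, ?_⟩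
  rw [e]
  exact IntervalIntegrable.zero

/-- Control functions are at least 1, so w*v* is dominated by (w*)³v*, whose moments are finite. -/
theorem IsControlled.mul_of_pow_three (hw : IsControlled s ℓ G w wst) {v vst : Pt d → ℝ}
    (hv : IsControlled s ℓ G v vst)
    (hw3v : IsControlled s ℓ G (fun x => w x ^ 3 * v x) (fun x => wst x ^ 3 * vst x))
    (hG0 : ∀ x, 0 ≤ G x) :
    IsControlled s ℓ G (fun x => w x * v x) (fun x => wst x * vst x) where
  continuous := hw.continuous.mul hv.continuous
  pos x := mul_pos (hw.pos x) (hv.pos x)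
  le_one x := mul_le_one₀ (hw.le_one x) (hv.pos x).le (hv.le_one x)
  continuous_st := hw.continuous_st.mul hv.continuous_st
  one_le_st x := one_le_mul_of_one_le_of_one_le (hw.one_le_st x) (hv.one_le_st x)
  moderate x y := (mul_le_mul (hw.moderate x y) (hv.moderate x y) (hv.pos _).le
    (mul_nonneg (zero_le_one.trans (hw.one_le_st x)) (hw.pos y).le)).trans_eq (by ring)
  integrable n T hT := by
    obtain ⟨B, hB⟩ := hw3v.integrable n T hT
    refine ⟨B, fun t ht x => le_trans ?_ (hB t ht x)⟩
    have h1 := hw.one_le_st (sScale s ℓ t x)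
    have h2 := hv.one_le_st (sScale s ℓ t x)
    have h3 := sNorm_nonneg (s := s) x
    have h4 := hG0 x
    have h5 : wst (sScale s ℓ t x) ≤ wst (sScale s ℓ t x) ^ 3 := le_self_pow₀ h1 three_ne_zero
    gcongr

variable [NeZero d]

theorem IsControlled.integrable_hSum (hU : IsControlled s ℓ G W U) (hs : ∀ i, 1 ≤ s i)
    (hℓ : 0 < ℓ) (hGm : Measurable G) (hG0 : ∀ x, 0 ≤ G x) (𝔸 : Finset ℝ) (α r : ℝ) {r' : ℝ}
    (hr' : r' ∈ Ioc (0 : ℝ) 1) (x : Pt d) :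
    Integrable fun z => Gt s ℓ G r' (x - z) * (U (x - z) * hSum 𝔸 ℓ α r (sNorm s (x - z))) := by
  have hs0 : 0 < s 0 := by linarith [hs 0]
  have e : (fun z => Gt s ℓ G r' (x - z) * (U (x - z) * hSum 𝔸 ℓ α r (sNorm s (x - z)))) =
      fun z => ∑ α' ∈ 𝔸 with α' ≤ α, r ^ (α' / ℓ) * (Gt s ℓ G r' (x - z) *
        (U (x - z) * sNorm s (x - z) ^ (α - α') * tw s z ^ (-0 : ℝ))) := by
    funext z
    unfold hSum
    rw [Finset.mul_sum, Finset.mul_sum]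
    refine Finset.sum_congr rfl fun α' _ => ?_
    rw [neg_zero, Real.rpow_zero]
    ring
  rw [e]
  refine integrable_finsetSum _ fun α' hα' => Integrable.const_mul ?_ _
  obtain ⟨C, -, h⟩ := hU.integral_tw hs hℓ hGm hG0
    (sub_nonneg.2 (Finset.mem_filter.1 hα').2) le_rfl hs0
  exact (h r' hr' x).1

/-- The approximation of the model gives an error off the diagonal of size 1/(n+1) times a fixed
growth function; that function is integrable against G_{r'}, which makes the limit in the semigroup
identity legitimate. -/
theorem IsModel.approx_single {M : ModelData d T} (hM : IsModel s ℓ Q w wst M)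
    (hs : ∀ i, 1 ≤ s i) (hℓ : 0 < ℓ) (hGm : Measurable G) (hG0 : ∀ x, 0 ≤ G x)
    (hQ : IsGSemigroup s ℓ G Q) (hw : IsControlled s ℓ G w wst) (hsym : ∀ x, wst (-x) = wst x)
    (hwU : ∀ x, wst x ^ 2 ≤ U x) (x : Pt d) {α : ℝ} (hα : α ∈ A) (τ : T.V α) :
    ∃ (𝔸 : Finset ℝ) (c : ℝ), 0 ≤ c ∧ ∀ n : ℕ, ∃ f : Pt d → ℝ, Continuous f ∧
      (∃ c : ℝ, ∀ y, |f y| * w y ≤ c) ∧ ∀ r ∈ Ioc (0 : ℝ) 1, ∀ z,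
        |M.Pi x (DFinsupp.single α τ) r z - ofFun Q f r z| ≤
          (1 / ((n : ℝ) + 1)) * (c * (U (x - z) * hSum 𝔸 ℓ α r (sNorm s (x - z)))) := by
  -- The model norms involve homogeneities strictly below their order, so the order α + 1 is used to
  -- include α.
  obtain ⟨P, G', hP, hG', h⟩ := hM.exists_approx hs hℓ hGm hG0 hQ hw (α + 1)
  obtain ⟨𝔸, h𝔸⟩ := T.exists_finset (α + 1)
  have hα𝔸 : α ∈ 𝔸 := (h𝔸 α).2 ⟨hα, by linarith⟩
  have hwx := inv_pos.2 (hw.pos x)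
  refine ⟨𝔸, ((1 + G') * ‖τ‖ + (P + 1) * ‖τ‖) * (w x)⁻¹ ^ 2, by positivity, fun n => ?_⟩
  have hε : 0 < 1 / ((n : ℝ) + 1) := by positivity
  have hε1 : 1 / ((n : ℝ) + 1) ≤ 1 := by
    rw [div_le_one (by positivity)]; linarith [(Nat.cast_nonneg n : (0 : ℝ) ≤ n)]
  obtain ⟨M', hM', hp, hf⟩ := h _ hε hε1
  obtain ⟨f, hfc, hfb, hfe⟩ := hf x (DFinsupp.single α τ)
  refine ⟨f, hfc, hfb, fun r hr z => ?_⟩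
  rw [← hfe r hr z]
  refine (hp.pi_sub_le hM.modelLike hM' hs hw hsym (by linarith) hε.le hG' (by linarith) hε.le h𝔸
    hα𝔸 τ τ x hr z).trans ?_
  rw [sub_self, norm_zero, mul_zero, add_zero]
  have hh := hSum_nonneg (ℓ := ℓ) 𝔸 α hr.1.le (sNorm_nonneg (s := s) (x - z))
  calc _ = (1 / ((n : ℝ) + 1)) * (((1 + G') * ‖τ‖ + (P + 1) * ‖τ‖) * (w x)⁻¹ ^ 2) *
        (wst (x - z) ^ 2 * hSum 𝔸 ℓ α r (sNorm s (x - z))) := by ring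
    _ ≤ (1 / ((n : ℝ) + 1)) * (((1 + G') * ‖τ‖ + (P + 1) * ‖τ‖) * (w x)⁻¹ ^ 2) *
        (U (x - z) * hSum 𝔸 ℓ α r (sNorm s (x - z))) := by
      refine mul_le_mul_of_nonneg_left (mul_le_mul_of_nonneg_right (hwU _) hh) (by positivity)
    _ = _ := by ring

theorem IsModel.dMeas_and_sgAt {M : ModelData d T} (hM : IsModel s ℓ Q w wst M)
    (hs : ∀ i, 1 ≤ s i) (hℓ : 0 < ℓ) (hGm : Measurable G) (hG0 : ∀ x, 0 ≤ G x)
    (hQ : IsGSemigroup s ℓ G Q) (hw : IsControlled s ℓ G w wst) (hsym : ∀ x, wst (-x) = wst x)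
    (hU : IsControlled s ℓ G W U) (hwU : ∀ x, wst x ^ 2 ≤ U x) (x : Pt d) (τ : T.Tot) :
    DMeas (M.Pi x τ) ∧ SGAt Q x (M.Pi x τ) := by
  induction τ using DFinsupp.induction with
  | h0 =>
    rw [map_zero]
    exact ⟨DMeas.zero, SGAt.zero x⟩
  | ha α b f _ _ ih =>
    rw [map_add]
    suffices h : DMeas (M.Pi x (DFinsupp.single α b)) ∧
        SGAt Q x (M.Pi x (DFinsupp.single α b)) from ⟨h.1.add ih.1, h.2.add ih.2⟩
    by_cases hα : α ∈ A
    · obtain ⟨𝔸, c, hc, h⟩ := hM.approx_single hs hℓ hGm hG0 hQ hw hsym hwU x hα b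
      choose f hfc hfb hfe using h
      have hmeas : ∀ n, DMeas (ofFun Q (f n)) := fun n => measurable_ofFun hQ (hfc n).measurable
      have hm : DMeas (M.Pi x (DFinsupp.single α b)) := by
        refine DMeas.of_tendsto hmeas fun t ht z => ?_
        rw [tendsto_iff_dist_tendsto_zero]
        have hlim := (tendsto_one_div_add_atTop_nhds_zero_nat (𝕜 := ℝ)).mul_const
          (c * (U (x - z) * hSum 𝔸 ℓ α t (sNorm s (x - z))))
        rw [zero_mul] at hlim
        refine squeeze_zero (fun _ => dist_nonneg) (fun n => ?_) hlim
        rw [dist_comm, Real.dist_eq]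
        exact hfe n t ht z
      refine ⟨hm, SGAt.of_approx hQ (tendsto_one_div_add_atTop_nhds_zero_nat (𝕜 := ℝ))
        (g := fun r z => c * (U (x - z) * hSum 𝔸 ℓ α r (sNorm s (x - z))))
        (fun n => (hfb n).elim fun c hc => SGAt.ofFun hw hs hℓ hGm hG0 hQ (hfc n) hc x)
        hm hmeas (fun r hr n z => hfe n r hr z) fun r hr r' hr' => ?_⟩
      refine ((hU.integrable_hSum hs hℓ hGm hG0 𝔸 α r hr' x).const_mul c).congr
        (Eventually.of_forall fun z => ?_)
      simp only
      ring
    · rw [RegStruct.eq_zero_of_notMem hα b, DFinsupp.single_zero, map_zero]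
      exact ⟨DMeas.zero, SGAt.zero x⟩

theorem IsModel.dMeas {M : ModelData d T} (hM : IsModel s ℓ Q w wst M)
    (hs : ∀ i, 1 ≤ s i) (hℓ : 0 < ℓ) (hGm : Measurable G) (hG0 : ∀ x, 0 ≤ G x)
    (hQ : IsGSemigroup s ℓ G Q) (hw : IsControlled s ℓ G w wst) (hsym : ∀ x, wst (-x) = wst x)
    (hU : IsControlled s ℓ G W U) (hwU : ∀ x, wst x ^ 2 ≤ U x) (x : Pt d) (τ : T.Tot) :
    DMeas (M.Pi x τ) :=
  (hM.dMeas_and_sgAt hs hℓ hGm hG0 hQ hw hsym hU hwU x τ).1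

theorem IsModel.kerConv {M : ModelData d T} (hM : IsModel s ℓ Q w wst M)
    (hs : ∀ i, 1 ≤ s i) (hℓ : 0 < ℓ) (hGm : Measurable G) (hG0 : ∀ x, 0 ≤ G x)
    (hQ : IsGSemigroup s ℓ G Q) (hw : IsControlled s ℓ G w wst) (hsym : ∀ x, wst (-x) = wst x)
    (hU : IsControlled s ℓ G W U) (hwU : ∀ x, wst x ^ 2 ≤ U x) {βbar δ CK : ℝ}
    {D : (Fin d → ℕ) → ℝ → Pt d → Pt d → ℝ} (hK : IsRegKernel s ℓ G Q βbar δ CK D) (x : Pt d)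
    {α : ℝ} (τ : T.V α) {k : Fin d → ℕ} (hk : mdeg s k < δ) (hkα : mdeg s k < α + βbar) :
    KerConv D k x (M.Pi x (DFinsupp.single α τ)) := by
  by_cases hα : α ∈ A
  · obtain ⟨𝔸, h𝔸⟩ := T.exists_finset (α + 1)
    have hα𝔸 : α ∈ 𝔸 := (h𝔸 α).2 ⟨hα, by linarith⟩
    have hp := ModelPair.self (M := M) (γ := α + 1) hw ENNReal.toReal_nonneg
      ENNReal.toReal_nonneg (ENNReal.ofReal_toReal (hM.pi_finite (α + 1)).ne).ge
      (ENNReal.ofReal_toReal (hM.gam_finite (α + 1)).ne).ge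
    obtain ⟨C, hC0, hC⟩ := hU.gInt_hSum hs hℓ hGm hG0 𝔸
    have hm := hM.dMeas hs hℓ hGm hG0 hQ hw hsym hU hwU x (DFinsupp.single α τ)
    set P := (piNorm ℓ w (α + 1) fun x (τ : T.Tot) => M.Pi x τ).toReal with hP
    set G' := (gamNorm s w wst (α + 1) fun x y (τ : T.Tot) => M.Gam x y τ).toReal with hG'
    have hP0 : 0 ≤ P := ENNReal.toReal_nonneg
    have hG'0 : 0 ≤ G' := ENNReal.toReal_nonneg
    have hwx := inv_pos.2 (hw.pos x)
    refine kerConv_of_GInt (c := C * (P * (1 + G') * ‖τ‖ * (w x)⁻¹ ^ 2)) hK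
      (hK.kMeas hQ hs) hℓ hk hm hkα fun r hr => ?_
    refine hC α hα𝔸 r hr x _ _ (by positivity) (hm.measurable hr).aestronglyMeasurable fun z => ?_
    -- Comparing a model with itself, with arguments 0 and τ, turns the difference estimate into an
    -- off-diagonal bound for Π_x τ.
    have h1 := hp.pi_sub_le hM.modelLike hM.modelLike hs hw hsym hP0 le_rfl hG'0 hG'0 le_rfl h𝔸
      hα𝔸 0 τ x hr z
    rw [DFinsupp.single_zero, map_zero, Pi.zero_apply, Pi.zero_apply, zero_sub, abs_neg] at h1
    refine h1.trans ?_
    rw [zero_sub, norm_neg, norm_zero, mul_zero, mul_zero, zero_add, zero_add]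
    have hh := hSum_nonneg (ℓ := ℓ) 𝔸 α hr.1.le (sNorm_nonneg (s := s) (x - z))
    calc _ = P * (1 + G') * ‖τ‖ * (w x)⁻¹ ^ 2 *
          (wst (x - z) ^ 2 * hSum 𝔸 ℓ α r (sNorm s (x - z))) := by ring
      _ ≤ _ := mul_le_mul_of_nonneg_left (mul_le_mul_of_nonneg_right (hwU _) hh) (by positivity)
  · rw [RegStruct.eq_zero_of_notMem hα τ, DFinsupp.single_zero, map_zero]
    exact kerConv_zero D k x

end ModelRegularity

/-! ### From models and modelled distributions to a system. -/

section SystemOfModels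

variable {d : ℕ} {A : Set ℝ} {T : RegStruct.{u} A} {s : Fin d → ℝ} {ℓ : ℝ}
  {G w wst v vst : Pt d → ℝ} {Q : ℝ → Pt d → Pt d → ℝ}

theorem ModelLike.gam_below {M : ModelData d T} (h : ModelLike M) {γ : ℝ} {τ : T.Tot}
    (hτ : T.Below γ τ) (x y : Pt d) : T.Below γ (M.Gam x y τ) := by
  intro β hβ
  obtain ⟨𝔸, h𝔸⟩ := T.exists_finset γ
  rw [RegStruct.eq_sum_single (F := 𝔸) τ fun α hα => by
    by_cases hA : α ∈ A
    · exact hτ α (not_lt.1 fun hlt => hα ((h𝔸 α).2 ⟨hA, hlt⟩))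
    · exact RegStruct.eq_zero_of_notMem hA _, map_sum, DFinsupp.finsetSum_apply]
  exact Finset.sum_eq_zero fun α hα => h.gam_above x y _ (((h𝔸 α).1 hα).2.trans_le hβ)

theorem RegStruct.Below.sub {γ : ℝ} {τ σ : T.Tot} (h : T.Below γ τ) (h' : T.Below γ σ) :
    T.Below γ (τ - σ) := fun α hα => by
  rw [DFinsupp.sub_apply, h α hα, h' α hα, sub_zero]

theorem RegStruct.Below.add {γ : ℝ} {τ σ : T.Tot} (h : T.Below γ τ) (h' : T.Below γ σ) :
    T.Below γ (τ + σ) := fun α hα => by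
  rw [DFinsupp.add_apply, h α hα, h' α hα, add_zero]

theorem RegStruct.Below.mono {γ γ' : ℝ} {τ : T.Tot} (h : T.Below γ τ) (hγ : γ ≤ γ') :
    T.Below γ' τ := fun α hα => h α (hγ.trans hα)

theorem RegStruct.Below.eq_sum {γ : ℝ} {τ : T.Tot} (h : T.Below γ τ) {𝔸 : Finset ℝ}
    (h𝔸 : ∀ α, α ∈ 𝔸 ↔ α ∈ A ∧ α < γ) : τ = ∑ α ∈ 𝔸, DFinsupp.single α (τ α) :=
  RegStruct.eq_sum_single τ fun α hα => by
    by_cases hA : α ∈ A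
    · exact h α (not_lt.1 fun hlt => hα ((h𝔸 α).2 ⟨hA, hlt⟩))
    · exact RegStruct.eq_zero_of_notMem hA _

theorem ModelData.pi_eq_sum (M : ModelData d T) {γ : ℝ} {τ : T.Tot} (h : T.Below γ τ)
    {𝔸 : Finset ℝ} (h𝔸 : ∀ α, α ∈ 𝔸 ↔ α ∈ A ∧ α < γ) (x : Pt d) (r : ℝ) (z : Pt d) :
    M.Pi x τ r z = ∑ α ∈ 𝔸, M.Pi x (DFinsupp.single α (τ α)) r z := by
  conv_lhs => rw [h.eq_sum h𝔸, map_sum]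
  rw [Finset.sum_apply, Finset.sum_apply]

theorem ModelLike.incr_below {M : ModelData d T} (h : ModelLike M) {γ : ℝ} {f : Pt d → T.Tot}
    {x y : Pt d} (hx : T.Below γ (f x)) (hy : T.Below γ (f y)) : T.Below γ (incr M f y x) :=
  hy.sub (h.gam_below hx y x)

variable [NeZero d]

theorem sizeNorm_le {γ η F : ℝ} {f : Pt d → T.Tot} (hv : ∀ x, 0 < v x) (hF : 0 ≤ F)
    (h : sizeNorm s γ η v f ≤ ENNReal.ofReal F) {α : ℝ} (hα : α < γ) {x : Pt d} (hx : x 0 ≠ 0) :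
    ‖f x α‖ ≤ F * (tw s x ^ min (η - α) 0 * (v x)⁻¹) := by
  have h1 : ENNReal.ofReal (v x * ‖f x α‖ / tw s x ^ min (η - α) 0) ≤ ENNReal.ofReal F := by
    refine le_trans ?_ h
    exact le_iSup_of_le α (le_iSup_of_le hα (le_iSup_of_le x (le_iSup_of_le hx le_rfl)))
  rw [ENNReal.ofReal_le_ofReal_iff hF,
    div_le_iff₀ (Real.rpow_pos_of_pos (tw_pos hx) _), mul_comm, ← le_div_iff₀ (hv x)] at h1
  refine h1.trans_eq ?_
  rw [div_eq_mul_inv]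
  ring

theorem incrNorm_le {γ η F : ℝ} {Δ : Pt d → Pt d → T.Tot} (hv : IsControlled s ℓ G v vst)
    (hF : 0 ≤ F) (h : incrNorm s γ η v vst Δ ≤ ENNReal.ofReal F) {α : ℝ} (hα : α < γ)
    {x y : Pt d} (hx : x 0 ≠ 0) (hy : y 0 ≠ 0) (hxy : x ≠ y) (hle : sNorm s (y - x) ≤ tw₂ s x y) :
    ‖Δ y x α‖ ≤
      F * (tw₂ s x y ^ (η - γ) * vst (x - y) * sNorm s (y - x) ^ (γ - α) * (v x)⁻¹) := by
  have h1 : ENNReal.ofReal (v x * ‖Δ y x α‖ /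
      (tw₂ s x y ^ (η - γ) * vst (x - y) * sNorm s (y - x) ^ (γ - α))) ≤ ENNReal.ofReal F := by
    refine le_trans ?_ h
    exact le_iSup_of_le α (le_iSup_of_le hα (le_iSup_of_le x (le_iSup_of_le y
      (le_iSup_of_le ⟨hx, hy, hxy, hle⟩ le_rfl))))
  have ht := tw₂_pos (s := s) hx hy
  have hu : 0 < vst (x - y) := zero_lt_one.trans_le (hv.one_le_st _)
  have hn : 0 < sNorm s (y - x) := sNorm_pos (sub_ne_zero.2 hxy.symm)
  rw [ENNReal.ofReal_le_ofReal_iff hF, div_le_iff₀ (by positivity), mul_comm,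
    ← le_div_iff₀ (hv.pos x)] at h1
  refine h1.trans_eq ?_
  rw [div_eq_mul_inv]
  ring

theorem recNorm_le {γ η F : ℝ} {u : Pt d → ℝ} {L : Pt d → Distr d} (hu : ∀ x, 0 < u x)
    (hF : 0 ≤ F) (h : recNorm s ℓ γ η u L ≤ ENNReal.ofReal F) {r : ℝ} (hr : r ∈ Ioc (0 : ℝ) 1)
    {x : Pt d} (hx : x 0 ≠ 0) :
    |L x r x| ≤ F * r ^ (γ / ℓ) * tw s x ^ (η - γ) * (u x)⁻¹ := by
  have h1 : ENNReal.ofReal (r ^ (-γ / ℓ) * tw s x ^ (γ - η) * u x * |L x r x|) ≤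
      ENNReal.ofReal F := by
    refine le_trans ?_ h
    exact le_iSup_of_le r (le_iSup_of_le hr (le_iSup_of_le x (le_iSup_of_le hx le_rfl)))
  have hr0 := hr.1
  have hux := hu x
  have ht := tw_pos (s := s) hx
  have e1 : r ^ (-γ / ℓ) = (r ^ (γ / ℓ))⁻¹ := by rw [neg_div, Real.rpow_neg hr0.le]
  have e2 : tw s x ^ (γ - η) = (tw s x ^ (η - γ))⁻¹ := by
    rw [← Real.rpow_neg ht.le, neg_sub]
  have p1 : 0 < r ^ (γ / ℓ) := Real.rpow_pos_of_pos hr0 _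
  have p2 : 0 < tw s x ^ (η - γ) := Real.rpow_pos_of_pos ht _
  rw [ENNReal.ofReal_le_ofReal_iff hF, mul_comm, ← le_div_iff₀ (by positivity)] at h1
  refine h1.trans_eq ?_
  rw [e1, e2]
  field_simp

/-- Real bounds for two modelled distributions and their difference. -/
structure MDPair (s : Fin d → ℝ) (γ η : ℝ) (v vst : Pt d → ℝ) (𝔸 : Finset ℝ)
    (M₁ M₂ : ModelData d T) (f₁ f₂ : Pt d → T.Tot) (F dF : ℝ) : Prop where
  size₁ : ∀ α ∈ 𝔸, ∀ x : Pt d, x 0 ≠ 0 → ‖f₁ x α‖ ≤ F * (tw s x ^ (η - α) * (v x)⁻¹)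
  dsize : ∀ α ∈ 𝔸, ∀ x : Pt d, x 0 ≠ 0 → ‖f₁ x α - f₂ x α‖ ≤ dF * (tw s x ^ (η - α) * (v x)⁻¹)
  inc₁ : ∀ α ∈ 𝔸, ∀ x y : Pt d, x 0 ≠ 0 → y 0 ≠ 0 → x ≠ y → sNorm s (y - x) ≤ tw₂ s x y →
    ‖incr M₁ f₁ y x α‖ ≤
      F * (tw₂ s x y ^ (η - γ) * vst (x - y) * sNorm s (y - x) ^ (γ - α) * (v x)⁻¹)
  dinc : ∀ α ∈ 𝔸, ∀ x y : Pt d, x 0 ≠ 0 → y 0 ≠ 0 → x ≠ y → sNorm s (y - x) ≤ tw₂ s x y →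
    ‖incr M₁ f₁ y x α - incr M₂ f₂ y x α‖ ≤
      dF * (tw₂ s x y ^ (η - γ) * vst (x - y) * sNorm s (y - x) ^ (γ - α) * (v x)⁻¹)

/-- With η' below every index, min(η − α, 0) ≥ η' − α. Since φ ≤ 1, the truncated exponent can be
replaced by the affine one η' − α, which adds up correctly in the later estimates. -/
theorem MDPair.of_norms {γ η η' F dF : ℝ} {𝔸 : Finset ℝ} {M₁ M₂ : ModelData d T}
    {f₁ f₂ : Pt d → T.Tot} (hv : IsControlled s ℓ G v vst) (hη : η' ≤ η)
    (h𝔸 : ∀ α ∈ 𝔸, η' ≤ α ∧ α < γ) (hF : 0 ≤ F) (hdF : 0 ≤ dF)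
    (h1 : sizeNorm s γ η v f₁ ≤ ENNReal.ofReal F)
    (h2 : sizeNorm s γ η v (fun x => f₁ x - f₂ x) ≤ ENNReal.ofReal dF)
    (h3 : incrNorm s γ η v vst (incr M₁ f₁) ≤ ENNReal.ofReal F)
    (h4 : incrNorm s γ η v vst (fun y x => incr M₁ f₁ y x - incr M₂ f₂ y x) ≤
      ENNReal.ofReal dF) : MDPair s γ η' v vst 𝔸 M₁ M₂ f₁ f₂ F dF := by
  have a1 : ∀ α ∈ 𝔸, ∀ x : Pt d, x 0 ≠ 0 → ∀ c : ℝ, 0 ≤ c →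
      c * (tw s x ^ min (η - α) 0 * (v x)⁻¹) ≤ c * (tw s x ^ (η' - α) * (v x)⁻¹) :=
    fun α hα x hx c hc => by
      have := inv_pos.2 (hv.pos x)
      refine mul_le_mul_of_nonneg_left (mul_le_mul_of_nonneg_right ?_ this.le) hc
      refine Real.rpow_le_rpow_of_exponent_ge (tw_pos hx) (tw_le_one x) (le_min ?_ ?_)
      · linarith
      · linarith [(h𝔸 α hα).1]
  have a2 : ∀ α : ℝ, ∀ x y : Pt d, x 0 ≠ 0 → y 0 ≠ 0 → ∀ c : ℝ, 0 ≤ c →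
      c * (tw₂ s x y ^ (η - γ) * vst (x - y) * sNorm s (y - x) ^ (γ - α) * (v x)⁻¹) ≤
      c * (tw₂ s x y ^ (η' - γ) * vst (x - y) * sNorm s (y - x) ^ (γ - α) * (v x)⁻¹) :=
    fun α x y hx hy c hc => by
      have := inv_pos.2 (hv.pos x)
      have hu : 0 ≤ vst (x - y) := zero_le_one.trans (hv.one_le_st _)
      have hn := sNorm_nonneg (s := s) (y - x)
      have : tw₂ s x y ^ (η - γ) ≤ tw₂ s x y ^ (η' - γ) :=
        Real.rpow_le_rpow_of_exponent_ge (tw₂_pos hx hy) (tw₂_le_one x y) (by linarith)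
      gcongr
  refine ⟨fun α hα x hx => ?_, fun α hα x hx => ?_, fun α hα x y hx hy hxy hle => ?_,
    fun α hα x y hx hy hxy hle => ?_⟩
  · exact (sizeNorm_le hv.pos hF h1 (h𝔸 α hα).2 hx).trans (a1 α hα x hx F hF)
  · exact (sizeNorm_le hv.pos hdF h2 (h𝔸 α hα).2 hx).trans (a1 α hα x hx dF hdF)
  · exact (incrNorm_le hv hF h3 (h𝔸 α hα).2 hx hy hxy hle).trans (a2 α x y hx hy F hF)
  · exact (incrNorm_le hv hdF h4 (h𝔸 α hα).2 hx hy hxy hle).trans (a2 α x y hx hy dF hdF)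

/-- The realization at `y` of the component of homogeneity `α` of a difference. -/
noncomputable def piDiff (M₁ M₂ : ModelData d T) (τ₁ τ₂ : T.Tot) (α : ℝ) (y : Pt d) : Distr d :=
  M₁.Pi y (DFinsupp.single α (τ₁ α)) - M₂.Pi y (DFinsupp.single α (τ₂ α))

/-- The constant is the product rule for Π and Γ acting on f: either the model changes at fixed f,
or f changes at fixed model. Two inverse powers of w arise from transport and from the diagonal
bound, and one of v from f; as w ≤ 1, all of them are dominated by the weight w³v. -/
theorem ModelPair.sys {γ η : ℝ} {M₁ M₂ : ModelData d T} {P₂ dP G₁ G₂ dG F dF Rc : ℝ}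
    (h : ModelPair s ℓ w wst γ M₁ M₂ P₂ dP G₁ G₂ dG) (h₁ : ModelLike M₁) (h₂ : ModelLike M₂)
    (hs : ∀ i, 1 ≤ s i) (hw : IsControlled s ℓ G w wst) (hv : IsControlled s ℓ G v vst)
    (hsym : ∀ x, wst (-x) = wst x)
    (hP : 0 ≤ P₂) (hdP : 0 ≤ dP) (hG₁ : 0 ≤ G₁) (hG₂ : 0 ≤ G₂) (hdG : 0 ≤ dG)
    (hF : 0 ≤ F) (hdF : 0 ≤ dF) (hRc : 0 ≤ Rc)
    {𝔸 : Finset ℝ} (h𝔸 : ∀ α, α ∈ 𝔸 ↔ α ∈ A ∧ α < γ) {f₁ f₂ : Pt d → T.Tot}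
    (hm : MDPair s γ η v vst 𝔸 M₁ M₂ f₁ f₂ F dF)
    (hf₁ : ∀ x : Pt d, x 0 ≠ 0 → T.Below γ (f₁ x)) (hf₂ : ∀ x : Pt d, x 0 ≠ 0 → T.Below γ (f₂ x))
    {Λ₁ Λ₂ : Distr d} (hM₁ : ∀ x τ, DMeas (M₁.Pi x τ)) (hM₂ : ∀ x τ, DMeas (M₂.Pi x τ))
    (hΛ₁ : DMeas Λ₁) (hΛ₂ : DMeas Λ₂)
    (hL : ∀ r ∈ Ioc (0 : ℝ) 1, ∀ x : Pt d, x 0 ≠ 0 →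
      |(recenter M₁ f₁ Λ₁ x - recenter M₂ f₂ Λ₂ x) r x| ≤
        Rc * r ^ (γ / ℓ) * tw s x ^ (η - γ) * (w x * v x)⁻¹) :
    Sys s ℓ (fun x => w x ^ 3 * v x) (fun x => wst x ^ 3 * vst x) 𝔸 γ η
      (fun x => recenter M₁ f₁ Λ₁ x - recenter M₂ f₂ Λ₂ x)
      (fun α y x => piDiff M₁ M₂ (incr M₁ f₁ y x) (incr M₂ f₂ y x) α y)
      (fun α x => piDiff M₁ M₂ (f₁ x) (f₂ x) α x) (Λ₁ - Λ₂)
      (dP * (1 + G₁) * F + P₂ * dG * F + P₂ * (1 + G₂) * dF) Rc := by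
  set Z := dP * (1 + G₁) * F + P₂ * dG * F + P₂ * (1 + G₂) * dF with hZ
  have hZ0 : 0 ≤ Z := by positivity
  have hcomb : ∀ (a b E : ℝ), 0 ≤ E → a ≤ F * E → b ≤ dF * E →
      dP * (1 + G₁) * a + P₂ * dG * a + P₂ * (1 + G₂) * b ≤ Z * E := by
    intro a b E hE ha hb
    calc _ ≤ dP * (1 + G₁) * (F * E) + P₂ * dG * (F * E) + P₂ * (1 + G₂) * (dF * E) := by gcongr
      _ = _ := by rw [hZ]; ring
  have hw0 : ∀ x, 0 < (w x)⁻¹ := fun x => inv_pos.2 (hw.pos x)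
  have hv0 : ∀ x, 0 < (v x)⁻¹ := fun x => inv_pos.2 (hv.pos x)
  have hw1 : ∀ x, 1 ≤ (w x)⁻¹ := fun x => (one_le_inv₀ (hw.pos x)).2 (hw.le_one x)
  have hu1 : ∀ x, 1 ≤ wst x := hw.one_le_st
  have hv1 : ∀ x, 1 ≤ vst x := hv.one_le_st
  have hu0 : ∀ x, 0 ≤ wst x := fun x => zero_le_one.trans (hu1 x)
  have hvs0 : ∀ x, 0 ≤ vst x := fun x => zero_le_one.trans (hv1 x)
  have hWi : ∀ x, (w x ^ 3 * v x)⁻¹ = (w x)⁻¹ ^ 3 * (v x)⁻¹ := fun x => by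
    rw [mul_inv, inv_pow]
  have hU2 : ∀ x, wst x ^ 2 ≤ wst x ^ 3 := fun x => pow_le_pow_right₀ (hu1 x) (by norm_num)
  have hUU : ∀ x, wst x ^ 2 ≤ wst x ^ 3 * vst x := fun x =>
    (hU2 x).trans (le_mul_of_one_le_right (pow_nonneg (hu0 x) _) (hv1 x))
  have hWW : ∀ x, (w x)⁻¹ ^ 2 ≤ (w x)⁻¹ ^ 3 := fun x => pow_le_pow_right₀ (hw1 x) (by norm_num)
  have hrel : ∀ x : Pt d, ∀ r ∈ Ioc (0 : ℝ) 1, ∀ z, ∀ τ₁ τ₂ : T.Tot, T.Below γ τ₁ → T.Below γ τ₂ →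
      M₁.Pi x τ₁ r z - M₂.Pi x τ₂ r z = ∑ α ∈ 𝔸, piDiff M₁ M₂ τ₁ τ₂ α x r z := by
    intro x r hr z τ₁ τ₂ h1 h2
    rw [M₁.pi_eq_sum h1 h𝔸, M₂.pi_eq_sum h2 h𝔸, ← Finset.sum_sub_distrib]
    rfl
  refine ⟨fun x => (hΛ₁.sub (hM₁ x _)).sub (hΛ₂.sub (hM₂ x _)),
    fun α y x => (hM₁ _ _).sub (hM₂ _ _), fun α x => (hM₁ _ _).sub (hM₂ _ _), hΛ₁.sub hΛ₂,
    fun x hx r hr z => ?_, fun x y hx hy r hr z => ?_, fun r hr x hx => ?_,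
    fun α hα r hr x hx z => ?_, fun α hα r hr x y hx hy hxy hle z => ?_⟩
  · rw [← hrel x r hr z _ _ (hf₁ x hx) (hf₂ x hx)]
    simp only [recenter, Pi.sub_apply]
    ring
  -- Since Π_x = Π_y Γ_{yx}, the difference L_x − L_y is Π_y applied to f(y) − Γ_{yx} f(x).
  · rw [← hrel y r hr z _ _ (h₁.incr_below (hf₁ x hx) (hf₁ y hy))
      (h₂.incr_below (hf₂ x hx) (hf₂ y hy))]
    simp only [incr, map_sub, Pi.sub_apply, recenter, h₁.pi_gam _ _ _ r hr, h₂.pi_gam _ _ _ r hr]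
    ring
  · refine (hL r hr x hx).trans ?_
    have := hr.1
    have := tw_nonneg (s := s) x
    refine mul_le_mul_of_nonneg_left ?_ (by positivity)
    change _ ≤ (w x ^ 3 * v x)⁻¹
    rw [hWi, mul_inv]
    exact mul_le_mul_of_nonneg_right (le_self_pow₀ (hw1 x) three_ne_zero) (hv0 x).le
  · have htw : 0 ≤ tw s x ^ (η - α) := Real.rpow_nonneg (tw_nonneg x) _
    have hE : 0 ≤ tw s x ^ (η - α) * (v x)⁻¹ := mul_nonneg htw (hv0 x).le
    have hh := hSum_nonneg (ℓ := ℓ) 𝔸 α hr.1.le (sNorm_nonneg (s := s) (x - z))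
    refine (h.pi_sub_le h₁ h₂ hs hw hsym hP hdP hG₁ hG₂ hdG h𝔸 hα _ _ x hr z).trans ?_
    calc _ ≤ (Z * (tw s x ^ (η - α) * (v x)⁻¹)) * (wst (x - z) ^ 2 * (w x)⁻¹ ^ 2) *
          hSum 𝔸 ℓ α r (sNorm s (x - z)) := by
          refine mul_le_mul_of_nonneg_right (mul_le_mul_of_nonneg_right
            (hcomb _ _ _ hE (hm.size₁ α hα x hx) (hm.dsize α hα x hx)) ?_) hh
          positivity
      _ = (Z * (tw s x ^ (η - α) * ((w x)⁻¹ ^ 2 * (v x)⁻¹))) *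
          (wst (x - z) ^ 2 * hSum 𝔸 ℓ α r (sNorm s (x - z))) := by ring
      _ ≤ (Z * (tw s x ^ (η - α) * ((w x)⁻¹ ^ 3 * (v x)⁻¹))) *
          ((wst (x - z) ^ 3 * vst (x - z)) * hSum 𝔸 ℓ α r (sNorm s (x - z))) := by
          refine mul_le_mul ?_ (mul_le_mul_of_nonneg_right (hUU _) hh) ?_ ?_
          · exact mul_le_mul_of_nonneg_left (mul_le_mul_of_nonneg_left
              (mul_le_mul_of_nonneg_right (hWW x) (hv0 x).le) htw) hZ0
          · exact mul_nonneg (sq_nonneg _) hh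
          · have := hw0 x; have := hv0 x; positivity
      _ = _ := by rw [← hWi]
  · have htw : 0 ≤ tw₂ s x y ^ (η - γ) := Real.rpow_nonneg (tw₂_pos hx hy).le _
    have hn : 0 ≤ sNorm s (y - x) ^ (γ - α) := Real.rpow_nonneg (sNorm_nonneg _) _
    have hE : 0 ≤ tw₂ s x y ^ (η - γ) * vst (x - y) * sNorm s (y - x) ^ (γ - α) * (v x)⁻¹ :=
      mul_nonneg (mul_nonneg (mul_nonneg htw (hvs0 _)) hn) (hv0 x).le
    have hh := hSum_nonneg (ℓ := ℓ) 𝔸 α hr.1.le (sNorm_nonneg (s := s) (y - z))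
    have hvx := hv0 x
    have hwx := hw0 x
    have hwy := hw0 y
    have hvs := hvs0 (x - y)
    have hus := hu0 (x - y)
    refine (h.pi_sub_le h₁ h₂ hs hw hsym hP hdP hG₁ hG₂ hdG h𝔸 hα _ _ y hr z).trans ?_
    calc _ ≤ (Z * (tw₂ s x y ^ (η - γ) * vst (x - y) * sNorm s (y - x) ^ (γ - α) * (v x)⁻¹)) *
          (wst (y - z) ^ 2 * (w y)⁻¹ ^ 2) * hSum 𝔸 ℓ α r (sNorm s (y - z)) := by
          refine mul_le_mul_of_nonneg_right (mul_le_mul_of_nonneg_right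
            (hcomb _ _ _ hE (hm.inc₁ α hα x y hx hy hxy hle) (hm.dinc α hα x y hx hy hxy hle)) ?_)
            hh
          positivity
      _ = (Z * (sNorm s (y - x) ^ (γ - α) * tw₂ s x y ^ (η - γ)) *
          ((w y)⁻¹ ^ 2 * (vst (x - y) * (v x)⁻¹))) *
          (wst (y - z) ^ 2 * hSum 𝔸 ℓ α r (sNorm s (y - z))) := by ring
      _ ≤ (Z * (sNorm s (y - x) ^ (γ - α) * tw₂ s x y ^ (η - γ)) *
          ((wst (x - y) ^ 3 * (w x)⁻¹ ^ 3) * (vst (x - y) * (v x)⁻¹))) *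
          ((wst (y - z) ^ 3 * vst (y - z)) * hSum 𝔸 ℓ α r (sNorm s (y - z))) := by
          refine mul_le_mul ?_ (mul_le_mul_of_nonneg_right (hUU _) hh)
            (mul_nonneg (sq_nonneg _) hh) (by positivity)
          refine mul_le_mul_of_nonneg_left (mul_le_mul_of_nonneg_right ?_ (by positivity))
            (by positivity)
          -- Here Π is based at y, while the bound is stated with the weight at x.
          calc (w y)⁻¹ ^ 2 ≤ (wst (x - y) * (w x)⁻¹) ^ 2 :=
                pow_le_pow_left₀ hwy.le (hw.inv_le x y) 2
            _ = wst (x - y) ^ 2 * (w x)⁻¹ ^ 2 := mul_pow _ _ _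
            _ ≤ _ := mul_le_mul (hU2 _) (hWW x) (by positivity) (by positivity)
      _ = _ := by rw [hWi]; ring

end SystemOfModels

/-! ### Algebraic form of 𝓚f and of its increments. -/

section Algebra

variable {d : ℕ} {A Abar : Set ℝ} {T : RegStruct.{u₁} A} {Tbar : RegStruct.{u₂} Abar}
  {s : Fin d → ℝ} {X : ∀ k : Fin d → ℕ, Tbar.V (mdeg s k)} {β γ δ : ℝ}
  {D : (Fin d → ℕ) → ℝ → Pt d → Pt d → ℝ} {Q : ℝ → Pt d → Pt d → ℝ} {I : AbsInt T Tbar β}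

theorem AbsInt.app_apply (I : AbsInt T Tbar β) (τ : T.Tot) (α : ℝ) :
    (I.app τ) (α + β) = I α (τ α) := by
  classical
  unfold AbsInt.app
  rw [DFinsupp.sum, DFinsupp.finsetSum_apply, Finset.sum_eq_single α]
  · exact DFinsupp.single_eq_same
  · exact fun α' _ hne => DFinsupp.single_eq_of_ne fun h => hne (add_right_cancel h).symm
  · intro hα
    rw [DFinsupp.notMem_support_iff.1 hα, map_zero, DFinsupp.single_zero, DFinsupp.zero_apply]

theorem AbsInt.app_sub (I : AbsInt T Tbar β) (τ σ : T.Tot) :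
    I.app (τ - σ) = I.app τ - I.app σ := by
  refine DFinsupp.ext fun a => ?_
  obtain ⟨α, rfl⟩ : ∃ α, a = α + β := ⟨a - β, by ring⟩
  rw [DFinsupp.sub_apply, I.app_apply, I.app_apply, I.app_apply, DFinsupp.sub_apply, map_sub]

theorem AbsInt.app_below (I : AbsInt T Tbar β) {τ : T.Tot} (h : T.Below γ τ) :
    Tbar.Below (γ + β) (I.app τ) := fun a ha => by
  obtain ⟨α, rfl⟩ : ∃ α, a = α + β := ⟨a - β, by ring⟩
  rw [I.app_apply, h α (by linarith), map_zero]

theorem polySum_congr {r : ℝ} {c c' : (Fin d → ℕ) → ℝ} (h : ∀ k ∈ mbelow s r, c k = c' k) :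
    polySum s X r c = polySum s X r c' :=
  Finset.sum_congr rfl fun k hk => by rw [h k hk]

theorem polySum_add (r : ℝ) (c c' : (Fin d → ℕ) → ℝ) :
    polySum s X r (fun k => c k + c' k) = polySum s X r c + polySum s X r c' := by
  unfold polySum
  rw [← Finset.sum_add_distrib]
  exact Finset.sum_congr rfl fun k _ => by rw [← add_smul, add_div]

theorem polySum_sub (r : ℝ) (c c' : (Fin d → ℕ) → ℝ) :
    polySum s X r (fun k => c k - c' k) = polySum s X r c - polySum s X r c' := by
  unfold polySum
  rw [← Finset.sum_sub_distrib]
  exact Finset.sum_congr rfl fun k _ => by rw [← sub_smul, sub_div]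

theorem polySum_below (hs : ∀ i, 1 ≤ s i) (r : ℝ) (c : (Fin d → ℕ) → ℝ) :
    Tbar.Below r (polySum s X r c) := fun a ha => by
  unfold polySum
  rw [DFinsupp.finsetSum_apply]
  refine Finset.sum_eq_zero fun k hk => ?_
  rw [DFinsupp.smul_apply, DFinsupp.single_eq_of_ne, smul_zero]
  exact (((mem_mbelow hs).1 hk).trans_le ha).ne'

theorem norm_polySum_le (r : ℝ) {c : (Fin d → ℕ) → ℝ} {a B b : ℝ} (hB : 0 ≤ B) (hb : 0 ≤ b)
    (hc : ∀ k ∈ mbelow s r, mdeg s k = a → |c k| ≤ B) (hX : ∀ k ∈ mbelow s r, ‖X k‖ ≤ b) :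
    ‖(polySum s X r c) a‖ ≤ (mbelow s r).card * (B * b) := by
  unfold polySum
  rw [DFinsupp.finsetSum_apply]
  refine (norm_sum_le _ _).trans ((Finset.sum_le_card_nsmul _ _ (B * b) fun k hk => ?_).trans_eq
    (nsmul_eq_mul _ _))
  rw [DFinsupp.smul_apply, norm_smul]
  by_cases h : mdeg s k = a
  · subst h
    rw [DFinsupp.single_eq_same]
    exact mul_le_mul ((abs_div_mfact_le _ _).trans (hc k hk rfl)) (hX k hk) (norm_nonneg _) hB
  · rw [DFinsupp.single_eq_of_ne (Ne.symm h), norm_zero, mul_zero]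
    positivity

/-- Polynomials with different truncation orders are collected by monomial: the truncation |k| < α +
β becomes a restriction on α, which is the splitting used in the Schauder estimates. -/
theorem sum_polySum (hs : ∀ i, 1 ≤ s i) (𝔸 : Finset ℝ) (h𝔸 : ∀ α ∈ 𝔸, α < γ)
    (g : ℝ → (Fin d → ℕ) → ℝ) :
    ∑ α ∈ 𝔸, polySum s X (α + β) (g α) =
      polySum s X (γ + β) fun k => ∑ α ∈ 𝔸 with mdeg s k < α + β, g α k := by
  have e : ∀ α ∈ 𝔸, polySum s X (α + β) (g α) = polySum s X (γ + β)
      fun k => if mdeg s k < α + β then g α k else 0 := by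
    intro α hα
    unfold polySum
    have hsub : mbelow s (α + β) ⊆ mbelow s (γ + β) := fun k hk => by
      rw [mem_mbelow hs] at hk ⊢
      linarith [h𝔸 α hα]
    rw [← Finset.sum_subset hsub fun k _ hk => by
      beta_reduce
      rw [if_neg (fun h => hk ((mem_mbelow hs).2 h)), zero_div, zero_smul]]
    exact Finset.sum_congr rfl fun k hk => by
      beta_reduce
      rw [if_pos ((mem_mbelow hs).1 hk)]
  rw [Finset.sum_congr rfl e]
  unfold polySum
  rw [Finset.sum_comm]
  refine Finset.sum_congr rfl fun k _ => ?_
  beta_reduce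
  rw [← Finset.sum_smul, Finset.sum_filter, Finset.sum_div]

theorem kerI_zero (k : Fin d → ℕ) (x : Pt d) : kerI D k x 0 = 0 := by
  simp [kerI, kerT]

theorem opJ_eq (hs : ∀ i, 1 ≤ s i) {M : ModelData d T} {τ : T.Tot} (hτ : T.Below γ τ)
    {𝔸 : Finset ℝ} (h𝔸 : ∀ α, α ∈ 𝔸 ↔ α ∈ A ∧ α < γ) (x : Pt d) :
    opJ s X β D M x τ = polySum s X (γ + β) fun k =>
      ∑ α ∈ 𝔸 with mdeg s k < α + β, kerI D k x (M.Pi x (DFinsupp.single α (τ α))) := by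
  classical
  rw [← sum_polySum hs 𝔸 (fun α hα => ((h𝔸 α).1 hα).2)
    fun α k => kerI D k x (M.Pi x (DFinsupp.single α (τ α)))]
  unfold opJ
  rw [DFinsupp.sum]
  refine Finset.sum_subset_zero_on_sdiff (fun α hα => ?_) (fun α hα => ?_) (fun α _ => rfl)
  · rw [DFinsupp.mem_support_iff] at hα
    refine (h𝔸 α).2 ⟨?_, ?_⟩
    · by_contra h
      exact hα (RegStruct.eq_zero_of_notMem h _)
    · by_contra h
      exact hα (hτ α (not_lt.1 h))
  · have h0 : τ α = 0 := DFinsupp.notMem_support_iff.1 (Finset.mem_sdiff.1 hα).2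
    simp only [h0, DFinsupp.single_zero, map_zero, kerI_zero]
    simp [polySum]

theorem mchoose_mul {k l : Fin d → ℕ} (h : l ≤ k) :
    mchoose k l * mfact l * mfact (k - l) = mfact k := by
  unfold mchoose mfact
  rw [← Finset.prod_mul_distrib, ← Finset.prod_mul_distrib]
  exact Finset.prod_congr rfl fun i _ => Nat.choose_mul_factorial_mul_factorial (h i)

/-- Translation acts on the coefficients as Taylor re-expansion at y. The pairs l ≤ k are reindexed
by (k − l, l), and the truncation order is preserved because degrees add. -/
theorem gam_polySum (hs : ∀ i, 1 ≤ s i) {M : ModelData d T} {Mbar : ModelData d Tbar}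
    (h : IsCompatible s Q X δ β D I M Mbar) (r : ℝ) (c : (Fin d → ℕ) → ℝ) (x y : Pt d) :
    Mbar.Gam y x (polySum s X r c) = polySum s X r fun k =>
      ∑ l ∈ mbelow s (r - mdeg s k), mpow (y - x) l / (mfact l : ℝ) * c (k + l) := by
  unfold polySum
  simp only [map_sum, map_smul, h.gam_poly, Finset.smul_sum, smul_smul, Finset.sum_div,
    Finset.sum_smul]
  rw [Finset.sum_sigma', Finset.sum_sigma']
  refine Finset.sum_bij' (fun p _ => ⟨p.1 - p.2, p.2⟩) (fun p _ => ⟨p.1 + p.2, p.2⟩) ?_ ?_ ?_ ?_ ?_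
  · rintro ⟨k, l⟩ hp
    obtain ⟨h1, h2⟩ := Finset.mem_sigma.1 hp
    have h2' : l ≤ k := Finset.mem_Iic.1 h2
    have e : mdeg s (k - l) + mdeg s l = mdeg s k := by
      rw [← mdeg_add, tsub_add_cancel_of_le h2']
    have h0 := mdeg_nonneg hs l
    have h1' := (mem_mbelow hs).1 h1
    simp only at h1'
    refine Finset.mem_sigma.2 ⟨(mem_mbelow hs).2 ?_, (mem_mbelow hs).2 ?_⟩
    · simp only; linarith
    · simp only; linarith
  · rintro ⟨k, l⟩ hp
    obtain ⟨h1, h2⟩ := Finset.mem_sigma.1 hp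
    have h2' := (mem_mbelow hs).1 h2
    simp only at h2'
    refine Finset.mem_sigma.2 ⟨(mem_mbelow hs).2 ?_, Finset.mem_Iic.2 ?_⟩
    · simp only [mdeg_add]; linarith
    · simp
  · rintro ⟨k, l⟩ hp
    have h2' : l ≤ k := Finset.mem_Iic.1 (Finset.mem_sigma.1 hp).2
    simp only [tsub_add_cancel_of_le h2']
  · rintro ⟨k, l⟩ _
    simp only [add_tsub_cancel_right]
  · rintro ⟨k, l⟩ hp
    have h2' : l ≤ k := Finset.mem_Iic.1 (Finset.mem_sigma.1 hp).2
    simp only [tsub_add_cancel_of_le h2']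
    congr 1
    -- The factorials combine as binom(k, l)/k! = 1/(l! (k − l)!).
    have e := mchoose_mul h2'
    have e' : (mchoose k l : ℝ) * mfact l * mfact (k - l) = mfact k := by exact_mod_cast e
    have p1 : (0 : ℝ) < mfact l := by exact_mod_cast mfact_pos l
    have p2 : (0 : ℝ) < mfact (k - l) := by exact_mod_cast mfact_pos (k - l)
    have p3 : (0 : ℝ) < mfact k := by exact_mod_cast mfact_pos k
    field_simp
    rw [← e']
    ring

theorem opK_eq (hs : ∀ i, 1 ≤ s i) {M : ModelData d T} {f : Pt d → T.Tot} (Λ : Distr d) {x : Pt d}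
    (hf : T.Below γ (f x)) {𝔸 : Finset ℝ} (h𝔸 : ∀ α, α ∈ 𝔸 ↔ α ∈ A ∧ α < γ) :
    opK s X γ β D I M f Λ x = I.app (f x) + polySum s X (γ + β) fun k =>
      kerI D k x (recenter M f Λ x) + ∑ α ∈ 𝔸 with mdeg s k < α + β,
        kerI D k x (M.Pi x (DFinsupp.single α (f x α))) := by
  unfold opK opN
  rw [opJ_eq hs hf h𝔸, polySum_add]
  abel

theorem opK_below (hs : ∀ i, 1 ≤ s i) {M : ModelData d T} {f : Pt d → T.Tot} (Λ : Distr d)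
    {x : Pt d} (hf : T.Below γ (f x)) : Tbar.Below (γ + β) (opK s X γ β D I M f Λ x) := by
  obtain ⟨𝔸, h𝔸⟩ := T.exists_finset γ
  rw [opK_eq hs Λ hf h𝔸]
  exact (I.app_below hf).add (polySum_below hs _ _)

/-- Compatibility moves I + 𝓙(x) through Γ̄_{yx}, so the increment of the model-dependent part is I
+ 𝓙(y) applied to the increment of f. What remains is L_y against the Taylor re-expansion of the
coefficients built from L_x. The kernel integrals must converge for the two values of 𝓙(y) to be
subtracted under the integral. -/
theorem incr_opK (hs : ∀ i, 1 ≤ s i) {M : ModelData d T} {Mbar : ModelData d Tbar}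
    (h : IsCompatible s Q X δ β D I M Mbar) (hM : ModelLike M) (hγ : γ ≤ δ - β)
    {f : Pt d → T.Tot} (Λ : Distr d) {x y : Pt d} (hx : T.Below γ (f x)) (hy : T.Below γ (f y))
    {𝔸 : Finset ℝ} (h𝔸 : ∀ α, α ∈ 𝔸 ↔ α ∈ A ∧ α < γ)
    (hpi : ∀ α (τ : T.V α) k, α < γ → mdeg s k < α + β →
      KerConv D k y (M.Pi y (DFinsupp.single α τ))) :
    incr Mbar (opK s X γ β D I M f Λ) y x = I.app (incr M f y x) + polySum s X (γ + β) fun k =>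
      kerI D k y (recenter M f Λ y) + ∑ α ∈ 𝔸 with mdeg s k < α + β,
        kerI D k y (M.Pi y (DFinsupp.single α (incr M f y x α))) -
      ∑ l ∈ mbelow s (γ + β - mdeg s k), mpow (y - x) l / (mfact l : ℝ) *
        kerI D (k + l) x (recenter M f Λ x) := by
  have hg := hM.gam_below hx y x
  have e1 : Mbar.Gam y x (opK s X γ β D I M f Λ x) = I.app (M.Gam y x (f x)) +
      opJ s X β D M y (M.Gam y x (f x)) + Mbar.Gam y x (opN s X γ β D M f Λ x) := by
    unfold opK
    rw [map_add, h.comm x y (f x) (hx.mono hγ)]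
  have e2 : opJ s X β D M y (f y) - opJ s X β D M y (M.Gam y x (f x)) =
      polySum s X (γ + β) fun k => ∑ α ∈ 𝔸 with mdeg s k < α + β,
        kerI D k y (M.Pi y (DFinsupp.single α (incr M f y x α))) := by
    rw [opJ_eq hs hy h𝔸, opJ_eq hs hg h𝔸, ← polySum_sub]
    refine polySum_congr fun k _ => ?_
    rw [← Finset.sum_sub_distrib]
    refine Finset.sum_congr rfl fun α hα => ?_
    obtain ⟨hα1, hα2⟩ := Finset.mem_filter.1 hα
    have hαγ := ((h𝔸 α).1 hα1).2
    rw [← kerI_sub (hpi α _ k hαγ hα2) (hpi α _ k hαγ hα2), ← map_sub, ← DFinsupp.single_sub]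
    rfl
  have e3 : incr Mbar (opK s X γ β D I M f Λ) y x = I.app (incr M f y x) +
      (opJ s X β D M y (f y) - opJ s X β D M y (M.Gam y x (f x))) +
      (opN s X γ β D M f Λ y - Mbar.Gam y x (opN s X γ β D M f Λ x)) := by
    unfold incr
    rw [e1, I.app_sub]
    unfold opK
    abel
  rw [e3, e2]
  unfold opN
  rw [gam_polySum hs h, polySum_sub, polySum_add]
  abel

variable {M₁ M₂ : ModelData d T} {f₁ f₂ : Pt d → T.Tot} {Λ₁ Λ₂ : Distr d}

/-- Linearity of the kernel integrals, given convergence, expresses the difference of two lifts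
through exactly the distributions forming the system of the differences. -/
theorem opK_sub (hs : ∀ i, 1 ≤ s i) {x : Pt d} (hf₁ : T.Below γ (f₁ x)) (hf₂ : T.Below γ (f₂ x))
    {𝔸 : Finset ℝ} (h𝔸 : ∀ α, α ∈ 𝔸 ↔ α ∈ A ∧ α < γ)
    (hpi₁ : ∀ α (τ : T.V α) k, α < γ → mdeg s k < α + β →
      KerConv D k x (M₁.Pi x (DFinsupp.single α τ)))
    (hpi₂ : ∀ α (τ : T.V α) k, α < γ → mdeg s k < α + β →
      KerConv D k x (M₂.Pi x (DFinsupp.single α τ)))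
    (hr₁ : ∀ k, mdeg s k < γ + β → KerConv D k x (recenter M₁ f₁ Λ₁ x))
    (hr₂ : ∀ k, mdeg s k < γ + β → KerConv D k x (recenter M₂ f₂ Λ₂ x)) :
    opK s X γ β D I M₁ f₁ Λ₁ x - opK s X γ β D I M₂ f₂ Λ₂ x =
      I.app (f₁ x - f₂ x) + polySum s X (γ + β) fun k =>
        kerI D k x (recenter M₁ f₁ Λ₁ x - recenter M₂ f₂ Λ₂ x) +
          ∑ α ∈ 𝔸 with mdeg s k < α + β, kerI D k x (piDiff M₁ M₂ (f₁ x) (f₂ x) α x) := by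
  rw [opK_eq hs Λ₁ hf₁ h𝔸, opK_eq hs Λ₂ hf₂ h𝔸, I.app_sub, add_sub_add_comm, ← polySum_sub]
  congr 1
  refine polySum_congr fun k hk => ?_
  have hk' := (mem_mbelow hs).1 hk
  rw [kerI_sub (hr₁ k hk') (hr₂ k hk'), add_sub_add_comm, ← Finset.sum_sub_distrib]
  congr 1
  refine Finset.sum_congr rfl fun α hα => ?_
  obtain ⟨hα1, hα2⟩ := Finset.mem_filter.1 hα
  have hαγ := ((h𝔸 α).1 hα1).2
  exact (kerI_sub (hpi₁ α _ k hαγ hα2) (hpi₂ α _ k hαγ hα2)).symm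

theorem incr_opK_sub (hs : ∀ i, 1 ≤ s i) {Mbar₁ Mbar₂ : ModelData d Tbar}
    (h₁ : IsCompatible s Q X δ β D I M₁ Mbar₁) (h₂ : IsCompatible s Q X δ β D I M₂ Mbar₂)
    (hM₁ : ModelLike M₁) (hM₂ : ModelLike M₂) (hγ : γ ≤ δ - β) {x y : Pt d}
    (hx₁ : T.Below γ (f₁ x)) (hy₁ : T.Below γ (f₁ y))
    (hx₂ : T.Below γ (f₂ x)) (hy₂ : T.Below γ (f₂ y))
    {𝔸 : Finset ℝ} (h𝔸 : ∀ α, α ∈ 𝔸 ↔ α ∈ A ∧ α < γ)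
    (hpi₁ : ∀ α (τ : T.V α) k, α < γ → mdeg s k < α + β →
      KerConv D k y (M₁.Pi y (DFinsupp.single α τ)))
    (hpi₂ : ∀ α (τ : T.V α) k, α < γ → mdeg s k < α + β →
      KerConv D k y (M₂.Pi y (DFinsupp.single α τ)))
    (hrx₁ : ∀ k, mdeg s k < γ + β → KerConv D k x (recenter M₁ f₁ Λ₁ x))
    (hry₁ : ∀ k, mdeg s k < γ + β → KerConv D k y (recenter M₁ f₁ Λ₁ y))
    (hrx₂ : ∀ k, mdeg s k < γ + β → KerConv D k x (recenter M₂ f₂ Λ₂ x))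
    (hry₂ : ∀ k, mdeg s k < γ + β → KerConv D k y (recenter M₂ f₂ Λ₂ y)) :
    incr Mbar₁ (opK s X γ β D I M₁ f₁ Λ₁) y x - incr Mbar₂ (opK s X γ β D I M₂ f₂ Λ₂) y x =
      I.app (incr M₁ f₁ y x - incr M₂ f₂ y x) + polySum s X (γ + β) fun k =>
        kerI D k y (recenter M₁ f₁ Λ₁ y - recenter M₂ f₂ Λ₂ y) +
          ∑ α ∈ 𝔸 with mdeg s k < α + β,
            kerI D k y (piDiff M₁ M₂ (incr M₁ f₁ y x) (incr M₂ f₂ y x) α y) -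
          ∑ l ∈ mbelow s (γ + β - mdeg s k), mpow (y - x) l / (mfact l : ℝ) *
            kerI D (k + l) x (recenter M₁ f₁ Λ₁ x - recenter M₂ f₂ Λ₂ x) := by
  rw [incr_opK hs h₁ hM₁ hγ Λ₁ hx₁ hy₁ h𝔸 hpi₁, incr_opK hs h₂ hM₂ hγ Λ₂ hx₂ hy₂ h𝔸 hpi₂,
    I.app_sub, add_sub_add_comm, ← polySum_sub]
  congr 1
  refine polySum_congr fun k hk => ?_
  have hk' := (mem_mbelow hs).1 hk
  rw [kerI_sub (hry₁ k hk') (hry₂ k hk'), sub_sub_sub_comm, add_sub_add_comm,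
    ← Finset.sum_sub_distrib, ← Finset.sum_sub_distrib]
  congr 1
  · congr 1
    refine Finset.sum_congr rfl fun α hα => ?_
    obtain ⟨hα1, hα2⟩ := Finset.mem_filter.1 hα
    have hαγ := ((h𝔸 α).1 hα1).2
    exact (kerI_sub (hpi₁ α _ k hαγ hα2) (hpi₂ α _ k hαγ hα2)).symm
  · refine Finset.sum_congr rfl fun l hl => ?_
    have hl' : mdeg s (k + l) < γ + β := by
      rw [mdeg_add]; linarith [(mem_mbelow hs).1 hl]
    rw [kerI_sub (hrx₁ _ hl') (hrx₂ _ hl'), mul_sub]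

end Algebra

/-! ### From coefficient bounds to norms of modelled distributions. -/

section Bounds

variable {d : ℕ} {A Abar : Set ℝ} {T : RegStruct.{u₁} A} {Tbar : RegStruct.{u₂} Abar}
  {s : Fin d → ℝ} {ℓ : ℝ} {X : ∀ k : Fin d → ℕ, Tbar.V (mdeg s k)} {β γ δ : ℝ}
  {D : (Fin d → ℕ) → ℝ → Pt d → Pt d → ℝ} {Q : ℝ → Pt d → Pt d → ℝ} {I : AbsInt T Tbar β}
  {G w wst v vst W U : Pt d → ℝ}

theorem AbsInt.norm_le_of_opN {J : ℝ} (hJ : 0 ≤ J) (h : I.opN γ ≤ ENNReal.ofReal J) {α : ℝ}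
    (hα : α < γ) : ‖I α‖ ≤ J := by
  have h1 : ENNReal.ofReal ‖I α‖ ≤ ENNReal.ofReal J := by
    refine le_trans ?_ h
    exact le_iSup_of_le α (le_iSup_of_le hα le_rfl)
  rwa [ENNReal.ofReal_le_ofReal_iff hJ] at h1

/-- Below γ only finitely many components of the regularity structure are nonzero, so the supremum
is finite. -/
theorem AbsInt.opN_lt_top (I : AbsInt T Tbar β) (γ : ℝ) : I.opN γ < ∞ := by
  obtain ⟨𝔸, h𝔸⟩ := T.exists_finset γ
  refine lt_of_le_of_lt (iSup_le fun α => iSup_le fun hα => ENNReal.ofReal_le_ofReal ?_)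
    (ENNReal.ofReal_lt_top (r := ∑ α ∈ 𝔸, ‖I α‖))
  by_cases hA : α ∈ A
  · exact Finset.single_le_sum (f := fun α => ‖I α‖) (fun _ _ => norm_nonneg _)
      ((h𝔸 α).2 ⟨hA, hα⟩)
  · have : I α = 0 := by
      ext τ
      rw [RegStruct.eq_zero_of_notMem hA τ, map_zero, map_zero]
    rw [this, norm_zero]
    exact Finset.sum_nonneg fun _ _ => norm_nonneg _

variable [NeZero d]

theorem sizeNorm_le_of {γ η F : ℝ} {f : Pt d → T.Tot} (hv : ∀ x, 0 < v x)
    (h : ∀ α < γ, ∀ x : Pt d, x 0 ≠ 0 → ‖f x α‖ ≤ F * (tw s x ^ min (η - α) 0 * (v x)⁻¹)) :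
    sizeNorm s γ η v f ≤ ENNReal.ofReal F := by
  refine iSup_le fun α => iSup_le fun hα => iSup_le fun x => iSup_le fun hx =>
    ENNReal.ofReal_le_ofReal ?_
  have hp := Real.rpow_pos_of_pos (tw_pos (s := s) hx) (min (η - α) 0)
  have hvx := hv x
  rw [div_le_iff₀ hp]
  refine (mul_le_mul_of_nonneg_left (h α hα x hx) hvx.le).trans_eq ?_
  field_simp

theorem incrNorm_le_of {γ η F : ℝ} {Δ : Pt d → Pt d → T.Tot} (hv : IsControlled s ℓ G v vst)
    (h : ∀ α < γ, ∀ x y : Pt d, x 0 ≠ 0 → y 0 ≠ 0 → x ≠ y → sNorm s (y - x) ≤ tw₂ s x y →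
      ‖Δ y x α‖ ≤
        F * (tw₂ s x y ^ (η - γ) * vst (x - y) * sNorm s (y - x) ^ (γ - α) * (v x)⁻¹)) :
    incrNorm s γ η v vst Δ ≤ ENNReal.ofReal F := by
  refine iSup_le fun α => iSup_le fun hα => iSup_le fun x => iSup_le fun y => iSup_le fun hxy =>
    ENNReal.ofReal_le_ofReal ?_
  have ht := tw₂_pos (s := s) hxy.1 hxy.2.1
  have hu : 0 < vst (x - y) := zero_lt_one.trans_le (hv.one_le_st _)
  have hn : 0 < sNorm s (y - x) := sNorm_pos (sub_ne_zero.2 hxy.2.2.1.symm)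
  have hvx := hv.pos x
  rw [div_le_iff₀ (by positivity)]
  refine (mul_le_mul_of_nonneg_left (h α hα x y hxy.1 hxy.2.1 hxy.2.2.1 hxy.2.2.2)
    hvx.le).trans_eq ?_
  field_simp

theorem norm_app_apply_le {J : ℝ} (hJ : ∀ α < γ, ‖I α‖ ≤ J) (τ : T.Tot) {a : ℝ} (ha : a < γ + β) :
    ‖(I.app τ) a‖ ≤ J * ‖τ (a - β)‖ := by
  obtain ⟨α, rfl⟩ : ∃ α, a = α + β := ⟨a - β, by ring⟩
  rw [I.app_apply, add_sub_cancel_right]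
  exact (I α).le_of_opNorm_le (hJ α (by linarith)) _

/-- In degree a only the component a − β of f and the monomials of degree exactly a occur, so the
exponents of the two contributions match. The inequalities ζ ≤ η and W ≤ v weaken the bound on f to
the target weight and exponent. -/
theorem sizeNorm_app_add_polySum_le {η ζ J F B b : ℝ} {f : Pt d → T.Tot}
    {c : Pt d → (Fin d → ℕ) → ℝ} {g : Pt d → Tbar.Tot} (hs : ∀ i, 1 ≤ s i) (hv : ∀ x, 0 < v x)
    (hW : ∀ x, 0 < W x) (hWv : ∀ x, W x ≤ v x) (hζ : ζ ≤ η) (hJ0 : 0 ≤ J)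
    (hJ : ∀ α < γ, ‖I α‖ ≤ J) (hF : 0 ≤ F) (hB : 0 ≤ B) (hb : 0 ≤ b)
    (hX : ∀ k, mdeg s k < γ + β → ‖X k‖ ≤ b)
    (hf : sizeNorm s γ η v f ≤ ENNReal.ofReal F)
    (hg : ∀ x : Pt d, x 0 ≠ 0 → g x = I.app (f x) + polySum s X (γ + β) (c x))
    (hc : ∀ k, mdeg s k < γ + β → ∀ x : Pt d, x 0 ≠ 0 →
      |c x k| ≤ B * (tw s x ^ min (ζ + β - mdeg s k) 0 * (W x)⁻¹)) :
    sizeNorm s (γ + β) (ζ + β) W g ≤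
      ENNReal.ofReal (J * F + (mbelow s (γ + β)).card * (B * b)) := by
  refine sizeNorm_le_of hW fun a ha x hx => ?_
  have htw := tw_pos (s := s) hx
  have hWi := inv_pos.2 (hW x)
  set E := tw s x ^ min (ζ + β - a) 0 * (W x)⁻¹ with hE
  have hE0 : 0 ≤ E := by positivity
  rw [hg x hx, DFinsupp.add_apply, add_mul]
  refine (norm_add_le _ _).trans (add_le_add ?_ ?_)
  · refine (norm_app_apply_le hJ (f x) ha).trans ?_
    rw [mul_assoc]
    refine mul_le_mul_of_nonneg_left ((sizeNorm_le hv hF hf (by linarith) hx).trans ?_) hJ0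
    refine mul_le_mul_of_nonneg_left ?_ hF
    refine mul_le_mul ?_ (inv_anti₀ (hW x) (hWv x)) (inv_pos.2 (hv x)).le (by positivity)
    refine Real.rpow_le_rpow_of_exponent_ge htw (tw_le_one x) ?_
    exact min_le_min_right _ (by linarith)
  · refine (norm_polySum_le (γ + β) (mul_nonneg hB hE0) hb (fun k hk hka => ?_)
      fun k hk => hX k ((mem_mbelow hs).1 hk)).trans_eq (by ring)
    rw [hE, ← hka]
    exact hc k ((mem_mbelow hs).1 hk) x hx

theorem incrNorm_app_add_polySum_le {η ζ J F B b : ℝ} {f : Pt d → Pt d → T.Tot}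
    {c : Pt d → Pt d → (Fin d → ℕ) → ℝ} {g : Pt d → Pt d → Tbar.Tot} (hs : ∀ i, 1 ≤ s i)
    (hv : IsControlled s ℓ G v vst) (hU : IsControlled s ℓ G W U) (hWv : ∀ x, W x ≤ v x)
    (hUv : ∀ x, vst x ≤ U x) (hζ : ζ ≤ η) (hJ0 : 0 ≤ J)
    (hJ : ∀ α < γ, ‖I α‖ ≤ J) (hF : 0 ≤ F) (hB : 0 ≤ B) (hb : 0 ≤ b)
    (hX : ∀ k, mdeg s k < γ + β → ‖X k‖ ≤ b)
    (hf : incrNorm s γ η v vst f ≤ ENNReal.ofReal F)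
    (hg : ∀ x y : Pt d, x 0 ≠ 0 → y 0 ≠ 0 →
      g y x = I.app (f y x) + polySum s X (γ + β) (c y x))
    (hc : ∀ k, mdeg s k < γ + β → ∀ x y : Pt d, x 0 ≠ 0 → y 0 ≠ 0 → x ≠ y →
      sNorm s (y - x) ≤ tw₂ s x y → |c y x k| ≤ B * (tw₂ s x y ^ (ζ - γ) * U (x - y) *
          sNorm s (y - x) ^ (γ + β - mdeg s k) * (W x)⁻¹)) :
    incrNorm s (γ + β) (ζ + β) W U g ≤
      ENNReal.ofReal (J * F + (mbelow s (γ + β)).card * (B * b)) := by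
  refine incrNorm_le_of hU fun a ha x y hx hy hxy hle => ?_
  have htw := tw₂_pos (s := s) hx hy
  have hWi := inv_pos.2 (hU.pos x)
  have hvi := inv_pos.2 (hv.pos x)
  have hu : 0 < vst (x - y) := zero_lt_one.trans_le (hv.one_le_st _)
  have hU0 : 0 < U (x - y) := zero_lt_one.trans_le (hU.one_le_st _)
  have hn : 0 < sNorm s (y - x) := sNorm_pos (sub_ne_zero.2 hxy.symm)
  rw [add_sub_add_right_eq_sub]
  set E := tw₂ s x y ^ (ζ - γ) * U (x - y) * sNorm s (y - x) ^ (γ + β - a) * (W x)⁻¹ with hE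
  have hE0 : 0 ≤ E := by positivity
  rw [hg x y hx hy, DFinsupp.add_apply, add_mul]
  refine (norm_add_le _ _).trans (add_le_add ?_ ?_)
  · refine (norm_app_apply_le hJ (f y x) ha).trans ?_
    rw [mul_assoc]
    refine mul_le_mul_of_nonneg_left
      ((incrNorm_le hv hF hf (by linarith) hx hy hxy hle).trans ?_) hJ0
    have e : γ - (a - β) = γ + β - a := by ring
    have h1 : tw₂ s x y ^ (η - γ) ≤ tw₂ s x y ^ (ζ - γ) :=
      Real.rpow_le_rpow_of_exponent_ge htw (tw₂_le_one x y) (by linarith)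
    have h2 := hUv (x - y)
    have h3 := inv_anti₀ (hU.pos x) (hWv x)
    rw [e, hE]
    refine mul_le_mul_of_nonneg_left ?_ hF
    gcongr
  · refine (norm_polySum_le (γ + β) (mul_nonneg hB hE0) hb (fun k hk hka => ?_)
      fun k hk => hX k ((mem_mbelow hs).1 hk)).trans_eq (by ring)
    rw [hE, ← hka]
    exact hc k ((mem_mbelow hs).1 hk) x y hx hy hxy hle

end Bounds

/-! ### The two norms of a difference of lifts. -/

section Difference

variable {d : ℕ} [NeZero d] {s : Fin d → ℝ} {ℓ : ℝ} {G w wst v vst W U : Pt d → ℝ}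

/-- The bounds for the difference of two lifts, in terms of the system of distributions attached to
the difference of the data. -/
theorem exists_opK_sub_bound {A : Set ℝ} {η η' ζ β βbar γ δ : ℝ} {𝔸 : Finset ℝ}
    (hU : IsControlled s ℓ G W U) (hv : IsControlled s ℓ G v vst) (hs : ∀ i, 1 ≤ s i)
    (hℓ : 0 < ℓ) (hGm : Measurable G) (hG0 : ∀ x, 0 ≤ G x) (hWv : ∀ x, W x ≤ v x)
    (hUv : ∀ x, vst x ≤ U x)
    (h𝔸A : ∀ α, α ∈ 𝔸 ↔ α ∈ A ∧ α < γ) (h𝔸 : ∀ α ∈ 𝔸, η' ≤ α ∧ α < γ) (hηγ : η' ≤ γ)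
    (hη : γ - s 0 < η') (hζ' : ζ ≤ η') (hζ : ζ ≤ η) (hββ : β ≤ βbar) (hγδ : γ + βbar < δ)
    (hcase : β < βbar ∨ ∀ a ∈ (𝔸 : Set ℝ) ∪ {γ, ζ}, ∀ k : Fin d → ℕ, a + βbar ≠ mdeg s k) :
    ∃ C : ℝ, 0 ≤ C ∧ ∀ (b : ℝ), 0 ≤ b →
      ∀ (Q : ℝ → Pt d → Pt d → ℝ), IsGSemigroup s ℓ G Q →
      ∀ (CK : ℝ) (D : (Fin d → ℕ) → ℝ → Pt d → Pt d → ℝ), IsRegKernel s ℓ G Q βbar δ CK D →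
      ∀ (Abar : Set ℝ) (T : RegStruct.{u₁} A) (Tbar : RegStruct.{u₂} Abar)
        (X : ∀ k : Fin d → ℕ, Tbar.V (mdeg s k)), (∀ k, mdeg s k < γ + β → ‖X k‖ ≤ b) →
      ∀ (I : AbsInt T Tbar β) (J : ℝ), 0 ≤ J → I.opN γ ≤ ENNReal.ofReal J →
      ∀ (M₁ M₂ : ModelData d T) (Mbar₁ Mbar₂ : ModelData d Tbar), ModelLike M₁ → ModelLike M₂ →
        IsCompatible s Q X δ β D I M₁ Mbar₁ → IsCompatible s Q X δ β D I M₂ Mbar₂ →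
      ∀ (f₁ f₂ : Pt d → T.Tot) (Λ₁ Λ₂ : Distr d), (∀ x : Pt d, x 0 ≠ 0 → T.Below γ (f₁ x)) →
        (∀ x : Pt d, x 0 ≠ 0 → T.Below γ (f₂ x)) →
        (∀ x α (τ : T.V α) k, α < γ → mdeg s k < α + β →
          KerConv D k x (M₁.Pi x (DFinsupp.single α τ))) →
        (∀ x α (τ : T.V α) k, α < γ → mdeg s k < α + β →
          KerConv D k x (M₂.Pi x (DFinsupp.single α τ))) →
        (∀ x : Pt d, x 0 ≠ 0 → ∀ k, mdeg s k < γ + β → KerConv D k x (recenter M₁ f₁ Λ₁ x)) →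
        (∀ x : Pt d, x 0 ≠ 0 → ∀ k, mdeg s k < γ + β → KerConv D k x (recenter M₂ f₂ Λ₂ x)) →
      ∀ (Z Rc : ℝ), 0 ≤ Z → 0 ≤ Rc →
        Sys s ℓ W U 𝔸 γ η' (fun x => recenter M₁ f₁ Λ₁ x - recenter M₂ f₂ Λ₂ x)
          (fun α y x => piDiff M₁ M₂ (incr M₁ f₁ y x) (incr M₂ f₂ y x) α y)
          (fun α x => piDiff M₁ M₂ (f₁ x) (f₂ x) α x) (Λ₁ - Λ₂) Z Rc →
      ∀ (dS dI : ℝ), 0 ≤ dS → 0 ≤ dI →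
        sizeNorm s γ η v (fun x => f₁ x - f₂ x) ≤ ENNReal.ofReal dS →
        incrNorm s γ η v vst (fun y x => incr M₁ f₁ y x - incr M₂ f₂ y x) ≤ ENNReal.ofReal dI →
        sizeNorm s (γ + β) (ζ + β) W
            (fun x => opK s X γ β D I M₁ f₁ Λ₁ x - opK s X γ β D I M₂ f₂ Λ₂ x) ≤
          ENNReal.ofReal (J * dS + C * b * (CK * (Z + Rc))) ∧
        incrNorm s (γ + β) (ζ + β) W U (fun y x => incr Mbar₁ (opK s X γ β D I M₁ f₁ Λ₁) y x -
            incr Mbar₂ (opK s X γ β D I M₂ f₂ Λ₂) y x) ≤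
          ENNReal.ofReal (J * dI + C * b * (CK * (Z + Rc))) := by
  obtain ⟨C₁, hC₁0, hC₁⟩ := Sys.size_coef hU hs hℓ hGm hG0 h𝔸 hηγ hη hζ' hββ hγδ hcase
  obtain ⟨C₂, hC₂0, hC₂⟩ := Sys.hol_coef hU hs hℓ hGm hG0 h𝔸 hηγ hη hζ' hββ hγδ hcase
  -- One C₁ or C₂ for each monomial of degree below γ + β; a common constant serves both norms.
  refine ⟨(mbelow s (γ + β)).card * (C₁ + C₂), by positivity, ?_⟩
  intro b hb Q hQ CK D hK Abar T Tbar X hX I J hJ0 hJ M₁ M₂ Mbar₁ Mbar₂ hM₁ hM₂ hc₁ hc₂ f₁ f₂ Λ₁ Λ₂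
    hf₁ hf₂ hpi₁ hpi₂ hr₁ hr₂ Z Rc hZ hRc hSys dS dI hdS hdI hS hI
  have hD := hK.kMeas hQ hs
  have hCK := hK.const_pos
  have hJ' : ∀ α < γ, ‖I α‖ ≤ J := fun α hα => I.norm_le_of_opN hJ0 hJ hα
  have hE : 0 ≤ CK * (Z + Rc) := by positivity
  have hle : ∀ c : ℝ, 0 ≤ c → c ≤ C₁ + C₂ → ∀ F : ℝ,
      J * F + (mbelow s (γ + β)).card * (c * (CK * (Z + Rc)) * b) ≤
      J * F + (mbelow s (γ + β)).card * (C₁ + C₂) * b * (CK * (Z + Rc)) := fun c hc0 hc F => by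
    refine add_le_add le_rfl ?_
    calc _ = (mbelow s (γ + β)).card * c * b * (CK * (Z + Rc)) := by ring
      _ ≤ _ := by gcongr
  constructor
  · refine (sizeNorm_app_add_polySum_le hs hv.pos hU.pos hWv hζ hJ0 hJ' hdS
      (mul_nonneg hC₁0 hE) hb hX hS
      (fun x hx => opK_sub hs (hf₁ x hx) (hf₂ x hx) h𝔸A (hpi₁ x) (hpi₂ x) (hr₁ x hx) (hr₂ x hx))
      fun k hk x hx => hC₁ Q CK D hK hD _ _ _ _ Z Rc hSys hZ hRc k hk x hx).trans
      (ENNReal.ofReal_le_ofReal (hle C₁ hC₁0 (by linarith) dS))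
  · refine (incrNorm_app_add_polySum_le hs hv hU hWv hUv hζ hJ0 hJ' hdI
      (mul_nonneg hC₂0 hE) hb hX hI
      (fun x y hx hy => incr_opK_sub hs hc₁ hc₂ hM₁ hM₂ (by linarith) (hf₁ x hx) (hf₁ y hy)
        (hf₂ x hx) (hf₂ y hy) h𝔸A (hpi₁ y) (hpi₂ y) (hr₁ x hx) (hr₁ y hy) (hr₂ x hx) (hr₂ y hy))
      fun k hk x y hx hy hxy hle =>
        hC₂ Q CK D hK hD _ _ _ _ Z Rc hSys hZ hRc k hk x y hx hy hxy hle).trans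
      (ENNReal.ofReal_le_ofReal (hle C₂ hC₂0 (by linarith) dI))

end Difference

/-! ### Systems attached to models; comparison with zero data. -/

section Lift

variable {d : ℕ} {A Abar : Set ℝ} {T : RegStruct.{u₁} A} {Tbar : RegStruct.{u₂} Abar}
  {s : Fin d → ℝ} {ℓ : ℝ} {X : ∀ k : Fin d → ℕ, Tbar.V (mdeg s k)} {β γ δ : ℝ}
  {D : (Fin d → ℕ) → ℝ → Pt d → Pt d → ℝ} {Q : ℝ → Pt d → Pt d → ℝ} {I : AbsInt T Tbar β}
  {G w wst v vst : Pt d → ℝ}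

theorem recenter_zero (M : ModelData d T) (x : Pt d) : recenter M 0 0 x = 0 := by
  simp [recenter]

theorem incr_zero (M : ModelData d T) (x y : Pt d) : incr M 0 y x = 0 := by
  simp [incr]

/-- Zero data have zero lift, so the bounds for one modelled distribution are contained in those for
differences. -/
theorem opK_zero (M : ModelData d T) (x : Pt d) : opK s X γ β D I M 0 0 x = 0 := by
  simp [opK, opN, opJ, AbsInt.app, recenter_zero, kerI_zero, polySum, DFinsupp.sum]

variable [NeZero d]

theorem recNorm_sub_lt_top {η : ℝ} {u : Pt d → ℝ} {L L' : Pt d → Distr d} (hu : ∀ x, 0 < u x)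
    (h : recNorm s ℓ γ η u L < ∞) (h' : recNorm s ℓ γ η u L' < ∞) :
    recNorm s ℓ γ η u (fun x => L x - L' x) < ∞ := by
  refine lt_of_le_of_lt ?_ (ENNReal.add_lt_top.2 ⟨h, h'⟩)
  refine iSup_le fun t => iSup_le fun ht => iSup_le fun x => iSup_le fun hx => ?_
  have ht0 := ht.1
  have hux := hu x
  have htw := tw_pos (s := s) hx
  have hp : 0 ≤ t ^ (-γ / ℓ) * tw s x ^ (γ - η) * u x := by positivity
  have h1 : ENNReal.ofReal (t ^ (-γ / ℓ) * tw s x ^ (γ - η) * u x * |L x t x|) ≤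
      recNorm s ℓ γ η u L :=
    le_iSup_of_le t (le_iSup_of_le ht (le_iSup_of_le x (le_iSup_of_le hx le_rfl)))
  have h2 : ENNReal.ofReal (t ^ (-γ / ℓ) * tw s x ^ (γ - η) * u x * |L' x t x|) ≤
      recNorm s ℓ γ η u L' :=
    le_iSup_of_le t (le_iSup_of_le ht (le_iSup_of_le x (le_iSup_of_le hx le_rfl)))
  refine le_trans ?_ (add_le_add h1 h2)
  rw [← ENNReal.ofReal_add (by positivity) (by positivity), ← mul_add]
  exact ENNReal.ofReal_le_ofReal (mul_le_mul_of_nonneg_left (abs_sub _ _) hp)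

theorem IsModel.sys {M₁ M₂ : ModelData d T} (h₁ : IsModel s ℓ Q w wst M₁)
    (h₂ : IsModel s ℓ Q w wst M₂) (hs : ∀ i, 1 ≤ s i) (hℓ : 0 < ℓ) (hGm : Measurable G)
    (hG0 : ∀ x, 0 ≤ G x) (hQ : IsGSemigroup s ℓ G Q) (hw : IsControlled s ℓ G w wst)
    (hv : IsControlled s ℓ G v vst) (hsym : ∀ x, wst (-x) = wst x)
    (hw3v : IsControlled s ℓ G (fun x => w x ^ 3 * v x) (fun x => wst x ^ 3 * vst x))
    {η η' P₂ dP G₁ G₂ dG F dF Rc : ℝ} (hη : η' ≤ η) {𝔸 : Finset ℝ}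
    (h𝔸A : ∀ α, α ∈ 𝔸 ↔ α ∈ A ∧ α < γ) (h𝔸 : ∀ α ∈ 𝔸, η' ≤ α ∧ α < γ)
    {f₁ f₂ : Pt d → T.Tot} (hf₁ : ∀ x : Pt d, x 0 ≠ 0 → T.Below γ (f₁ x))
    (hf₂ : ∀ x : Pt d, x 0 ≠ 0 → T.Below γ (f₂ x)) {Λ₁ Λ₂ : Distr d} (hΛ₁ : DMeas Λ₁)
    (hΛ₂ : DMeas Λ₂) (hP : 0 ≤ P₂) (hdP : 0 ≤ dP) (hG₁ : 0 ≤ G₁) (hG₂ : 0 ≤ G₂) (hdG : 0 ≤ dG)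
    (hF : 0 ≤ F) (hdF : 0 ≤ dF) (hRc : 0 ≤ Rc)
    (a1 : M₂.piN ℓ w γ ≤ ENNReal.ofReal P₂)
    (a2 : piNorm ℓ w γ (fun x (τ : T.Tot) => M₁.Pi x τ - M₂.Pi x τ) ≤ ENNReal.ofReal dP)
    (a3 : M₁.gamN s w wst γ ≤ ENNReal.ofReal G₁) (a4 : M₂.gamN s w wst γ ≤ ENNReal.ofReal G₂)
    (a5 : gamNorm s w wst γ (fun x y (τ : T.Tot) => M₁.Gam x y τ - M₂.Gam x y τ) ≤
      ENNReal.ofReal dG)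
    (b1 : sizeNorm s γ η v f₁ ≤ ENNReal.ofReal F)
    (b2 : sizeNorm s γ η v (fun x => f₁ x - f₂ x) ≤ ENNReal.ofReal dF)
    (b3 : incrNorm s γ η v vst (incr M₁ f₁) ≤ ENNReal.ofReal F)
    (b4 : incrNorm s γ η v vst (fun y x => incr M₁ f₁ y x - incr M₂ f₂ y x) ≤ ENNReal.ofReal dF)
    (c1 : recNorm s ℓ γ η (fun x => w x * v x)
      (fun x => recenter M₁ f₁ Λ₁ x - recenter M₂ f₂ Λ₂ x) ≤ ENNReal.ofReal Rc) :
    Sys s ℓ (fun x => w x ^ 3 * v x) (fun x => wst x ^ 3 * vst x) 𝔸 γ η'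
      (fun x => recenter M₁ f₁ Λ₁ x - recenter M₂ f₂ Λ₂ x)
      (fun α y x => piDiff M₁ M₂ (incr M₁ f₁ y x) (incr M₂ f₂ y x) α y)
      (fun α x => piDiff M₁ M₂ (f₁ x) (f₂ x) α x) (Λ₁ - Λ₂)
      (dP * (1 + G₁) * F + P₂ * dG * F + P₂ * (1 + G₂) * dF) Rc := by
  have hwU : ∀ x, wst x ^ 2 ≤ wst x ^ 3 * vst x := fun x =>
    (pow_le_pow_right₀ (hw.one_le_st x) (by norm_num)).trans
      (le_mul_of_one_le_right (pow_nonneg (zero_le_one.trans (hw.one_le_st x)) _)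
        (hv.one_le_st x))
  refine (ModelPair.of_norms hw hP hdP hG₁ hG₂ hdG a1 a2 a3 a4 a5).sys h₁.modelLike h₂.modelLike hs
    hw hv hsym hP hdP hG₁ hG₂ hdG hF hdF hRc h𝔸A (MDPair.of_norms hv hη h𝔸 hF hdF b1 b2 b3 b4)
    hf₁ hf₂ (h₁.dMeas hs hℓ hGm hG0 hQ hw hsym hw3v hwU)
    (h₂.dMeas hs hℓ hGm hG0 hQ hw hsym hw3v hwU) hΛ₁ hΛ₂ fun r hr x hx => ?_
  have hwv : ∀ x, 0 < w x * v x := fun x => mul_pos (hw.pos x) (hv.pos x)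
  refine (recNorm_le hwv hRc c1 hr hx).trans ?_
  have := hr.1
  have := hwv x
  have h1 : tw s x ^ (η - γ) ≤ tw s x ^ (η' - γ) :=
    Real.rpow_le_rpow_of_exponent_ge (tw_pos hx) (tw_le_one x) (by linarith)
  gcongr

/-- In the comparison with f = 0, Λ = 0 over the same model, the differences of Π and Γ vanish and
the product rule reduces to ‖Π‖(1 + ‖Γ‖)|||f|||. -/
theorem IsModel.sys_self {M : ModelData d T} (h : IsModel s ℓ Q w wst M)
    (hs : ∀ i, 1 ≤ s i) (hℓ : 0 < ℓ) (hGm : Measurable G)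
    (hG0 : ∀ x, 0 ≤ G x) (hQ : IsGSemigroup s ℓ G Q) (hw : IsControlled s ℓ G w wst)
    (hv : IsControlled s ℓ G v vst) (hsym : ∀ x, wst (-x) = wst x)
    (hw3v : IsControlled s ℓ G (fun x => w x ^ 3 * v x) (fun x => wst x ^ 3 * vst x))
    {η η' ζ : ℝ} (hη : η' ≤ η) {𝔸 : Finset ℝ}
    (h𝔸A : ∀ α, α ∈ 𝔸 ↔ α ∈ A ∧ α < γ) (h𝔸 : ∀ α ∈ 𝔸, η' ≤ α ∧ α < γ)
    {f : Pt d → T.Tot} (hf : IsMD s γ η v vst M f) {Λ : Distr d}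
    (hΛ : IsReconstruction s ℓ Q γ η ζ (fun x => w x * v x) M f Λ) :
    Sys s ℓ (fun x => w x ^ 3 * v x) (fun x => wst x ^ 3 * vst x) 𝔸 γ η'
      (fun x => recenter M f Λ x - recenter M 0 0 x)
      (fun α y x => piDiff M M (incr M f y x) (incr M 0 y x) α y)
      (fun α x => piDiff M M (f x) ((0 : Pt d → T.Tot) x) α x) (Λ - 0)
      ((M.piN ℓ w γ).toReal * (1 + (M.gamN s w wst γ).toReal) * (mdNorm s γ η v vst M f).toReal)
      (recNorm s ℓ γ η (fun x => w x * v x) (recenter M f Λ)).toReal := by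
  have hmd : mdNorm s γ η v vst M f < ∞ := ENNReal.add_lt_top.2 ⟨hf.size_finite, hf.hol_finite⟩
  have e1 : ENNReal.ofReal (mdNorm s γ η v vst M f).toReal = mdNorm s γ η v vst M f :=
    ENNReal.ofReal_toReal hmd.ne
  have hS := h.sys (Q := Q) (f₁ := f) (f₂ := 0) (Λ₁ := Λ) (Λ₂ := 0) (dP := 0) (dG := 0)
    (P₂ := (M.piN ℓ w γ).toReal) (G₁ := (M.gamN s w wst γ).toReal)
    (G₂ := (M.gamN s w wst γ).toReal) (F := (mdNorm s γ η v vst M f).toReal)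
    (dF := (mdNorm s γ η v vst M f).toReal)
    (Rc := (recNorm s ℓ γ η (fun x => w x * v x) (recenter M f Λ)).toReal)
    h hs hℓ hGm hG0 hQ hw hv hsym hw3v hη h𝔸A h𝔸 hf.below
    (fun x _ α _ => rfl) (hΛ.mem.dMeas hQ fun x => mul_pos (hw.pos x) (hv.pos x)) DMeas.zero
    ENNReal.toReal_nonneg le_rfl ENNReal.toReal_nonneg ENNReal.toReal_nonneg le_rfl
    ENNReal.toReal_nonneg ENNReal.toReal_nonneg ENNReal.toReal_nonneg
    (ENNReal.ofReal_toReal (h.pi_finite γ).ne).ge (by simp [piNorm])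
    (ENNReal.ofReal_toReal (h.gam_finite γ).ne).ge (ENNReal.ofReal_toReal (h.gam_finite γ).ne).ge
    (by simp [gamNorm]) (by rw [e1]; exact le_self_add)
    (by simp only [Pi.zero_apply, sub_zero]; rw [e1]; exact le_self_add)
    (by rw [e1]; exact le_add_self)
    (by simp only [incr_zero, sub_zero]; rw [e1]; exact le_add_self)
    (by simp only [recenter_zero, sub_zero]; rw [ENNReal.ofReal_toReal hΛ.finite.ne])
  simpa only [zero_mul, mul_zero, zero_add] using hS

theorem IsModel.kerConv_recenter {M : ModelData d T} (h : IsModel s ℓ Q w wst M)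
    (hs : ∀ i, 1 ≤ s i) (hℓ : 0 < ℓ) (hGm : Measurable G)
    (hG0 : ∀ x, 0 ≤ G x) (hQ : IsGSemigroup s ℓ G Q) (hw : IsControlled s ℓ G w wst)
    (hv : IsControlled s ℓ G v vst) (hsym : ∀ x, wst (-x) = wst x)
    (hw3v : IsControlled s ℓ G (fun x => w x ^ 3 * v x) (fun x => wst x ^ 3 * vst x))
    {η η' ζ βbar CK : ℝ} (hη : η' ≤ η) {𝔸 : Finset ℝ}
    (h𝔸A : ∀ α, α ∈ 𝔸 ↔ α ∈ A ∧ α < γ) (h𝔸 : ∀ α ∈ 𝔸, η' ≤ α ∧ α < γ) (hηγ : η' ≤ γ)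
    (hη' : γ - s 0 < η') (hK : IsRegKernel s ℓ G Q βbar δ CK D)
    {f : Pt d → T.Tot} (hf : IsMD s γ η v vst M f) {Λ : Distr d}
    (hΛ : IsReconstruction s ℓ Q γ η ζ (fun x => w x * v x) M f Λ) {x : Pt d} (hx : x 0 ≠ 0)
    {k : Fin d → ℕ} (hkδ : mdeg s k < δ) (hk : mdeg s k < γ + βbar) :
    KerConv D k x (recenter M f Λ x) := by
  have hS := h.sys_self hs hℓ hGm hG0 hQ hw hv hsym hw3v hη h𝔸A h𝔸 hf hΛ
  have hc := Sys.kerConv_L hw3v hs hℓ hGm hG0 h𝔸 hηγ hη' hS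
    (mul_nonneg (mul_nonneg ENNReal.toReal_nonneg (by positivity)) ENNReal.toReal_nonneg)
    ENNReal.toReal_nonneg hK (hK.kMeas hQ hs) hx hkδ hk
  simpa only [recenter_zero, sub_zero] using hc

end Lift

/-! ### The theorem: convergence, bounds and local Lipschitz continuity. -/

set_option maxHeartbeats 1000000 in
theorem mainTheorem4 {d : ℕ} [NeZero d] (s : Fin d → ℝ) (hs : ∀ i, 1 ≤ s i) (ℓ : ℝ) (hℓ : 0 < ℓ)
    (G : Pt d → ℝ) (hGm : Measurable G) (hG0 : ∀ x, 0 ≤ G x)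
    (w wst v vst : Pt d → ℝ)
    (hw : IsControlled s ℓ G w wst) (hv : IsControlled s ℓ G v vst)
    (hsym : ∀ x, wst (-x) = wst x)
    (hw3v : IsControlled s ℓ G (fun x => w x ^ 3 * v x) (fun x => wst x ^ 3 * vst x))
    (A : Set ℝ) (α₀ : ℝ) (hα₀ : IsLeast A α₀)
    (γ η ζ β βbar δ : ℝ)
    (hβ : 0 < β) (hββ : β ≤ βbar) (hγδ : γ + βbar < δ)
    (hη : η ∈ Ioc (γ - s 0) γ) (hα₀γ : γ - s 0 < α₀)
    (hζ0 : ζ ≤ 0) (hζ : ζ ≤ min η α₀)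
    (hcase : β < βbar ∨
      (β = βbar ∧ ∀ a ∈ A ∪ {γ, ζ}, ∀ k : Fin d → ℕ, a + βbar ≠ mdeg s k)) :
    (∀ b : ℝ, ∃ C : ℝ, 0 < C ∧
      ∀ (Q : ℝ → Pt d → Pt d → ℝ), IsGSemigroup s ℓ G Q →
      ∀ (CK : ℝ) (D : (Fin d → ℕ) → ℝ → Pt d → Pt d → ℝ), IsRegKernel s ℓ G Q βbar δ CK D →
      ∀ (Abar : Set ℝ) (T : RegStruct.{u₁} A) (Tbar : RegStruct.{u₂} Abar)
        (X : ∀ k : Fin d → ℕ, Tbar.V (mdeg s k)), IsPolySector Tbar s X →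
        (∀ k, mdeg s k < γ + β → ‖X k‖ ≤ b) →
      ∀ (I : AbsInt T Tbar β) (M : ModelData d T) (Mbar : ModelData d Tbar),
        IsModel s ℓ Q w wst M → IsModel s ℓ Q w wst Mbar → IsCompatible s Q X δ β D I M Mbar →
      ∀ (f : Pt d → T.Tot) (Λ : Distr d), IsMD s γ η v vst M f →
        IsReconstruction s ℓ Q γ η ζ (fun x => w x * v x) M f Λ →
        (∀ x α (τ : T.V α) k, α + β < δ → mdeg s k < α + β →
          KerConv D k x (M.Pi x (DFinsupp.single α τ))) ∧
        (∀ x : Pt d, x 0 ≠ 0 → ∀ k, mdeg s k < γ + β → KerConv D k x (recenter M f Λ x)) ∧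
        IsMD s (γ + β) (ζ + β) (fun x => w x ^ 3 * v x) (fun x => wst x ^ 3 * vst x) Mbar
          (opK s X γ β D I M f Λ) ∧
        sizeNorm s (γ + β) (ζ + β) (fun x => w x ^ 3 * v x) (opK s X γ β D I M f Λ) ≤
          ENNReal.ofReal C * (I.opN γ * sizeNorm s γ η v f +
            ENNReal.ofReal CK *
              (M.piN ℓ w γ * (1 + M.gamN s w wst γ) ^ 2 * mdNorm s γ η v vst M f +
                besovNorm ℓ ζ (fun x => w x * v x) Λ +
                recNorm s ℓ γ η (fun x => w x * v x) (recenter M f Λ))) ∧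
        holNorm s (γ + β) (ζ + β) (fun x => w x ^ 3 * v x) (fun x => wst x ^ 3 * vst x) Mbar
            (opK s X γ β D I M f Λ) ≤
          ENNReal.ofReal C *
            (I.opN γ * (M.gamN s w wst γ * sizeNorm s γ η v f + holNorm s γ η v vst M f) +
              ENNReal.ofReal CK *
                (M.piN ℓ w γ * (1 + M.gamN s w wst γ) ^ 2 * mdNorm s γ η v vst M f +
                  recNorm s ℓ γ η (fun x => w x * v x) (recenter M f Λ)))) ∧
    (∀ (Q : ℝ → Pt d → Pt d → ℝ), IsGSemigroup s ℓ G Q →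
      ∀ (CK : ℝ) (D : (Fin d → ℕ) → ℝ → Pt d → Pt d → ℝ), IsRegKernel s ℓ G Q βbar δ CK D →
      ∀ (Abar : Set ℝ) (T : RegStruct.{u₁} A) (Tbar : RegStruct.{u₂} Abar)
        (X : ∀ k : Fin d → ℕ, Tbar.V (mdeg s k)), IsPolySector Tbar s X →
      ∀ (I : AbsInt T Tbar β), ∃ C : ℝ, 0 < C ∧
      ∀ (R : ℝ), 0 < R →
      ∀ (M₁ M₂ : ModelData d T) (Mbar₁ Mbar₂ : ModelData d Tbar),
        IsModel s ℓ Q w wst M₁ → IsModel s ℓ Q w wst M₂ →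
        IsModel s ℓ Q w wst Mbar₁ → IsModel s ℓ Q w wst Mbar₂ →
        IsCompatible s Q X δ β D I M₁ Mbar₁ → IsCompatible s Q X δ β D I M₂ Mbar₂ →
      ∀ (f₁ f₂ : Pt d → T.Tot) (Λ₁ Λ₂ : Distr d),
        IsMD s γ η v vst M₁ f₁ → IsMD s γ η v vst M₂ f₂ →
        IsReconstruction s ℓ Q γ η ζ (fun x => w x * v x) M₁ f₁ Λ₁ →
        IsReconstruction s ℓ Q γ η ζ (fun x => w x * v x) M₂ f₂ Λ₂ →
        M₁.piN ℓ w γ + M₁.gamN s w wst γ ≤ ENNReal.ofReal R →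
        M₂.piN ℓ w γ + M₂.gamN s w wst γ ≤ ENNReal.ofReal R →
        mdNorm s γ η v vst M₁ f₁ ≤ ENNReal.ofReal R →
        mdNorm s γ η v vst M₂ f₂ ≤ ENNReal.ofReal R →
        (0 < γ →
          mdDist s (γ + β) (ζ + β) (fun x => w x ^ 3 * v x) (fun x => wst x ^ 3 * vst x)
              Mbar₁ Mbar₂ (opK s X γ β D I M₁ f₁ Λ₁) (opK s X γ β D I M₂ f₂ Λ₂) ≤
            ENNReal.ofReal (C * (1 + R) ^ 2) *
              (modelDist s ℓ w wst γ M₁ M₂ + mdDist s γ η v vst M₁ M₂ f₁ f₂)) ∧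
        mdDist s (γ + β) (ζ + β) (fun x => w x ^ 3 * v x) (fun x => wst x ^ 3 * vst x)
            Mbar₁ Mbar₂ (opK s X γ β D I M₁ f₁ Λ₁) (opK s X γ β D I M₂ f₂ Λ₂) ≤
          ENNReal.ofReal (C * (1 + R) ^ 2) *
            (modelDist s ℓ w wst γ M₁ M₂ + mdDist s γ η v vst M₁ M₂ f₁ f₂ +
              besovNorm ℓ ζ (fun x => w x * v x) (Λ₁ - Λ₂) +
              recNorm s ℓ γ η (fun x => w x * v x)
                (fun x => recenter M₁ f₁ Λ₁ x - recenter M₂ f₂ Λ₂ x))) := by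
  set U : Pt d → ℝ := fun x => wst x ^ 3 * vst x with hUdef
  set W : Pt d → ℝ := fun x => w x ^ 3 * v x with hWdef
  have hwU : ∀ x, wst x ^ 2 ≤ U x := fun x =>
    (pow_le_pow_right₀ (hw.one_le_st x) (by norm_num)).trans
      (le_mul_of_one_le_right (pow_nonneg (zero_le_one.trans (hw.one_le_st x)) _)
        (hv.one_le_st x))
  have hUv : ∀ x, vst x ≤ U x := fun x =>
    le_mul_of_one_le_left (zero_le_one.trans (hv.one_le_st x)) (one_le_pow₀ (hw.one_le_st x))
  have hWv : ∀ x, W x ≤ v x := fun x =>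
    mul_le_of_le_one_left (hv.pos x).le (pow_le_one₀ (hw.pos x).le (hw.le_one x))
  have hwv := hw.mul_of_pow_three hv hw3v hG0
  -- The systems are used with exponent min(η, α₀): it lies below every index, and above γ − s_0 by
  -- the two assumptions on η and α₀.
  have hηγ : min η α₀ ≤ γ := (min_le_left _ _).trans hη.2
  have hη' : γ - s 0 < min η α₀ := lt_min hη.1 hα₀γ
  have hζη : ζ ≤ η := hζ.trans (min_le_left _ _)
  have h𝔸 : ∀ 𝔸 : Finset ℝ, (∀ α, α ∈ 𝔸 ↔ α ∈ A ∧ α < γ) → ∀ α ∈ 𝔸, min η α₀ ≤ α ∧ α < γ :=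
    fun 𝔸 h α hα => ⟨(min_le_right _ _).trans (hα₀.2 ((h α).1 hα).1), ((h α).1 hα).2⟩
  have hcase' : ∀ 𝔸 : Finset ℝ, (∀ α, α ∈ 𝔸 ↔ α ∈ A ∧ α < γ) →
      (β < βbar ∨ ∀ a ∈ (𝔸 : Set ℝ) ∪ {γ, ζ}, ∀ k : Fin d → ℕ, a + βbar ≠ mdeg s k) :=
    fun 𝔸 h => hcase.imp_right fun hc a ha k =>
      hc.2 a (ha.imp_left fun ha => ((h a).1 ha).1) k
  constructor
  · intro b
    -- The constant must be fixed before the regularity structure. If A has infinitely many elements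
    -- below γ, no regularity structure with index set A exists and nothing is to be proved.
    by_cases hfin : (A ∩ Iio γ).Finite
    swap
    · refine ⟨1, one_pos, fun Q hQ CK D hK Abar T => absurd ?_ hfin⟩
      obtain ⟨𝔸, h⟩ := T.exists_finset γ
      exact 𝔸.finite_toSet.subset fun α hα => (h α).2 hα
    have hA𝔸 : ∀ α, α ∈ hfin.toFinset ↔ α ∈ A ∧ α < γ := fun α => by simp
    obtain ⟨C, hC0, hC⟩ := exists_opK_sub_bound.{u₁, u₂} (A := A) (η := η) hw3v hv hs hℓ hGm hG0
      hWv hUv hA𝔸 (h𝔸 _ hA𝔸) hηγ hη' hζ hζη hββ hγδ (hcase' _ hA𝔸)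
    -- The summand 1 pays for the part coming from I; the given b may be negative.
    refine ⟨1 + C * max b 0, by positivity, ?_⟩
    intro Q hQ CK D hK Abar T Tbar X hX hXb I M Mbar hM hMbar hcomp f Λ hf hΛ
    have hpi : ∀ x α (τ : T.V α) k, α + β < δ → mdeg s k < α + β →
        KerConv D k x (M.Pi x (DFinsupp.single α τ)) := fun x α τ k hα hk =>
      hM.kerConv hs hℓ hGm hG0 hQ hw hsym hw3v hwU hK x τ (by linarith) (by linarith)
    have hrec : ∀ x : Pt d, x 0 ≠ 0 → ∀ k, mdeg s k < γ + β →
        KerConv D k x (recenter M f Λ x) := fun x hx k hk =>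
      hM.kerConv_recenter hs hℓ hGm hG0 hQ hw hv hsym hw3v (min_le_left _ _) hA𝔸 (h𝔸 _ hA𝔸) hηγ
        hη' hK hf hΛ hx (by linarith) (by linarith)
    have hS := hM.sys_self hs hℓ hGm hG0 hQ hw hv hsym hw3v (min_le_left _ _) hA𝔸 (h𝔸 _ hA𝔸) hf hΛ
    have hmd : mdNorm s γ η v vst M f < ∞ := ENNReal.add_lt_top.2 ⟨hf.size_finite, hf.hol_finite⟩
    have hCK := hK.const_pos
    have eJ := ENNReal.ofReal_toReal (I.opN_lt_top γ).ne
    have eP := ENNReal.ofReal_toReal (hM.pi_finite γ).ne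
    have eG := ENNReal.ofReal_toReal (hM.gam_finite γ).ne
    have eN := ENNReal.ofReal_toReal hmd.ne
    have eR := ENNReal.ofReal_toReal hΛ.finite.ne
    have eS := ENNReal.ofReal_toReal hf.size_finite.ne
    have eH := ENNReal.ofReal_toReal hf.hol_finite.ne
    change ENNReal.ofReal (M.piN ℓ w γ).toReal = M.piN ℓ w γ at eP
    change ENNReal.ofReal (M.gamN s w wst γ).toReal = M.gamN s w wst γ at eG
    set J := (I.opN γ).toReal with hJ
    set P := (M.piN ℓ w γ).toReal with hP
    set Gm := (M.gamN s w wst γ).toReal with hGam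
    set N := (mdNorm s γ η v vst M f).toReal with hN
    set Rc := (recNorm s ℓ γ η (fun x => w x * v x) (recenter M f Λ)).toReal with hRc
    set S := (sizeNorm s γ η v f).toReal with hSz
    set H := (holNorm s γ η v vst M f).toReal with hH
    have hJ0 : 0 ≤ J := ENNReal.toReal_nonneg
    have hP0 : 0 ≤ P := ENNReal.toReal_nonneg
    have hGm0 : 0 ≤ Gm := ENNReal.toReal_nonneg
    have hN0 : 0 ≤ N := ENNReal.toReal_nonneg
    have hRc0 : 0 ≤ Rc := ENNReal.toReal_nonneg
    have hS0 : 0 ≤ S := ENNReal.toReal_nonneg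
    have hH0 : 0 ≤ H := ENNReal.toReal_nonneg
    have hpi' : ∀ x α (τ : T.V α) k, α < γ → mdeg s k < α + β →
        KerConv D k x (M.Pi x (DFinsupp.single α τ)) := fun x α τ k hα hk =>
      hpi x α τ k (by linarith) hk
    -- Comparison with zero data over the same pair of models.
    obtain ⟨hb1, hb2⟩ := hC (max b 0) (le_max_right _ _) Q hQ CK D hK Abar T Tbar X
      (fun k hk => (hXb k hk).trans (le_max_left _ _)) I J hJ0 eJ.ge M M Mbar Mbar hM.modelLike
      hM.modelLike hcomp hcomp f 0 Λ 0 hf.below (fun x _ α _ => rfl) hpi' hpi' hrec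
      (fun x _ k _ => by rw [recenter_zero]; exact kerConv_zero D k x) (P * (1 + Gm) * N) Rc
      (by positivity) hRc0 hS S H hS0 hH0 (by simp only [Pi.zero_apply, sub_zero]; exact eS.ge)
      (by simp only [incr_zero, sub_zero]; exact eH.ge)
    have hz : (opK s X γ β D I M (0 : Pt d → T.Tot) 0) = 0 := funext fun x => opK_zero M x
    simp only [hz, Pi.zero_apply, sub_zero] at hb1
    simp only [hz, incr_zero, sub_zero] at hb2
    have hmain : ∀ E E' : ℝ, 0 ≤ E → E ≤ E' → J * E + C * max b 0 * (CK * (P * (1 + Gm) * N + Rc)) ≤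
        (1 + C * max b 0) * (J * E' + CK * (P * (1 + Gm) ^ 2 * N + Rc)) := by
      intro E E' hE hEE
      have h1 : P * (1 + Gm) * N ≤ P * (1 + Gm) ^ 2 * N := by
        refine mul_le_mul_of_nonneg_right (mul_le_mul_of_nonneg_left ?_ hP0) hN0
        exact le_self_pow₀ (by linarith) two_ne_zero
      have h2 : 0 ≤ C * max b 0 := mul_nonneg hC0 (le_max_right _ _)
      have h3 : 0 ≤ CK * (P * (1 + Gm) ^ 2 * N + Rc) := by positivity
      have h4 : 0 ≤ C * max b 0 * (J * E') :=
        mul_nonneg h2 (mul_nonneg hJ0 (hE.trans hEE))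
      have h5 : C * max b 0 * (CK * (P * (1 + Gm) * N + Rc)) ≤
          C * max b 0 * (CK * (P * (1 + Gm) ^ 2 * N + Rc)) := by gcongr
      have h6 : J * E ≤ J * E' := by gcongr
      linarith
    have eRHS : ∀ E : ℝ, 0 ≤ E → ENNReal.ofReal ((1 + C * max b 0) *
        (J * E + CK * (P * (1 + Gm) ^ 2 * N + Rc))) = ENNReal.ofReal (1 + C * max b 0) *
        (ENNReal.ofReal J * ENNReal.ofReal E + ENNReal.ofReal CK * (ENNReal.ofReal P *
          (1 + ENNReal.ofReal Gm) ^ 2 * ENNReal.ofReal N + ENNReal.ofReal Rc)) := by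
      intro E hE
      have h1 : 0 ≤ 1 + C * max b 0 := by positivity
      rw [ENNReal.ofReal_mul h1,
        ENNReal.ofReal_add (mul_nonneg hJ0 hE) (by positivity), ENNReal.ofReal_mul hJ0, ENNReal.ofReal_mul hCK.le,
        ENNReal.ofReal_add (by positivity) hRc0, ENNReal.ofReal_mul (by positivity),
        ENNReal.ofReal_mul hP0, ENNReal.ofReal_pow (by positivity),
        ENNReal.ofReal_add zero_le_one hGm0, ENNReal.ofReal_one]
    refine ⟨hpi, hrec, ⟨fun x hx => opK_below hs Λ (hf.below x hx),
      hb1.trans_lt ENNReal.ofReal_lt_top, hb2.trans_lt ENNReal.ofReal_lt_top⟩, ?_, ?_⟩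
    · refine (hb1.trans (ENNReal.ofReal_le_ofReal (hmain S S hS0 le_rfl))).trans ?_
      rw [eRHS S hS0, eJ, eP, eG, eN, eR, eS]
      gcongr
      -- The Besov norm only enlarges the right-hand side: Λ was already controlled through its
      -- recentred parts.
      exact le_self_add
    · refine (hb2.trans (ENNReal.ofReal_le_ofReal (hmain H (Gm * S + H) hH0
        (le_add_of_nonneg_left (by positivity))))).trans ?_
      rw [eRHS _ (by positivity), ENNReal.ofReal_add (by positivity) hH0, ENNReal.ofReal_mul hGm0,
        eJ, eP, eG, eN, eR, eS, eH]
  · intro Q hQ CK D hK Abar T Tbar X hX I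
    obtain ⟨𝔸, hA𝔸⟩ := T.exists_finset γ
    obtain ⟨C, hC0, hC⟩ := exists_opK_sub_bound.{u₁, u₂} (A := A) (η := η) hw3v hv hs hℓ hGm hG0
      hWv hUv hA𝔸 (h𝔸 _ hA𝔸) hηγ hη' hζ hζη hββ hγδ (hcase' _ hA𝔸)
    -- The absorption constant is meaningful only for γ > 0; the default 0 allows one constant for
    -- both conclusions.
    obtain ⟨C₃, hC₃0, hC₃⟩ : ∃ C₃ : ℝ, 0 ≤ C₃ ∧ (0 < γ → ∀ L S T' Λ Z Rc,
        Sys s ℓ W U 𝔸 γ (min η α₀) L S T' Λ Z Rc → 0 ≤ Z → 0 ≤ Rc →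
        (∀ x : Pt d, x 0 ≠ 0 → ∀ r t, 0 < r → r < t → t ≤ 1 →
          L x t x = ∫ z, Q (t - r) x z * L x r z) →
        Sys s ℓ W U 𝔸 γ (min η α₀) L S T' Λ Z (C₃ * Z)) := by
      by_cases hγ : 0 < γ
      · obtain ⟨C₃, h0, h⟩ := Sys.bound_L_of_semigroup hw3v hs hℓ hGm hG0 (h𝔸 _ hA𝔸) hηγ hη' hγ hQ
        exact ⟨C₃, h0, fun _ => h⟩
      · exact ⟨0, le_rfl, fun h => absurd h hγ⟩
    set b := ∑ k ∈ mbelow s (γ + β), ‖X k‖ with hb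
    have hb0 : 0 ≤ b := Finset.sum_nonneg fun _ _ => norm_nonneg _
    have hXb : ∀ k, mdeg s k < γ + β → ‖X k‖ ≤ b := fun k hk =>
      Finset.single_le_sum (f := fun k => ‖X k‖) (fun _ _ => norm_nonneg _) ((mem_mbelow hs).2 hk)
    have hCK := hK.const_pos
    have eJ := ENNReal.ofReal_toReal (I.opN_lt_top γ).ne
    set J := (I.opN γ).toReal with hJ
    have hJ0 : 0 ≤ J := ENNReal.toReal_nonneg
    -- J pays for I, the factor 2 for the sum of the two norms, and C₃ for the reconstruction
    -- constant when it is absorbed; the summand 1 makes the constant nonzero, so that its product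
    -- with ∞ is ∞.
    refine ⟨J + 2 * (C * b * CK) * (1 + C₃) + 1, by positivity, ?_⟩
    intro R hR M₁ M₂ Mbar₁ Mbar₂ hM₁ hM₂ hMbar₁ hMbar₂ hc₁ hc₂ f₁ f₂ Λ₁ Λ₂ hf₁ hf₂ hΛ₁ hΛ₂ hR₁ hR₂
      hfR₁ hfR₂
    have hKpos : ENNReal.ofReal ((J + 2 * (C * b * CK) * (1 + C₃) + 1) * (1 + R) ^ 2) ≠ 0 := by
      rw [Ne, ENNReal.ofReal_eq_zero, not_le]
      positivity
    -- If the distance of the data is infinite, both inequalities are trivial; otherwise all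
    -- quantities can be treated as real numbers.
    by_cases htop : modelDist s ℓ w wst γ M₁ M₂ + mdDist s γ η v vst M₁ M₂ f₁ f₂ = ∞
    · rw [htop, top_add, top_add, ENNReal.mul_top hKpos]
      exact ⟨fun _ => le_top, le_top⟩
    obtain ⟨ht1, ht2⟩ := ENNReal.add_ne_top.1 htop
    obtain ⟨tP, tG⟩ := ENNReal.add_ne_top.1 ht1
    obtain ⟨tS, tI⟩ := ENNReal.add_ne_top.1 ht2
    have tR : recNorm s ℓ γ η (fun x => w x * v x)
        (fun x => recenter M₁ f₁ Λ₁ x - recenter M₂ f₂ Λ₂ x) < ∞ :=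
      recNorm_sub_lt_top hwv.pos hΛ₁.finite hΛ₂.finite
    have eP := ENNReal.ofReal_toReal tP
    have eG := ENNReal.ofReal_toReal tG
    have eS := ENNReal.ofReal_toReal tS
    have eI := ENNReal.ofReal_toReal tI
    have eR := ENNReal.ofReal_toReal tR.ne
    set dP := (piNorm ℓ w γ fun x (τ : T.Tot) => M₁.Pi x τ - M₂.Pi x τ).toReal with hdP
    set dG := (gamNorm s w wst γ fun x y (τ : T.Tot) => M₁.Gam x y τ - M₂.Gam x y τ).toReal
      with hdG
    set dS := (sizeNorm s γ η v fun x => f₁ x - f₂ x).toReal with hdS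
    set dI := (incrNorm s γ η v vst fun y x => incr M₁ f₁ y x - incr M₂ f₂ y x).toReal with hdI
    set Rc := (recNorm s ℓ γ η (fun x => w x * v x)
        (fun x => recenter M₁ f₁ Λ₁ x - recenter M₂ f₂ Λ₂ x)).toReal with hRc
    have dP0 : 0 ≤ dP := ENNReal.toReal_nonneg
    have dG0 : 0 ≤ dG := ENNReal.toReal_nonneg
    have dS0 : 0 ≤ dS := ENNReal.toReal_nonneg
    have dI0 : 0 ≤ dI := ENNReal.toReal_nonneg
    have Rc0 : 0 ≤ Rc := ENNReal.toReal_nonneg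
    have hpi : ∀ M : ModelData d T, IsModel s ℓ Q w wst M → ∀ x α (τ : T.V α) k, α < γ →
        mdeg s k < α + β → KerConv D k x (M.Pi x (DFinsupp.single α τ)) :=
      fun M hM x α τ k hα hk =>
        hM.kerConv hs hℓ hGm hG0 hQ hw hsym hw3v hwU hK x τ (by linarith) (by linarith)
    have hrec : ∀ M : ModelData d T, IsModel s ℓ Q w wst M → ∀ f, IsMD s γ η v vst M f → ∀ Λ,
        IsReconstruction s ℓ Q γ η ζ (fun x => w x * v x) M f Λ → ∀ x : Pt d, x 0 ≠ 0 →
        ∀ k, mdeg s k < γ + β → KerConv D k x (recenter M f Λ x) :=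
      fun M hM f hf Λ hΛ x hx k hk =>
        hM.kerConv_recenter hs hℓ hGm hG0 hQ hw hv hsym hw3v (min_le_left _ _) hA𝔸 (h𝔸 _ hA𝔸) hηγ
          hη' hK hf hΛ hx (by linarith) (by linarith)
    have hm₁ := hΛ₁.mem.dMeas hQ hwv.pos
    have hm₂ := hΛ₂.mem.dMeas hQ hwv.pos
    have hSys := hM₁.sys (f₁ := f₁) (f₂ := f₂) (Λ₁ := Λ₁) (Λ₂ := Λ₂) hM₂ hs hℓ hGm hG0 hQ hw hv hsym
      hw3v (min_le_left η α₀) hA𝔸 (h𝔸 _ hA𝔸) hf₁.below hf₂.below hm₁ hm₂ hR.le dP0 hR.le hR.le dG0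
      hR.le (add_nonneg dS0 dI0) Rc0 (le_self_add.trans hR₂) eP.ge (le_add_self.trans hR₁)
      (le_add_self.trans hR₂) eG.ge (le_self_add.trans hfR₁)
      (eS.ge.trans (ENNReal.ofReal_le_ofReal (by linarith))) (le_add_self.trans hfR₁)
      (eI.ge.trans (ENNReal.ofReal_le_ofReal (by linarith))) eR.ge
    -- The product rule with all single norms bounded by R: every coefficient of a difference is at
    -- most (1 + R)², hence the quadratic constant.
    set Z := dP * (1 + R) * R + R * dG * R + R * (1 + R) * (dS + dI) with hZ
    have hZ0 : 0 ≤ Z := by positivity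
    have hZle : Z ≤ (1 + R) ^ 2 * (dP + dG + (dS + dI)) := by
      have h1 : 0 ≤ dP * (1 + R) := by positivity
      have h2 : 0 ≤ dG * (1 + 2 * R) := by positivity
      have h3 : 0 ≤ (dS + dI) * (1 + R) := by positivity
      rw [hZ]
      linarith
    have hgen : ∀ r : ℝ, 0 ≤ r → Sys s ℓ W U 𝔸 γ (min η α₀)
          (fun x => recenter M₁ f₁ Λ₁ x - recenter M₂ f₂ Λ₂ x)
          (fun α y x => piDiff M₁ M₂ (incr M₁ f₁ y x) (incr M₂ f₂ y x) α y)
          (fun α x => piDiff M₁ M₂ (f₁ x) (f₂ x) α x) (Λ₁ - Λ₂) Z r →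
        mdDist s (γ + β) (ζ + β) W U Mbar₁ Mbar₂ (opK s X γ β D I M₁ f₁ Λ₁)
          (opK s X γ β D I M₂ f₂ Λ₂) ≤
        ENNReal.ofReal (J * (dS + dI) + 2 * (C * b * CK) * (Z + r)) := by
      intro r hr h
      obtain ⟨hb1, hb2⟩ := hC b hb0 Q hQ CK D hK Abar T Tbar X hXb I J hJ0 eJ.ge M₁ M₂ Mbar₁ Mbar₂
        hM₁.modelLike hM₂.modelLike hc₁ hc₂ f₁ f₂ Λ₁ Λ₂ hf₁.below hf₂.below (hpi M₁ hM₁)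
        (hpi M₂ hM₂) (hrec M₁ hM₁ f₁ hf₁ Λ₁ hΛ₁) (hrec M₂ hM₂ f₂ hf₂ Λ₂ hΛ₂) Z r hZ0 hr h dS dI dS0
        dI0 eS.ge eI.ge
      refine (add_le_add hb1 hb2).trans_eq ?_
      rw [← ENNReal.ofReal_add (by positivity) (by positivity)]
      congr 1
      ring
    have h1R : 1 ≤ (1 + R) ^ 2 := one_le_pow₀ (by linarith)
    have hK0 : 0 ≤ C * b * CK := by positivity
    have eDist : modelDist s ℓ w wst γ M₁ M₂ + mdDist s γ η v vst M₁ M₂ f₁ f₂ =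
        ENNReal.ofReal (dP + dG + (dS + dI)) := by
      rw [ENNReal.ofReal_add (by positivity) (by positivity), ENNReal.ofReal_add dP0 dG0,
        ENNReal.ofReal_add dS0 dI0, eP, eG, eS, eI]
      rfl
    set V := dP + dG + (dS + dI) with hV
    have hV0 : 0 ≤ V := by positivity
    have hVS : J * (dS + dI) ≤ J * ((1 + R) ^ 2 * V) := by
      refine mul_le_mul_of_nonneg_left ?_ hJ0
      exact (by rw [hV]; linarith : dS + dI ≤ V).trans (le_mul_of_one_le_left hV0 h1R)
    constructor
    -- Both recentred distributions satisfy the semigroup identity, hence so does their difference.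
    -- Absorption then replaces the reconstruction constant by a multiple of Z.
    · intro hγ
      have hwsg : ∀ M : ModelData d T, IsModel s ℓ Q w wst M → ∀ f Λ,
          IsReconstruction s ℓ Q γ η ζ (fun x => w x * v x) M f Λ → ∀ x,
          SGAt Q x (recenter M f Λ x) := fun M hM f Λ hΛ x =>
        (hΛ.mem.sgAt hwv hs hℓ hGm hG0 hQ x).sub
          (hM.dMeas_and_sgAt hs hℓ hGm hG0 hQ hw hsym hw3v hwU x (f x)).2
      have h := hC₃ hγ _ _ _ _ Z Rc hSys hZ0 Rc0 fun x _ r t hr hrt ht =>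
        (((hwsg M₁ hM₁ f₁ Λ₁ hΛ₁ x).sub (hwsg M₂ hM₂ f₂ Λ₂ hΛ₂ x)) r t hr hrt ht).2
      refine (hgen (C₃ * Z) (by positivity) h).trans ?_
      rw [eDist, ← ENNReal.ofReal_mul (by positivity)]
      refine ENNReal.ofReal_le_ofReal ?_
      calc _ = J * (dS + dI) + 2 * (C * b * CK) * (1 + C₃) * Z := by ring
        _ ≤ J * ((1 + R) ^ 2 * V) + 2 * (C * b * CK) * (1 + C₃) * ((1 + R) ^ 2 * V) := by gcongr
        _ ≤ J * ((1 + R) ^ 2 * V) + 2 * (C * b * CK) * (1 + C₃) * ((1 + R) ^ 2 * V) +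
            (1 + R) ^ 2 * V := le_add_of_nonneg_right (by positivity)
        _ = _ := by ring
    · refine (hgen Rc Rc0 hSys).trans ?_
      rw [eDist]
      calc _ ≤ ENNReal.ofReal ((J + 2 * (C * b * CK) * (1 + C₃) + 1) * (1 + R) ^ 2 * (V + Rc)) := by
            refine ENNReal.ofReal_le_ofReal ?_
            have e1 : Z + Rc ≤ (1 + R) ^ 2 * (V + Rc) := by
              rw [mul_add]
              exact add_le_add hZle (le_mul_of_one_le_left Rc0 h1R)
            have e2 : (1 + R) ^ 2 * V ≤ (1 + R) ^ 2 * (V + Rc) := by gcongr; linarith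
            calc _ ≤ J * ((1 + R) ^ 2 * (V + Rc)) + 2 * (C * b * CK) * ((1 + R) ^ 2 * (V + Rc)) :=
                  add_le_add (hVS.trans (mul_le_mul_of_nonneg_left e2 hJ0))
                    (mul_le_mul_of_nonneg_left e1 (by positivity))
              _ ≤ J * ((1 + R) ^ 2 * (V + Rc)) + 2 * (C * b * CK) * ((1 + R) ^ 2 * (V + Rc)) +
                  (2 * (C * b * CK) * C₃ + 1) * ((1 + R) ^ 2 * (V + Rc)) :=
                  le_add_of_nonneg_right (by positivity)
              _ = _ := by ring
        _ = ENNReal.ofReal ((J + 2 * (C * b * CK) * (1 + C₃) + 1) * (1 + R) ^ 2) *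
            (ENNReal.ofReal V + recNorm s ℓ γ η (fun x => w x * v x)
              (fun x => recenter M₁ f₁ Λ₁ x - recenter M₂ f₂ Λ₂ x)) := by
            rw [ENNReal.ofReal_mul (by positivity), ENNReal.ofReal_add hV0 Rc0, eR]
        _ ≤ _ := by
            refine mul_le_mul_right (add_le_add le_self_add le_rfl) _
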